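/- All graphs are finite and simple. A *terminal* of a graph is a vertex of degree one; for a vertex set $A$, $N(A)$ is the set of vertices outside $A$ that have a neighbour in $A$; a set $X$ is *complete* (*anticomplete*) to $Y$ if all (no) edges between $X$ and $Y$ are present. $G$ is a *square structure* with respect to a 4-tuple $(x_1,x_2,x_3,x_4)$ of distinct terminals if $V(G)$ is the union of pairwise disjoint sets $A_1,\dots,A_4,S_1,\dots,S_4,R$ (a *split*; some of these sets may be empty) such that, with subscripts modulo 4 and for $i=1,\dots,4$: $x_i\in A_i$; $S_i$ is stable and non-empty; $S_i$ is complete to $S_{i+1}$ and anticomplete to $S_{i+2}$; $N(A_i)=S_i$; $N(R)\subseteq S_1\cup S_2\cup S_3\cup S_4$; $G[A_i]$ is connected. $G$ is a *cubic structure* with respect to $(x_1,x_2,x_3,x_4)$ if $V(G)$ is the union of pairwise disjoint sets $A_1,\dots,A_4,B_1,\dots,B_4,S_1,\dots,S_8,R$ (a *split*) such that, with $S=S_1\cup\dots\cup S_8$ and for $i=1,\dots,4$: $x_i\in A_i$; $S_1,\dots,S_8$ are stable; $S_1,\dots,S_4$ are non-empty and at most one of $S_5,\dots,S_8$ is empty;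 $S_i$ is complete to $(S_5\cup S_6\cup S_7\cup S_8)\setminus S_{i+4}$ and anticomplete to $S_{i+4}$; $S_1,\dots,S_4$ are pairwise anticomplete, and so are $S_5,\dots,S_8$; $N(A_i)=S_i$; $N(B_i)\subseteq S_i\cup(N(S_i)\cap S)$; $N(R)\subseteq S_5\cup S_6\cup S_7\cup S_8$; $G[A_i]$ is connected. **Theorem.** Let $G$ be a connected triangle-free graph and let $x_1,x_2,x_3,x_4$ be four distinct terminals of $G$. Then exactly one of the following two statements holds: 1. $G$ is a cubic structure with respect to $(x_1,x_2,x_3,x_4)$, or $G$ is a square structure with respect to $(x_{\pi(1)},x_{\pi(2)},x_{\pi(3)},x_{\pi(4)})$ for some permutation $\pi$ of $\{1,2,3,4\}$; 2. $G$ contains an induced tree that covers $x_1,x_2,x_3,x_4$. Moreover, there is an algorithm that, given a connected triangle-free graph $G$ with $n$ vertices and $m$ edges (by adjacency lists) and four distinct terminals $x_1,x_2,x_3,x_4$ of $G$, outputs in time $O(nm)$, on a random access machine with words of $O(\log n)$ bits, either a split of $V(G)$ showing that statement 1 holds, or the vertex set of an induced tree that covers $x_1,x_2,x_3,x_4$.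 -/

import Mathlib

universe u

/-! ## Graph notions -/

/-- A terminal of a graph is a vertex of degree one. -/
def IsTerminal {V : Type u} (G : SimpleGraph V) (v : V) : Prop :=
  (G.neighborSet v).ncard = 1

/-- `N(A)`: the vertices that are not in `A` but have a neighbour in `A`. -/
def nbhd {V : Type u} (G : SimpleGraph V) (A : Set V) : Set V :=
  {v | v ∉ A ∧ ∃ a ∈ A, G.Adj a v}

/-- All possible edges between `X` and `Y` are present. -/
def CompleteTo {V : Type u} (G : SimpleGraph V) (X Y : Set V) : Prop :=
  ∀ a ∈ X, ∀ b ∈ Y, G.Adj a b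

/-- There is no edge between `X` and `Y`. -/
def AnticompleteTo {V : Type u} (G : SimpleGraph V) (X Y : Set V) : Prop :=
  ∀ a ∈ X, ∀ b ∈ Y, ¬ G.Adj a b

/-- The set `T` induces a tree of `G` that contains the four vertices `x 0, …, x 3`. -/
def IsInducedTreeCovering {V : Type u} (G : SimpleGraph V) (x : Fin 4 → V) (T : Set V) : Prop :=
  (∀ i, x i ∈ T) ∧ (G.induce T).IsTree

/-- `(A₁, …, A₄, S₁, …, S₄, R)` is a split showing that `G` is a square structure with respect
to the terminals `x`. Indices run over `Fin 4`, where addition is modulo 4. -/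
structure IsSquareSplit {V : Type u} (G : SimpleGraph V) (x : Fin 4 → V)
    (A S : Fin 4 → Set V) (R : Set V) : Prop where
  cover : (⋃ i, A i) ∪ (⋃ i, S i) ∪ R = Set.univ
  disjoint : Pairwise fun a b : Fin 4 ⊕ Fin 4 ⊕ Unit =>
    Disjoint (Sum.elim A (Sum.elim S fun _ => R) a) (Sum.elim A (Sum.elim S fun _ => R) b)
  terminal_mem : ∀ i, x i ∈ A i
  stable : ∀ i, G.IsIndepSet (S i)
  nonempty : ∀ i, (S i).Nonempty
  complete : ∀ i, CompleteTo G (S i) (S (i + 1))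
  anticomplete : ∀ i, AnticompleteTo G (S i) (S (i + 2))
  nbhd_A : ∀ i, nbhd G (A i) = S i
  nbhd_R : nbhd G R ⊆ ⋃ i, S i
  connected_A : ∀ i, (G.induce (A i)).Connected

/-- `(A₁, …, A₄, B₁, …, B₄, S₁, …, S₈, R)` is a split showing that `G` is a cubic structure with
respect to the terminals `x`. The sets `S₁, …, S₄` are `S 0, …, S 3`, and the sets `S₅, …, S₈` are
`S' 0, …, S' 3`, so that `S' i` is the set usually written `S_{i+4}`. -/
structure IsCubicSplit {V : Type u} (G : SimpleGraph V) (x : Fin 4 → V)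
    (A B S S' : Fin 4 → Set V) (R : Set V) : Prop where
  cover : (⋃ i, A i) ∪ (⋃ i, B i) ∪ ((⋃ i, S i) ∪ ⋃ i, S' i) ∪ R = Set.univ
  disjoint : Pairwise fun a b : Fin 4 ⊕ Fin 4 ⊕ Fin 4 ⊕ Fin 4 ⊕ Unit =>
    Disjoint (Sum.elim A (Sum.elim B (Sum.elim S (Sum.elim S' fun _ => R))) a)
      (Sum.elim A (Sum.elim B (Sum.elim S (Sum.elim S' fun _ => R))) b)
  terminal_mem : ∀ i, x i ∈ A i
  stable : ∀ i, G.IsIndepSet (S i)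
  stable' : ∀ i, G.IsIndepSet (S' i)
  nonempty : ∀ i, (S i).Nonempty
  /-- At most one of `S₅, S₆, S₇, S₈` is empty. -/
  nonempty' : ∀ i j, S' i = ∅ → S' j = ∅ → i = j
  complete : ∀ i j, i ≠ j → CompleteTo G (S i) (S' j)
  anticomplete_opp : ∀ i, AnticompleteTo G (S i) (S' i)
  anticomplete : ∀ i j, i ≠ j → AnticompleteTo G (S i) (S j)
  anticomplete' : ∀ i j, i ≠ j → AnticompleteTo G (S' i) (S' j)
  nbhd_A : ∀ i, nbhd G (A i) = S i
  nbhd_B : ∀ i, nbhd G (B i) ⊆ S i ∪ (nbhd G (S i) ∩ ((⋃ j, S j) ∪ ⋃ j, S' j))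
  nbhd_R : nbhd G R ⊆ ⋃ i, S' i
  connected_A : ∀ i, (G.induce (A i)).Connected

/-- `G` is a square structure with respect to the terminals `x`. -/
def IsSquareStructure {V : Type u} (G : SimpleGraph V) (x : Fin 4 → V) : Prop :=
  ∃ A S R, IsSquareSplit G x A S R

/-- `G` is a cubic structure with respect to the terminals `x`. -/
def IsCubicStructure {V : Type u} (G : SimpleGraph V) (x : Fin 4 → V) : Prop :=
  ∃ A B S S' R, IsCubicSplit G x A B S S' R

/-! ## Random access machine programs with a step count

Structured programs over natural number registers and arrays, with constants, addition, truncated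
subtraction, comparison, indirect reading and writing of memory, branching and loops. There is no
multiplication and no other operation on words. Every operation costs one step, and an execution is
confined to words: no value that occurs in it, and no address, may exceed a given bound `W`. -/

namespace RAM

/-- The memory: registers `reg 0, reg 1, …`, and arrays `arr 0, arr 1, …` of cells. -/
structure State where
  reg : ℕ → ℕ
  arr : ℕ → ℕ → ℕ

/-- Expressions; the comparisons return `1` for true and `0` for false. -/
inductive Expr where
  | const (c : ℕ)
  | reg (r : ℕ)
  | get (a : ℕ) (i : Expr)
  | add (e f : Expr)
  | sub (e f : Expr)
  | lt (e f : Expr)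
  | eq (e f : Expr)

/-- The value of an expression. -/
def Expr.eval (σ : State) : Expr → ℕ
  | .const c => c
  | .reg r => σ.reg r
  | .get a i => σ.arr a (i.eval σ)
  | .add e f => e.eval σ + f.eval σ
  | .sub e f => e.eval σ - f.eval σ
  | .lt e f => if e.eval σ < f.eval σ then 1 else 0
  | .eq e f => if e.eval σ = f.eval σ then 1 else 0

/-- The number of steps that the evaluation of an expression takes: one for each constant,
register access, array access or operator. -/
def Expr.cost : Expr → ℕ
  | .const _ => 1
  | .reg _ => 1
  | .get _ i => i.cost + 1
  | .add e f => e.cost + f.cost + 1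
  | .sub e f => e.cost + f.cost + 1
  | .lt e f => e.cost + f.cost + 1
  | .eq e f => e.cost + f.cost + 1

/-- The value of the expression and of all its subexpressions is at most `W`. -/
def Expr.Fits (W : ℕ) (σ : State) : Expr → Prop
  | .const c => c ≤ W
  | .reg r => σ.reg r ≤ W
  | .get a i => i.Fits W σ ∧ σ.arr a (i.eval σ) ≤ W
  | .add e f => e.Fits W σ ∧ f.Fits W σ ∧ e.eval σ + f.eval σ ≤ W
  | .sub e f => e.Fits W σ ∧ f.Fits W σ
  | .lt e f => e.Fits W σ ∧ f.Fits W σ ∧ 1 ≤ W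
  | .eq e f => e.Fits W σ ∧ f.Fits W σ ∧ 1 ≤ W

/-- Programs. -/
inductive Prog where
  | skip
  | assign (r : ℕ) (e : Expr)
  | store (a : ℕ) (i e : Expr)
  | seq (p q : Prog)
  | ite (e : Expr) (p q : Prog)
  | loop (e : Expr) (p : Prog)

/-- The state after writing `v` into register `r`. -/
def State.setReg (σ : State) (r v : ℕ) : State :=
  { σ with reg := Function.update σ.reg r v }

/-- The state after writing `v` into cell `i` of array `a`. -/
def State.setArr (σ : State) (a i v : ℕ) : State :=
  { σ with arr := Function.update σ.arr a (Function.update (σ.arr a) i v) }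

/-- `Exec W p σ t τ`: started in the state `σ`, the program `p` halts in the state `τ` after exactly
`t` steps, and all values that it handles are at most `W`. A test counts as true when its value is
nonzero; `loop e p` repeats `p` as long as the test `e` is true. Exactly one rule applies to each
program and state, so executions are deterministic; a program that loops forever or handles
a value greater than `W` has no execution. -/
inductive Exec (W : ℕ) : Prog → State → ℕ → State → Prop where
  | skip (σ : State) : Exec W .skip σ 1 σ
  | assign (σ : State) (r : ℕ) (e : Expr) (he : e.Fits W σ) :
      Exec W (.assign r e) σ (e.cost + 1) (σ.setReg r (e.eval σ))
  | store (σ : State) (a : ℕ) (i e : Expr) (hi : i.Fits W σ) (he : e.Fits W σ) :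
      Exec W (.store a i e) σ (i.cost + e.cost + 1) (σ.setArr a (i.eval σ) (e.eval σ))
  | seq (σ τ υ : State) (p q : Prog) (s t : ℕ) (hp : Exec W p σ s τ) (hq : Exec W q τ t υ) :
      Exec W (.seq p q) σ (s + t) υ
  | ite_true (σ τ : State) (e : Expr) (p q : Prog) (t : ℕ) (he : e.Fits W σ)
      (h : e.eval σ ≠ 0) (hp : Exec W p σ t τ) :
      Exec W (.ite e p q) σ (e.cost + 1 + t) τ
  | ite_false (σ τ : State) (e : Expr) (p q : Prog) (t : ℕ) (he : e.Fits W σ)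
      (h : e.eval σ = 0) (hq : Exec W q σ t τ) :
      Exec W (.ite e p q) σ (e.cost + 1 + t) τ
  | loop_true (σ τ υ : State) (e : Expr) (p : Prog) (s t : ℕ) (he : e.Fits W σ)
      (h : e.eval σ ≠ 0) (hp : Exec W p σ s τ) (hl : Exec W (.loop e p) τ t υ) :
      Exec W (.loop e p) σ (e.cost + 1 + s + t) υ
  | loop_false (σ : State) (e : Expr) (p : Prog) (he : e.Fits W σ) (h : e.eval σ = 0) :
      Exec W (.loop e p) σ (e.cost + 1) σ

end RAM

/-! ## Input and output of the algorithm -/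

/-- `adj` is a representation of `G` by adjacency lists: the list `adj v` enumerates the neighbours
of `v`, in any order and without repetition. -/
def IsAdjLists {n : ℕ} (G : SimpleGraph (Fin n)) (adj : Fin n → List (Fin n)) : Prop :=
  ∀ v, (adj v).Nodup ∧ ∀ w, w ∈ adj v ↔ G.Adj v w

/-- The initial memory on a graph with vertices `0, …, n - 1`, given by adjacency lists, and four
vertices `x 0, …, x 3`. Register `0` holds `n` and registers `1, …, 4` hold `x 0, …, x 3`.
Array `1` holds the concatenation of the lists `adj 0, …, adj (n - 1)`, and array `0` holds the
positions of the lists in it: the list of `v` stands in the cells from `arr 0 v` to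
`arr 0 (v + 1) - 1` of array `1`. Everything else is `0`. -/
def inputState {n : ℕ} (adj : Fin n → List (Fin n)) (x : Fin 4 → Fin n) : RAM.State where
  reg r := if r = 0 then n else if h : r - 1 < 4 then x ⟨r - 1, h⟩ else 0
  arr a k :=
    if a = 0 then (if k ≤ n then ((List.ofFn adj).take k).flatten.length else 0)
    else if a = 1 then ((List.ofFn adj).flatten.map Fin.val).getD k 0
    else 0

/-- The set of vertices that received the label `c` in the final memory: the output assigns to
each vertex `v` the label in cell `v` of array `2`. -/
def labelled (n : ℕ) (τ : RAM.State) (c : ℕ) : Set (Fin n) :=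
  {v | τ.arr 2 v = c}

/-- The final memory `τ` is a correct output. Register `0` tells the kind of the output.
* `0`: a tree of `G` that covers the terminals, formed by the vertices with label `1`;
* `1`: a split of a square structure with respect to the terminals in some order (the order in
  which they lie in `A₁, …, A₄`), with labels `0-3` for `A₁, …, A₄`, `4-7` for `S₁, …, S₄`, and
  `8` for `R`;
* `2`: a split of a cubic structure, with labels `0-3` for `A₁, …, A₄`, `4-7` for `B₁, …, B₄`,
  `8-11` for `S₁, …, S₄`, `12-15` for `S₅, …, S₈`, and `16` for `R`. -/
def IsCorrectOutput {n : ℕ} (G : SimpleGraph (Fin n)) (x : Fin 4 → Fin n) (τ : RAM.State) : Prop :=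
  (τ.reg 0 = 0 ∧ IsInducedTreeCovering G x (labelled n τ 1)) ∨
  (τ.reg 0 = 1 ∧ ∃ π : Equiv.Perm (Fin 4), IsSquareSplit G (x ∘ π)
    (fun i => labelled n τ i.val) (fun i => labelled n τ (4 + i.val)) (labelled n τ 8)) ∨
  (τ.reg 0 = 2 ∧ IsCubicSplit G x
    (fun i => labelled n τ i.val) (fun i => labelled n τ (4 + i.val))
    (fun i => labelled n τ (8 + i.val)) (fun i => labelled n τ (12 + i.val)) (labelled n τ 16))

/-- The program `p` solves the problem in time `O(nm)` on connected triangle-free graphs with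
`n` vertices, `m` edges and four distinct terminals: whatever the order of the adjacency lists, it
halts with a correct output after at most `C * (n * m)` steps, working with words of `O(log n)` bits
(all values are at most `n ^ k`), where `C` and `k` are constants. -/
def SolvesInTimeNM (p : RAM.Prog) : Prop :=
  ∃ C k : ℕ, ∀ (n : ℕ) (G : SimpleGraph (Fin n)) (x : Fin 4 → Fin n)
    (adj : Fin n → List (Fin n)),
    G.Connected → G.CliqueFree 3 → Function.Injective x → (∀ i, IsTerminal G (x i)) →
    IsAdjLists G adj →
    ∃ (t : ℕ) (τ : RAM.State), RAM.Exec (n ^ k) p (inputState adj x) t τ ∧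
      t ≤ C * (n * G.edgeSet.ncard) ∧ IsCorrectOutput G x τ

/-! Existence rests on minimal connections. Let `H` be an inclusion-minimal vertex set that links
the four terminals, and let `C` be a cycle in it. Each vertex of `C` cuts some terminal off from the
rest of `C`, since otherwise it could be dropped. A terminal is cut off by at most one vertex of
`C`, namely the only one to which its component of `H \ C` is attached. So `C` has length at most
four. In a triangle-free graph, `H` therefore induces a tree (`MinLink.isInducedTreeCovering`), or
it contains a square whose four vertices carry the four terminals on disjoint components, one each
(`MinLink.square`). The second outcome is a square structure on `H` (`sqInv_of_square`).

A structure is stored as a labelling (`SqInv`, `CubInv`) and absorbs one vertex after another. Let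
`v` be an untreated vertex with a neighbour in some `A_i` of a square structure. Either `v` joins
one of the sets `A_i` or `S_i`, or it yields a tree, or it sees `A_{i+1}`, `A_{i+3}`, `S_i` and
nothing of `A_i`, `A_{i+2}`, `S_{i+2}` (`SqInv.fail`). In the last case there is a tree again, or
the square structure turns into a cubic one that has `v` in one of `S_5, ..., S_8` (`SqInv.turn`). A
cubic structure grows in the same manner, with a tree as the only alternative (`CubInv.fail`). When
no candidate vertex is left, the label classes form a split.

All trees that arise during growth come from one principle, `GoodMask.not_hasSquare`. Suppose that
all terminals reach a centre `o` inside `Q`, and that two of them are alone in their pieces of `Q`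
without `o`. If a minimal linking set inside `Q` contained a square, then after deletion of `o` all
terminals but at most one would still hang together around the cycle, which contradicts the two
lonely terminals. So a minimal linking set inside `Q` is a tree, and each case of the analysis only
has to name `Q`, a centre and a colouring of the pieces. Moreover each such `Q` consists of all
`A_i`, of `v`, of the terminals, and for each of boundedly many labels of nothing, one tabulated
vertex, or the whole class (`InFam`). The algorithm need not know which case occurred: it tries all
sets of this form, whose number is a constant.

The two statements exclude each other because a tree contains no square. A tree through all
terminals must meet every `S_1, ..., S_4`. In a square structure this gives a square at once. In a
cubic structure a square appears unless the tree meets at most one of `S_5, ..., S_8`, and then the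
tree cannot leave the corner opposite to that set.

The algorithm is a concrete program, and the existence half of the theorem is read off from its
correctness (`RAM.main_spec`). Minimizing takes one graph search per vertex, looking for squares
takes linear time per vertex, and growing takes linear time per relabelled vertex, with at most two
relabellings of a vertex in each phase. The brute-force search runs only when a phase gets stuck,
and once more during the conversion. The total is `O(n (n + m))`, which is `O(nm)` since the graph
is connected. The bound on the word size is separate: the program adds nothing but constants up to
`20`, so values grow by at most `20` per step (`RAM.Run.exec`). -/

/-! ## Reachability inside a set of vertices -/

section Reach

variable {V : Type u} {G : SimpleGraph V}

/-- `b` can be reached from `a` by a walk of `G` all of whose vertices lie in `H`. -/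
def RIn (G : SimpleGraph V) (H : Set V) (a b : V) : Prop :=
  a ∈ H ∧ Relation.ReflTransGen (fun u w => G.Adj u w ∧ w ∈ H) a b

namespace RIn

variable {H K : Set V} {a b c : V}

theorem refl (h : a ∈ H) : RIn G H a a := ⟨h, .refl⟩

theorem left (h : RIn G H a b) : a ∈ H := h.1

theorem step (h : RIn G H a b) (hbc : G.Adj b c) (hc : c ∈ H) : RIn G H a c :=
  ⟨h.1, h.2.tail ⟨hbc, hc⟩⟩

@[elab_as_elim]
theorem induction {P : V → Prop} (h : RIn G H a b) (h0 : P a)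
    (hs : ∀ u w, RIn G H a u → P u → G.Adj u w → w ∈ H → P w) : P b := by
  obtain ⟨ha, h⟩ := h
  induction h with
  | refl => exact h0
  | tail h1 h2 ih => exact hs _ _ ⟨ha, h1⟩ ih h2.1 h2.2

theorem right (h : RIn G H a b) : b ∈ H :=
  h.induction h.1 fun _ _ _ _ _ h => h

theorem trans (h : RIn G H a b) (h' : RIn G H b c) : RIn G H a c :=
  ⟨h.1, h.2.trans h'.2⟩

theorem of_adj (ha : a ∈ H) (hab : G.Adj a b) (hb : b ∈ H) : RIn G H a b :=
  (refl ha).step hab hb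

theorem symm (h : RIn G H a b) : RIn G H b a :=
  h.induction (refl h.1) fun _ _ hu ih huw hw => (of_adj hw huw.symm hu.right).trans ih

/-- A walk in `H` is a walk in `K` when `K` contains all that it can meet. -/
theorem of_forall (h : RIn G H a b) (hK : ∀ z, RIn G H a z → z ∈ K) : RIn G K a b :=
  h.induction (refl (hK _ (refl h.1))) fun _ _ hu ih huw hw => ih.step huw (hK _ (hu.step huw hw))

theorem mono (h : RIn G H a b) (hHK : H ⊆ K) : RIn G K a b :=
  h.of_forall fun _ hz => hHK hz.right

/-- A colouring that is constant along the edges inside `H` is constant along walks. -/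
theorem color_eq {α : Type*} {f : V → α} (h : RIn G H a b)
    (hf : ∀ u ∈ H, ∀ w ∈ H, G.Adj u w → f u = f w) : f a = f b :=
  h.induction rfl fun _ _ hu ih huw hw => ih.trans (hf _ hu.right _ hw huw)

/-- A set that is closed under adjacency inside `H` contains all that its elements reach. -/
theorem mem_of_closed (h : RIn G H a b) (ha : a ∈ K)
    (hK : ∀ u ∈ K, ∀ w ∈ H, G.Adj u w → w ∈ K) : b ∈ K :=
  h.induction ha fun _ _ _ ih huw hw => hK _ ih _ hw huw

/-- A walk in `H` that starts outside `C` either avoids `C` or meets it for the first time. -/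
theorem avoid_or_hit (h : RIn G H a b) {C : Set V} (ha : a ∉ C) :
    RIn G (H \ C) a b ∨ ∃ z, RIn G (H \ C) a z ∧ ∃ y ∈ C, G.Adj z y := by
  refine h.induction (Or.inl (refl ⟨h.1, ha⟩)) ?_
  rintro u w - (ih | ih) huw hw
  · by_cases hC : w ∈ C
    · exact Or.inr ⟨u, ih, w, hC, huw⟩
    · exact Or.inl (ih.step huw ⟨hw, hC⟩)
  · exact Or.inr ih

end RIn

/-- The bridge to connectivity of induced subgraphs. The combinatorial arguments use `RIn`, where
the set can be varied without passing between subtypes. -/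
theorem induce_connected_iff {H : Set V} :
    (G.induce H).Connected ↔ H.Nonempty ∧ ∀ a ∈ H, ∀ b ∈ H, RIn G H a b := by
  constructor
  · intro h
    refine ⟨Set.nonempty_coe_sort.mp h.nonempty, fun a ha b hb => ?_⟩
    obtain ⟨w⟩ := h.preconnected ⟨a, ha⟩ ⟨b, hb⟩
    have : ∀ (p q : H), (G.induce H).Walk p q → RIn G H p q := by
      intro p q w
      induction w with
      | nil => exact RIn.refl (Subtype.property _)
      | cons hadj _ ih =>
        exact (RIn.of_adj (Subtype.property _) hadj (Subtype.property _)).trans ih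
    exact this _ _ w
  · rintro ⟨⟨a, ha⟩, h⟩
    have key : ∀ b, RIn G H a b → ∃ hb : b ∈ H, (G.induce H).Reachable ⟨a, ha⟩ ⟨b, hb⟩ := by
      intro b hb
      refine hb.induction ⟨ha, SimpleGraph.Reachable.refl _⟩ ?_
      rintro u w - ⟨hu, ih⟩ huw hw
      exact ⟨hw, ih.trans (SimpleGraph.Adj.reachable (by simpa using huw))⟩
    have : Nonempty H := ⟨⟨a, ha⟩⟩
    refine SimpleGraph.Connected.mk fun p q => ?_
    obtain ⟨_, hp⟩ := key p (h a ha p p.2)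
    obtain ⟨_, hq⟩ := key q (h a ha q q.2)
    exact hp.symm.trans hq

theorem induce_connected_of_root {H : Set V} {a : V} (ha : a ∈ H) (h : ∀ b ∈ H, RIn G H a b) :
    (G.induce H).Connected :=
  induce_connected_iff.mpr ⟨⟨a, ha⟩, fun b hb c hc => (h b hb).symm.trans (h c hc)⟩

/-- There are no triangles. -/
def TriFree (G : SimpleGraph V) : Prop := ∀ a b c, G.Adj a b → G.Adj b c → G.Adj a c → False

theorem triFree_of_cliqueFree (h : G.CliqueFree 3) : TriFree G := by
  classical
  intro a b c hab hbc hac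
  exact h _ (SimpleGraph.is3Clique_triple_iff.mpr ⟨hab, hac, hbc⟩)

end Reach

/-! ## Squares in trees, and structures that exclude trees -/

section Exclusion

variable {V : Type u} {G : SimpleGraph V}

/-- `H` contains a (not necessarily induced) cycle of length four. -/
def HasSquare (G : SimpleGraph V) (H : Set V) : Prop :=
  ∃ a ∈ H, ∃ b ∈ H, ∃ c ∈ H, ∃ d ∈ H, a ≠ c ∧ b ≠ d ∧
    G.Adj a b ∧ G.Adj b c ∧ G.Adj c d ∧ G.Adj d a

/-- A square provides two different paths of length two between opposite corners, while paths in a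
tree are unique. -/
theorem not_hasSquare_of_isTree {T : Set V} (h : (G.induce T).IsTree) : ¬ HasSquare G T := by
  rintro ⟨a, ha, b, hb, c, hc, d, hd, hac, hbd, h1, h2, h3, h4⟩
  have e1 : (G.induce T).Adj ⟨a, ha⟩ ⟨b, hb⟩ := h1
  have e2 : (G.induce T).Adj ⟨b, hb⟩ ⟨c, hc⟩ := h2
  have e3 : (G.induce T).Adj ⟨d, hd⟩ ⟨c, hc⟩ := h3.symm
  have e4 : (G.induce T).Adj ⟨a, ha⟩ ⟨d, hd⟩ := h4.symm
  let p : (G.induce T).Walk ⟨a, ha⟩ ⟨c, hc⟩ := .cons e1 (.cons e2 .nil)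
  let q : (G.induce T).Walk ⟨a, ha⟩ ⟨c, hc⟩ := .cons e4 (.cons e3 .nil)
  have hp : p.IsPath := by
    simp [p, SimpleGraph.Walk.cons_isPath_iff, h1.ne, hac, h2.ne]
  have hq : q.IsPath := by
    simp [q, SimpleGraph.Walk.cons_isPath_iff, h4.ne', hac, h3.ne']
  have := congrArg (fun r : (G.induce T).Path _ _ => r.1.support)
    ((h.isAcyclic.subsingleton_path _ _).elim ⟨p, hp⟩ ⟨q, hq⟩)
  simp [p, q] at this
  exact hbd this

/-- A connected set that contains all terminals has to leave every `A_i`, and this is possible only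
through `S_i`. One vertex from each `S_i` makes a square. -/
theorem no_tree_of_square {x : Fin 4 → V} {A S : Fin 4 → Set V} {R : Set V}
    (h : IsSquareSplit G x A S R) {T : Set V} (hx : ∀ i, x i ∈ T) : ¬ (G.induce T).IsTree := by
  intro hT
  have hconn := (induce_connected_iff.mp hT.connected).2
  have hmeet : ∀ i, ∃ s ∈ T, s ∈ S i := by
    intro i
    by_contra! hno
    have h1 : x (i + 1) ∈ A i := by
      refine (hconn _ (hx i) _ (hx (i + 1))).mem_of_closed (h.terminal_mem i) ?_
      intro u hu w hw huw
      by_contra hwA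
      exact hno w hw (h.nbhd_A i ▸ ⟨hwA, u, hu, huw⟩)
    have hd := h.disjoint (i := Sum.inl i) (j := Sum.inl (i + 1)) (by simp)
    exact Set.disjoint_left.mp hd h1 (h.terminal_mem (i + 1))
  choose s hsT hsS using hmeet
  have hne : ∀ i j, i ≠ j → s i ≠ s j := by
    intro i j hij he
    have hd := h.disjoint (i := Sum.inr (Sum.inl i)) (j := Sum.inr (Sum.inl j)) (by simpa using hij)
    exact Set.disjoint_left.mp hd (hsS i) (he ▸ hsS j)
  have hadj : ∀ i, G.Adj (s i) (s (i + 1)) := fun i => h.complete i _ (hsS i) _ (hsS (i + 1))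
  exact not_hasSquare_of_isTree hT ⟨s 0, hsT 0, s 1, hsT 1, s 2, hsT 2, s 3, hsT 3,
    hne _ _ (by decide), hne _ _ (by decide), hadj 0, hadj 1, hadj 2, hadj 3⟩

/-- The tree meets every `S_i` as in a square structure, and then it can afford at most one of the
sets `S' j`. The corner `A j ∪ S j ∪ B j` sends no edge to `S' j`, so inside the tree it has no
exit. -/
theorem no_tree_of_cubic {x : Fin 4 → V} {A B S S' : Fin 4 → Set V} {R : Set V}
    (h : IsCubicSplit G x A B S S' R) {T : Set V} (hx : ∀ i, x i ∈ T) :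
    ¬ (G.induce T).IsTree := by
  intro hT
  have hconn := (induce_connected_iff.mp hT.connected).2
  have dAA : ∀ i j v, v ∈ A i → v ∈ A j → i = j := by
    intro i j v h1 h2
    by_contra hij
    exact Set.disjoint_left.mp
      (h.disjoint (i := Sum.inl i) (j := Sum.inl j) (by simpa using hij)) h1 h2
  have dAB : ∀ i j v, v ∈ A i → v ∉ B j := fun i j v h1 h2 => Set.disjoint_left.mp
      (h.disjoint (i := Sum.inl i) (j := Sum.inr (Sum.inl j)) (by simp)) h1 h2
  have dAS : ∀ i j v, v ∈ A i → v ∉ S j := fun i j v h1 h2 => Set.disjoint_left.mp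
      (h.disjoint (i := Sum.inl i) (j := Sum.inr (Sum.inr (Sum.inl j))) (by simp)) h1 h2
  have dBS : ∀ i j v, v ∈ B i → v ∉ S j := fun i j v h1 h2 => Set.disjoint_left.mp
      (h.disjoint (i := Sum.inr (Sum.inl i)) (j := Sum.inr (Sum.inr (Sum.inl j))) (by simp)) h1 h2
  have dSS : ∀ i j v, v ∈ S i → v ∈ S j → i = j := by
    intro i j v h1 h2
    by_contra hij
    exact Set.disjoint_left.mp (h.disjoint (i := Sum.inr (Sum.inr (Sum.inl i)))
      (j := Sum.inr (Sum.inr (Sum.inl j))) (by simpa using hij)) h1 h2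
  have dSS' : ∀ i j v, v ∈ S i → v ∉ S' j := fun i j v h1 h2 => Set.disjoint_left.mp
      (h.disjoint (i := Sum.inr (Sum.inr (Sum.inl i)))
        (j := Sum.inr (Sum.inr (Sum.inr (Sum.inl j)))) (by simp)) h1 h2
  have dS'S' : ∀ i j v, v ∈ S' i → v ∈ S' j → i = j := by
    intro i j v h1 h2
    by_contra hij
    exact Set.disjoint_left.mp (h.disjoint (i := Sum.inr (Sum.inr (Sum.inr (Sum.inl i))))
      (j := Sum.inr (Sum.inr (Sum.inr (Sum.inl j)))) (by simpa using hij)) h1 h2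
  have dSR : ∀ i v, v ∈ S i → v ∉ R := fun i v h1 h2 => Set.disjoint_left.mp
      (h.disjoint (i := Sum.inr (Sum.inr (Sum.inl i)))
        (j := Sum.inr (Sum.inr (Sum.inr (Sum.inr ())))) (by simp)) h1 h2
  have hmeet : ∀ i, ∃ s ∈ T, s ∈ S i := by
    intro i
    by_contra! hno
    have h1 : x (i + 1) ∈ A i := by
      refine (hconn _ (hx i) _ (hx (i + 1))).mem_of_closed (h.terminal_mem i) ?_
      intro u hu w hw huw
      by_contra hwA
      exact hno w hw (h.nbhd_A i ▸ ⟨hwA, u, hu, huw⟩)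
    have := dAA _ _ _ h1 (h.terminal_mem (i + 1))
    revert this; fin_cases i <;> decide
  choose s hsT hsS using hmeet
  -- Vertices of `S' i` and `S' j` have the tree's vertices in `S k` and `S l` as common neighbours,
  -- for the two remaining indices `k` and `l`.
  have htwo : ∀ i j, i ≠ j → ∀ t ∈ T, t ∈ S' i → ∀ t' ∈ T, t' ∉ S' j := by
    intro i j hij t ht htS t' ht' htS'
    obtain ⟨k, l, hkl, hki, hkj, hli, hlj⟩ :
        ∃ k l : Fin 4, k ≠ l ∧ k ≠ i ∧ k ≠ j ∧ l ≠ i ∧ l ≠ j := by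
      clear htS htS'; revert i j; decide
    refine not_hasSquare_of_isTree hT ⟨t, ht, s k, hsT k, t', ht', s l, hsT l, ?_, ?_,
      (h.complete k i hki _ (hsS k) _ htS).symm, h.complete k j hkj _ (hsS k) _ htS',
      (h.complete l j hlj _ (hsS l) _ htS').symm, h.complete l i hli _ (hsS l) _ htS⟩
    · rintro rfl; exact hij (dS'S' _ _ _ htS htS')
    · intro he; exact hkl (dSS _ _ _ (hsS k) (he ▸ hsS l))
  -- The index of the only `S' j` that the tree may meet. If it meets none, any index serves, and
  -- `0` is taken.
  obtain ⟨j, hj⟩ : ∃ j, ∀ i, i ≠ j → ∀ t ∈ T, t ∉ S' i := by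
    by_cases hex : ∃ j, ∃ t ∈ T, t ∈ S' j
    · obtain ⟨j, t, ht, htS⟩ := hex
      exact ⟨j, fun i hi t' ht' => htwo j i (Ne.symm hi) t ht htS t' ht'⟩
    · push Not at hex
      exact ⟨0, fun i _ t ht => hex i t ht⟩
  -- The corner of index `j` is closed under adjacency inside the tree. Edges to the sets `S' k`
  -- with `k ≠ j` end outside the tree, and those to `S' j` do not exist.
  have key : x (j + 1) ∈ A j ∪ S j ∪ B j := by
    refine (hconn _ (hx j) _ (hx (j + 1))).mem_of_closed (Or.inl (Or.inl (h.terminal_mem j))) ?_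
    have hBT : ∀ i, ∀ u ∈ B i, ∀ w ∈ T, G.Adj u w → w ∈ B i ∨ w ∈ S i ∨ w ∈ S' j := by
      intro i u hu w hw huw
      by_cases hwB : w ∈ B i
      · exact Or.inl hwB
      rcases h.nbhd_B i ⟨hwB, u, hu, huw⟩ with h1 | ⟨⟨h1, a, ha, haw⟩, h2⟩
      · exact Or.inr (Or.inl h1)
      · rcases h2 with h2 | h2
        · obtain ⟨k, hk⟩ := Set.mem_iUnion.mp h2
          by_cases hik : i = k
          · exact absurd (hik ▸ hk) h1
          · exact absurd haw (h.anticomplete i k hik _ ha _ hk)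
        · obtain ⟨k, hk⟩ := Set.mem_iUnion.mp h2
          by_cases hkj : k = j
          · exact Or.inr (Or.inr (hkj ▸ hk))
          · exact absurd hk (hj k hkj w hw)
    rintro u ((hu | hu) | hu) w hw huw
    · by_cases hwA : w ∈ A j
      · exact Or.inl (Or.inl hwA)
      · exact Or.inl (Or.inr (h.nbhd_A j ▸ ⟨hwA, u, hu, huw⟩))
    · have hcov : w ∈ (⋃ i, A i) ∪ (⋃ i, B i) ∪ ((⋃ i, S i) ∪ ⋃ i, S' i) ∪ R := by
        rw [h.cover]; trivial
      rcases hcov with ((hw' | hw') | (hw' | hw')) | hw'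
      · obtain ⟨k, hk⟩ := Set.mem_iUnion.mp hw'
        have : u ∈ nbhd G (A k) := ⟨fun hc => dAS _ _ _ hc hu, w, hk, huw.symm⟩
        rw [h.nbhd_A k] at this
        rw [dSS _ _ _ hu this]
        exact Or.inl (Or.inl hk)
      · obtain ⟨k, hk⟩ := Set.mem_iUnion.mp hw'
        have : u ∈ nbhd G (B k) := ⟨fun hc => dBS _ _ _ hc hu, w, hk, huw.symm⟩
        rcases h.nbhd_B k this with h1 | ⟨⟨h1, a, ha, hau⟩, -⟩
        · rw [dSS _ _ _ hu h1]; exact Or.inr hk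
        · by_cases hkj : k = j
          · subst hkj; exact absurd hu h1
          · exact absurd hau (h.anticomplete k j hkj _ ha _ hu)
      · obtain ⟨k, hk⟩ := Set.mem_iUnion.mp hw'
        by_cases hjk : j = k
        · exact Or.inl (Or.inr (hjk ▸ hk))
        · exact absurd huw (h.anticomplete j k hjk _ hu _ hk)
      · obtain ⟨k, hk⟩ := Set.mem_iUnion.mp hw'
        by_cases hkj : k = j
        · subst hkj; exact absurd huw (h.anticomplete_opp k _ hu _ hk)
        · exact absurd hk (hj k hkj w hw)
      · have : u ∈ nbhd G R := ⟨dSR _ _ hu, w, hw', huw.symm⟩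
        obtain ⟨k, hk⟩ := Set.mem_iUnion.mp (h.nbhd_R this)
        exact absurd hk (dSS' _ _ _ hu)
    · rcases hBT j u hu w hw huw with h1 | h1 | h1
      · exact Or.inr h1
      · exact Or.inl (Or.inr h1)
      · by_cases hwB : w ∈ B j
        · exact Or.inr hwB
        rcases h.nbhd_B j ⟨hwB, u, hu, huw⟩ with h3 | ⟨⟨-, a, ha, haw⟩, -⟩
        · exact Or.inl (Or.inr h3)
        · exact absurd haw (h.anticomplete_opp j _ ha _ h1)
  have hne : j + 1 ≠ j := by fin_cases j <;> decide
  have hxA := h.terminal_mem (j + 1)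
  rcases key with (h1 | h1) | h1
  · exact hne (dAA _ _ _ hxA h1)
  · exact dAS _ _ _ hxA h1
  · exact dAB _ _ _ hxA h1

end Exclusion

/-! ## Minimal sets that link the terminals -/

section Minimal

variable {V : Type u} {G : SimpleGraph V}

/-- Every terminal has at most one neighbour. -/
def Pendant (G : SimpleGraph V) (x : Fin 4 → V) : Prop :=
  ∀ j u w, G.Adj (x j) u → G.Adj (x j) w → u = w

/-- `H` links the terminals, and no other vertex of `H` can be left out. -/
structure MinLink (G : SimpleGraph V) (x : Fin 4 → V) (H : Set V) : Prop where
  link : ∀ j, RIn G H (x 0) (x j)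
  min : ∀ u ∈ H, (∀ j, u ≠ x j) → ¬ ∀ j, RIn G (H \ {u}) (x 0) (x j)

/-- The sequence `c` runs around a cycle of length `l` in `H`. -/
structure CycIn (G : SimpleGraph V) (H : Set V) (l : ℕ) (c : ℕ → V) : Prop where
  len : 3 ≤ l
  per : Function.Periodic c l
  adj : ∀ k, G.Adj (c k) (c (k + 1))
  inj : ∀ i < l, ∀ j < l, c i = c j → i = j
  mem : ∀ k, c k ∈ H

theorem CycIn.eq_iff {H : Set V} {l : ℕ} {c : ℕ → V} (h : CycIn G H l c) (i j : ℕ) :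
    c i = c j ↔ i % l = j % l := by
  have hl : 0 < l := by have := h.len; omega
  constructor
  · intro he
    refine h.inj _ (Nat.mod_lt _ hl) _ (Nat.mod_lt _ hl) ?_
    rw [h.per.map_mod_nat, h.per.map_mod_nat, he]
  · intro he
    rw [← h.per.map_mod_nat i, he, h.per.map_mod_nat]

/-- What remains of a cycle without one of its vertices is connected. -/
theorem CycIn.around {H : Set V} {l : ℕ} {c : ℕ → V} (h : CycIn G H l c) (k k' : ℕ)
    (hne : c k' ≠ c k) : RIn G (H \ {c k}) (c (k + 1)) (c k') := by
  have hl := h.len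
  have hoff : ∀ r, r + 1 < l → c (k + 1 + r) ≠ c k := by
    intro r hr he
    rw [h.eq_iff] at he
    have h1 : (k + (r + 1)) % l = (k + 0) % l := by rw [← add_assoc, add_right_comm]; simpa using he
    have h2 : (r + 1) % l = 0 % l := Nat.ModEq.add_left_cancel' k h1
    rw [Nat.mod_eq_of_lt hr] at h2
    simp at h2
  have key : ∀ r, r + 1 < l → RIn G (H \ {c k}) (c (k + 1)) (c (k + 1 + r)) := by
    intro r
    induction r with
    | zero => exact fun hr => RIn.refl ⟨h.mem _, hoff 0 hr⟩
    | succ r ih =>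
      exact fun hr => (ih (by omega)).step (h.adj _) ⟨h.mem _, hoff (r + 1) hr⟩
  obtain ⟨r, hr, he⟩ : ∃ r, r < l ∧ c (k + 1 + r) = c k' := by
    -- This is `k' - (k + 1)` modulo `l`, with the subtraction written as multiplication by `l - 1`.
    refine ⟨(k' + (k + 1) * (l - 1)) % l, Nat.mod_lt _ (by omega), ?_⟩
    rw [h.eq_iff, Nat.add_mod, Nat.mod_mod, ← Nat.add_mod]
    have : k + 1 + (k' + (k + 1) * (l - 1)) = k' + (k + 1) * l := by
      obtain ⟨m, rfl⟩ : ∃ m, l = m + 1 := ⟨l - 1, by omega⟩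
      simp; ring
    rw [this, Nat.add_mul_mod_self_right]
  by_cases hr' : r + 1 < l
  · exact he ▸ key r hr'
  · exfalso
    apply hne
    rw [← he, show k + 1 + r = k + l by omega]
    exact h.per k

theorem CycIn.around' {H : Set V} {l : ℕ} {c : ℕ → V} (h : CycIn G H l c) (k k' k'' : ℕ)
    (h1 : c k' ≠ c k) (h2 : c k'' ≠ c k) : RIn G (H \ {c k}) (c k') (c k'') :=
  (h.around k k' h1).symm.trans (h.around k k'' h2)

variable {x : Fin 4 → V} {H : Set V}

/-- A nonterminal that `x 0` does not reach lies on none of the required walks and could be dropped.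
So a minimal linking set is connected. -/
theorem MinLink.reach (h : MinLink G x H) : ∀ u ∈ H, RIn G H (x 0) u := by
  intro u hu
  by_cases hux : ∃ j, u = x j
  · obtain ⟨j, rfl⟩ := hux
    exact h.link j
  · push Not at hux
    by_contra hno
    refine h.min u hu hux fun j => (h.link j).of_forall fun z hz => ⟨hz.right, ?_⟩
    rintro rfl
    exact hno hz

/-- A vertex of a cycle has two different neighbours on it, and a terminal has only one neighbour.
-/
theorem CycIn.ne_terminal {l : ℕ} {c : ℕ → V} (hp : Pendant G x) (h : CycIn G H l c) (k : ℕ)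
    (j : Fin 4) : c k ≠ x j := by
  intro he
  have hl := h.len
  have h1 : G.Adj (x j) (c (k + 1)) := he ▸ h.adj k
  have h2 : G.Adj (x j) (c (k + (l - 1))) := by
    have := (h.adj (k + (l - 1))).symm
    rw [show k + (l - 1) + 1 = k + l by omega, h.per k, he] at this
    exact this
  have h3 := hp j _ _ h1 h2
  rw [h.eq_iff] at h3
  have h4 : 1 % l = (l - 1) % l := Nat.ModEq.add_left_cancel' k h3
  rw [Nat.mod_eq_of_lt (by omega), Nat.mod_eq_of_lt (by omega)] at h4
  have : l ≠ 2 := by omega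
  omega

/-- Every vertex of a cycle in a minimal linking set separates some terminal from the cycle. -/
theorem MinLink.separates (hp : Pendant G x) (h : MinLink G x H) {l : ℕ} {c : ℕ → V}
    (hc : CycIn G H l c) (k : ℕ) :
    ∃ j, ∀ k', c k' ≠ c k → ¬ RIn G (H \ {c k}) (c k') (x j) := by
  have hne : c (k + 1) ≠ c k := (hc.adj k).ne'
  have hmin := h.min (c k) (hc.mem k) fun j => hc.ne_terminal hp k j
  -- The cycle without `c k` is connected. So if every terminal reached some vertex of it while
  -- avoiding `c k`, the terminals would be linked without `c k`.
  by_contra! hno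
  have hall : ∀ j, RIn G (H \ {c k}) (c (k + 1)) (x j) := by
    intro j
    obtain ⟨k', hk', hr⟩ := hno j
    exact (hc.around k k' hk').trans hr
  exact hmin fun j => (hall 0).symm.trans (hall j)

/-- Take a walk in `H` from the terminal to the cycle and stop just before its first vertex on the
cycle. -/
theorem MinLink.attach (hp : Pendant G x) (h : MinLink G x H) {l : ℕ} {c : ℕ → V}
    (hc : CycIn G H l c) (j : Fin 4) :
    ∃ k z, RIn G (H \ Set.range c) (x j) z ∧ G.Adj z (c k) := by
  have h1 : RIn G H (x j) (c 0) := (h.link j).symm.trans (h.reach _ (hc.mem 0))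
  have hx : x j ∉ Set.range c := by
    rintro ⟨k, hk⟩
    exact hc.ne_terminal hp k j hk
  rcases h1.avoid_or_hit hx with h2 | ⟨z, hz, _, ⟨k, rfl⟩, hk⟩
  · exact absurd ⟨0, rfl⟩ h2.right.2
  · exact ⟨k, z, hz, hk⟩

/-- If `c k` separates the terminal from the other cycle vertices, then the part that the terminal
reaches off the cycle can touch the cycle in `c k` only. -/
theorem CycIn.attach_unique {l : ℕ} {c : ℕ → V} (hc : CycIn G H l c) {k : ℕ} {j : Fin 4}
    (hs : ∀ k', c k' ≠ c k → ¬ RIn G (H \ {c k}) (c k') (x j)) {k' : ℕ} {z : V}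
    (hz : RIn G (H \ Set.range c) (x j) z) (hk' : G.Adj z (c k')) : c k' = c k := by
  by_contra hne
  refine hs k' hne (RIn.symm ?_)
  refine (hz.mono ?_).step hk' ⟨hc.mem _, hne⟩
  exact fun u hu => ⟨hu.1, fun he => hu.2 ⟨k, he.symm⟩⟩

theorem MinLink.separator_unique (hp : Pendant G x) (h : MinLink G x H) {l : ℕ} {c : ℕ → V}
    (hc : CycIn G H l c) {k k' : ℕ} {j : Fin 4}
    (hs : ∀ i, c i ≠ c k → ¬ RIn G (H \ {c k}) (c i) (x j))
    (hs' : ∀ i, c i ≠ c k' → ¬ RIn G (H \ {c k'}) (c i) (x j)) : c k = c k' := by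
  obtain ⟨i, z, hz, hi⟩ := h.attach hp hc j
  rw [← hc.attach_unique hs hz hi, hc.attach_unique hs' hz hi]

/-- Assigning to each cycle vertex a terminal that it cuts off is injective, and there are four
terminals. -/
theorem MinLink.cycle_length (hp : Pendant G x) (h : MinLink G x H) {l : ℕ} {c : ℕ → V}
    (hc : CycIn G H l c) : l ≤ 4 := by
  choose f hf using h.separates hp hc
  have hinj : Function.Injective fun i : Fin l => f i := by
    intro i j hij
    have h1 := hf j
    simp only at hij
    rw [← hij] at h1
    exact Fin.ext (hc.inj _ i.2 _ j.2 (h.separator_unique hp hc (hf i) h1))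
  simpa using Fintype.card_le_of_injective _ hinj

/-- The four vertices of a cycle of length four in a minimal linking set are attached to the four
terminals, each to one. -/
theorem MinLink.square (hp : Pendant G x) (h : MinLink G x H) {c : ℕ → V}
    (hc : CycIn G H 4 c) : ∃ π : Equiv.Perm (Fin 4), ∀ k : Fin 4,
      (∃ z, RIn G (H \ Set.range c) (x (π k)) z ∧ G.Adj z (c k)) ∧
      (∀ z k', RIn G (H \ Set.range c) (x (π k)) z → G.Adj z (c k') → c k' = c k) := by
  choose f hf using h.separates hp hc
  have hinj : Function.Injective fun i : Fin 4 => f i := by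
    intro i j hij
    have h1 := hf j
    simp only at hij
    rw [← hij] at h1
    exact Fin.ext (hc.inj _ i.2 _ j.2 (h.separator_unique hp hc (hf i) h1))
  refine ⟨Equiv.ofBijective _ (Finite.injective_iff_bijective.mp hinj), fun k => ⟨?_, ?_⟩⟩
  · obtain ⟨i, z, hz, hi⟩ := h.attach hp hc (f k)
    exact ⟨z, hz, hc.attach_unique (hf k) hz hi ▸ hi⟩
  · intro z k' hz hk'
    exact hc.attach_unique (hf k) hz hk'

theorem cycIn_of_square {a b c d : V} (ha : a ∈ H) (hb : b ∈ H) (hc : c ∈ H) (hd : d ∈ H)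
    (hac : a ≠ c) (hbd : b ≠ d) (h1 : G.Adj a b) (h2 : G.Adj b c) (h3 : G.Adj c d)
    (h4 : G.Adj d a) :
    CycIn G H 4 fun k => if k % 4 = 0 then a else if k % 4 = 1 then b else
      if k % 4 = 2 then c else d := by
  have hmod : ∀ k : ℕ, k % 4 = 0 ∨ k % 4 = 1 ∨ k % 4 = 2 ∨ k % 4 = 3 := by omega
  refine ⟨by omega, fun k => by simp, fun k => ?_, ?_, fun k => ?_⟩
  · rcases hmod k with h | h | h | h <;> simp [Nat.add_mod, h, h1, h2, h3, h4]
  · intro i hi j hj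
    have n1 := h1.ne; have n2 := h2.ne; have n3 := h3.ne; have n4 := h4.ne
    interval_cases i <;> interval_cases j <;> simp_all [Ne.symm]
  · rcases hmod k with h | h | h | h <;> simp [h, ha, hb, hc, hd]

theorem CycIn.hasSquare {c : ℕ → V} (h : CycIn G H 4 c) : HasSquare G H := by
  have h30 := h.adj 3
  rw [show 3 + 1 = 0 + 4 from rfl, h.per 0] at h30
  refine ⟨c 0, h.mem 0, c 1, h.mem 1, c 2, h.mem 2, c 3, h.mem 3, ?_, ?_, h.adj 0, h.adj 1,
    h.adj 2, h30⟩
  · intro he; have := h.inj 0 (by omega) 2 (by omega) he; omega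
  · intro he; have := h.inj 1 (by omega) 3 (by omega) he; omega

theorem exists_cycIn_of_not_isAcyclic (h : ¬ (G.induce H).IsAcyclic) :
    ∃ l c, CycIn G H l c := by
  unfold SimpleGraph.IsAcyclic at h
  push Not at h
  obtain ⟨v, w, hw⟩ := h
  have hl := hw.three_le_length
  refine ⟨w.length, fun k => (w.getVert (k % w.length)).1, hl, fun k => by simp, ?_, ?_,
    fun k => Subtype.property _⟩
  · intro k
    have hlt : k % w.length < w.length := Nat.mod_lt _ (by omega)
    have hadj : G.Adj (w.getVert (k % w.length)).1 (w.getVert (k % w.length + 1)).1 :=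
      w.adj_getVert_succ hlt
    by_cases hlast : k % w.length + 1 < w.length
    · have : (k + 1) % w.length = k % w.length + 1 := by
        rw [Nat.add_mod, Nat.mod_eq_of_lt (show 1 < w.length by omega), Nat.mod_eq_of_lt hlast]
      simpa only [this] using hadj
    · have h1 : k % w.length + 1 = w.length := by omega
      have : (k + 1) % w.length = 0 := by
        rw [Nat.add_mod, Nat.mod_eq_of_lt (show 1 < w.length by omega), h1, Nat.mod_self]
      simp only [this]
      rw [h1] at hadj
      simpa using hadj
  · intro i hi j hj he
    have he' := Subtype.ext he
    rw [Nat.mod_eq_of_lt hi, Nat.mod_eq_of_lt hj] at he'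
    exact hw.getVert_injOn' (by simp; omega) (by simp; omega) he'

/-- A minimal linking set without squares induces a tree. -/
theorem MinLink.isInducedTreeCovering (ht : TriFree G) (hp : Pendant G x) (h : MinLink G x H)
    (hno : ¬ HasSquare G H) : IsInducedTreeCovering G x H := by
  refine ⟨fun i => (h.link i).right, ?_, ?_⟩
  · exact induce_connected_of_root (h.link 0).right h.reach
  · by_contra hac
    obtain ⟨l, c, hc⟩ := exists_cycIn_of_not_isAcyclic hac
    have h1 := hc.len
    have h2 := h.cycle_length hp hc
    obtain rfl | rfl : l = 3 ∨ l = 4 := by omega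
    · have h30 := hc.adj 2
      rw [show 2 + 1 = 0 + 3 from rfl, hc.per 0] at h30
      exact ht _ _ _ (hc.adj 0) (hc.adj 1) h30.symm
    · exact hno hc.hasSquare

/-- A set of vertices in which all terminals reach a centre, and whose other vertices fall into
parts without edges between them such that two of the terminals are alone in their parts. The
parts are the classes of a colouring. -/
def GoodMask (G : SimpleGraph V) (x : Fin 4 → V) (Q : Set V) : Prop :=
  ∃ (o : V) (col : V → ℕ) (d d' : Fin 4), d ≠ d' ∧
    (∀ u ∈ Q, ∀ w ∈ Q, u ≠ o → w ≠ o → G.Adj u w → col u = col w) ∧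
    (∀ e, col (x e) = col (x d) → e = d) ∧ (∀ e, col (x e) = col (x d') → e = d') ∧
    ∀ e, RIn G Q (x e) o

theorem GoodMask.link {Q : Set V} (h : GoodMask G x Q) (j : Fin 4) : RIn G Q (x 0) (x j) := by
  obtain ⟨o, -, -, -, -, -, -, -, h⟩ := h
  exact (h 0).trans (h j).symm

/-- A minimal linking set inside a good set has no squares. -/
theorem GoodMask.not_hasSquare {Q : Set V} (hQ : GoodMask G x Q) (hp : Pendant G x)
    (h : MinLink G x H) (hHQ : H ⊆ Q) : ¬ HasSquare G H := by
  rintro ⟨s0, m0, s1, m1, s2, m2, s3, m3, hac, hbd, a1, a2, a3, a4⟩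
  have hc := cycIn_of_square m0 m1 m2 m3 hac hbd a1 a2 a3 a4
  generalize (fun k => if k % 4 = 0 then s0 else if k % 4 = 1 then s1 else
      if k % 4 = 2 then s2 else s3) = c at hc
  clear m0 m1 m2 m3 hac hbd a1 a2 a3 a4
  obtain ⟨π, hπ⟩ := h.square hp hc
  obtain ⟨o, col, d, d', hdd, hcol, hd, hd', -⟩ := hQ
  have hsame : ∀ a b, RIn G (H \ {o}) a b → col a = col b := fun a b hab =>
    hab.color_eq fun u hu w hw huw => hcol u (hHQ hu.1) w (hHQ hw.1) hu.2 hw.2 huw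
  -- A point `p` of the cycle from which the deletion of `o` cuts off at most one terminal.
  obtain ⟨p, hbad⟩ : ∃ p, ∀ e e', ¬ RIn G (H \ {o}) (x e) p → ¬ RIn G (H \ {o}) (x e') p →
      e = e' := by
    -- If `o` lies on the cycle, the rest of the cycle stays connected, and only the terminal
    -- attached at `o` can lose its connection to it.
    by_cases ho : o ∈ Set.range c
    · obtain ⟨k0, rfl⟩ := ho
      refine ⟨c (k0 + 1), ?_⟩
      have key : ∀ e, ¬ RIn G (H \ {c k0}) (x e) (c (k0 + 1)) → c (π.symm e) = c k0 := by
        intro e he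
        by_contra hne
        obtain ⟨⟨z, hz, hzc⟩, -⟩ := hπ (π.symm e)
        rw [Equiv.apply_symm_apply] at hz
        have hz' : RIn G (H \ {c k0}) (x e) z :=
          hz.mono fun u hu => ⟨hu.1, fun he => hu.2 ⟨k0, he.symm⟩⟩
        exact he ((hz'.step hzc ⟨hc.mem _, hne⟩).trans (hc.around' k0 _ _ hne (hc.adj k0).ne'))
      intro e e' he he'
      have h1 := hc.inj _ (π.symm e).2 _ (π.symm e').2 ((key e he).trans (key e' he').symm)
      exact π.symm.injective (Fin.ext h1)
    -- If `o` is off the cycle, the cycle survives. A terminal that loses it has `o` in its own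
    -- component of `H` without the cycle, and these components are disjoint.
    · refine ⟨c 0, ?_⟩
      have hcr : ∀ i j, RIn G (H \ {o}) (c i) (c j) := by
        have h0 : ∀ i, RIn G (H \ {o}) (c 0) (c i) := by
          intro i
          induction i with
          | zero => exact RIn.refl ⟨hc.mem 0, fun he => ho ⟨0, he⟩⟩
          | succ i ih => exact ih.step (hc.adj i) ⟨hc.mem _, fun he => ho ⟨_, he⟩⟩
        exact fun i j => (h0 i).symm.trans (h0 j)
      have key : ∀ e, ¬ RIn G (H \ {o}) (x e) (c 0) → RIn G (H \ Set.range c) (x e) o := by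
        intro e he
        by_contra hne
        obtain ⟨⟨z, hz, hzc⟩, -⟩ := hπ (π.symm e)
        rw [Equiv.apply_symm_apply] at hz
        have hz' : RIn G (H \ {o}) (x e) z := by
          refine hz.of_forall fun u hu => ⟨hu.right.1, ?_⟩
          rintro rfl
          exact hne hu
        exact he ((hz'.step hzc ⟨hc.mem _, fun he => ho ⟨_, he⟩⟩).trans (hcr _ _))
      intro e e' he he'
      have h1 := (key e he).trans (key e' he').symm
      obtain ⟨⟨z, hz, hzc⟩, -⟩ := hπ (π.symm e')
      rw [Equiv.apply_symm_apply] at hz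
      have h2 := (hπ (π.symm e)).2 z (π.symm e') (by rw [Equiv.apply_symm_apply]; exact h1.trans hz)
        hzc
      exact (π.symm.injective (Fin.ext (hc.inj _ (π.symm e').2 _ (π.symm e).2 h2))).symm
  -- If the lonely terminal `d` reached `p`, then none of the other three would, whereas at most one
  -- terminal fails to. So both lonely terminals fail, although only one may.
  have key : ∀ d, (∀ e, col (x e) = col (x d) → e = d) → ¬ RIn G (H \ {o}) (x d) p := by
    intro d hd hdp
    have hbd : ∀ e, e ≠ d → ¬ RIn G (H \ {o}) (x e) p := fun e he hep =>
      he (hd e (hsame _ _ (hep.trans hdp.symm)))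
    obtain ⟨e, e', hee, he, he'⟩ : ∃ e e' : Fin 4, e ≠ e' ∧ e ≠ d ∧ e' ≠ d := by
      clear hdp hbd hd; revert d; decide
    exact hee (hbad e e' (hbd e he) (hbd e' he'))
  exact hdd (hbad d d' (key d hd) (key d' hd'))

end Minimal

/-! ## Labellings that describe square structures, and how they grow -/

section Tables

variable {V : Type u}

/-- For every label, `P` holds a neighbour of `v` with this label and `M` a non-neighbour, if there
is one. -/
structure Tab (G : SimpleGraph V) (L : V → ℕ) (v : V) (P M : ℕ → Set V) : Prop where
  P_sub : ∀ l u, u ∈ P l → G.Adj v u ∧ L u = l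
  M_sub : ∀ l u, u ∈ M l → ¬ G.Adj v u ∧ L u = l
  P_ex : ∀ u, G.Adj v u → (P (L u)).Nonempty
  M_ex : ∀ u, ¬ G.Adj v u → (M (L u)).Nonempty
  P_ss : ∀ l, (P l).Subsingleton
  M_ss : ∀ l, (M l).Subsingleton

theorem Tab.pos {G : SimpleGraph V} {L : V → ℕ} {v : V} {P M : ℕ → Set V} (h : Tab G L v P M)
    {u : V} {l : ℕ} (hu : G.Adj v u) (hl : L u = l) : ∃ s, P l = {s} ∧ G.Adj v s ∧ L s = l := by
  subst hl
  obtain ⟨s, hs⟩ := h.P_ex u hu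
  exact ⟨s, (h.P_ss _).eq_singleton_of_mem hs, h.P_sub _ _ hs⟩

theorem Tab.neg {G : SimpleGraph V} {L : V → ℕ} {v : V} {P M : ℕ → Set V} (h : Tab G L v P M)
    {u : V} {l : ℕ} (hu : ¬ G.Adj v u) (hl : L u = l) :
    ∃ s, M l = {s} ∧ ¬ G.Adj v s ∧ L s = l := by
  subst hl
  obtain ⟨s, hs⟩ := h.M_ex u hu
  exact ⟨s, (h.M_ss _).eq_singleton_of_mem hs, h.M_sub _ _ hs⟩

/-- `Q` consists of the vertices with labels below `4`, of `v`, of the terminals, and for every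
label in the list `ls` of nothing, of the entry of one of the tables, or of all vertices with this
label. -/
structure InFam (L : V → ℕ) (v : V) (x : Fin 4 → V) (P M : ℕ → Set V) (ls : List ℕ) (Q : Set V) :
    Prop where
  low : ∀ u, L u < 4 → u ∈ Q
  self : v ∈ Q
  term : ∀ i, x i ∈ Q
  sub : ∀ u ∈ Q, u = v ∨ L u < 4 ∨ (∃ i, u = x i) ∨ L u ∈ ls
  rep : ∀ l ∈ ls, ∃ E : Set V, (E = ∅ ∨ E = P l ∨ E = M l ∨ E = {u | L u = l}) ∧
    ∀ u, u ≠ v → L u = l → (u ∈ Q ↔ u ∈ E)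

/-- Square structures list the terminals in cyclic order, as `x ∘ π`, but the program searches with
the terminals in the given order. Neither membership in the family nor goodness depends on the
order. -/
theorem InFam.of_comp {L : V → ℕ} {v : V} {x : Fin 4 → V} {P M : ℕ → Set V} {ls : List ℕ}
    {Q : Set V} (π : Equiv.Perm (Fin 4)) (h : InFam L v (x ∘ π) P M ls Q) :
    InFam L v x P M ls Q where
  low := h.low
  self := h.self
  term i := by simpa using h.term (π.symm i)
  sub u hu := by
    rcases h.sub u hu with h1 | h1 | ⟨i, h1⟩ | h1
    · exact Or.inl h1
    · exact Or.inr (Or.inl h1)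
    · exact Or.inr (Or.inr (Or.inl ⟨π i, h1⟩))
    · exact Or.inr (Or.inr (Or.inr h1))
  rep := h.rep

theorem GoodMask.of_comp {G : SimpleGraph V} {x : Fin 4 → V} {Q : Set V} (π : Equiv.Perm (Fin 4))
    (h : GoodMask G (x ∘ π) Q) : GoodMask G x Q := by
  obtain ⟨o, col, d, d', hdd, hcol, hd, hd', hr⟩ := h
  refine ⟨o, col, π d, π d', fun he => hdd (π.injective he), hcol, fun e he => ?_, fun e he => ?_,
    fun e => by simpa using hr (π.symm e)⟩
  · rw [← hd (π.symm e) (by simpa using he)]; simp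
  · rw [← hd' (π.symm e) (by simpa using he)]; simp

/-- A growth rule: a vertex with label `old` that has no neighbour with a label in `none` and is
adjacent to all vertices with labels in `all` gets the label `new`. -/
structure Rule where
  old : ℕ
  none : List ℕ
  all : List ℕ
  new : ℕ

/-- The rule applies to the vertex `v`. -/
def Rule.Applies (G : SimpleGraph V) (L : V → ℕ) (v : V) (r : Rule) : Prop :=
  L v = r.old ∧ (∀ l ∈ r.none, ∀ w, G.Adj v w → L w ≠ l) ∧ ∀ l ∈ r.all, ∀ w, L w = l → G.Adj v w

end Tables

/-! ### Good sets that are described by labels and tabulated vertices -/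

section Masks

variable {V : Type u} {G : SimpleGraph V} {y : Fin 4 → V} {L : V → ℕ} {v : V}

/-- A set is good if its colouring can be read off from the labels, with an exception for `v`. -/
theorem goodMask_of_labels (hy : ∀ e, y e ≠ v) {Q : Set V} (o : V) (κ : ℕ → ℕ) (κv : ℕ)
    (d d' : Fin 4) (hdd : d ≠ d')
    (h1 : ∀ u ∈ Q, ∀ w ∈ Q, u ≠ o → w ≠ o → u ≠ v → w ≠ v → G.Adj u w → κ (L u) = κ (L w))
    (h2 : v ≠ o → ∀ u ∈ Q, u ≠ o → u ≠ v → G.Adj v u → κ (L u) = κv)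
    (h3 : ∀ e, κ (L (y e)) = κ (L (y d)) → e = d)
    (h4 : ∀ e, κ (L (y e)) = κ (L (y d')) → e = d')
    (h5 : ∀ e, RIn G Q (y e) o) : GoodMask G y Q := by
  classical
  refine ⟨o, fun u => if u = v then κv else κ (L u), d, d', hdd, ?_, ?_, ?_, h5⟩
  · intro u hu w hw huo hwo huw
    by_cases huv : u = v
    · subst huv
      have hwv : w ≠ u := huw.ne'
      simp [hwv, h2 huo w hw hwo hwv huw]
    · by_cases hwv : w = v
      · subst hwv
        simp [huv, h2 hwo u hu huo huv huw.symm]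
      · simp [huv, hwv, h1 u hu w hw huo hwo huv hwv huw]
  · intro e he
    simp only [hy, if_false] at he
    exact h3 e he
  · intro e he
    simp only [hy, if_false] at he
    exact h4 e he

/-- For a label in `ls` the set holds the whole class if `F` selects it, one tabulated vertex if `T`
has a member with this label, and otherwise nothing. The condition on `y` matters when a terminal
has an intermediate label. -/
theorem inFam_of_labels {P M : ℕ → Set V} {ls : List ℕ} (hls : ∀ l ∈ ls, 4 ≤ l) (T : Set V)
    (F : ℕ → Prop) (hF : ∀ l, F l → l ∈ ls) (hy : ∀ i, L (y i) < 4 ∨ F (L (y i)))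
    (hT : ∀ s ∈ T, L s ∈ ls ∧ ¬ F (L s) ∧ (P (L s) = {s} ∨ M (L s) = {s}))
    (hinj : ∀ s ∈ T, ∀ s' ∈ T, L s = L s' → s = s') :
    InFam L v y P M ls {u | L u < 4 ∨ u = v ∨ u ∈ T ∨ F (L u)} where
  low u hu := Or.inl hu
  self := Or.inr (Or.inl rfl)
  term i := (hy i).imp_right fun h => Or.inr (Or.inr h)
  sub u hu := by
    rcases hu with hu | hu | hu | hu
    · exact Or.inr (Or.inl hu)
    · exact Or.inl hu
    · exact Or.inr (Or.inr (Or.inr (hT u hu).1))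
    · exact Or.inr (Or.inr (Or.inr (hF _ hu)))
  rep l hl := by
    have hl4 := hls l hl
    by_cases hFl : F l
    · refine ⟨{u | L u = l}, Or.inr (Or.inr (Or.inr rfl)), fun u _ hul => ?_⟩
      simp only [Set.mem_ofPred_eq]
      exact ⟨fun _ => hul, fun _ => Or.inr (Or.inr (Or.inr (hul ▸ hFl)))⟩
    by_cases hex : ∃ s ∈ T, L s = l
    · obtain ⟨s, hs, rfl⟩ := hex
      refine ⟨{s}, ?_, fun u huv hul => ?_⟩
      · rcases (hT s hs).2.2 with hP | hM
        · exact Or.inr (Or.inl hP.symm)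
        · exact Or.inr (Or.inr (Or.inl hM.symm))
      · simp only [Set.mem_ofPred_eq, Set.mem_singleton_iff]
        constructor
        · rintro (hu | hu | hu | hu)
          · omega
          · exact absurd hu huv
          · exact hinj u hu s hs hul
          · exact absurd (hul ▸ hu) hFl
        · rintro rfl
          exact Or.inr (Or.inr (Or.inl hs))
    · refine ⟨∅, Or.inl rfl, fun u huv hul => ?_⟩
      simp only [Set.mem_ofPred_eq, Set.mem_empty_iff_false, iff_false]
      rintro (hu | hu | hu | hu)
      · omega
      · exact huv hu
      · exact hex ⟨u, hu, hul⟩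
      · exact hFl (hul ▸ hu)

/-- Any vertex can be replaced by a tabulated one with the same label. The next two lemmas keep its
adjacency to `v` as well, so that the case analyses can work with arbitrary vertices first. -/
theorem Tab.pick {P M : ℕ → Set V} (T : Tab G L v P M) (u : V) :
    ∃ s, L s = L u ∧ (P (L s) = {s} ∨ M (L s) = {s}) := by
  by_cases hvu : G.Adj v u
  · obtain ⟨s, h1, -, h3⟩ := T.pos hvu rfl
    exact ⟨s, h3, Or.inl (h3 ▸ h1)⟩
  · obtain ⟨s, h1, -, h3⟩ := T.neg hvu rfl
    exact ⟨s, h3, Or.inr (h3 ▸ h1)⟩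

theorem Tab.pick_pos {P M : ℕ → Set V} (T : Tab G L v P M) {u : V} (hvu : G.Adj v u) :
    ∃ s, L s = L u ∧ G.Adj v s ∧ (P (L s) = {s} ∨ M (L s) = {s}) := by
  obtain ⟨s, h1, h2, h3⟩ := T.pos hvu rfl
  exact ⟨s, h3, h2, Or.inl (h3 ▸ h1)⟩

theorem Tab.pick_neg {P M : ℕ → Set V} (T : Tab G L v P M) {u : V} (hvu : ¬ G.Adj v u) :
    ∃ s, L s = L u ∧ ¬ G.Adj v s ∧ (P (L s) = {s} ∨ M (L s) = {s}) := by
  obtain ⟨s, h1, h2, h3⟩ := T.neg hvu rfl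
  exact ⟨s, h3, h2, Or.inr (h3 ▸ h1)⟩

end Masks

/-- `a b c d` is the cyclic order of the indices, in one of the two directions. -/
def Cyc (a b c d : Fin 4) : Prop :=
  (b = a + 1 ∧ c = a + 2 ∧ d = a + 3) ∨ (b = a + 3 ∧ c = a + 2 ∧ d = a + 1)

instance (a b c d : Fin 4) : Decidable (Cyc a b c d) := inferInstanceAs (Decidable (_ ∨ _))

namespace Cyc

variable {a b c d : Fin 4}

theorem rot (h : Cyc a b c d) : Cyc b c d a := by revert a b c d; decide

theorem flip (h : Cyc a b c d) : Cyc b a d c := by revert a b c d; decide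

theorem vals (h : Cyc a b c d) : a.val ≠ b.val ∧ a.val ≠ c.val ∧ a.val ≠ d.val ∧ b.val ≠ c.val ∧
    b.val ≠ d.val ∧ c.val ≠ d.val := by revert a b c d; decide

theorem cases (h : Cyc a b c d) (j : Fin 4) : j = a ∨ j = b ∨ j = c ∨ j = d := by
  revert a b c d j; decide

theorem succ_or (h : Cyc a b c d) : b = a + 1 ∨ a = b + 1 := by revert a b c d; decide

theorem opp (h : Cyc a b c d) : c = a + 2 := by revert a b c d; decide

end Cyc

/-! ### Square structures as invariants of a labelling -/

section Square

variable {V : Type u} {G : SimpleGraph V} {y : Fin 4 → V} {L : V → ℕ}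

/-- The labels `0-3` (for `A₁, …, A₄`), `4-7` (for `S₁, …, S₄`) and `8` (for vertices not yet
treated) describe a square structure on the vertices with labels below `8`. -/
structure SqInv (G : SimpleGraph V) (y : Fin 4 → V) (L : V → ℕ) : Prop where
  term : ∀ i : Fin 4, L (y i) = i.val
  ne : ∀ i : Fin 4, ∃ u, L u = 4 + i.val
  comp : ∀ (i : Fin 4) u w, L u = 4 + i.val → L w = 4 + (i + 1).val → G.Adj u w
  att : ∀ (i : Fin 4) u, L u = 4 + i.val → ∃ w, G.Adj u w ∧ L w = i.val
  nbA : ∀ (i : Fin 4) u w, L u = i.val → G.Adj u w → L w = i.val ∨ L w = 4 + i.val ∨ L w = 8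
  conn : ∀ (i : Fin 4) u, L u = i.val → RIn G {w | L w = i.val} (y i) u
  le : ∀ u, L u ≤ 8

namespace SqInv

theorem adj (h : SqInv G y L) {a b c d : Fin 4} (hc : Cyc a b c d) {u w : V}
    (hu : L u = 4 + a.val) (hw : L w = 4 + b.val) : G.Adj u w := by
  rcases hc.succ_or with rfl | rfl
  · exact h.comp _ u w hu hw
  · exact (h.comp _ w u hw hu).symm

/-- An edge between opposite sets would form a triangle with any vertex of a set in between. For
this reason `SqInv` records neither these non-edges nor the stability of the sets `S_i`. -/
theorem not_adj_opp (ht : TriFree G) (h : SqInv G y L) {a b c d : Fin 4} (hc : Cyc a b c d)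
    {u w : V} (hu : L u = 4 + a.val) (hw : L w = 4 + c.val) : ¬ G.Adj u w := by
  obtain ⟨z, hz⟩ := h.ne b
  exact fun huw => ht _ _ _ (h.adj hc hu hz) (h.adj hc.rot hz hw) huw

theorem not_adj_same (ht : TriFree G) (h : SqInv G y L) {a : Fin 4}
    {u w : V} (hu : L u = 4 + a.val) (hw : L w = 4 + a.val) : ¬ G.Adj u w := by
  obtain ⟨z, hz⟩ := h.ne (a + 1)
  exact fun huw => ht _ _ _ (h.comp a u z hu hz) (h.comp a w z hw hz).symm huw

/-- The labels `i` of `A_i` and `4 + i` of `S_i` agree modulo `4`. The residue thus serves as a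
colour that is constant along the edges at the sets `A_i`, apart from edges to untreated vertices.
-/
theorem nb_low (h : SqInv G y L) {u w : V} (hu : L u < 4) (huw : G.Adj u w) :
    L w = 8 ∨ L w % 4 = L u % 4 := by
  have := h.nbA ⟨L u, hu⟩ u w rfl huw
  simp only at this
  omega

/-- As soon as no untreated vertex touches an `A_i`, the invariant gives `N(A_i) = S_i`, and the
untreated vertices can serve as `R`. -/
theorem isSquareSplit (ht : TriFree G) (h : SqInv G y L)
    (hfin : ∀ u w, L u < 4 → L w = 8 → ¬ G.Adj u w) :
    IsSquareSplit G y (fun i => {v | L v = i.val}) (fun i => {v | L v = 4 + i.val})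
      {v | L v = 8} where
  cover := by
    ext v
    simp only [Set.mem_union, Set.mem_iUnion, Set.mem_ofPred_eq, Set.mem_univ, iff_true]
    have := h.le v
    by_cases h4 : L v < 4
    · exact Or.inl (Or.inl ⟨⟨L v, h4⟩, rfl⟩)
    · by_cases h8 : L v < 8
      · exact Or.inl (Or.inr ⟨⟨L v - 4, by omega⟩, by simp only; omega⟩)
      · exact Or.inr (by omega)
  disjoint := by
    intro p q hpq
    rw [Set.disjoint_left]
    rintro v hp hq
    rcases p with i | i | _ <;> rcases q with j | j | _ <;>
      simp only [Sum.elim_inl, Sum.elim_inr, Set.mem_ofPred_eq] at hp hq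
    · exact hpq (by rw [Fin.ext (hp.symm.trans hq)])
    · omega
    · omega
    · omega
    · exact hpq (by rw [Fin.ext (show i.val = j.val by omega)])
    · omega
    · omega
    · omega
    · exact hpq rfl
  terminal_mem := h.term
  stable i u hu w hw _ := h.not_adj_same ht hu hw
  nonempty := h.ne
  complete i u hu w hw := h.comp i u w hu hw
  anticomplete i u hu w hw :=
    h.not_adj_opp ht (b := i + 1) (d := i + 3) (Or.inl ⟨rfl, rfl, rfl⟩) hu hw
  nbhd_A i := by
    ext v
    constructor
    · rintro ⟨h1, u, hu, huv⟩
      rcases h.nbA i u v hu huv with h2 | h2 | h2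
      · exact absurd h2 h1
      · exact h2
      · refine absurd huv (hfin u v ?_ h2)
        rw [show L u = i.val from hu]; exact i.2
    · intro hv
      obtain ⟨w, hw, hwl⟩ := h.att i v hv
      refine ⟨?_, w, hwl, hw.symm⟩
      have h4 : L v = 4 + i.val := hv
      intro hc
      have : L v = i.val := hc
      omega
  nbhd_R := by
    rintro v ⟨hv, u, hu, huv⟩
    have h1 := h.le v
    have h2 : L v ≠ 8 := hv
    have h3 : ¬ L v < 4 := fun h4 => hfin v u h4 hu huv.symm
    exact Set.mem_iUnion.mpr ⟨⟨L v - 4, by omega⟩, by simp only [Set.mem_ofPred_eq]; omega⟩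
  connected_A i := induce_connected_of_root (h.term i) (h.conn i)

variable {v : V}

/-- The neighbour in `A_i` keeps this set connected, and the condition on all neighbours is what
`nbA` demands, both of the new member and of the old vertices that see it. -/
theorem grow_A [DecidableEq V] (h : SqInv G y L) (hv : L v = 8) (i : Fin 4)
    (hex : ∃ u, L u = i.val ∧ G.Adj v u)
    (hnb : ∀ w, G.Adj v w → L w = i.val ∨ L w = 4 + i.val ∨ L w = 8) :
    SqInv G y (Function.update L v i.val) := by
  have hL : ∀ u, L u ≠ 8 → u ≠ v := by rintro u hu rfl; exact hu hv
  have hi := i.2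
  have hS : ∀ (j : Fin 4) u, Function.update L v i.val u = 4 + j.val → L u = 4 + j.val := by
    intro j u hu
    by_cases huv : u = v
    · subst huv; rw [Function.update_self] at hu; omega
    · rwa [Function.update_of_ne huv] at hu
  have hkeep : ∀ u, L u ≠ 8 → Function.update L v i.val u = L u := fun u hu =>
    Function.update_of_ne (hL u hu) _ _
  have hmono : ∀ j : Fin 4, {w | L w = j.val} ⊆ {w | Function.update L v i.val w = j.val} := by
    intro j w hw
    have hw' : L w = j.val := hw
    have := j.2
    simpa [hkeep w (by omega)] using hw'
  refine ⟨fun j => ?_, fun j => ?_, fun j u w hu hw => ?_, fun j u hu => ?_, fun j u w hu huw => ?_,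
    fun j u hu => ?_, fun u => ?_⟩
  · have := h.term j
    have := j.2
    rw [hkeep _ (by omega)]; assumption
  · obtain ⟨u, hu⟩ := h.ne j
    have := j.2
    exact ⟨u, by rw [hkeep _ (by omega)]; exact hu⟩
  · exact h.comp j u w (hS _ _ hu) (hS _ _ hw)
  · obtain ⟨w, hw, hwl⟩ := h.att j u (hS _ _ hu)
    have := j.2
    exact ⟨w, hw, by rw [hkeep _ (by omega)]; exact hwl⟩
  · by_cases huv : u = v
    · subst huv
      rw [Function.update_self] at hu
      rw [← hu]
      by_cases hwv : w = u
      · exact absurd huw (hwv ▸ G.irrefl)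
      · rw [Function.update_of_ne hwv]; exact hnb w huw
    · rw [Function.update_of_ne huv] at hu
      by_cases hwv : w = v
      · subst hwv
        have := hnb u huw.symm
        have := j.2
        rw [Function.update_self]
        omega
      · rw [Function.update_of_ne hwv]; exact h.nbA j u w hu huw
  · by_cases huv : u = v
    · subst huv
      rw [Function.update_self] at hu
      obtain rfl : i = j := Fin.ext hu
      obtain ⟨w, hw, hwv⟩ := hex
      exact ((h.conn i w hw).mono (hmono i)).step hwv.symm (by simp)
    · rw [Function.update_of_ne huv] at hu
      exact (h.conn j u hu).mono (hmono j)
  · by_cases huv : u = v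
    · subst huv; rw [Function.update_self]; omega
    · rw [Function.update_of_ne huv]; exact h.le u

/-- Non-adjacency to `S_i` and `S_{i+2}` is not needed: it follows from completeness to `S_{i+1}`,
since there are no triangles. -/
theorem grow_S [DecidableEq V] (h : SqInv G y L) (hv : L v = 8) (i : Fin 4)
    (hex : ∃ u, L u = i.val ∧ G.Adj v u)
    (hA : ∀ w, G.Adj v w → L w < 4 → L w = i.val)
    (hn : ∀ w, L w = 4 + (i + 1).val → G.Adj v w) (hp : ∀ w, L w = 4 + (i + 3).val → G.Adj v w) :
    SqInv G y (Function.update L v (4 + i.val)) := by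
  have hL : ∀ u, L u ≠ 8 → u ≠ v := by rintro u hu rfl; exact hu hv
  have hi := i.2
  have hkeep : ∀ u, L u ≠ 8 → Function.update L v (4 + i.val) u = L u := fun u hu =>
    Function.update_of_ne (hL u hu) _ _
  have hlow : ∀ (j : Fin 4) u, Function.update L v (4 + i.val) u = j.val → L u = j.val := by
    intro j u hu
    by_cases huv : u = v
    · subst huv; rw [Function.update_self] at hu; omega
    · rwa [Function.update_of_ne huv] at hu
  refine ⟨fun j => ?_, fun j => ?_, fun j u w hu hw => ?_, fun j u hu => ?_, fun j u w hu huw => ?_,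
    fun j u hu => ?_, fun u => ?_⟩
  · have := h.term j
    have := j.2
    rw [hkeep _ (by omega)]; assumption
  · obtain ⟨u, hu⟩ := h.ne j
    have := j.2
    exact ⟨u, by rw [hkeep _ (by omega)]; exact hu⟩
  · by_cases huv : u = v
    · subst huv
      rw [Function.update_self] at hu
      obtain rfl : i = j := Fin.ext (by omega)
      by_cases hwv : w = u
      · subst hwv
        rw [Function.update_self] at hw
        have : i.val ≠ (i + 1).val := by clear * -; revert i; decide
        omega
      · rw [Function.update_of_ne hwv] at hw; exact hn w hw
    · rw [Function.update_of_ne huv] at hu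
      by_cases hwv : w = v
      · subst hwv
        rw [Function.update_self] at hw
        obtain rfl : i = j + 1 := Fin.ext (by omega)
        refine (hp u ?_).symm
        rw [hu]
        congr 2
        clear * -; revert j; decide
      · rw [Function.update_of_ne hwv] at hw; exact h.comp j u w hu hw
  · by_cases huv : u = v
    · subst huv
      rw [Function.update_self] at hu
      obtain rfl : i = j := Fin.ext (by omega)
      obtain ⟨w, hw, hwv⟩ := hex
      exact ⟨w, hwv, by rw [hkeep _ (by omega)]; exact hw⟩
    · rw [Function.update_of_ne huv] at hu
      obtain ⟨w, hw, hwl⟩ := h.att j u hu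
      have := j.2
      exact ⟨w, hw, by rw [hkeep _ (by omega)]; exact hwl⟩
  · have hu' := hlow j u hu
    have := j.2
    by_cases hwv : w = v
    · subst hwv
      have := hA u huw.symm (by omega)
      rw [Function.update_self]; omega
    · rw [Function.update_of_ne hwv]; exact h.nbA j u w hu' huw
  · refine (h.conn j u (hlow j u hu)).mono fun w hw => ?_
    have hw' : L w = j.val := hw
    have := j.2
    simpa [hkeep w (by omega)] using hw'
  · by_cases huv : u = v
    · subst huv; rw [Function.update_self]; omega
    · rw [Function.update_of_ne huv]; exact h.le u

/-! ### Good sets around a vertex that does not fit in -/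

theorem reach_A (h : SqInv G y L) {Q : Set V} (hQ : ∀ u, L u < 4 → u ∈ Q) {j : Fin 4} {u : V}
    (hu : L u = j.val) : RIn G Q (y j) u :=
  (h.conn j u hu).mono fun w hw => hQ w (by have := j.2; have : L w = j.val := hw; omega)

theorem reach_S (h : SqInv G y L) {Q : Set V} (hQ : ∀ u, L u < 4 → u ∈ Q) {j : Fin 4} {s : V}
    (hs : s ∈ Q) (hl : L s = 4 + j.val) : RIn G Q (y j) s := by
  obtain ⟨w, hw, hwl⟩ := h.att j s hl
  exact (h.reach_A hQ hwl).step hw.symm hs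

theorem reach_v (h : SqInv G y L) {Q : Set V} (hQ : ∀ u, L u < 4 → u ∈ Q) {j : Fin 4}
    (hv : v ∈ Q) (hex : ∃ u, L u = j.val ∧ G.Adj v u) : RIn G Q (y j) v := by
  obtain ⟨w, hw, hvw⟩ := hex
  exact (h.reach_A hQ hw).step hvw.symm hv

/-- `goodMask_of_labels` for the labels of a square structure. -/
theorem goodMask_of_labels (h : SqInv G y L) (hv : L v = 8) {Q : Set V} (o : V) (κ : ℕ → ℕ) (κv : ℕ)
    (d d' : Fin 4) (hdd : d ≠ d')
    (h1 : ∀ u ∈ Q, ∀ w ∈ Q, u ≠ o → w ≠ o → u ≠ v → w ≠ v → G.Adj u w → κ (L u) = κ (L w))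
    (h2 : v ≠ o → ∀ u ∈ Q, u ≠ o → u ≠ v → G.Adj v u → κ (L u) = κv)
    (h3 : ∀ e : Fin 4, κ e.val = κ d.val → e = d) (h4 : ∀ e : Fin 4, κ e.val = κ d'.val → e = d')
    (h5 : ∀ e, RIn G Q (y e) o) : GoodMask G y Q := by
  refine _root_.goodMask_of_labels (L := L) (v := v) ?_ o κ κv d d' hdd h1 h2 ?_ ?_ h5
  · intro e he
    have := h.term e
    rw [he] at this
    have := e.2
    omega
  · simpa only [h.term] using h3
  · simpa only [h.term] using h4

/-- The label classes of a set of vertices with labels `0-3` and of representatives. -/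
theorem inFam (h : SqInv G y L) {P M : ℕ → Set V} (T : Set V)
    (hT : ∀ s ∈ T, 4 ≤ L s ∧ L s < 8 ∧ (P (L s) = {s} ∨ M (L s) = {s}))
    (hinj : ∀ s ∈ T, ∀ s' ∈ T, L s = L s' → s = s') :
    InFam L v y P M [4, 5, 6, 7] {u | L u < 4 ∨ u = v ∨ u ∈ T} where
  low u hu := Or.inl hu
  self := Or.inr (Or.inl rfl)
  term i := Or.inl (by rw [h.term]; exact i.2)
  sub u hu := by
    rcases hu with hu | hu | hu
    · exact Or.inr (Or.inl hu)
    · exact Or.inl hu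
    · refine Or.inr (Or.inr (Or.inr ?_))
      have := hT u hu
      simp only [List.mem_cons, List.not_mem_nil, or_false]
      omega
  rep l hl := by
    have hl4 : 4 ≤ l := by
      simp only [List.mem_cons, List.not_mem_nil, or_false] at hl
      omega
    by_cases hex : ∃ s ∈ T, L s = l
    · obtain ⟨s, hs, rfl⟩ := hex
      refine ⟨{s}, ?_, fun u huv hul => ?_⟩
      · rcases (hT s hs).2.2 with hP | hM
        · exact Or.inr (Or.inl hP.symm)
        · exact Or.inr (Or.inr (Or.inl hM.symm))
      · simp only [Set.mem_ofPred_eq, Set.mem_singleton_iff]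
        constructor
        · rintro (hu | hu | hu)
          · omega
          · exact absurd hu huv
          · exact hinj u hu s hs hul
        · rintro rfl
          exact Or.inr (Or.inr hs)
    · refine ⟨∅, Or.inl rfl, fun u huv hul => ?_⟩
      simp only [Set.mem_ofPred_eq, Set.mem_empty_iff_false, iff_false]
      rintro (hu | hu | hu)
      · omega
      · exact huv hu
      · exact hex ⟨u, hu, hul⟩

end SqInv

end Square

/-! ### A vertex that a square structure cannot absorb -/

section SquareFail

variable {V : Type u} {G : SimpleGraph V} {y : Fin 4 → V} {L : V → ℕ} {v : V}

namespace SqInv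

/-- The centre is `sc`. Without it `A_c` is a piece, and so is `A_d` with `sd`, because `v` avoids
them all. Everything else forms the third colour class. Hence `c` and `d` are alone, and `hr`
provides the way from `A_a` through `v` to the centre. -/
theorem good_adjacent (ht : TriFree G) (h : SqInv G y L) (hv : L v = 8) {a b c d : Fin 4}
    (hc : Cyc a b c d) {sb sc sd : V} (lb : L sb = 4 + b.val) (lc : L sc = 4 + c.val)
    (ld : L sd = 4 + d.val) (ha : ∃ u, L u = a.val ∧ G.Adj v u)
    (nc : ∀ u, G.Adj v u → L u ≠ c.val) (nd : ∀ u, G.Adj v u → L u ≠ d.val) (nsd : ¬ G.Adj v sd)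
    (hr : G.Adj v sc ∨ G.Adj v sb ∨ ∃ u, L u = b.val ∧ G.Adj v u) :
    GoodMask G y {u | L u < 4 ∨ u = v ∨ u ∈ ({sb, sc, sd} : Set V)} := by
  set Q : Set V := {u | L u < 4 ∨ u = v ∨ u ∈ ({sb, sc, sd} : Set V)} with hQdef
  obtain ⟨vab, vac, vad, vbc, vbd, vcd⟩ := hc.vals
  have := a.2; have := b.2; have := c.2; have := d.2
  have hlow : ∀ u, L u < 4 → u ∈ Q := fun u hu => Or.inl hu
  have hvQ : v ∈ Q := Or.inr (Or.inl rfl)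
  have hsb : sb ∈ Q := Or.inr (Or.inr (by simp))
  have hsc : sc ∈ Q := Or.inr (Or.inr (by simp))
  have hsd : sd ∈ Q := Or.inr (Or.inr (by simp))
  have hbc : G.Adj sb sc := h.adj hc.rot lb lc
  have hcd : G.Adj sc sd := h.adj hc.rot.rot lc ld
  have hbd : ¬ G.Adj sb sd := h.not_adj_opp ht hc.rot lb ld
  refine h.goodMask_of_labels hv sc
    (fun l => if l % 4 = c.val then 2 else if l % 4 = d.val then 3 else 0) 0 c d
    (fun he => vcd (congrArg _ he)) ?_ ?_ ?_ ?_ ?_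
  · intro u hu w hw huo hwo huv hwv huw
    have e8 : ∀ z ∈ Q, z ≠ v → L z ≠ 8 := by
      rintro z (hz | hz | hz) hzv
      · omega
      · exact absurd hz hzv
      · simp only [Set.mem_insert_iff, Set.mem_singleton_iff] at hz
        rcases hz with rfl | rfl | rfl <;> omega
    have hmod : L u % 4 = L w % 4 := by
      by_cases hu4 : L u < 4
      · rcases h.nb_low hu4 huw with h1 | h1
        · exact absurd h1 (e8 w hw hwv)
        · omega
      · by_cases hw4 : L w < 4
        · rcases h.nb_low hw4 huw.symm with h1 | h1
          · exact absurd h1 (e8 u hu huv)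
          · omega
        · have hu' := (hu.resolve_left hu4).resolve_left huv
          have hw' := (hw.resolve_left hw4).resolve_left hwv
          simp only [Set.mem_insert_iff, Set.mem_singleton_iff, huo, hwo, false_or] at hu' hw'
          rcases hu' with rfl | rfl <;> rcases hw' with rfl | rfl
          · rfl
          · exact absurd huw hbd
          · exact absurd huw.symm hbd
          · rfl
    simp only [hmod]
  · intro _ u hu huo huv huw
    have h1 := nc u huw
    have h2 := nd u huw
    rcases hu with hu | hu | hu
    · have : L u % 4 = L u := Nat.mod_eq_of_lt hu
      simp [this, h1, h2]
    · exact absurd hu huv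
    · simp only [Set.mem_insert_iff, Set.mem_singleton_iff, huo, false_or] at hu
      rcases hu with rfl | rfl
      · have : L u % 4 = b.val := by omega
        simp [this, vbc, vbd]
      · exact absurd huw nsd
  · intro e he
    have := e.2
    simp only [Nat.mod_eq_of_lt this, Nat.mod_eq_of_lt c.2] at he
    refine Fin.ext ?_
    split_ifs at he <;> omega
  · intro e he
    have := e.2
    simp only [Nat.mod_eq_of_lt this, Nat.mod_eq_of_lt d.2] at he
    refine Fin.ext ?_
    split_ifs at he <;> omega
  · intro e
    have rb : RIn G Q (y b) sc := (h.reach_S hlow hsb lb).step hbc hsc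
    rcases hc.cases e with rfl | rfl | rfl | rfl
    · have rv := h.reach_v hlow hvQ ha
      rcases hr with hr | hr | hr
      · exact rv.step hr hsc
      · exact (rv.step hr hsb).step hbc hsc
      · exact rv.trans ((h.reach_v hlow hvQ hr).symm.trans rb)
    · exact rb
    · exact h.reach_S hlow hsc lc
    · exact (h.reach_S hlow hsd ld).step hcd.symm hsc

/-- The centre is `sc` again, and now `v` joins `A_a` to `A_c`. The terminals `b` and `d` are alone
in the pieces of `sb` and `sd`, which `v` does not see. -/
theorem good_opposite (ht : TriFree G) (h : SqInv G y L) (hv : L v = 8) {a b c d : Fin 4}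
    (hc : Cyc a b c d) {sb sc sd : V} (lb : L sb = 4 + b.val) (lc : L sc = 4 + c.val)
    (ld : L sd = 4 + d.val) (ha : ∃ u, L u = a.val ∧ G.Adj v u)
    (hc' : ∃ u, L u = c.val ∧ G.Adj v u)
    (nb : ∀ u, G.Adj v u → L u ≠ b.val) (nd : ∀ u, G.Adj v u → L u ≠ d.val)
    (nsb : ¬ G.Adj v sb) (nsd : ¬ G.Adj v sd) :
    GoodMask G y {u | L u < 4 ∨ u = v ∨ u ∈ ({sb, sc, sd} : Set V)} := by
  set Q : Set V := {u | L u < 4 ∨ u = v ∨ u ∈ ({sb, sc, sd} : Set V)} with hQdef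
  obtain ⟨vab, vac, vad, vbc, vbd, vcd⟩ := hc.vals
  have := a.2; have := b.2; have := c.2; have := d.2
  have hlow : ∀ u, L u < 4 → u ∈ Q := fun u hu => Or.inl hu
  have hvQ : v ∈ Q := Or.inr (Or.inl rfl)
  have hsb : sb ∈ Q := Or.inr (Or.inr (by simp))
  have hsc : sc ∈ Q := Or.inr (Or.inr (by simp))
  have hsd : sd ∈ Q := Or.inr (Or.inr (by simp))
  have hbc : G.Adj sb sc := h.adj hc.rot lb lc
  have hcd : G.Adj sc sd := h.adj hc.rot.rot lc ld
  have hbd : ¬ G.Adj sb sd := h.not_adj_opp ht hc.rot lb ld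
  refine h.goodMask_of_labels hv sc
    (fun l => if l % 4 = b.val then 2 else if l % 4 = d.val then 3 else 0) 0 b d
    (fun he => vbd (congrArg _ he)) ?_ ?_ ?_ ?_ ?_
  · intro u hu w hw huo hwo huv hwv huw
    have e8 : ∀ z ∈ Q, z ≠ v → L z ≠ 8 := by
      rintro z (hz | hz | hz) hzv
      · omega
      · exact absurd hz hzv
      · simp only [Set.mem_insert_iff, Set.mem_singleton_iff] at hz
        rcases hz with rfl | rfl | rfl <;> omega
    have hmod : L u % 4 = L w % 4 := by
      by_cases hu4 : L u < 4
      · rcases h.nb_low hu4 huw with h1 | h1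
        · exact absurd h1 (e8 w hw hwv)
        · omega
      · by_cases hw4 : L w < 4
        · rcases h.nb_low hw4 huw.symm with h1 | h1
          · exact absurd h1 (e8 u hu huv)
          · omega
        · have hu' := (hu.resolve_left hu4).resolve_left huv
          have hw' := (hw.resolve_left hw4).resolve_left hwv
          simp only [Set.mem_insert_iff, Set.mem_singleton_iff, huo, hwo, false_or] at hu' hw'
          rcases hu' with rfl | rfl <;> rcases hw' with rfl | rfl
          · rfl
          · exact absurd huw hbd
          · exact absurd huw.symm hbd
          · rfl
    simp only [hmod]
  · intro _ u hu huo huv huw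
    have h1 := nb u huw
    have h2 := nd u huw
    rcases hu with hu | hu | hu
    · have : L u % 4 = L u := Nat.mod_eq_of_lt hu
      simp [this, h1, h2]
    · exact absurd hu huv
    · simp only [Set.mem_insert_iff, Set.mem_singleton_iff, huo, false_or] at hu
      rcases hu with rfl | rfl
      · exact absurd huw nsb
      · exact absurd huw nsd
  · intro e he
    have := e.2
    simp only [Nat.mod_eq_of_lt this, Nat.mod_eq_of_lt b.2] at he
    refine Fin.ext ?_
    split_ifs at he <;> omega
  · intro e he
    have := e.2
    simp only [Nat.mod_eq_of_lt this, Nat.mod_eq_of_lt d.2] at he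
    refine Fin.ext ?_
    split_ifs at he <;> omega
  · intro e
    have rc : RIn G Q (y c) sc := h.reach_S hlow hsc lc
    rcases hc.cases e with rfl | rfl | rfl | rfl
    · exact (h.reach_v hlow hvQ ha).trans ((h.reach_v hlow hvQ hc').symm.trans rc)
    · exact (h.reach_S hlow hsb lb).step hbc hsc
    · exact rc
    · exact (h.reach_S hlow hsd ld).step hcd.symm hsc

/-- With `v` as the centre, the four indices form four pieces: two are joined to `v` directly and
two through `sb` and `sd`. -/
theorem good_four (ht : TriFree G) (h : SqInv G y L) (hv : L v = 8) {a b c d : Fin 4}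
    (hc : Cyc a b c d) {sb sd : V} (lb : L sb = 4 + b.val) (ld : L sd = 4 + d.val)
    (ha : ∃ u, L u = a.val ∧ G.Adj v u) (hc' : ∃ u, L u = c.val ∧ G.Adj v u)
    (vb : G.Adj v sb) (vd : G.Adj v sd) :
    GoodMask G y {u | L u < 4 ∨ u = v ∨ u ∈ ({sb, sd} : Set V)} := by
  set Q : Set V := {u | L u < 4 ∨ u = v ∨ u ∈ ({sb, sd} : Set V)} with hQdef
  obtain ⟨vab, vac, vad, vbc, vbd, vcd⟩ := hc.vals
  have := a.2; have := b.2; have := c.2; have := d.2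
  have hlow : ∀ u, L u < 4 → u ∈ Q := fun u hu => Or.inl hu
  have hvQ : v ∈ Q := Or.inr (Or.inl rfl)
  have hsb : sb ∈ Q := Or.inr (Or.inr (by simp))
  have hsd : sd ∈ Q := Or.inr (Or.inr (by simp))
  have hbd : ¬ G.Adj sb sd := h.not_adj_opp ht hc.rot lb ld
  refine h.goodMask_of_labels hv v (fun l => l % 4) 0 b d
    (fun he => vbd (congrArg _ he)) ?_ (fun hn => absurd rfl hn) ?_ ?_ ?_
  · intro u hu w hw huo hwo huv hwv huw
    have e8 : ∀ z ∈ Q, z ≠ v → L z ≠ 8 := by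
      rintro z (hz | hz | hz) hzv
      · omega
      · exact absurd hz hzv
      · simp only [Set.mem_insert_iff, Set.mem_singleton_iff] at hz
        rcases hz with rfl | rfl <;> omega
    by_cases hu4 : L u < 4
    · rcases h.nb_low hu4 huw with h1 | h1
      · exact absurd h1 (e8 w hw hwv)
      · exact h1.symm
    · by_cases hw4 : L w < 4
      · rcases h.nb_low hw4 huw.symm with h1 | h1
        · exact absurd h1 (e8 u hu huv)
        · exact h1
      · have hu' := (hu.resolve_left hu4).resolve_left huv
        have hw' := (hw.resolve_left hw4).resolve_left hwv
        simp only [Set.mem_insert_iff, Set.mem_singleton_iff] at hu' hw'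
        rcases hu' with rfl | rfl <;> rcases hw' with rfl | rfl
        · rfl
        · exact absurd huw hbd
        · exact absurd huw.symm hbd
        · rfl
  · intro e he
    have := e.2
    exact Fin.ext (by omega)
  · intro e he
    have := e.2
    exact Fin.ext (by omega)
  · intro e
    rcases hc.cases e with rfl | rfl | rfl | rfl
    · exact h.reach_v hlow hvQ ha
    · exact (h.reach_S hlow hsb lb).step vb.symm hvQ
    · exact h.reach_v hlow hvQ hc'
    · exact (h.reach_S hlow hsd ld).step vd.symm hvQ

/-- The centre is `v`. The vertices `sc` and `sd` attach the fourth terminal to `A_c`, so that `A_a`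
and `A_b` remain as pieces of their own. -/
theorem good_three (h : SqInv G y L) (hv : L v = 8) {a b c d : Fin 4}
    (hc : Cyc a b c d) {sc sd : V} (lc : L sc = 4 + c.val) (ld : L sd = 4 + d.val)
    (ha : ∃ u, L u = a.val ∧ G.Adj v u) (hb : ∃ u, L u = b.val ∧ G.Adj v u)
    (hc' : ∃ u, L u = c.val ∧ G.Adj v u) :
    GoodMask G y {u | L u < 4 ∨ u = v ∨ u ∈ ({sc, sd} : Set V)} := by
  set Q : Set V := {u | L u < 4 ∨ u = v ∨ u ∈ ({sc, sd} : Set V)} with hQdef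
  obtain ⟨vab, vac, vad, vbc, vbd, vcd⟩ := hc.vals
  have := a.2; have := b.2; have := c.2; have := d.2
  have hlow : ∀ u, L u < 4 → u ∈ Q := fun u hu => Or.inl hu
  have hvQ : v ∈ Q := Or.inr (Or.inl rfl)
  have hsc : sc ∈ Q := Or.inr (Or.inr (by simp))
  have hsd : sd ∈ Q := Or.inr (Or.inr (by simp))
  refine h.goodMask_of_labels hv v (fun l => if l % 4 = a.val then 0 else
    if l % 4 = b.val then 1 else 2) 0 a b
    (fun he => vab (congrArg _ he)) ?_ (fun hn => absurd rfl hn) ?_ ?_ ?_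
  · intro u hu w hw huo hwo huv hwv huw
    have e8 : ∀ z ∈ Q, z ≠ v → L z ≠ 8 := by
      rintro z (hz | hz | hz) hzv
      · omega
      · exact absurd hz hzv
      · simp only [Set.mem_insert_iff, Set.mem_singleton_iff] at hz
        rcases hz with rfl | rfl <;> omega
    by_cases hu4 : L u < 4
    · rcases h.nb_low hu4 huw with h1 | h1
      · exact absurd h1 (e8 w hw hwv)
      · simp only [h1]
    · by_cases hw4 : L w < 4
      · rcases h.nb_low hw4 huw.symm with h1 | h1
        · exact absurd h1 (e8 u hu huv)
        · simp only [h1]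
      · have key : ∀ z ∈ Q, ¬ L z < 4 → z ≠ v → L z % 4 ≠ a.val ∧ L z % 4 ≠ b.val := by
          intro z hz hz4 hzv
          have hz' := (hz.resolve_left hz4).resolve_left hzv
          simp only [Set.mem_insert_iff, Set.mem_singleton_iff] at hz'
          rcases hz' with rfl | rfl <;> omega
        simp [key u hu hu4 huv, key w hw hw4 hwv]
  · intro e he
    have := e.2
    simp only [Nat.mod_eq_of_lt this, Nat.mod_eq_of_lt a.2] at he
    refine Fin.ext ?_
    split_ifs at he
    omega
  · intro e he
    have := e.2
    simp only [Nat.mod_eq_of_lt this, Nat.mod_eq_of_lt b.2] at he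
    refine Fin.ext ?_
    split_ifs at he <;> omega
  · intro e
    have hcd : G.Adj sc sd := h.adj hc.rot.rot lc ld
    have rc : RIn G Q (y c) v := h.reach_v hlow hvQ hc'
    rcases hc.cases e with rfl | rfl | rfl | rfl
    · exact h.reach_v hlow hvQ ha
    · exact h.reach_v hlow hvQ hb
    · exact rc
    · exact ((h.reach_S hlow hsd ld).step hcd.symm hsc).trans ((h.reach_S hlow hsc lc).symm.trans rc)

end SqInv

/-- The rules by which a square structure grows. -/
def sqRules : List Rule :=
  (List.finRange 4).map (fun i => ⟨8, (List.range 8).filter (fun l => l % 4 ≠ i.val), [], i.val⟩) ++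
  (List.finRange 4).map (fun i => ⟨8, (List.range 4).filter (fun l => l ≠ i.val) ++
    [4 + i.val, 4 + (i + 2).val], [4 + (i + 1).val, 4 + (i + 3).val], 4 + i.val⟩)

theorem SqInv.grow [DecidableEq V] (h : SqInv G y L) {r : Rule} (hr : r ∈ sqRules)
    (ha : r.Applies G L v) (hex : ∃ u, L u < 4 ∧ G.Adj v u) :
    SqInv G y (Function.update L v r.new) := by
  obtain ⟨u, hu4, hu⟩ := hex
  simp only [sqRules, List.mem_append, List.mem_map, List.mem_finRange, true_and] at hr
  rcases hr with ⟨i, rfl⟩ | ⟨i, rfl⟩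
  · obtain ⟨h1, h2, -⟩ := ha
    have hi := i.2
    have key : ∀ w, G.Adj v w → L w < 8 → L w % 4 = i.val := by
      intro w hw h8
      by_contra hne
      exact h2 (L w) (by simp [h8, hne]) w hw rfl
    refine h.grow_A h1 i ⟨u, ?_, hu⟩ fun w hw => ?_
    · have := key u hu (by omega); omega
    · have := h.le w
      by_cases h8 : L w = 8
      · exact Or.inr (Or.inr h8)
      · have := key w hw (by omega); omega
  · obtain ⟨h1, h2, h3⟩ := ha
    have key : ∀ w, G.Adj v w → L w < 4 → L w = i.val := by
      intro w hw h4
      by_contra hne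
      exact h2 (L w) (by simp [h4, hne]) w hw rfl
    exact h.grow_S h1 i ⟨u, key u hu hu4, hu⟩ key (fun w hw => h3 _ (by simp) w hw)
      (fun w hw => h3 _ (by simp) w hw)

/-- The vertex `v` is adjacent to `A_{i+1}`, `A_{i+3}`, `S_i` and to none of `A_i`, `A_{i+2}`,
`S_{i+2}`. -/
structure Turn (G : SimpleGraph V) (L : V → ℕ) (v : V) (i : Fin 4) : Prop where
  some : ∀ l ∈ [4 + i.val, (i + 1).val, (i + 3).val], ∃ u, G.Adj v u ∧ L u = l
  none : ∀ l ∈ [i.val, (i + 2).val, 4 + (i + 2).val], ∀ u, G.Adj v u → L u ≠ l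

/-- The cases depend on which sets `A_j` (`α`) and `S_j` (`β`) are seen by `v`. Two consecutive
`S_j` are never both seen, as this would be a triangle. Three consecutive `A_j`, or two consecutive
ones, give a good set. For two opposite `A_j` it matters whether both, none, or exactly one of the
two sets `S_j` in between are seen, and the last possibility is the turn. If only one `A_a` is seen,
then a growth rule applies or there is a good set. -/
theorem SqInv.fail (ht : TriFree G) (h : SqInv G y L) (hv : L v = 8)
    (hex : ∃ u, L u < 4 ∧ G.Adj v u) (hno : ∀ r ∈ sqRules, ¬ r.Applies G L v) {P M : ℕ → Set V}
    (T : Tab G L v P M) :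
    (∃ Q, InFam L v y P M [4, 5, 6, 7] Q ∧ GoodMask G y Q) ∨ ∃ i, Turn G L v i := by
  classical
  set α : Fin 4 → Prop := fun j => ∃ u, L u = j.val ∧ G.Adj v u with hα
  set β : Fin 4 → Prop := fun j => ∃ u, G.Adj v u ∧ L u = 4 + j.val with hβ
  have hα0 : ∃ j, α j := by
    obtain ⟨u, hu, hvu⟩ := hex
    exact ⟨⟨L u, hu⟩, u, rfl, hvu⟩
  have nα : ∀ j, ¬ α j → ∀ u, G.Adj v u → L u ≠ j.val := fun j hj u hu hl => hj ⟨u, hl, hu⟩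
  have hβtri : ∀ {a b c d : Fin 4}, Cyc a b c d → β a → ¬ β b := by
    rintro a b c d hc ⟨u, hu, hul⟩ ⟨w, hw, hwl⟩
    exact ht _ _ _ hu (h.adj hc hul hwl) hw
  -- representatives, with prescribed adjacency to `v` where it matters
  have pick : ∀ j : Fin 4, ∃ s, L s = 4 + j.val ∧ (P (L s) = {s} ∨ M (L s) = {s}) := by
    intro j
    obtain ⟨z, hz⟩ := h.ne j
    by_cases hvz : G.Adj v z
    · obtain ⟨s, h1, -, h3⟩ := T.pos hvz hz
      exact ⟨s, h3, Or.inl (h3 ▸ h1)⟩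
    · obtain ⟨s, h1, -, h3⟩ := T.neg hvz hz
      exact ⟨s, h3, Or.inr (h3 ▸ h1)⟩
  have pickP : ∀ j : Fin 4, β j → ∃ s, L s = 4 + j.val ∧ G.Adj v s ∧ (P (L s) = {s} ∨ M (L s) = {s}) := by
    rintro j ⟨z, hz, hzl⟩
    obtain ⟨s, h1, h2, h3⟩ := T.pos hz hzl
    exact ⟨s, h3, h2, Or.inl (h3 ▸ h1)⟩
  have pickM : ∀ (j : Fin 4) z, L z = 4 + j.val → ¬ G.Adj v z →
      ∃ s, L s = 4 + j.val ∧ ¬ G.Adj v s ∧ (P (L s) = {s} ∨ M (L s) = {s}) := by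
    rintro j z hzl hz
    obtain ⟨s, h1, h2, h3⟩ := T.neg hz hzl
    exact ⟨s, h3, h2, Or.inr (h3 ▸ h1)⟩
  have pickN : ∀ j : Fin 4, ¬ β j →
      ∃ s, L s = 4 + j.val ∧ ¬ G.Adj v s ∧ (P (L s) = {s} ∨ M (L s) = {s}) := by
    intro j hj
    obtain ⟨z, hz⟩ := h.ne j
    exact pickM j z hz fun hvz => hj ⟨z, hvz, hz⟩
  have fam3 : ∀ {a b c d : Fin 4}, Cyc a b c d → ∀ {sb sc sd : V}, L sb = 4 + b.val →
      L sc = 4 + c.val → L sd = 4 + d.val → (P (L sb) = {sb} ∨ M (L sb) = {sb}) →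
      (P (L sc) = {sc} ∨ M (L sc) = {sc}) → (P (L sd) = {sd} ∨ M (L sd) = {sd}) →
      InFam L v y P M [4, 5, 6, 7] {u | L u < 4 ∨ u = v ∨ u ∈ ({sb, sc, sd} : Set V)} := by
    intro a b c d hc sb sc sd lb lc ld tb tc td
    have := b.2; have := c.2; have := d.2
    obtain ⟨vab, vac, vad, vbc, vbd, vcd⟩ := hc.vals
    refine h.inFam _ ?_ ?_
    · rintro s (rfl | rfl | rfl)
      · exact ⟨by omega, by omega, tb⟩
      · exact ⟨by omega, by omega, tc⟩
      · exact ⟨by omega, by omega, td⟩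
    · rintro s (rfl | rfl | rfl) s' (rfl | rfl | rfl) he <;> first | rfl | omega
  have fam2 : ∀ {b c : Fin 4}, b ≠ c → ∀ {sb sc : V}, L sb = 4 + b.val →
      L sc = 4 + c.val → (P (L sb) = {sb} ∨ M (L sb) = {sb}) →
      (P (L sc) = {sc} ∨ M (L sc) = {sc}) →
      InFam L v y P M [4, 5, 6, 7] {u | L u < 4 ∨ u = v ∨ u ∈ ({sb, sc} : Set V)} := by
    intro b c hbc sb sc lb lc tb tc
    have := b.2; have := c.2
    have hbc' : b.val ≠ c.val := fun he => hbc (Fin.ext he)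
    refine h.inFam _ ?_ ?_
    · rintro s (rfl | rfl)
      · exact ⟨by omega, by omega, tb⟩
      · exact ⟨by omega, by omega, tc⟩
    · rintro s (rfl | rfl) s' (rfl | rfl) he <;> first | rfl | omega
  -- three consecutive sets
  by_cases h3 : ∃ a b c d, Cyc a b c d ∧ α a ∧ α b ∧ α c
  · obtain ⟨a, b, c, d, hc, ha, hb, hc'⟩ := h3
    obtain ⟨sc, lc, tc⟩ := pick c
    obtain ⟨sd, ld, td⟩ := pick d
    exact Or.inl ⟨_, fam2 (fun he => hc.vals.2.2.2.2.2 (congrArg _ he)) lc ld tc td,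
      h.good_three hv hc lc ld ha hb hc'⟩
  have h3' : ∀ {a b c d}, Cyc a b c d → α a → α b → ¬ α c := fun hc ha hb hc' =>
    h3 ⟨_, _, _, _, hc, ha, hb, hc'⟩
  -- two consecutive sets
  by_cases h2 : ∃ a b c d, Cyc a b c d ∧ α a ∧ α b ∧ ¬ β d
  · obtain ⟨a, b, c, d, hc, ha, hb, hd⟩ := h2
    obtain ⟨sb, lb, tb⟩ := pick b
    obtain ⟨sc, lc, tc⟩ := pick c
    obtain ⟨sd, ld, nd, td⟩ := pickN d hd
    exact Or.inl ⟨_, fam3 hc lb lc ld tb tc td, h.good_adjacent ht hv hc lb lc ld ha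
      (nα _ (h3' hc ha hb)) (nα _ fun hd' => h3' hc.flip hb ha hd') nd (Or.inr (Or.inr hb))⟩
  -- Otherwise the previous case, applied in both directions of the cyclic order, shows that `v`
  -- sees both sets `S_c` and `S_d`, which are complete to each other.
  have h2' : ∀ {a b c d}, Cyc a b c d → α a → ¬ α b := by
    intro a b c d hc ha hb
    have hd : β d := by
      by_contra hd
      exact h2 ⟨a, b, c, d, hc, ha, hb, hd⟩
    have hc' : β c := by
      by_contra hd
      exact h2 ⟨b, a, d, c, hc.flip, hb, ha, hd⟩
    exact hβtri hc.rot.rot hc' hd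
  obtain ⟨a, ha⟩ := hα0
  have hc : Cyc a (a + 1) (a + 2) (a + 3) := Or.inl ⟨rfl, rfl, rfl⟩
  have hc' : Cyc a (a + 3) (a + 2) (a + 1) := Or.inr ⟨rfl, rfl, rfl⟩
  have nb := h2' hc ha
  have nd := h2' hc' ha
  by_cases hac : α (a + 2)
  · -- two opposite sets
    by_cases hb : β (a + 1)
    · by_cases hd : β (a + 3)
      · obtain ⟨sb, lb, ab, tb⟩ := pickP _ hb
        obtain ⟨sd, ld, ad, td⟩ := pickP _ hd
        exact Or.inl ⟨_, fam2 (fun he => hc.vals.2.2.2.2.1 (congrArg _ he)) lb ld tb td,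
          h.good_four ht hv hc lb ld ha hac ab ad⟩
      · refine Or.inr ⟨a + 1, ?_, ?_⟩
        · rw [show a + 1 + 1 = a + 2 by clear * -; revert a; decide,
            show a + 1 + 3 = a by clear * -; revert a; decide]
          obtain ⟨u, hu, hu'⟩ := hac
          obtain ⟨w, hw, hw'⟩ := ha
          simp only [List.mem_cons, List.not_mem_nil, or_false, forall_eq_or_imp, forall_eq]
          exact ⟨hb, ⟨u, hu', hu⟩, w, hw', hw⟩
        · rw [show a + 1 + 2 = a + 3 by clear * -; revert a; decide]
          simp only [List.mem_cons, List.not_mem_nil, or_false, forall_eq_or_imp, forall_eq]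
          exact ⟨nα _ nb, nα _ nd, fun u hu hl => hd ⟨u, hu, hl⟩⟩
    · by_cases hd : β (a + 3)
      · refine Or.inr ⟨a + 3, ?_, ?_⟩
        · rw [show a + 3 + 1 = a by clear * -; revert a; decide,
            show a + 3 + 3 = a + 2 by clear * -; revert a; decide]
          obtain ⟨u, hu, hu'⟩ := hac
          obtain ⟨w, hw, hw'⟩ := ha
          simp only [List.mem_cons, List.not_mem_nil, or_false, forall_eq_or_imp, forall_eq]
          exact ⟨hd, ⟨w, hw', hw⟩, u, hu', hu⟩
        · rw [show a + 3 + 2 = a + 1 by clear * -; revert a; decide]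
          simp only [List.mem_cons, List.not_mem_nil, or_false, forall_eq_or_imp, forall_eq]
          exact ⟨nα _ nd, nα _ nb, fun u hu hl => hb ⟨u, hu, hl⟩⟩
      · obtain ⟨sb, lb, ab, tb⟩ := pickN _ hb
        obtain ⟨sd, ld, ad, td⟩ := pickN _ hd
        obtain ⟨sc, lc, tc⟩ := pick (a + 2)
        exact Or.inl ⟨_, fam3 hc lb lc ld tb tc td, h.good_opposite ht hv hc lb lc ld ha hac
          (nα _ nb) (nα _ nd) ab ad⟩
  -- one set
  refine Or.inl ?_
  by_cases hβc : β (a + 2)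
  · have hβb : ¬ β (a + 1) := hβtri (show Cyc (a + 2) (a + 1) a (a + 3) by
      clear * -; revert a; decide) hβc
    have hβd : ¬ β (a + 3) := hβtri (show Cyc (a + 2) (a + 3) a (a + 1) by
      clear * -; revert a; decide) hβc
    obtain ⟨sb, lb, ab, tb⟩ := pickN _ hβb
    obtain ⟨sd, ld, ad, td⟩ := pickN _ hβd
    obtain ⟨sc, lc, ac, tc⟩ := pickP _ hβc
    exact ⟨_, fam3 hc lb lc ld tb tc td, h.good_adjacent ht hv hc lb lc ld ha
      (nα _ hac) (nα _ nd) ad (Or.inl ac)⟩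
  have key : ∀ {b d : Fin 4}, Cyc a b (a + 2) d → ¬ α d → β b → ∀ z, L z = 4 + d.val →
      ¬ G.Adj v z → ∃ Q, InFam L v y P M [4, 5, 6, 7] Q ∧ GoodMask G y Q := by
    intro b d hc nd hb z hz hvz
    obtain ⟨sb, lb, ab, tb⟩ := pickP _ hb
    obtain ⟨sd, ld, ad, td⟩ := pickM _ z hz hvz
    obtain ⟨sc, lc, tc⟩ := pick (a + 2)
    exact ⟨_, fam3 hc lb lc ld tb tc td, h.good_adjacent ht hv hc lb lc ld ha
      (nα _ hac) (nα _ nd) ad (Or.inr (Or.inl ab))⟩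
  by_contra hgood
  -- Without a good set, seeing one vertex of `S_{a+1}` or `S_{a+3}` forces `v` to be complete to
  -- the other of these sets, hence to both. Then `v` joins `S_a`. If it sees none of them, it joins
  -- `A_a`.
  have hfull1 : β (a + 1) → ∀ z, L z = 4 + (a + 3).val → G.Adj v z := by
    intro hb z hz
    by_contra hvz
    exact hgood (key hc nd hb z hz hvz)
  have hfull3 : β (a + 3) → ∀ z, L z = 4 + (a + 1).val → G.Adj v z := by
    intro hb z hz
    by_contra hvz
    exact hgood (key hc' nb hb z hz hvz)
  obtain ⟨z1, hz1⟩ := h.ne (a + 1)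
  obtain ⟨z3, hz3⟩ := h.ne (a + 3)
  have hlow : ∀ w, G.Adj v w → L w < 4 → L w = a.val := by
    intro w hw h4
    have hw' : α ⟨L w, h4⟩ := ⟨w, rfl, hw⟩
    rcases hc.cases ⟨L w, h4⟩ with he | he | he | he
    · exact congrArg Fin.val he
    · exact absurd (he ▸ hw') nb
    · exact absurd (he ▸ hw') hac
    · exact absurd (he ▸ hw') nd
  by_cases hb : β (a + 1)
  · have hβa : ¬ β a := hβtri (show Cyc (a + 1) a (a + 3) (a + 2) by
      clear * -; revert a; decide) hb
    have f3 := hfull1 hb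
    have f1 := hfull3 ⟨z3, f3 z3 hz3, hz3⟩
    refine hno ⟨8, (List.range 4).filter (fun l => l ≠ a.val) ++
      [4 + a.val, 4 + (a + 2).val], [4 + (a + 1).val, 4 + (a + 3).val], 4 + a.val⟩
      (List.mem_append_right _ (List.mem_map.mpr ⟨a, List.mem_finRange a, rfl⟩)) ⟨hv, ?_, ?_⟩
    · intro l hl w hw hwl
      simp only [List.mem_append, List.mem_filter, List.mem_range, List.mem_cons,
        List.not_mem_nil, or_false, decide_eq_true_eq] at hl
      rcases hl with ⟨hl, hl'⟩ | rfl | rfl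
      · exact hl' (hwl ▸ hlow w hw (hwl ▸ hl))
      · exact hβa ⟨w, hw, hwl⟩
      · exact hβc ⟨w, hw, hwl⟩
    · simp only [List.mem_cons, List.not_mem_nil, or_false, forall_eq_or_imp, forall_eq]
      exact ⟨f1, f3⟩
  · have hd : ¬ β (a + 3) := fun hd => hb ⟨z1, hfull3 hd z1 hz1, hz1⟩
    refine hno ⟨8, (List.range 8).filter (fun l => l % 4 ≠ a.val), [], a.val⟩
      (List.mem_append_left _ (List.mem_map.mpr ⟨a, List.mem_finRange a, rfl⟩)) ⟨hv, ?_, by simp⟩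
    intro l hl w hw hwl
    simp only [List.mem_filter, List.mem_range, decide_eq_true_eq] at hl
    obtain ⟨hl, hl'⟩ := hl
    by_cases h4 : l < 4
    · have := hlow w hw (hwl ▸ h4)
      have := a.2
      omega
    · rcases hc.cases ⟨l - 4, by omega⟩ with he | he | he | he
      · have : l - 4 = a.val := congrArg Fin.val he
        have := a.2
        omega
      · exact hb ⟨w, hw, by rw [← he]; simp only; omega⟩
      · exact hβc ⟨w, hw, by rw [← he]; simp only; omega⟩
      · exact hd ⟨w, hw, by rw [← he]; simp only; omega⟩

end SquareFail

/-! ## Labellings that describe cubic structures, and how they grow -/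

/-- The four indices in some order. -/
def Four (a b c d : Fin 4) : Prop := a ≠ b ∧ a ≠ c ∧ a ≠ d ∧ b ≠ c ∧ b ≠ d ∧ c ≠ d

instance (a b c d : Fin 4) : Decidable (Four a b c d) := inferInstanceAs (Decidable (_ ∧ _))

namespace Four

variable {a b c d : Fin 4}

theorem vals (h : Four a b c d) : a.val ≠ b.val ∧ a.val ≠ c.val ∧ a.val ≠ d.val ∧ b.val ≠ c.val ∧
    b.val ≠ d.val ∧ c.val ≠ d.val := by revert a b c d; decide

theorem cases (h : Four a b c d) (j : Fin 4) : j = a ∨ j = b ∨ j = c ∨ j = d := by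
  revert a b c d j; decide

theorem swap (h : Four a b c d) : Four a c b d := by revert a b c d; decide

theorem exists_of_ne (h : a ≠ b) : ∃ c d, Four a b c d := by revert a b; decide

theorem exists_of_three (h1 : a ≠ b) (h2 : a ≠ c) (h3 : b ≠ c) : ∃ d, Four a b c d := by
  revert a b c; decide

end Four

section Cubic

variable {V : Type u} {G : SimpleGraph V} {x : Fin 4 → V} {L : V → ℕ}

/-- The labels `0-3` (for `A₁, …, A₄`), `4-7` (for parts of `B₁, …, B₄`), `8-11` (for `S₁, …, S₄`),
`12-15` (for `S₅, …, S₈`) and `16` (for vertices not yet treated) describe a cubic structure on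
the vertices with labels below `16`, except that there may be edges from `Aᵢ` to `Bᵢ`. -/
structure CubInv (G : SimpleGraph V) (x : Fin 4 → V) (L : V → ℕ) : Prop where
  term : ∀ i : Fin 4, L (x i) = i.val
  ne : ∀ i : Fin 4, ∃ u, L u = 8 + i.val
  ne' : ∀ i j : Fin 4, (∀ u, L u ≠ 12 + i.val) → (∀ u, L u ≠ 12 + j.val) → i = j
  comp : ∀ (i j : Fin 4) u w, i ≠ j → L u = 8 + i.val → L w = 12 + j.val → G.Adj u w
  att : ∀ (i : Fin 4) u, L u = 8 + i.val → ∃ w, G.Adj u w ∧ L w = i.val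
  low : ∀ u w, L u < 12 → L w < 12 → G.Adj u w → L u % 4 = L w % 4
  opp : ∀ u w, L u < 12 → 12 ≤ L w → L w < 16 → G.Adj u w → L w % 4 ≠ L u % 4
  nbA : ∀ u w, L u < 4 → G.Adj u w → L w < 12 ∨ L w = 16
  conn : ∀ (i : Fin 4) u, L u = i.val → RIn G {w | L w = i.val} (x i) u
  connC : ∀ (i : Fin 4) u, L u < 12 → L u % 4 = i.val →
    RIn G {w | L w < 12 ∧ L w % 4 = i.val} (x i) u
  le : ∀ u, L u ≤ 16

namespace CubInv

/-- Two vertices of `S_5, ..., S_8` exclude at most two indices, so some `S_k` is complete to both.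
An edge between them would close a triangle. -/
theorem not_adj_high (ht : TriFree G) (h : CubInv G x L) {u w : V} (hu : 12 ≤ L u) (hu' : L u < 16)
    (hw : 12 ≤ L w) (hw' : L w < 16) : ¬ G.Adj u w := by
  obtain ⟨k, hk1, hk2⟩ : ∃ k : Fin 4, k.val ≠ L u - 12 ∧ k.val ≠ L w - 12 := by
    have : ∀ i j : Fin 4, ∃ k : Fin 4, k.val ≠ i.val ∧ k.val ≠ j.val := by decide
    exact this ⟨L u - 12, by omega⟩ ⟨L w - 12, by omega⟩
  obtain ⟨s, hs⟩ := h.ne k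
  intro huw
  refine ht s u w ?_ huw ?_
  · exact h.comp k ⟨L u - 12, by omega⟩ _ _ (fun he => hk1 (congrArg Fin.val he)) hs
      (by simp only; omega)
  · exact h.comp k ⟨L w - 12, by omega⟩ _ _ (fun he => hk2 (congrArg Fin.val he)) hs
      (by simp only; omega)

/-- One of two of the sets `S₅, …, S₈` is non-empty. -/
theorem exists_high (h : CubInv G x L) {i j : Fin 4} (hij : i ≠ j) :
    (∃ u, L u = 12 + i.val) ∨ ∃ u, L u = 12 + j.val := by
  by_contra! hno
  exact hij (h.ne' i j hno.1 hno.2)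

/-- At most one of `S_5, ..., S_8` is empty, so some non-empty `S' j` with `j ≠ i` is complete to `S
i`, and an edge inside `S i` would form a triangle with it. -/
theorem not_adj_S (ht : TriFree G) (h : CubInv G x L) {i : Fin 4} {u w : V}
    (hu : L u = 8 + i.val) (hw : L w = 8 + i.val) : ¬ G.Adj u w := by
  intro huw
  have h1 : i ≠ i + 1 := by clear * -; revert i; decide
  have h2 : i ≠ i + 2 := by clear * -; revert i; decide
  rcases h.exists_high (show i + 1 ≠ i + 2 by clear * -; revert i; decide) with ⟨s, hs⟩ | ⟨s, hs⟩
  · exact ht _ _ _ huw (h.comp _ _ w s h1 hw hs) (h.comp _ _ u s h1 hu hs)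
  · exact ht _ _ _ huw (h.comp _ _ w s h2 hw hs) (h.comp _ _ u s h2 hu hs)

/-- The two hypotheses say that no candidate for growth is left. The first turns the untreated
vertices into `R`. The second removes the edges between `A_i` and `B_i` that the invariant
tolerates. -/
theorem isCubicSplit (ht : TriFree G) (h : CubInv G x L)
    (hout : ∀ u w, L u < 12 → L w = 16 → ¬ G.Adj u w)
    (hB : ∀ u w, L u < 4 → 4 ≤ L w → L w < 8 → ¬ G.Adj u w) :
    IsCubicSplit G x (fun i => {v | L v = i.val}) (fun i => {v | L v = 4 + i.val})
      (fun i => {v | L v = 8 + i.val}) (fun i => {v | L v = 12 + i.val}) {v | L v = 16} where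
  cover := by
    ext v
    simp only [Set.mem_union, Set.mem_iUnion, Set.mem_ofPred_eq, Set.mem_univ, iff_true]
    have := h.le v
    by_cases h4 : L v < 4
    · exact Or.inl (Or.inl (Or.inl ⟨⟨L v, h4⟩, rfl⟩))
    by_cases h8 : L v < 8
    · exact Or.inl (Or.inl (Or.inr ⟨⟨L v - 4, by omega⟩, by simp only; omega⟩))
    by_cases h12 : L v < 12
    · exact Or.inl (Or.inr (Or.inl ⟨⟨L v - 8, by omega⟩, by simp only; omega⟩))
    by_cases h16 : L v < 16
    · exact Or.inl (Or.inr (Or.inr ⟨⟨L v - 12, by omega⟩, by simp only; omega⟩))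
    exact Or.inr (by omega)
  disjoint := by
    intro p q hpq
    rw [Set.disjoint_left]
    rintro v hp hq
    have key : ∀ (m : ℕ) (i j : Fin 4), L v = m + i.val → L v = m + j.val → i = j :=
      fun m i j hi hj => Fin.ext (by omega)
    rcases p with i | i | i | i | _ <;> rcases q with j | j | j | j | _ <;>
      simp only [Sum.elim_inl, Sum.elim_inr, Set.mem_ofPred_eq] at hp hq <;>
      first
      | omega
      | exact hpq rfl
      | exact hpq (by rw [key _ i j hp hq])
      | exact hpq (by rw [key 0 i j (by omega) (by omega)])
  terminal_mem := h.term
  stable i u hu w hw _ := h.not_adj_S ht hu hw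
  stable' i u hu w hw _ := by
    have hu' : L u = 12 + i.val := hu
    have hw' : L w = 12 + i.val := hw
    exact h.not_adj_high ht (by omega) (by omega) (by omega) (by omega)
  nonempty := h.ne
  nonempty' i j hi hj := h.ne' i j (fun u hu => (Set.ext_iff.mp hi u).mp hu)
    (fun u hu => (Set.ext_iff.mp hj u).mp hu)
  complete i j hij u hu w hw := h.comp i j u w hij hu hw
  anticomplete_opp i u hu w hw huw := by
    have hu' : L u = 8 + i.val := hu
    have hw' : L w = 12 + i.val := hw
    have := h.opp u w (by omega) (by omega) (by omega) huw
    omega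
  anticomplete i j hij u hu w hw huw := by
    have hu' : L u = 8 + i.val := hu
    have hw' : L w = 8 + j.val := hw
    have := h.low u w (by omega) (by omega) huw
    exact hij (Fin.ext (by omega))
  anticomplete' i j _ u hu w hw := by
    have hu' : L u = 12 + i.val := hu
    have hw' : L w = 12 + j.val := hw
    exact h.not_adj_high ht (by omega) (by omega) (by omega) (by omega)
  nbhd_A i := by
    have hi := i.2
    ext v
    constructor
    · rintro ⟨h1, u, hu, huv⟩
      have hu' : L u = i.val := hu
      have h1' : L v ≠ i.val := h1
      rcases h.nbA u v (by omega) huv with h2 | h2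
      · have h3 := h.low u v (by omega) h2 huv
        have h4 : ¬ (4 ≤ L v ∧ L v < 8) := fun h4 => hB u v (by omega) h4.1 h4.2 huv
        change L v = 8 + i.val
        omega
      · exact absurd huv (hout u v (by omega) h2)
    · intro hv
      have hv' : L v = 8 + i.val := hv
      obtain ⟨w, hw, hwl⟩ := h.att i v hv
      refine ⟨?_, w, hwl, hw.symm⟩
      intro hc
      have : L v = i.val := hc
      omega
  nbhd_B i := by
    have hi := i.2
    rintro v ⟨h1, u, hu, huv⟩
    have hu' : L u = 4 + i.val := hu
    have h1' : L v ≠ 4 + i.val := h1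
    have hle := h.le v
    have h16 : L v ≠ 16 := fun h16 => hout u v (by omega) h16 huv
    by_cases h12 : L v < 12
    · have h3 := h.low u v (by omega) h12 huv
      have h4 : ¬ L v < 4 := fun h4 => hB v u h4 (by omega) (by omega) huv.symm
      left
      change L v = 8 + i.val
      omega
    · right
      have h3 := h.opp u v (by omega) (by omega) (by omega) huv
      obtain ⟨s, hs⟩ := h.ne i
      refine ⟨⟨?_, s, hs, ?_⟩, Or.inr (Set.mem_iUnion.mpr ⟨⟨L v - 12, by omega⟩, ?_⟩)⟩
      · intro hc
        have : L v = 8 + i.val := hc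
        omega
      · refine h.comp i ⟨L v - 12, by omega⟩ s v (fun he => ?_) hs (by simp only; omega)
        have : i.val = L v - 12 := congrArg Fin.val he
        omega
      · simp only [Set.mem_ofPred_eq]; omega
  nbhd_R := by
    rintro v ⟨hv, u, hu, huv⟩
    have h1 := h.le v
    have h2 : L v ≠ 16 := hv
    have h3 : ¬ L v < 12 := fun h4 => hout v u h4 hu huv.symm
    exact Set.mem_iUnion.mpr ⟨⟨L v - 12, by omega⟩, by simp only [Set.mem_ofPred_eq]; omega⟩
  connected_A i := induce_connected_of_root (h.term i) (h.conn i)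

/-- The order of the terminals does not matter. -/
theorem of_comp {L' : V → ℕ} (π : Equiv.Perm (Fin 4)) (h : CubInv G (x ∘ π) L)
    (h16 : ∀ u, L' u = 16 ↔ L u = 16)
    (hL : ∀ u, ∀ m < 4, ∀ i : Fin 4, L u = 4 * m + i.val → L' u = 4 * m + (π i).val) :
    CubInv G x L' := by
  have hinv : ∀ u, ∀ m < 4, ∀ i : Fin 4, L' u = 4 * m + i.val ↔ L u = 4 * m + (π.symm i).val := by
    intro u m hm i
    constructor
    · intro hu
      have hle := h.le u
      have h1 : L u ≠ 16 := fun hc => by have := (h16 u).mpr hc; omega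
      have h2 := hL u (L u / 4) (by omega) ⟨L u % 4, by omega⟩ (by simp only; omega)
      have h3 : L u / 4 = m := by omega
      have h4 : π ⟨L u % 4, by omega⟩ = i := Fin.ext (by omega)
      rw [← h4, Equiv.symm_apply_apply]
      simp only; omega
    · intro hu
      simpa using hL u m hm _ hu
  have hdec : ∀ u, L' u ≠ 16 → ∃ m < 4, ∃ i : Fin 4, L' u = 4 * m + i.val ∧
      L u = 4 * m + (π.symm i).val := by
    intro u hu
    have hle := h.le u
    have h1 : L u ≠ 16 := fun hc => hu ((h16 u).mpr hc)
    refine ⟨L u / 4, by omega, π ⟨L u % 4, by omega⟩, ?_, ?_⟩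
    · exact hL u (L u / 4) (by omega) ⟨L u % 4, by omega⟩ (by simp only; omega)
    · simp only [Equiv.symm_apply_apply]; omega
  have hle' : ∀ u, L' u ≤ 16 := by
    intro u
    by_contra hc
    obtain ⟨m, hm, i, h1, -⟩ := hdec u (by omega)
    omega
  have h0 : ∀ (i : Fin 4) u, L' u = i.val ↔ L u = (π.symm i).val := fun i u => by
    simpa using hinv u 0 (by omega) i
  have h2 : ∀ (i : Fin 4) u, L' u = 8 + i.val ↔ L u = 8 + (π.symm i).val := fun i u =>
    hinv u 2 (by omega) i
  have h3 : ∀ (i : Fin 4) u, L' u = 12 + i.val ↔ L u = 12 + (π.symm i).val := fun i u =>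
    hinv u 3 (by omega) i
  have hxs : ∀ i, x i = (x ∘ π) (π.symm i) := fun i => by simp
  have hmod : ∀ u, L' u ≠ 16 → ∀ i : Fin 4, L' u % 4 = i.val ↔ L u % 4 = (π.symm i).val := by
    intro u hu i
    obtain ⟨m, -, j, e1, e2⟩ := hdec u hu
    have e3 : L' u % 4 = j.val := by omega
    have e4 : L u % 4 = (π.symm j).val := by omega
    rw [e3, e4]
    constructor
    · intro he; rw [Fin.ext he]
    · intro he; rw [π.symm.injective (Fin.ext he)]
  have hlt : ∀ u k, k ≤ 4 → (L' u < 4 * k ↔ L u < 4 * k) := by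
    intro u k hk
    by_cases hu : L' u = 16
    · have := (h16 u).mp hu; omega
    · obtain ⟨m, -, j, e1, e2⟩ := hdec u hu
      omega
  have hlt1 : ∀ u, L' u < 4 ↔ L u < 4 := fun u => hlt u 1 (by omega)
  have hlt3 : ∀ u, L' u < 12 ↔ L u < 12 := fun u => hlt u 3 (by omega)
  have hlt4 : ∀ u, L' u < 16 ↔ L u < 16 := fun u => hlt u 4 (by omega)
  have hmodeq : ∀ u w, L' u ≠ 16 → L' w ≠ 16 → (L' u % 4 = L' w % 4 ↔ L u % 4 = L w % 4) := by
    intro u w hu hw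
    obtain ⟨m, -, j, e1, e2⟩ := hdec w hw
    have e3 : L' w % 4 = j.val := by omega
    have e4 : L w % 4 = (π.symm j).val := by omega
    rw [e3, e4]
    exact hmod u hu j
  refine ⟨fun i => ?_, fun i => ?_, fun i j hi hj => ?_, fun i j u w hij hu hw => ?_,
    fun i u hu => ?_, fun u w hu hw huw => ?_, fun u w hu hw hw' huw => ?_, fun u w hu huw => ?_,
    fun i u hu => ?_, fun i u hu hu' => ?_, hle'⟩
  · rw [h0, hxs i]; exact h.term _
  · obtain ⟨u, hu⟩ := h.ne (π.symm i)
    exact ⟨u, (h2 i u).mpr hu⟩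
  · exact π.symm.injective (h.ne' _ _ (fun u hu => hi u ((h3 i u).mpr hu))
      (fun u hu => hj u ((h3 j u).mpr hu)))
  · exact h.comp _ _ u w (fun he => hij (π.symm.injective he)) ((h2 i u).mp hu) ((h3 j w).mp hw)
  · obtain ⟨w, hw, hwl⟩ := h.att _ u ((h2 i u).mp hu)
    exact ⟨w, hw, (h0 i w).mpr hwl⟩
  · exact (hmodeq u w (by omega) (by omega)).mpr
      (h.low u w ((hlt3 u).mp hu) ((hlt3 w).mp hw) huw)
  · intro he
    have h12 : ¬ L w < 12 := fun hc => by have := (hlt3 w).mpr hc; omega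
    exact h.opp u w ((hlt3 u).mp hu) (by omega) ((hlt4 w).mp hw') huw
      ((hmodeq w u (by omega) (by omega)).mp he)
  · rw [hlt3, h16]
    exact h.nbA u w ((hlt1 u).mp hu) huw
  · rw [hxs i]
    exact (h.conn _ u ((h0 i u).mp hu)).mono fun w hw => (h0 i w).mpr hw
  · rw [hxs i]
    refine (h.connC _ u ((hlt3 u).mp hu) ((hmod u (by omega) i).mp hu')).mono fun w hw => ?_
    have hw3 := (hlt3 w).mpr hw.1
    exact ⟨hw3, (hmod w (by omega) i).mpr hw.2⟩

variable {v : V}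

/-- A vertex of `Bᵢ` moves to `Aᵢ` or `Sᵢ`. -/
theorem move [DecidableEq V] (h : CubInv G x L) (i : Fin 4) (hv : L v = 4 + i.val) (k : ℕ)
    (hex : ∃ u, L u < 4 ∧ G.Adj v u)
    (hk : (k = i.val ∧ ∀ w, G.Adj v w → L w < 12 ∨ L w = 16) ∨
      (k = 8 + i.val ∧ ∀ (j : Fin 4) w, i ≠ j → L w = 12 + j.val → G.Adj v w)) :
    CubInv G x (Function.update L v k) := by
  have hi := i.2
  set L' := Function.update L v k with hL'
  have hk12 : k < 12 := by omega
  have hkm : k % 4 = i.val := by omega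
  have e1 : L' v = k := Function.update_self _ _ _
  have e2 : ∀ u, u ≠ v → L' u = L u := fun u hu => Function.update_of_ne hu _ _
  -- The vertex stays in its corner and keeps its residue modulo `4`. All conditions that see only
  -- whether labels are below `12` and their residues carry over unchanged.
  have hlt : ∀ u, (L' u < 12 ↔ L u < 12) := by
    intro u
    by_cases hu : u = v
    · subst hu; omega
    · rw [e2 u hu]
  have hmod : ∀ u, L' u % 4 = L u % 4 := by
    intro u
    by_cases hu : u = v
    · subst hu; omega
    · rw [e2 u hu]
  have hge : ∀ u, 12 ≤ L u → L' u = L u := fun u hu => e2 u (by rintro rfl; omega)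
  have hge' : ∀ u, 12 ≤ L' u → L' u = L u := fun u hu => e2 u (by rintro rfl; omega)
  have hA : ∀ u, L u < 4 → L' u = L u := fun u hu => e2 u (by rintro rfl; omega)
  have hS : ∀ (j : Fin 4) u, L u = 8 + j.val → L' u = L u := fun j u hu =>
    e2 u (by rintro rfl; omega)
  obtain ⟨z, hz, hvz⟩ := hex
  have hzi : L z = i.val := by
    have := h.low v z (by omega) (by omega) hvz
    omega
  refine ⟨fun j => ?_, fun j => ?_, fun j l hj hl => ?_, fun j l u w hjl hu hw => ?_,
    fun j u hu => ?_, fun u w hu hw huw => ?_, fun u w hu hw hw' huw => ?_, fun u w hu huw => ?_,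
    fun j u hu => ?_, fun j u hu hu' => ?_, fun u => ?_⟩
  · have := h.term j
    have := j.2
    rw [hA _ (by omega)]; assumption
  · obtain ⟨u, hu⟩ := h.ne j
    exact ⟨u, by rw [hS j u hu]; exact hu⟩
  · exact h.ne' j l (fun u hu => hj u (by rw [hge u (by omega)]; exact hu))
      (fun u hu => hl u (by rw [hge u (by omega)]; exact hu))
  · have hw' : L w = 12 + l.val := by rw [← hge' w (by omega)]; exact hw
    by_cases huv : u = v
    · subst huv
      have := j.2
      rcases hk with ⟨hk, -⟩ | ⟨hk, hk'⟩
      · omega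
      · exact hk' l w (fun he => hjl (he ▸ Fin.ext (by omega))) hw'
    · exact h.comp j l u w hjl (by rw [← e2 u huv]; exact hu) hw'
  · by_cases huv : u = v
    · subst huv
      refine ⟨z, hvz, ?_⟩
      rw [hA z hz]; omega
    · obtain ⟨w, hw, hwl⟩ := h.att j u (by rw [← e2 u huv]; exact hu)
      have := j.2
      exact ⟨w, hw, by rw [hA w (by omega)]; exact hwl⟩
  · rw [hmod, hmod]; exact h.low u w ((hlt u).mp hu) ((hlt w).mp hw) huw
  · rw [hmod, hmod]
    have := hge' w hw
    exact h.opp u w ((hlt u).mp hu) (by omega) (by omega) huw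
  · by_cases huv : u = v
    · subst huv
      rcases hk with ⟨-, hk⟩ | ⟨hk, -⟩
      · rcases hk w huw with h1 | h1
        · exact Or.inl ((hlt w).mpr h1)
        · exact Or.inr (by rw [hge w (by omega)]; exact h1)
      · omega
    · rcases h.nbA u w (by rw [← e2 u huv]; exact hu) huw with h1 | h1
      · exact Or.inl ((hlt w).mpr h1)
      · exact Or.inr (by rw [hge w (by omega)]; exact h1)
  · have hj := j.2
    have hsub : {w | L w = j.val} ⊆ {w | L' w = j.val} := by
      intro w hw
      have hw' : L w = j.val := hw
      change L' w = j.val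
      rw [hA w (by omega)]; exact hw'
    by_cases huv : u = v
    · subst huv
      obtain rfl : i = j := Fin.ext (by omega)
      exact ((h.conn i z hzi).mono hsub).step hvz.symm hu
    · exact (h.conn j u (by rw [← e2 u huv]; exact hu)).mono hsub
  · refine (h.connC j u ((hlt u).mp hu) (by rw [← hmod]; exact hu')).mono fun w hw => ?_
    exact ⟨(hlt w).mpr hw.1, by rw [hmod]; exact hw.2⟩
  · by_cases huv : u = v
    · subst huv; omega
    · rw [e2 u huv]; exact h.le u

/-- A new vertex joins `Bᵢ`. -/
theorem grow_B [DecidableEq V] (h : CubInv G x L) (hv : L v = 16) (i : Fin 4)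
    (hex : ∃ u, L u < 12 ∧ G.Adj v u)
    (hn : ∀ w, G.Adj v w → L w < 12 → L w % 4 = i.val)
    (hn' : ∀ w, G.Adj v w → L w ≠ 12 + i.val) : CubInv G x (Function.update L v (4 + i.val)) := by
  have hi := i.2
  set L' := Function.update L v (4 + i.val) with hL'
  have e1 : L' v = 4 + i.val := Function.update_self _ _ _
  have e2 : ∀ u, u ≠ v → L' u = L u := fun u hu => Function.update_of_ne hu _ _
  have hlt : ∀ u, L u < 16 → L' u = L u := fun u hu => e2 u (by rintro rfl; omega)
  have hsub : ∀ j : Fin 4, {w | L w < 12 ∧ L w % 4 = j.val} ⊆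
      {w | L' w < 12 ∧ L' w % 4 = j.val} := by
    intro j w hw
    have hw' : L w < 12 ∧ L w % 4 = j.val := hw
    change L' w < 12 ∧ L' w % 4 = j.val
    rw [hlt w (by omega)]; exact hw'
  have hne : ∀ u (l : ℕ), L' u = l → l < 4 ∨ 8 ≤ l → u ≠ v := by rintro u l hu hl rfl; omega
  refine ⟨fun j => ?_, fun j => ?_, fun j l hj hl => ?_, fun j l u w hjl hu hw => ?_,
    fun j u hu => ?_, fun u w hu hw huw => ?_, fun u w hu hw hw' huw => ?_, fun u w hu huw => ?_,
    fun j u hu => ?_, fun j u hu hu' => ?_, fun u => ?_⟩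
  · have := h.term j
    have := j.2
    rw [hlt _ (by omega)]; assumption
  · obtain ⟨u, hu⟩ := h.ne j
    have := j.2
    exact ⟨u, by rw [hlt u (by omega)]; exact hu⟩
  · have := j.2
    have := l.2
    exact h.ne' j l (fun u hu => hj u (by rw [hlt u (by omega)]; exact hu))
      (fun u hu => hl u (by rw [hlt u (by omega)]; exact hu))
  · rw [e2 u (hne u _ hu (by omega))] at hu
    rw [e2 w (hne w _ hw (by omega))] at hw
    exact h.comp j l u w hjl hu hw
  · rw [e2 u (hne u _ hu (by omega))] at hu
    obtain ⟨w, hw, hwl⟩ := h.att j u hu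
    have := j.2
    exact ⟨w, hw, by rw [hlt w (by omega)]; exact hwl⟩
  · by_cases huv : u = v
    · subst huv
      have hwu : w ≠ u := huw.ne'
      rw [e2 w hwu] at hw ⊢
      have := hn w huw hw
      omega
    · by_cases hwv : w = v
      · subst hwv
        rw [e2 u huv] at hu ⊢
        have := hn u huw.symm hu
        omega
      · rw [e2 u huv] at hu ⊢
        rw [e2 w hwv] at hw ⊢
        exact h.low u w hu hw huw
  · have hwv := hne w _ rfl (Or.inr (by omega))
    rw [e2 w hwv] at hw hw' ⊢
    by_cases huv : u = v
    · subst huv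
      have := hn' w huw
      omega
    · rw [e2 u huv] at hu ⊢
      exact h.opp u w hu hw hw' huw
  · have huv := hne u _ rfl (Or.inl hu)
    rw [e2 u huv] at hu
    by_cases hwv : w = v
    · subst hwv
      left; omega
    · rw [e2 w hwv]; exact h.nbA u w hu huw
  · have := j.2
    rw [e2 u (hne u _ hu (by omega))] at hu
    refine (h.conn j u hu).mono fun w hw => ?_
    have hw' : L w = j.val := hw
    change L' w = j.val
    rw [hlt w (by omega)]; exact hw'
  · by_cases huv : u = v
    · subst huv
      obtain rfl : i = j := Fin.ext (by omega)
      obtain ⟨z, hz, huz⟩ := hex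
      exact ((h.connC i z hz (hn z huz hz)).mono (hsub i)).step huz.symm ⟨hu, hu'⟩
    · rw [e2 u huv] at hu hu'
      exact (h.connC j u hu hu').mono (hsub j)
  · by_cases huv : u = v
    · subst huv; omega
    · rw [e2 u huv]; exact h.le u

/-- A new vertex joins one of `S₅, …, S₈`. -/
theorem grow_high [DecidableEq V] (h : CubInv G x L) (hv : L v = 16) (i : Fin 4)
    (hA : ∀ w, G.Adj v w → 4 ≤ L w) (hn : ∀ w, G.Adj v w → L w < 12 → L w % 4 ≠ i.val)
    (hc : ∀ (j : Fin 4) w, j ≠ i → L w = 8 + j.val → G.Adj v w) :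
    CubInv G x (Function.update L v (12 + i.val)) := by
  have hi := i.2
  set L' := Function.update L v (12 + i.val) with hL'
  have e1 : L' v = 12 + i.val := Function.update_self _ _ _
  have e2 : ∀ u, u ≠ v → L' u = L u := fun u hu => Function.update_of_ne hu _ _
  have hlt : ∀ u, L u < 16 → L' u = L u := fun u hu => e2 u (by rintro rfl; omega)
  have hne : ∀ u, L' u < 12 → L' u = L u := fun u hu => e2 u (by rintro rfl; omega)
  refine ⟨fun j => ?_, fun j => ?_, fun j l hj hl => ?_, fun j l u w hjl hu hw => ?_,
    fun j u hu => ?_, fun u w hu hw huw => ?_, fun u w hu hw hw' huw => ?_, fun u w hu huw => ?_,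
    fun j u hu => ?_, fun j u hu hu' => ?_, fun u => ?_⟩
  · have := h.term j
    have := j.2
    rw [hlt _ (by omega)]; assumption
  · obtain ⟨u, hu⟩ := h.ne j
    have := j.2
    exact ⟨u, by rw [hlt u (by omega)]; exact hu⟩
  · have := j.2
    have := l.2
    exact h.ne' j l (fun u hu => hj u (by rw [hlt u (by omega)]; exact hu))
      (fun u hu => hl u (by rw [hlt u (by omega)]; exact hu))
  · have := j.2
    rw [hne u (by omega)] at hu
    by_cases hwv : w = v
    · subst hwv
      obtain rfl : i = l := Fin.ext (by omega)
      exact (hc j u hjl hu).symm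
    · rw [e2 w hwv] at hw
      exact h.comp j l u w hjl hu hw
  · have := j.2
    rw [hne u (by omega)] at hu
    obtain ⟨w, hw, hwl⟩ := h.att j u hu
    exact ⟨w, hw, by rw [hlt w (by omega)]; exact hwl⟩
  · have eu := hne u hu
    have ew := hne w hw
    rw [eu] at hu ⊢
    rw [ew] at hw ⊢
    exact h.low u w hu hw huw
  · have eu := hne u hu
    rw [eu] at hu ⊢
    by_cases hwv : w = v
    · subst hwv
      have := hn u huw.symm hu
      omega
    · rw [e2 w hwv] at hw hw' ⊢
      exact h.opp u w hu hw hw' huw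
  · rw [hne u (by omega)] at hu
    by_cases hwv : w = v
    · subst hwv
      have := hA u huw.symm
      omega
    · rw [e2 w hwv]
      exact h.nbA u w hu huw
  · have := j.2
    rw [hne u (by omega)] at hu
    refine (h.conn j u hu).mono fun w hw => ?_
    have hw' : L w = j.val := hw
    change L' w = j.val
    rw [hlt w (by omega)]; exact hw'
  · have eu := hne u hu
    rw [eu] at hu hu'
    refine (h.connC j u hu hu').mono fun w hw => ?_
    have hw' : L w < 12 ∧ L w % 4 = j.val := hw
    change L' w < 12 ∧ L' w % 4 = j.val
    rw [hlt w (by omega)]; exact hw'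
  · by_cases huv : u = v
    · subst huv; omega
    · rw [e2 u huv]; exact h.le u

end CubInv

end Cubic

/-! ### A vertex that a cubic structure cannot absorb -/

section CubicFail

variable {V : Type u} {G : SimpleGraph V} {x : Fin 4 → V} {L : V → ℕ} {v : V}

namespace CubInv

theorem reach_A (h : CubInv G x L) {Q : Set V} (hQ : ∀ u, L u < 4 → u ∈ Q) {j : Fin 4} {u : V}
    (hu : L u = j.val) : RIn G Q (x j) u :=
  (h.conn j u hu).mono fun w hw => hQ w (by have := j.2; have : L w = j.val := hw; omega)

theorem reach_S (h : CubInv G x L) {Q : Set V} (hQ : ∀ u, L u < 4 → u ∈ Q) {j : Fin 4} {s : V}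
    (hs : s ∈ Q) (hl : L s = 8 + j.val) : RIn G Q (x j) s := by
  obtain ⟨w, hw, hwl⟩ := h.att j s hl
  exact (h.reach_A hQ hwl).step hw.symm hs

theorem reach_C (h : CubInv G x L) {Q : Set V} {j : Fin 4}
    (hQ : ∀ u, L u < 12 → L u % 4 = j.val → u ∈ Q) {u : V} (hu : L u < 12)
    (hu' : L u % 4 = j.val) : RIn G Q (x j) u :=
  (h.connC j u hu hu').mono fun w hw => hQ w hw.1 hw.2

theorem term_ne (h : CubInv G x L) (hv : 4 ≤ L v) (e : Fin 4) : x e ≠ v := by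
  intro he
  have := h.term e
  rw [he] at this
  have := e.2
  omega

/-- With `v` as the centre, the four whole corners are the pieces, since there are no edges between
different corners. -/
theorem good_four (h : CubInv G x L) (hv : 4 ≤ L v)
    (hC : ∀ e : Fin 4, ∃ u, G.Adj v u ∧ L u < 12 ∧ L u % 4 = e.val) :
    GoodMask G x {u | L u < 4 ∨ u = v ∨ u ∈ (∅ : Set V) ∨ (4 ≤ L u ∧ L u < 12)} := by
  refine goodMask_of_labels (L := L) (h.term_ne hv) v (fun l => l % 4) 0 0 1 (by decide) ?_
    (fun hn => absurd rfl hn) ?_ ?_ ?_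
  · rintro u hu w hw huv hwv - - huw
    have key : ∀ z, z ∈ {u | L u < 4 ∨ u = v ∨ u ∈ (∅ : Set V) ∨ (4 ≤ L u ∧ L u < 12)} → z ≠ v →
        L z < 12 := by
      rintro z (hz | hz | hz | hz) hzv
      · omega
      · exact absurd hz hzv
      · exact absurd hz (Set.notMem_empty _)
      · omega
    exact h.low u w (key u hu huv) (key w hw hwv) huw
  · intro e he
    simp only [h.term] at he
    have := e.2
    exact Fin.ext (by simp at he ⊢; omega)
  · intro e he
    simp only [h.term] at he
    have := e.2
    exact Fin.ext (by simp at he ⊢; omega)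
  · intro e
    obtain ⟨u, hu, hl, hm⟩ := hC e
    refine (h.reach_C (fun w hw _ => ?_) hl hm).step hu.symm (Or.inr (Or.inl rfl))
    by_cases h4 : L w < 4
    · exact Or.inl h4
    · exact Or.inr (Or.inr (Or.inr ⟨by omega, hw⟩))

/-- The centre is `v`. Through `t` the fourth terminal is joined to corner `c`. As `t` belongs to
`S' b`, it has no edges to corner `b`, and it has none to `A_a`. So `a` and `b` are alone. -/
theorem good_two_low (h : CubInv G x L) (hv : 4 ≤ L v) {a b c d : Fin 4}
    (hf : Four a b c d) {sd t : V} (ld : L sd = 8 + d.val) (lt : L t = 12 + b.val)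
    (ha : ∃ u, G.Adj v u ∧ L u = a.val) (hb : ∃ u, G.Adj v u ∧ L u < 12 ∧ L u % 4 = b.val)
    (hc : ∃ u, G.Adj v u ∧ L u < 12 ∧ L u % 4 = c.val) :
    GoodMask G x {u | L u < 4 ∨ u = v ∨ u ∈ ({sd, t} : Set V) ∨
      (4 ≤ L u ∧ L u < 12 ∧ (L u % 4 = b.val ∨ L u % 4 = c.val))} := by
  set Q : Set V := {u | L u < 4 ∨ u = v ∨ u ∈ ({sd, t} : Set V) ∨
      (4 ≤ L u ∧ L u < 12 ∧ (L u % 4 = b.val ∨ L u % 4 = c.val))} with hQdef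
  obtain ⟨vab, vac, vad, vbc, vbd, vcd⟩ := hf.vals
  have := a.2; have := b.2; have := c.2; have := d.2
  have hlow : ∀ u, L u < 4 → u ∈ Q := fun u hu => Or.inl hu
  have hvQ : v ∈ Q := Or.inr (Or.inl rfl)
  have hsd : sd ∈ Q := Or.inr (Or.inr (Or.inl (by simp)))
  have htQ : t ∈ Q := Or.inr (Or.inr (Or.inl (by simp)))
  have hC : ∀ j : Fin 4, j = b ∨ j = c → ∀ u, L u < 12 → L u % 4 = j.val → u ∈ Q := by
    intro j hj u hu hm
    by_cases h4 : L u < 4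
    · exact Or.inl h4
    · refine Or.inr (Or.inr (Or.inr ⟨by omega, hu, ?_⟩))
      rcases hj with rfl | rfl
      · exact Or.inl hm
      · exact Or.inr hm
  have key : ∀ z ∈ Q, z ≠ v → (L z < 12 ∧ (4 ≤ L z → L z % 4 ≠ a.val)) ∨ z = t := by
    rintro z (hz | hz | hz | hz) hzv
    · left; omega
    · exact absurd hz hzv
    · rcases hz with rfl | rfl
      · left; omega
      · exact Or.inr rfl
    · left; omega
  refine goodMask_of_labels (L := L) (h.term_ne hv) v
    (fun l => if 12 ≤ l then 2 else if l % 4 = a.val then 0 else if l % 4 = b.val then 1 else 2)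
    0 a b (fun he => vab (congrArg _ he)) ?_ (fun hn => absurd rfl hn) ?_ ?_ ?_
  · have hmix : ∀ u ∈ Q, u ≠ v → L u < 12 → G.Adj u t → L u % 4 ≠ a.val ∧ L u % 4 ≠ b.val := by
      intro u hu huv hu12 hut
      have h1 := h.opp u t hu12 (by omega) (by omega) hut
      have h2 : 4 ≤ L u := by
        by_contra h4
        rcases h.nbA u t (by omega) hut with h5 | h5 <;> omega
      rcases key u hu huv with h3 | h3
      · exact ⟨h3.2 h2, by omega⟩
      · subst h3; omega
    rintro u hu w hw huv hwv - - huw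
    rcases key u hu huv with hu' | hu'
    · rcases key w hw hwv with hw' | hw'
      · have := h.low u w hu'.1 hw'.1 huw
        simp [show ¬ 12 ≤ L u by omega, show ¬ 12 ≤ L w by omega, this]
      · subst hw'
        have := hmix u hu huv hu'.1 huw
        simp [show 12 ≤ L w by omega, show ¬ 12 ≤ L u by omega, this]
    · rcases key w hw hwv with hw' | hw'
      · subst hu'
        have := hmix w hw hwv hw'.1 huw.symm
        simp [show 12 ≤ L u by omega, show ¬ 12 ≤ L w by omega, this]
      · subst hu' hw'
        exact absurd huw G.irrefl
  · intro e he
    have := e.2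
    simp only [h.term, Nat.mod_eq_of_lt this, Nat.mod_eq_of_lt a.2] at he
    refine Fin.ext ?_
    split_ifs at he <;> omega
  · intro e he
    have := e.2
    simp only [h.term, Nat.mod_eq_of_lt this, Nat.mod_eq_of_lt b.2] at he
    refine Fin.ext ?_
    split_ifs at he <;> omega
  · intro e
    have rv : ∀ j : Fin 4, j = b ∨ j = c → (∃ u, G.Adj v u ∧ L u < 12 ∧ L u % 4 = j.val) →
        RIn G Q (x j) v := by
      rintro j hj ⟨u, hu, hl, hm⟩
      exact (h.reach_C (hC j hj) hl hm).step hu.symm hvQ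
    rcases hf.cases e with rfl | rfl | rfl | rfl
    · obtain ⟨u, hu, hl⟩ := ha
      exact (h.reach_A hlow hl).step hu.symm hvQ
    · exact rv _ (Or.inl rfl) hb
    · exact rv _ (Or.inr rfl) hc
    · obtain ⟨sc, lc⟩ := h.ne c
      have hscQ : sc ∈ Q := hC c (Or.inr rfl) sc (by omega) (by omega)
      have r1 := (h.reach_S hlow hsd ld).step (h.comp _ _ _ _ (fun he => vbd (congrArg _ he.symm))
        ld lt) htQ
      have r2 := (h.reach_S hlow hscQ lc).step (h.comp _ _ _ _ (fun he => vbc (congrArg _ he.symm))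
        lc lt) htQ
      exact r1.trans (r2.symm.trans (rv _ (Or.inr rfl) hc))

/-- The centre is `t` from `S' b`, a common neighbour of `sa`, `sd` and the vertices of `S_c`. The
corners `b` and `c` form one piece with `v`. The pieces around `sa` and `sd` do not touch it, so `a`
and `d` are alone. -/
theorem good_two (h : CubInv G x L) (hv : 16 = L v) {a b c d : Fin 4}
    (hf : Four a b c d) {sa sd t : V} (la : L sa = 8 + a.val) (ld : L sd = 8 + d.val)
    (lt : L t = 12 + b.val) (nsa : ¬ G.Adj v sa)
    (na : ∀ u, G.Adj v u → L u ≠ a.val) (nd : ∀ u, G.Adj v u → L u < 12 → L u % 4 ≠ d.val)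
    (hb : ∃ u, G.Adj v u ∧ L u < 12 ∧ L u % 4 = b.val)
    (hc : ∃ u, G.Adj v u ∧ L u < 12 ∧ L u % 4 = c.val) :
    GoodMask G x {u | L u < 4 ∨ u = v ∨ u ∈ ({sa, sd, t} : Set V) ∨
      (4 ≤ L u ∧ L u < 12 ∧ (L u % 4 = b.val ∨ L u % 4 = c.val))} := by
  set Q : Set V := {u | L u < 4 ∨ u = v ∨ u ∈ ({sa, sd, t} : Set V) ∨
      (4 ≤ L u ∧ L u < 12 ∧ (L u % 4 = b.val ∨ L u % 4 = c.val))} with hQdef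
  obtain ⟨vab, vac, vad, vbc, vbd, vcd⟩ := hf.vals
  have := a.2; have := b.2; have := c.2; have := d.2
  have hlow : ∀ u, L u < 4 → u ∈ Q := fun u hu => Or.inl hu
  have hvQ : v ∈ Q := Or.inr (Or.inl rfl)
  have hsa : sa ∈ Q := Or.inr (Or.inr (Or.inl (by simp)))
  have hsd : sd ∈ Q := Or.inr (Or.inr (Or.inl (by simp)))
  have htQ : t ∈ Q := Or.inr (Or.inr (Or.inl (by simp)))
  have hC : ∀ j : Fin 4, j = b ∨ j = c → ∀ u, L u < 12 → L u % 4 = j.val → u ∈ Q := by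
    intro j hj u hu hm
    by_cases h4 : L u < 4
    · exact Or.inl h4
    · refine Or.inr (Or.inr (Or.inr ⟨by omega, hu, ?_⟩))
      rcases hj with rfl | rfl
      · exact Or.inl hm
      · exact Or.inr hm
  have key : ∀ z ∈ Q, z ≠ v → z ≠ t → L z < 12 ∧ (z ≠ sa → 4 ≤ L z → L z % 4 ≠ a.val) := by
    rintro z (hz | hz | hz | hz) hzv hzt
    · omega
    · exact absurd hz hzv
    · rcases hz with rfl | rfl | rfl
      · exact ⟨by omega, fun hn => absurd rfl hn⟩
      · omega
      · exact absurd rfl hzt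
    · omega
  refine goodMask_of_labels (L := L) (h.term_ne (v := v) (by omega)) t
    (fun l => if l % 4 = a.val then 1 else if l % 4 = d.val then 2 else 0)
    0 a d (fun he => vad (congrArg _ he)) ?_ ?_ ?_ ?_ ?_
  · rintro u hu w hw hut hwt huv hwv huw
    have := h.low u w (key u hu huv hut).1 (key w hw hwv hwt).1 huw
    simp only [this]
  · rintro - u hu hut huv hvu
    have h1 := key u hu huv hut
    have h2 : u ≠ sa := by rintro rfl; exact nsa hvu
    have h3 := nd u hvu h1.1
    have h4 : L u % 4 ≠ a.val := by
      by_cases h4 : 4 ≤ L u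
      · exact h1.2 h2 h4
      · have := na u hvu
        omega
    simp [h3, h4]
  · intro e he
    have := e.2
    simp only [h.term, Nat.mod_eq_of_lt this, Nat.mod_eq_of_lt a.2] at he
    refine Fin.ext ?_
    split_ifs at he <;> omega
  · intro e he
    have := e.2
    simp only [h.term, Nat.mod_eq_of_lt this, Nat.mod_eq_of_lt d.2] at he
    refine Fin.ext ?_
    split_ifs at he <;> omega
  · intro e
    have rv : ∀ j : Fin 4, j = b ∨ j = c → (∃ u, G.Adj v u ∧ L u < 12 ∧ L u % 4 = j.val) →
        RIn G Q (x j) v := by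
      rintro j hj ⟨u, hu, hl, hm⟩
      exact (h.reach_C (hC j hj) hl hm).step hu.symm hvQ
    obtain ⟨sc, lc⟩ := h.ne c
    have hscQ : sc ∈ Q := hC c (Or.inr rfl) sc (by omega) (by omega)
    have rc := (h.reach_S hlow hscQ lc).step (h.comp _ _ _ _ (fun he => vbc (congrArg _ he.symm))
      lc lt) htQ
    rcases hf.cases e with rfl | rfl | rfl | rfl
    · exact (h.reach_S hlow hsa la).step (h.comp _ _ _ _ (fun he => vab (congrArg _ he))
        la lt) htQ
    · exact (rv _ (Or.inl rfl) hb).trans ((rv _ (Or.inr rfl) hc).symm.trans rc)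
    · exact rc
    · exact (h.reach_S hlow hsd ld).step (h.comp _ _ _ _ (fun he => vbd (congrArg _ he.symm))
        ld lt) htQ

/-- The centre is `t` from `S' a`. Terminal `a` reaches it only by way of `v`, and the others
through their representatives in `S_b`, `S_c` and `S_d`. All four terminals lie in different pieces.
-/
theorem good_one (h : CubInv G x L) (hv : 16 = L v) {a b c d : Fin 4}
    (hf : Four a b c d) {sb sc sd t : V} (lb : L sb = 8 + b.val) (lc : L sc = 8 + c.val)
    (ld : L sd = 8 + d.val) (lt : L t = 12 + a.val) (vt : G.Adj v t)
    (hn : ∀ u, G.Adj v u → L u < 12 → L u % 4 = a.val)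
    (ha : ∃ u, G.Adj v u ∧ L u < 12) :
    GoodMask G x {u | L u < 4 ∨ u = v ∨ u ∈ ({sb, sc, sd, t} : Set V) ∨
      (4 ≤ L u ∧ L u < 12 ∧ L u % 4 = a.val)} := by
  set Q : Set V := {u | L u < 4 ∨ u = v ∨ u ∈ ({sb, sc, sd, t} : Set V) ∨
      (4 ≤ L u ∧ L u < 12 ∧ L u % 4 = a.val)} with hQdef
  obtain ⟨vab, vac, vad, vbc, vbd, vcd⟩ := hf.vals
  have := a.2; have := b.2; have := c.2; have := d.2
  have hlow : ∀ u, L u < 4 → u ∈ Q := fun u hu => Or.inl hu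
  have hvQ : v ∈ Q := Or.inr (Or.inl rfl)
  have hsb : sb ∈ Q := Or.inr (Or.inr (Or.inl (by simp)))
  have hsc : sc ∈ Q := Or.inr (Or.inr (Or.inl (by simp)))
  have hsd : sd ∈ Q := Or.inr (Or.inr (Or.inl (by simp)))
  have htQ : t ∈ Q := Or.inr (Or.inr (Or.inl (by simp)))
  have key : ∀ z ∈ Q, z ≠ v → z ≠ t → L z < 12 := by
    rintro z (hz | hz | hz | hz) hzv hzt
    · omega
    · exact absurd hz hzv
    · rcases hz with rfl | rfl | rfl | rfl
      · omega
      · omega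
      · omega
      · exact absurd rfl hzt
    · omega
  refine goodMask_of_labels (L := L) (h.term_ne (v := v) (by omega)) t (fun l => l % 4)
    a.val b c (fun he => vbc (congrArg _ he)) ?_ ?_ ?_ ?_ ?_
  · rintro u hu w hw hut hwt huv hwv huw
    exact h.low u w (key u hu huv hut) (key w hw hwv hwt) huw
  · rintro - u hu hut huv hvu
    exact hn u hvu (key u hu huv hut)
  · intro e he
    have := e.2
    simp only [h.term, Nat.mod_eq_of_lt this, Nat.mod_eq_of_lt b.2] at he
    exact Fin.ext he
  · intro e he
    have := e.2
    simp only [h.term, Nat.mod_eq_of_lt this, Nat.mod_eq_of_lt c.2] at he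
    exact Fin.ext he
  · intro e
    rcases hf.cases e with rfl | rfl | rfl | rfl
    · obtain ⟨u, hu, hl⟩ := ha
      refine ((h.reach_C (fun w hw hm => ?_) hl (hn u hu hl)).step hu.symm hvQ).step vt htQ
      by_cases h4 : L w < 4
      · exact Or.inl h4
      · exact Or.inr (Or.inr (Or.inr ⟨by omega, hw, hm⟩))
    · exact (h.reach_S hlow hsb lb).step (h.comp _ _ _ _ (fun he => vab (congrArg _ he.symm))
        lb lt) htQ
    · exact (h.reach_S hlow hsc lc).step (h.comp _ _ _ _ (fun he => vac (congrArg _ he.symm))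
        lc lt) htQ
    · exact (h.reach_S hlow hsd ld).step (h.comp _ _ _ _ (fun he => vad (congrArg _ he.symm))
        ld lt) htQ

/-- The centre is `s` from `S' b`, which `sb` does not see. The vertex `t` from `S' c` links `sb` to
`sd` and avoids `v` and `sc`, so the terminals `a` and `c` are alone without `s`. -/
theorem good_move (h : CubInv G x L) {a b c d : Fin 4}
    (hf : Four a b c d) (hv : L v = 4 + a.val) {sb sc sd s t : V} (lb : L sb = 8 + b.val)
    (lc : L sc = 8 + c.val) (ld : L sd = 8 + d.val) (ls : L s = 12 + b.val)
    (lt : L t = 12 + c.val) (vs : G.Adj v s) (vt : ¬ G.Adj v t)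
    (ha : ∃ u, G.Adj v u ∧ L u < 4) :
    GoodMask G x {u | L u < 4 ∨ u = v ∨ u ∈ ({sb, sc, sd, s, t} : Set V) ∨ False} := by
  set Q : Set V := {u | L u < 4 ∨ u = v ∨ u ∈ ({sb, sc, sd, s, t} : Set V) ∨ False} with hQdef
  obtain ⟨vab, vac, vad, vbc, vbd, vcd⟩ := hf.vals
  have := a.2; have := b.2; have := c.2; have := d.2
  have hlow : ∀ u, L u < 4 → u ∈ Q := fun u hu => Or.inl hu
  have hvQ : v ∈ Q := Or.inr (Or.inl rfl)
  have hsb : sb ∈ Q := Or.inr (Or.inr (Or.inl (by simp)))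
  have hsc : sc ∈ Q := Or.inr (Or.inr (Or.inl (by simp)))
  have hsd : sd ∈ Q := Or.inr (Or.inr (Or.inl (by simp)))
  have hsQ : s ∈ Q := Or.inr (Or.inr (Or.inl (by simp)))
  have htQ : t ∈ Q := Or.inr (Or.inr (Or.inl (by simp)))
  have key : ∀ z ∈ Q, z ≠ v → z ≠ s → (L z < 12 ∧ (4 ≤ L z → L z % 4 ≠ a.val)) ∨ z = t := by
    rintro z (hz | hz | hz | hz) hzv hzt
    · left; omega
    · exact absurd hz hzv
    · rcases hz with rfl | rfl | rfl | rfl | rfl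
      · left; omega
      · left; omega
      · left; omega
      · exact absurd rfl hzt
      · exact Or.inr rfl
    · exact hz.elim
  refine goodMask_of_labels (L := L) (h.term_ne (v := v) (by omega)) s
    (fun l => if 12 ≤ l then 3 else if l % 4 = a.val then 0 else if l % 4 = c.val then 2 else 3)
    0 a c (fun he => vac (congrArg _ he)) ?_ ?_ ?_ ?_ ?_
  · have hmix : ∀ u ∈ Q, u ≠ v → u ≠ s → L u < 12 → G.Adj u t →
        L u % 4 ≠ a.val ∧ L u % 4 ≠ c.val := by
      intro u hu huv hus hu12 hut
      have h1 := h.opp u t hu12 (by omega) (by omega) hut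
      have h2 : 4 ≤ L u := by
        by_contra h4
        rcases h.nbA u t (by omega) hut with h5 | h5 <;> omega
      rcases key u hu huv hus with h3 | h3
      · exact ⟨h3.2 h2, by omega⟩
      · subst h3; omega
    rintro u hu w hw hus hws huv hwv huw
    rcases key u hu huv hus with hu' | hu'
    · rcases key w hw hwv hws with hw' | hw'
      · have := h.low u w hu'.1 hw'.1 huw
        simp [show ¬ 12 ≤ L u by omega, show ¬ 12 ≤ L w by omega, this]
      · subst hw'
        have := hmix u hu huv hus hu'.1 huw
        simp [show 12 ≤ L w by omega, show ¬ 12 ≤ L u by omega, this]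
    · rcases key w hw hwv hws with hw' | hw'
      · subst hu'
        have := hmix w hw hwv hws hw'.1 huw.symm
        simp [show 12 ≤ L u by omega, show ¬ 12 ≤ L w by omega, this]
      · subst hu' hw'
        exact absurd huw G.irrefl
  · rintro - u hu hus huv hvu
    rcases key u hu huv hus with hu' | hu'
    · have := h.low v u (by omega) hu'.1 hvu
      have h3 : L u % 4 = a.val := by omega
      simp [show ¬ 12 ≤ L u by omega, h3]
    · subst hu'
      exact absurd hvu vt
  · intro e he
    have := e.2
    simp only [h.term, Nat.mod_eq_of_lt this, Nat.mod_eq_of_lt a.2] at he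
    refine Fin.ext ?_
    split_ifs at he <;> omega
  · intro e he
    have := e.2
    simp only [h.term, Nat.mod_eq_of_lt this, Nat.mod_eq_of_lt c.2] at he
    refine Fin.ext ?_
    split_ifs at he <;> omega
  · intro e
    have rd : RIn G Q (x d) s := (h.reach_S hlow hsd ld).step
      (h.comp _ _ _ _ (fun he => vbd (congrArg _ he.symm)) ld ls) hsQ
    rcases hf.cases e with rfl | rfl | rfl | rfl
    · obtain ⟨u, hu, hl⟩ := ha
      have := h.low v u (by omega) (by omega) hu
      exact ((h.reach_A hlow (show L u = e.val by omega)).step hu.symm hvQ).step vs hsQ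
    · have r1 := (h.reach_S hlow hsb lb).step
        (h.comp _ _ _ _ (fun he => vbc (congrArg _ he)) lb lt) htQ
      have r2 := (h.reach_S hlow hsd ld).step
        (h.comp _ _ _ _ (fun he => vcd (congrArg _ he.symm)) ld lt) htQ
      exact r1.trans (r2.symm.trans rd)
    · exact (h.reach_S hlow hsc lc).step
        (h.comp _ _ _ _ (fun he => vbc (congrArg _ he.symm)) lc ls) hsQ
    · exact rd

end CubInv

/-- The rules by which a cubic structure grows. -/
def cubRules : List Rule :=
  (List.finRange 4).map (fun i => ⟨4 + i.val, [12, 13, 14, 15], [], i.val⟩) ++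
  ((List.finRange 4).map (fun i => ⟨4 + i.val, [],
    [12, 13, 14, 15].filter (fun l => l ≠ 12 + i.val), 8 + i.val⟩) ++
  ((List.finRange 4).map (fun i => ⟨16, (List.range 12).filter (fun l => l % 4 ≠ i.val) ++
    [12 + i.val], [], 4 + i.val⟩) ++
  (List.finRange 4).map (fun i => ⟨16, [0, 1, 2, 3, 4 + i.val, 8 + i.val],
    [8, 9, 10, 11].filter (fun l => l ≠ 8 + i.val), 12 + i.val⟩)))

/-- The vertices that the growth of a cubic structure deals with. -/
def CubCand (G : SimpleGraph V) (L : V → ℕ) (v : V) : Prop :=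
  ∃ u, G.Adj v u ∧ ((L v = 16 ∧ L u < 12) ∨ (4 ≤ L v ∧ L v < 8 ∧ L u < 4))

theorem CubInv.grow [DecidableEq V] (h : CubInv G x L) {r : Rule} (hr : r ∈ cubRules)
    (ha : r.Applies G L v) (hex : CubCand G L v) :
    CubInv G x (Function.update L v r.new) := by
  obtain ⟨u, hu, hl⟩ := hex
  simp only [cubRules, List.mem_append, List.mem_map, List.mem_finRange, true_and] at hr
  obtain ⟨h1, h2, h3⟩ := ha
  rcases hr with ⟨i, rfl⟩ | ⟨i, rfl⟩ | ⟨i, rfl⟩ | ⟨i, rfl⟩ <;> simp only at h1 h2 h3 <;>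
    have hi := i.2
  · refine h.move i h1 _ ⟨u, by omega, hu⟩ (Or.inl ⟨rfl, fun w hw => ?_⟩)
    by_contra hno
    have := h.le w
    exact h2 (L w) (by simp only [List.mem_cons, List.not_mem_nil, or_false]; omega) w hw rfl
  · refine h.move i h1 _ ⟨u, by omega, hu⟩ (Or.inr ⟨rfl, fun j w hij hw => ?_⟩)
    have hj := j.2
    have hij' : j.val ≠ i.val := fun he => hij (Fin.ext he.symm)
    refine h3 (12 + j.val) ?_ w hw
    simp only [List.mem_filter, List.mem_cons, List.not_mem_nil, or_false, decide_eq_true_eq]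
    omega
  · refine h.grow_B h1 i ⟨u, by omega, hu⟩ (fun w hw hl => ?_) fun w hw => ?_
    · by_contra hne
      refine h2 (L w) ?_ w hw rfl
      simp [hl, hne]
    · exact h2 _ (by simp) w hw
  · refine h.grow_high h1 i (fun w hw => ?_) (fun w hw hl hm => ?_) fun j w hij hw => ?_
    · by_contra hno
      exact h2 (L w) (by simp only [List.mem_cons, List.not_mem_nil, or_false]; omega) w hw rfl
    · exact h2 (L w) (by simp only [List.mem_cons, List.not_mem_nil, or_false]; omega) w hw rfl
    · have hj := j.2
      have hij' : j.val ≠ i.val := fun he => hij (Fin.ext he)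
      refine h3 (8 + j.val) ?_ w hw
      simp only [List.mem_filter, List.mem_cons, List.not_mem_nil, or_false, decide_eq_true_eq]
      omega

/-- For a new vertex, count the corners that it sees. Four give a good set. With two or three,
either it joins the `S' d` of an unseen corner `d`, or a gap in another `S_a` or a neighbour in an
`A_a` gives a good set. With one corner `a`, either it joins `B_a`, or a neighbour in `S' a` gives a
good set. A vertex of `B_a` next to `A_a` moves to `A_a` if it sees nothing of the other sets `S' j`
and to `S_a` if it is complete to them. Anything in between is `good_move`. -/
theorem CubInv.fail (h : CubInv G x L) (hex : CubCand G L v)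
    (hno : ∀ r ∈ cubRules, ¬ r.Applies G L v) {P M : ℕ → Set V} (T : Tab G L v P M) :
    ∃ Q, InFam L v x P M [4, 5, 6, 7, 8, 9, 10, 11, 12, 13, 14, 15] Q ∧ GoodMask G x Q := by
  obtain ⟨u0, hu0, hl0⟩ := hex
  have hmem : ∀ l, 4 ≤ l → l < 16 → l ∈ [4, 5, 6, 7, 8, 9, 10, 11, 12, 13, 14, 15] := by
    intro l h1 h2
    simp only [List.mem_cons, List.not_mem_nil, or_false]
    omega
  have hge : ∀ l ∈ [4, 5, 6, 7, 8, 9, 10, 11, 12, 13, 14, 15], 4 ≤ l := by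
    intro l hl
    simp only [List.mem_cons, List.not_mem_nil, or_false] at hl
    omega
  have hx : ∀ i, L (x i) < 4 := fun i => by rw [h.term]; exact i.2
  have mem1 : ∀ r, r ∈ (List.finRange 4).map (fun i => (⟨4 + i.val, [12, 13, 14, 15], [], i.val⟩ :
      Rule)) → r ∈ cubRules := fun r hr => List.mem_append_left _ hr
  have mem2 : ∀ r, r ∈ (List.finRange 4).map (fun i => (⟨4 + i.val, [],
      [12, 13, 14, 15].filter (fun l => l ≠ 12 + i.val), 8 + i.val⟩ : Rule)) → r ∈ cubRules :=
    fun r hr => List.mem_append_right _ (List.mem_append_left _ hr)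
  have mem3 : ∀ r, r ∈ (List.finRange 4).map (fun i => (⟨16, (List.range 12).filter
      (fun l => l % 4 ≠ i.val) ++ [12 + i.val], [], 4 + i.val⟩ : Rule)) → r ∈ cubRules :=
    fun r hr => List.mem_append_right _ (List.mem_append_right _ (List.mem_append_left _ hr))
  have mem4 : ∀ r, r ∈ (List.finRange 4).map (fun i => (⟨16, [0, 1, 2, 3, 4 + i.val, 8 + i.val],
      [8, 9, 10, 11].filter (fun l => l ≠ 8 + i.val), 12 + i.val⟩ : Rule)) → r ∈ cubRules :=
    fun r hr => List.mem_append_right _ (List.mem_append_right _ (List.mem_append_right _ hr))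
  have pickS : ∀ j : Fin 4, ∃ s, L s = 8 + j.val ∧ (P (L s) = {s} ∨ M (L s) = {s}) := by
    intro j
    obtain ⟨z, hz⟩ := h.ne j
    obtain ⟨s, h1, h2⟩ := T.pick z
    exact ⟨s, h1.trans hz, h2⟩
  rcases hl0 with ⟨hv, hl0⟩ | ⟨hv4, hv8, hl0⟩
  · -- a new vertex
    set C : Fin 4 → Prop := fun j => ∃ u, G.Adj v u ∧ L u < 12 ∧ L u % 4 = j.val with hC
    have nC : ∀ j, ¬ C j → ∀ u, G.Adj v u → L u < 12 → L u % 4 ≠ j.val :=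
      fun j hj u hu hl hm => hj ⟨u, hu, hl, hm⟩
    by_cases hall : ∀ j, C j
    · refine ⟨_, inFam_of_labels hge ∅ (fun l => 4 ≤ l ∧ l < 12) (fun l hl => hmem l hl.1 (by omega))
        (fun i => Or.inl (hx i)) (by simp) (by simp), h.good_four (by omega) hall⟩
    push Not at hall
    obtain ⟨d, hd⟩ := hall
    by_cases hone : ∃ b c, b ≠ c ∧ C b ∧ C c
    · -- two corners at least
      by_cases hA : ∃ a b c d, Four a b c d ∧ (∃ u, G.Adj v u ∧ L u = a.val) ∧ C b ∧ C c
      · obtain ⟨a, b, c, d, hf, ha, hb, hc⟩ := hA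
        have key : ∀ {b c : Fin 4}, Four a b c d → C b → C c → (∃ t, L t = 12 + b.val) →
            ∃ Q, InFam L v x P M [4, 5, 6, 7, 8, 9, 10, 11, 12, 13, 14, 15] Q ∧
              GoodMask G x Q := by
          rintro b c hf hb hc ⟨t', ht'⟩
          obtain ⟨vab, vac, vad, vbc, vbd, vcd⟩ := hf.vals
          have := a.2; have := b.2; have := c.2; have := d.2
          obtain ⟨t, lt, tt⟩ := T.pick t'
          obtain ⟨sd, ld, td⟩ := pickS d
          have lt' : L t = 12 + b.val := lt.trans ht'
          refine ⟨_, inFam_of_labels hge {sd, t} (fun l => 4 ≤ l ∧ l < 12 ∧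
            (l % 4 = b.val ∨ l % 4 = c.val)) (fun l hl => hmem l hl.1 (by omega))
            (fun i => Or.inl (hx i)) ?_ ?_, h.good_two_low (by omega) hf ld lt' ha hb hc⟩
          · rintro s (rfl | rfl)
            · exact ⟨hmem _ (by omega) (by omega), by omega, td⟩
            · exact ⟨hmem _ (by omega) (by omega), by omega, tt⟩
          · rintro s (rfl | rfl) s' (rfl | rfl) he <;> first | rfl | omega
        -- The good set needs a vertex of `S' b`, which may be empty. In that case `S' c` is not,
        -- and `b` and `c` exchange their roles.
        rcases h.exists_high hf.2.2.2.1 with ht' | ht'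
        · exact key hf hb hc ht'
        · exact key hf.swap hc hb ht'
      -- the general case of two corners and a gap in the third
      have key : ∀ {a b c : Fin 4}, Four a b c d → C b → C c →
          (∀ u, G.Adj v u → L u ≠ a.val) → (∃ s, L s = 8 + a.val ∧ ¬ G.Adj v s) →
          (∃ t, L t = 12 + b.val) →
          ∃ Q, InFam L v x P M [4, 5, 6, 7, 8, 9, 10, 11, 12, 13, 14, 15] Q ∧
            GoodMask G x Q := by
        rintro a b c hf hb hc na ⟨s', hs', hvs'⟩ ⟨t', ht'⟩
        obtain ⟨vab, vac, vad, vbc, vbd, vcd⟩ := hf.vals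
        have := a.2; have := b.2; have := c.2; have := d.2
        obtain ⟨t, lt, tt⟩ := T.pick t'
        obtain ⟨sd, ld, td⟩ := pickS d
        obtain ⟨sa, la, va, ta⟩ := T.pick_neg hvs'
        have lt' : L t = 12 + b.val := lt.trans ht'
        have la' : L sa = 8 + a.val := la.trans hs'
        refine ⟨_, inFam_of_labels hge {sa, sd, t} (fun l => 4 ≤ l ∧ l < 12 ∧
          (l % 4 = b.val ∨ l % 4 = c.val)) (fun l hl => hmem l hl.1 (by omega))
          (fun i => Or.inl (hx i)) ?_ ?_,
          h.good_two hv.symm hf la' ld lt' va na (nC d hd) hb hc⟩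
        · rintro s (rfl | rfl | rfl)
          · exact ⟨hmem _ (by omega) (by omega), by omega, ta⟩
          · exact ⟨hmem _ (by omega) (by omega), by omega, td⟩
          · exact ⟨hmem _ (by omega) (by omega), by omega, tt⟩
        · rintro s (rfl | rfl | rfl) s' (rfl | rfl | rfl) he <;> first | rfl | omega
      have key' : ∀ {a b c : Fin 4}, Four a b c d → C b → C c →
          (∃ s, L s = 8 + a.val ∧ ¬ G.Adj v s) →
          ∃ Q, InFam L v x P M [4, 5, 6, 7, 8, 9, 10, 11, 12, 13, 14, 15] Q ∧
            GoodMask G x Q := by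
        intro a b c hf hb hc hs
        have na : ∀ u, G.Adj v u → L u ≠ a.val := fun u hu hl =>
          hA ⟨a, b, c, d, hf, ⟨u, hu, hl⟩, hb, hc⟩
        rcases h.exists_high hf.2.2.2.1 with ht' | ht'
        · exact key hf hb hc na hs ht'
        · exact key hf.swap hc hb na hs ht'
      obtain ⟨b, c, hbc, hb, hc⟩ := hone
      have hbd : b ≠ d := by rintro rfl; exact hd hb
      have hcd : c ≠ d := by rintro rfl; exact hd hc
      obtain ⟨a, hf'⟩ := Four.exists_of_three hbc hbd hcd
      have hf : Four a b c d := by clear * - hf'; revert a b c d; decide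
      -- Completeness to the non-empty `S_a` means that `v` sees corner `a` too. Then the same
      -- argument applies to every choice of two of the corners `a`, `b`, `c`, and `v` qualifies for
      -- `S' d`.
      by_contra hgood
      have hfull : ∀ {a b c : Fin 4}, Four a b c d → C b → C c → ∀ s, L s = 8 + a.val →
          G.Adj v s := by
        intro a b c hf hb hc s hs
        by_contra hvs
        exact hgood (key' hf hb hc ⟨s, hs, hvs⟩)
      have fa := hfull hf hb hc
      have ha : C a := by
        obtain ⟨s, hs⟩ := h.ne a
        have := a.2
        exact ⟨s, fa s hs, by omega, by omega⟩
      have hfb : Four b a c d := by clear * - hf; revert a b c d; decide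
      have hfc : Four c a b d := by clear * - hf; revert a b c d; decide
      have fb := hfull hfb ha hc
      have fc := hfull hfc ha hb
      refine hno _ (mem4 _ (List.mem_map.mpr ⟨d, List.mem_finRange d, rfl⟩)) ⟨hv, ?_, ?_⟩
      · intro l hl w hw hwl
        simp only [List.mem_cons, List.not_mem_nil, or_false] at hl
        by_cases h4 : l < 4
        · rcases hf.cases ⟨l, h4⟩ with he | he | he | he
          · exact hA ⟨a, b, c, d, hf, ⟨w, hw, by rw [← he]; exact hwl⟩, hb, hc⟩
          · exact hA ⟨b, a, c, d, hfb, ⟨w, hw, by rw [← he]; exact hwl⟩, ha, hc⟩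
          · exact hA ⟨c, a, b, d, hfc, ⟨w, hw, by rw [← he]; exact hwl⟩, ha, hb⟩
          · refine nC d hd w hw (by omega) ?_
            rw [← he]; simp only; omega
        · have := d.2
          exact nC d hd w hw (by omega) (by omega)
      · intro l hl w hwl
        simp only [List.mem_filter, List.mem_cons, List.not_mem_nil, or_false,
          decide_eq_true_eq] at hl
        rcases hf.cases ⟨l - 8, by omega⟩ with he | he | he | he <;>
          have he' := congrArg Fin.val he <;> simp only at he'
        · exact fa w (by omega)
        · exact fb w (by omega)
        · exact fc w (by omega)
        · omega
    · -- one corner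
      obtain ⟨a, ha⟩ : ∃ a : Fin 4, L u0 % 4 = a.val := ⟨⟨L u0 % 4, by omega⟩, rfl⟩
      have hn : ∀ u, G.Adj v u → L u < 12 → L u % 4 = a.val := by
        intro u hu hl
        by_contra hne
        exact hone ⟨⟨L u % 4, by omega⟩, a, fun he => hne (congrArg Fin.val he),
          ⟨u, hu, hl, rfl⟩, u0, hu0, hl0, ha⟩
      have ht' : ∃ t, G.Adj v t ∧ L t = 12 + a.val := by
        by_contra hnt
        refine hno _ (mem3 _ (List.mem_map.mpr ⟨a, List.mem_finRange a, rfl⟩))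
          ⟨hv, ?_, by simp⟩
        intro l hl w hw hwl
        simp only [List.mem_append, List.mem_filter, List.mem_range, List.mem_cons,
          List.not_mem_nil, or_false, decide_eq_true_eq] at hl
        rcases hl with ⟨hl, hl'⟩ | rfl
        · have := hn w hw (by omega)
          omega
        · exact hnt ⟨w, hw, hwl⟩
      obtain ⟨t', hvt', lt'⟩ := ht'
      obtain ⟨t, lt, vt, tt⟩ := T.pick_pos hvt'
      obtain ⟨b, c, d, hf⟩ : ∃ b c d, Four a b c d := by
        clear * -; revert a; decide
      obtain ⟨vab, vac, vad, vbc, vbd, vcd⟩ := hf.vals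
      have := a.2; have := b.2; have := c.2; have := d.2
      obtain ⟨sb, lb, tb⟩ := pickS b
      obtain ⟨sc, lc, tc⟩ := pickS c
      obtain ⟨sd, ld, td⟩ := pickS d
      rw [lt'] at lt
      refine ⟨_, inFam_of_labels hge {sb, sc, sd, t} (fun l => 4 ≤ l ∧ l < 12 ∧ l % 4 = a.val)
        (fun l hl => hmem l hl.1 (by omega)) (fun i => Or.inl (hx i)) ?_ ?_,
        h.good_one hv.symm hf lb lc ld lt vt hn ⟨u0, hu0, hl0⟩⟩
      · rintro s (rfl | rfl | rfl | rfl)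
        · exact ⟨hmem _ (by omega) (by omega), by omega, tb⟩
        · exact ⟨hmem _ (by omega) (by omega), by omega, tc⟩
        · exact ⟨hmem _ (by omega) (by omega), by omega, td⟩
        · exact ⟨hmem _ (by omega) (by omega), by omega, tt⟩
      · rintro s (rfl | rfl | rfl | rfl) s' (rfl | rfl | rfl | rfl) he <;> first | rfl | omega
  · -- a vertex of some `Bᵢ`
    obtain ⟨a, ha⟩ : ∃ a : Fin 4, L v = 4 + a.val := ⟨⟨L v - 4, by omega⟩, by simp only; omega⟩
    have hap := a.2
    have hs : ∃ b : Fin 4, b ≠ a ∧ ∃ s, G.Adj v s ∧ L s = 12 + b.val := by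
      by_contra hns
      refine hno _ (mem1 _ (List.mem_map.mpr ⟨a, List.mem_finRange a, rfl⟩)) ⟨ha, ?_, by simp⟩
      intro l hl w hw hwl
      simp only [List.mem_cons, List.not_mem_nil, or_false] at hl
      have h1 := h.opp v w (by omega) (by omega) (by omega) hw
      refine hns ⟨⟨l - 12, by omega⟩, ?_, w, hw, by simp only; omega⟩
      intro he
      have : l - 12 = a.val := congrArg Fin.val he
      omega
    have ht' : ∃ c : Fin 4, c ≠ a ∧ ∃ t, ¬ G.Adj v t ∧ L t = 12 + c.val := by
      by_contra hnt
      refine hno _ (mem2 _ (List.mem_map.mpr ⟨a, List.mem_finRange a, rfl⟩)) ⟨ha, by simp, ?_⟩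
      intro l hl w hwl
      simp only [List.mem_filter, List.mem_cons, List.not_mem_nil, or_false,
        decide_eq_true_eq] at hl
      by_contra hvw
      refine hnt ⟨⟨l - 12, by omega⟩, ?_, w, hvw, by simp only; omega⟩
      intro he
      have : l - 12 = a.val := congrArg Fin.val he
      omega
    have key : ∀ {b c : Fin 4}, b ≠ a → c ≠ a → b ≠ c → (∃ s, G.Adj v s ∧ L s = 12 + b.val) →
        (∃ t, ¬ G.Adj v t ∧ L t = 12 + c.val) →
        ∃ Q, InFam L v x P M [4, 5, 6, 7, 8, 9, 10, 11, 12, 13, 14, 15] Q ∧ GoodMask G x Q := by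
      rintro b c hba hca hbc ⟨s', hvs', ls'⟩ ⟨t', hvt', lt'⟩
      obtain ⟨s, ls, vs, ts⟩ := T.pick_pos hvs'
      obtain ⟨t, lt, vt, tt⟩ := T.pick_neg hvt'
      rw [ls'] at ls
      rw [lt'] at lt
      obtain ⟨d, hf⟩ := Four.exists_of_three hba.symm hca.symm hbc
      obtain ⟨vab, vac, vad, vbc, vbd, vcd⟩ := hf.vals
      have := a.2; have := b.2; have := c.2; have := d.2
      obtain ⟨sb, lb, tb⟩ := pickS b
      obtain ⟨sc, lc, tc⟩ := pickS c
      obtain ⟨sd, ld, td⟩ := pickS d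
      refine ⟨_, inFam_of_labels hge {sb, sc, sd, s, t} (fun _ => False)
        (fun l hl => hl.elim) (fun i => Or.inl (hx i)) ?_ ?_,
        h.good_move hf ha lb lc ld ls lt vs vt ⟨u0, hu0, hl0⟩⟩
      · rintro z (rfl | rfl | rfl | rfl | rfl)
        · exact ⟨hmem _ (by omega) (by omega), id, tb⟩
        · exact ⟨hmem _ (by omega) (by omega), id, tc⟩
        · exact ⟨hmem _ (by omega) (by omega), id, td⟩
        · exact ⟨hmem _ (by omega) (by omega), id, ts⟩
        · exact ⟨hmem _ (by omega) (by omega), id, tt⟩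
      · rintro z (rfl | rfl | rfl | rfl | rfl) z' (rfl | rfl | rfl | rfl | rfl) he <;>
          first | rfl | omega
    obtain ⟨b, hba, hs⟩ := hs
    obtain ⟨c, hca, ht'⟩ := ht'
    -- The neighbour and the non-neighbour may lie in the same `S' b`. Another `S'` set of index
    -- different from `a` is then non-empty, and each of its vertices can replace one of the two.
    by_cases hbc : b = c
    · subst hbc
      obtain ⟨c, d, hf⟩ := Four.exists_of_ne hba
      have hca : c ≠ a := hf.2.2.2.1.symm
      have hda : d ≠ a := hf.2.2.2.2.1.symm
      have hbc : b ≠ c := hf.2.1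
      have hbd : b ≠ d := hf.2.2.1
      have key' : ∀ {c : Fin 4}, c ≠ a → b ≠ c → (∃ u, L u = 12 + c.val) →
          ∃ Q, InFam L v x P M [4, 5, 6, 7, 8, 9, 10, 11, 12, 13, 14, 15] Q ∧ GoodMask G x Q := by
        rintro c hca hbc ⟨u, hu⟩
        by_cases hvu : G.Adj v u
        · exact key hca hba hbc.symm ⟨u, hvu, hu⟩ ht'
        · exact key hba hca hbc hs ⟨u, hvu, hu⟩
      rcases h.exists_high hf.2.2.2.2.2 with hu | hu
      · exact key' hca hbc hu
      · exact key' hda hbd hu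
    · exact key hba hca hbc hs ht'

end CubicFail

/-! ## From a square structure to a cubic structure -/

section Turning

variable {V : Type u} {G : SimpleGraph V} {y : Fin 4 → V} {L L₁ : V → ℕ} {v : V}

/-- `D` is the part of the set with label `a` that its terminal reaches outside `N(v)`, and `c` is
a further vertex of this set with a neighbour in `D`. -/
structure Side (G : SimpleGraph V) (y : Fin 4 → V) (L : V → ℕ) (v : V) (a : Fin 4) (D : Set V)
    (c : V) : Prop where
  D_eq : D = {u | RIn G {w | L w = a.val ∧ ¬ G.Adj v w} (y a) u}
  term : y a ∈ D
  lab : L c = a.val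
  notMem : c ∉ D
  adj : ∃ z ∈ D, G.Adj z c

theorem Side.of_mem {a : Fin 4} {D : Set V} {c : V} (h : Side G y L v a D c) {u : V} (hu : u ∈ D) :
    L u = a.val ∧ ¬ G.Adj v u := by
  rw [h.D_eq] at hu
  have hu' : RIn G {w | L w = a.val ∧ ¬ G.Adj v w} (y a) u := hu
  exact hu'.right

theorem Side.conn {a : Fin 4} {D : Set V} {c : V} (h : Side G y L v a D c) {u : V} (hu : u ∈ D) :
    RIn G D (y a) u := by
  have hu' := hu
  rw [h.D_eq] at hu'
  exact RIn.of_forall hu' fun z hz => by rw [h.D_eq]; exact hz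

/-- Otherwise `c` would itself belong to the component `D`. -/
theorem Side.adj_v {a : Fin 4} {D : Set V} {c : V} (h : Side G y L v a D c) : G.Adj v c := by
  by_contra hvc
  obtain ⟨z, hz, hzc⟩ := h.adj
  refine h.notMem ?_
  rw [h.D_eq] at hz ⊢
  exact RIn.step hz hzc ⟨h.lab, hvc⟩

/-- If `v` were the only neighbour of the terminal, the connected set `A_a` would consist of the
terminal alone. Its neighbour in the non-empty `S_a` would then be `v`, which is untreated. -/
theorem SqInv.term_not_adj (hp : Pendant G y) (h : SqInv G y L) (hv : L v = 8) (a : Fin 4) :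
    ¬ G.Adj v (y a) := by
  intro hva
  have ha := a.2
  obtain ⟨s, hs⟩ := h.ne a
  obtain ⟨w, hw, hwl⟩ := h.att a s hs
  have hwy : w ∈ ({y a} : Set V) := by
    refine (h.conn a w hwl).mem_of_closed rfl ?_
    rintro u rfl z hz huz
    have hz' : L z = a.val := hz
    have := hp a _ _ hva.symm huz
    subst this
    omega
  have hwy' : w = y a := hwy
  subst hwy'
  have := hp a _ _ hva.symm hw.symm
  subst this
  omega

theorem SqInv.term_mem_side (hp : Pendant G y) (h : SqInv G y L) (hv : L v = 8) (a : Fin 4) :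
    RIn G {w | L w = a.val ∧ ¬ G.Adj v w} (y a) (y a) :=
  RIn.refl ⟨h.term a, h.term_not_adj hp hv a⟩

/-- `A_a` is connected and contains a neighbour of `v`, so it has an edge that leaves the component
of the terminal in `A_a` minus `N(v)`. -/
theorem SqInv.exists_side (hp : Pendant G y) (h : SqInv G y L) (hv : L v = 8) (a : Fin 4)
    (hva : ∃ u, G.Adj v u ∧ L u = a.val) :
    ∃ z c, RIn G {w | L w = a.val ∧ ¬ G.Adj v w} (y a) z ∧ G.Adj z c ∧ L c = a.val ∧
      ¬ RIn G {w | L w = a.val ∧ ¬ G.Adj v w} (y a) c := by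
  by_contra! hno
  obtain ⟨u, hvu, hu⟩ := hva
  have : u ∈ {z | RIn G {w | L w = a.val ∧ ¬ G.Adj v w} (y a) z} :=
    (h.conn a u hu).mem_of_closed (h.term_mem_side hp hv a) fun z hz w hw hzw => hno z w hz hzw hw
  have h' : RIn G {w | L w = a.val ∧ ¬ G.Adj v w} (y a) u := this
  exact h'.right.2 hvu

/-- Intermediate labels: `p` for `D`, `p + 1` for `c`, and likewise `p'`, `p' + 1` on the other side.
-/
structure MidLab (L L₁ : V → ℕ) (a b : Fin 4) (D : Set V) (c : V) (D' : Set V) (c' : V)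
    (p p' : ℕ) : Prop where
  p_iff : ∀ u, L₁ u = p ↔ u ∈ D
  q_iff : ∀ u, L₁ u = p + 1 ↔ u = c
  p_iff' : ∀ u, L₁ u = p' ↔ u ∈ D'
  q_iff' : ∀ u, L₁ u = p' + 1 ↔ u = c'
  other : ∀ u, L u ≠ a.val → L u ≠ b.val → L₁ u = L u
  rest : ∀ u, L u = a.val ∨ L u = b.val →
    L₁ u = p ∨ L₁ u = p + 1 ∨ L₁ u = p' ∨ L₁ u = p' + 1 ∨ L₁ u = 8

theorem MidLab.symm {a b : Fin 4} {D D' : Set V} {c c' : V} {p p' : ℕ}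
    (h : MidLab L L₁ a b D c D' c' p p') : MidLab L L₁ b a D' c' D c p' p :=
  ⟨h.p_iff', h.q_iff', h.p_iff, h.q_iff, fun u h1 h2 => h.other u h2 h1,
    fun u hu => by have := h.rest u hu.symm; tauto⟩

/-- Everything around a vertex `v` at which a square structure turns into a cubic structure. -/
structure TurnCtx (G : SimpleGraph V) (y : Fin 4 → V) (L L₁ : V → ℕ) (v : V) (i a o b : Fin 4)
    (D : Set V) (c : V) (D' : Set V) (c' : V) (p p' : ℕ) (si so sa sb : V) : Prop where
  inv : SqInv G y L
  new : L v = 8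
  cyc : Cyc i a o b
  side : Side G y L v a D c
  side' : Side G y L v b D' c'
  mid : MidLab L L₁ a b D c D' c' p p'
  nums : p = 9 ∧ p' = 11 ∨ p = 11 ∧ p' = 9
  li : L si = 4 + i.val
  lo : L so = 4 + o.val
  la : L sa = 4 + a.val
  lb : L sb = 4 + b.val
  vi : G.Adj v si
  no : ∀ u, G.Adj v u → L u ≠ i.val ∧ L u ≠ o.val ∧ L u ≠ 4 + o.val

namespace TurnCtx

variable {i a o b : Fin 4} {D D' : Set V} {c c' : V} {p p' : ℕ} {si so sa sb : V}

/-- The reflection that exchanges the two sides. To permit it, `nums` allows the intermediate labels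
in both orders. -/
theorem symm (h : TurnCtx G y L L₁ v i a o b D c D' c' p p' si so sa sb) :
    TurnCtx G y L L₁ v i b o a D' c' D c p' p si so sb sa :=
  ⟨h.inv, h.new, by have := h.cyc; clear * - this; revert i a o b; decide, h.side', h.side,
    h.mid.symm, by have := h.nums; tauto, h.li, h.lo, h.lb, h.la, h.vi, h.no⟩

theorem not_adj_a (ht : TriFree G) (h : TurnCtx G y L L₁ v i a o b D c D' c' p p' si so sa sb)
    {u : V} (hu : L u = 4 + a.val) : ¬ G.Adj v u :=
  fun hvu => ht _ _ _ h.vi (h.inv.adj h.cyc h.li hu) hvu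

theorem mem_cases (h : TurnCtx G y L L₁ v i a o b D c D' c' p p' si so sa sb) {u : V}
    (hu : L₁ u < 4) : L₁ u = L u ∧ (L u = i.val ∨ L u = o.val) := by
  have hn := h.nums
  by_cases h1 : L u = a.val ∨ L u = b.val
  · have := h.mid.rest u h1
    omega
  · push Not at h1
    have h2 := h.mid.other u h1.1 h1.2
    refine ⟨h2, ?_⟩
    rcases h.cyc.cases ⟨L u, by omega⟩ with he | he | he | he <;> have he' := congrArg Fin.val he <;>
      simp only at he' <;> omega

theorem low_of (h : TurnCtx G y L L₁ v i a o b D c D' c' p p' si so sa sb) {u : V} {j : Fin 4}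
    (hj : j = i ∨ j = o) (hu : L u = j.val) : L₁ u < 4 := by
  obtain ⟨v1, v2, v3, v4, v5, v6⟩ := h.cyc.vals
  have := j.2
  rw [h.mid.other u, hu]
  · omega
  · rcases hj with rfl | rfl <;> omega
  · rcases hj with rfl | rfl <;> omega

theorem mid_S (h : TurnCtx G y L L₁ v i a o b D c D' c' p p' si so sa sb) {u : V}
    (hu : 4 ≤ L u) : L₁ u = L u := by
  have := a.2; have := b.2
  exact h.mid.other u (by omega) (by omega)

/-- The connections to `si` that all good sets have in common. -/
theorem reach (h : TurnCtx G y L L₁ v i a o b D c D' c' p p' si so sa sb) {Q : Set V}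
    (hlow : ∀ u, L₁ u < 4 → u ∈ Q) (hv : v ∈ Q) (hsi : si ∈ Q) (hso : so ∈ Q) (hsa : sa ∈ Q)
    (hD' : ∀ u ∈ D', u ∈ Q) (hc' : c' ∈ Q) (e : Fin 4) (he : e ≠ a) : RIn G Q (y e) si := by
  have hA : ∀ j : Fin 4, j = i ∨ j = o → ∀ s, L s = 4 + j.val → s ∈ Q → RIn G Q (y j) s := by
    intro j hj s hs hsQ
    obtain ⟨w, hw, hwl⟩ := h.inv.att j s hs
    refine ((h.inv.conn j w hwl).mono fun z hz => hlow z (h.low_of hj hz)).step hw.symm hsQ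
  rcases h.cyc.cases e with rfl | rfl | rfl | rfl
  · exact hA _ (Or.inl rfl) _ h.li hsi
  · exact absurd rfl he
  · exact ((hA _ (Or.inr rfl) _ h.lo hso).step (h.inv.adj h.cyc.rot h.la h.lo).symm hsa).step
      (h.inv.adj h.cyc h.li h.la).symm hsi
  · obtain ⟨z, hz, hzc⟩ := h.side'.adj
    exact ((((h.side'.conn hz).mono hD').step hzc hc').step h.side'.adj_v.symm hv).step h.vi hsi

theorem term_lab (h : TurnCtx G y L L₁ v i a o b D c D' c' p p' si so sa sb) :
    L₁ (y i) = i.val ∧ L₁ (y a) = p ∧ L₁ (y o) = o.val ∧ L₁ (y b) = p' := by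
  obtain ⟨v1, v2, v3, v4, v5, v6⟩ := h.cyc.vals
  have ti := h.inv.term i
  have t_o := h.inv.term o
  refine ⟨?_, (h.mid.p_iff _).mpr h.side.term, ?_, (h.mid.p_iff' _).mpr h.side'.term⟩
  · rw [h.mid.other _ (by omega) (by omega)]; exact ti
  · rw [h.mid.other _ (by omega) (by omega)]; exact t_o

theorem term_ne (h : TurnCtx G y L L₁ v i a o b D c D' c' p p' si so sa sb) (e : Fin 4) :
    y e ≠ v := by
  intro he
  have h1 := h.inv.term e
  have h2 := h.new
  rw [he] at h1
  have := e.2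
  omega

/-- The arithmetic of an edge that starts in some `A_j`. Its other end has the same index, so it
lies in `A_j` or `S_j`, and in the second case `j` is none of `i`, `a`, `b`. Either way both ends
get the same colour. For `good_hit` the lemma is used with `b` in place of `a`. -/
theorem half_iff {lu lw lu' lw' i a b : ℕ} {B B' : Prop} (hi : i < 4) (ha : a < 4) (hb : b < 4)
    (hu : lu < 4) (h1 : lw = 8 ∨ lw % 4 = lu % 4) (h8 : lw < 8) (hwi : lw ≠ 4 + i)
    (hwb : lw ≠ 4 + b) (hwa : lu = a → lw ≠ 4 + a) (eu : lu' = i ↔ lu = i) (ew : lw' = i ↔ lw = i)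
    (fu : B ↔ lu = a ∨ lu = b) (fw : B' ↔ lw = a ∨ lw = b) : (lu' = i ↔ lw' = i) ∧ (B ↔ B') := by
  rw [eu, ew, fu, fw]
  clear eu ew fu fw
  have : lw = lu ∨ lw = 4 + lu := by omega
  rcases this with rfl | rfl
  · exact ⟨Iff.rfl, Iff.rfl⟩
  · have n1 : lu ≠ i := by omega
    have n2 : lu ≠ b := by omega
    have n3 : lu ≠ a := fun he => hwa he (by omega)
    have m1 : 4 + lu ≠ i := by omega
    have m2 : 4 + lu ≠ b := by omega
    have m3 : 4 + lu ≠ a := by omega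
    simp only [n1, n2, n3, m1, m2, m3, or_self, and_self]

/-- The centre is `si`. Since `D` touches `sa`, terminal `a` reaches the centre without `c`, which
is left out. Then `v` with the other side is a piece that contains `b` only, and `A_i` is a piece
too. -/
theorem good_hit (ht : TriFree G) (h : TurnCtx G y L L₁ v i a o b D c D' c' p p' si so sa sb)
    (hD : ∃ z ∈ D, G.Adj z sa) :
    GoodMask G y {u | L₁ u < 4 ∨ u = v ∨ u ∈ ({si, so, sa} : Set V) ∨
      (L₁ u = p ∨ L₁ u = p' ∨ L₁ u = p' + 1)} := by
  set Q : Set V := {u | L₁ u < 4 ∨ u = v ∨ u ∈ ({si, so, sa} : Set V) ∨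
      (L₁ u = p ∨ L₁ u = p' ∨ L₁ u = p' + 1)} with hQ
  obtain ⟨via, vio, vib, vao, vab, vob⟩ := h.cyc.vals
  have := i.2; have := a.2; have := o.2; have := b.2
  have hn := h.nums
  have li := h.li; have lo := h.lo; have la := h.la
  have hlow : ∀ u, L₁ u < 4 → u ∈ Q := fun u hu => Or.inl hu
  have hvQ : v ∈ Q := Or.inr (Or.inl rfl)
  have hsi : si ∈ Q := Or.inr (Or.inr (Or.inl (by simp)))
  have hso : so ∈ Q := Or.inr (Or.inr (Or.inl (by simp)))
  have hsa : sa ∈ Q := Or.inr (Or.inr (Or.inl (by simp)))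
  have hpD : ∀ u ∈ D, u ∈ Q := fun u hu => Or.inr (Or.inr (Or.inr (Or.inl ((h.mid.p_iff u).mpr hu))))
  have hpD' : ∀ u ∈ D', u ∈ Q := fun u hu =>
    Or.inr (Or.inr (Or.inr (Or.inr (Or.inl ((h.mid.p_iff' u).mpr hu)))))
  have hc' : c' ∈ Q := Or.inr (Or.inr (Or.inr (Or.inr (Or.inr ((h.mid.q_iff' c').mpr rfl)))))
  obtain ⟨ti, ta, t_o, tb⟩ := h.term_lab
  -- the pieces: `0` for `D`, `sa`, `so` and the side of `o`, `1` for `v` and the side of `b`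
  have key : ∀ u ∈ Q, u ≠ v → u ≠ si →
      (L₁ u = i.val ∧ L u = i.val) ∨ (L₁ u = o.val ∧ L u = o.val) ∨ (u = sa ∧ L₁ u = 4 + a.val ∧ L u = 4 + a.val) ∨
      (u = so ∧ L₁ u = 4 + o.val ∧ L u = 4 + o.val) ∨ (u ∈ D ∧ L₁ u = p ∧ L u = a.val) ∨
      (L u = b.val ∧ (L₁ u = p' ∨ L₁ u = p' + 1)) := by
    rintro u (hu | hu | hu | hu) huv hui
    · have := h.mem_cases hu
      omega
    · exact absurd hu huv
    · rcases hu with rfl | rfl | rfl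
      · exact absurd rfl hui
      · have := h.mid_S (u := u) (by omega)
        exact Or.inr (Or.inr (Or.inr (Or.inl ⟨rfl, by omega, by omega⟩)))
      · have := h.mid_S (u := u) (by omega)
        exact Or.inr (Or.inr (Or.inl ⟨rfl, by omega, by omega⟩))
    · rcases hu with hu | hu | hu
      · have hD := (h.mid.p_iff u).mp hu
        exact Or.inr (Or.inr (Or.inr (Or.inr (Or.inl ⟨hD, hu, (h.side.of_mem hD).1⟩))))
      · have hD := (h.mid.p_iff' u).mp hu
        exact Or.inr (Or.inr (Or.inr (Or.inr (Or.inr ⟨(h.side'.of_mem hD).1, Or.inl hu⟩))))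
      · have hD := (h.mid.q_iff' u).mp hu
        exact Or.inr (Or.inr (Or.inr (Or.inr (Or.inr ⟨hD ▸ h.side'.lab, Or.inr hu⟩))))
  have key' : ∀ u ∈ Q, u ≠ v → u ≠ si → L u < 8 ∧ L u ≠ 4 + i.val ∧ L u ≠ 4 + b.val ∧
      (L₁ u = i.val ↔ L u = i.val) ∧
      ((L₁ u = p' ∨ L₁ u = p' + 1) ↔ (L u = b.val ∨ L u = b.val)) := by
    intro u hu huv hui
    rcases key u hu huv hui with ku | ku | ⟨-, ku⟩ | ⟨-, ku⟩ | ⟨-, ku⟩ | ku <;> clear key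
    · rw [ku.1, ku.2]; omega
    · rw [ku.1, ku.2]; omega
    · rw [ku.1, ku.2]; omega
    · rw [ku.1, ku.2]; omega
    · rw [ku.1, ku.2]; omega
    · rw [ku.1]; omega
  set κ : ℕ → ℕ := fun l => if l = i.val then 2 else if l = p' ∨ l = p' + 1 then 1 else 0 with hκ
  have ci : κ (L₁ (y i)) = 2 := by rw [hκ, ti]; simp only; rw [if_pos trivial]
  have ca : κ (L₁ (y a)) = 0 := by rw [hκ, ta]; simp only; rw [if_neg (by omega), if_neg (by omega)]
  have co : κ (L₁ (y o)) = 0 := by rw [hκ, t_o]; simp only; rw [if_neg (by omega), if_neg (by omega)]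
  have cb : κ (L₁ (y b)) = 1 := by rw [hκ, tb]; simp only; rw [if_neg (by omega), if_pos (by simp)]
  refine goodMask_of_labels (L := L₁) h.term_ne si κ 1 i b
    (fun he => vib (congrArg _ he)) ?_ ?_ ?_ ?_ ?_
  · have half : ∀ u ∈ Q, ∀ w ∈ Q, u ≠ si → w ≠ si → u ≠ v → w ≠ v → G.Adj u w → L u < 4 →
        (L₁ u = i.val ↔ L₁ w = i.val) ∧
        ((L₁ u = p' ∨ L₁ u = p' + 1) ↔ (L₁ w = p' ∨ L₁ w = p' + 1)) := by
      intro u hu w hw hui hwi huv hwv huw hu4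
      obtain ⟨-, -, -, ku1, ku2⟩ := key' u hu huv hui
      obtain ⟨kw1, kw2, kw3, kw4, kw5⟩ := key' w hw hwv hwi
      exact half_iff i.2 b.2 b.2 hu4 (h.inv.nb_low hu4 huw) kw1 kw2 kw3 (fun _ => kw3) ku1 kw4 ku2 kw5
    intro u hu w hw hui hwi huv hwv huw
    by_cases hu4 : L u < 4
    · obtain ⟨h1, h2⟩ := half u hu w hw hui hwi huv hwv huw hu4
      simp only [hκ, h1, h2]
    · by_cases hw4 : L w < 4
      · obtain ⟨h1, h2⟩ := half w hw u hu hwi hui hwv huv huw.symm hw4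
        simp only [hκ, h1, h2]
      · obtain ⟨-, -, -, ku1, ku2⟩ := key' u hu huv hui
        obtain ⟨-, -, -, kw1, kw2⟩ := key' w hw hwv hwi
        have n1 : ¬ (L₁ u = i.val) := fun he => hu4 ((ku1.mp he) ▸ i.2)
        have n2 : ¬ (L₁ w = i.val) := fun he => hw4 ((kw1.mp he) ▸ i.2)
        have n3 := mt ku2.mp (by omega)
        have n4 := mt kw2.mp (by omega)
        simp only [hκ, n1, n2, n3, n4]
  · rintro - u hu hui huv hvu
    have h1 := h.no u hvu
    rcases key u hu huv hui with hk | hk | ⟨-, hk⟩ | ⟨-, hk⟩ | ⟨hk, hk'⟩ | ⟨hk, hk'⟩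
    · omega
    · omega
    · exact absurd hvu (h.not_adj_a ht hk.2)
    · omega
    · exact absurd hvu (h.side.of_mem hk).2
    · have n1 : ¬ (L₁ u = i.val) := by omega
      simp only [hκ, n1, hk', if_true, if_false]
  · intro e he
    rcases h.cyc.cases e with rfl | rfl | rfl | rfl
    · rfl
    · rw [ca, ci] at he; omega
    · rw [co, ci] at he; omega
    · rw [cb, ci] at he; omega
  · intro e he
    rcases h.cyc.cases e with rfl | rfl | rfl | rfl
    · rw [ci, cb] at he; omega
    · rw [ca, cb] at he; omega
    · rw [co, cb] at he; omega
    · rfl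
  · intro e
    by_cases hea : e = a
    · subst hea
      obtain ⟨z, hz, hzs⟩ := hD
      exact (((h.side.conn hz).mono hpD).step hzs hsa).step (h.inv.adj h.cyc li la).symm hsi
    · exact h.reach hlow hvQ hsi hso hsa hpD' hc' e hea

/-- The centre is `si`, and now terminal `a` gets there through `c` and `v`. As `D` and `c` avoid
`sa`, both sides with `v` stay apart from `A_o`, `so` and `sa`. So `i` and `o` are alone. -/
theorem good_miss (ht : TriFree G) (h : TurnCtx G y L L₁ v i a o b D c D' c' p p' si so sa sb)
    (hD : ∀ z ∈ D, ¬ G.Adj z sa) (hc : ¬ G.Adj c sa) :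
    GoodMask G y {u | L₁ u < 4 ∨ u = v ∨ u ∈ ({si, so, sa} : Set V) ∨
      (9 ≤ L₁ u ∧ L₁ u ≤ 12)} := by
  set Q : Set V := {u | L₁ u < 4 ∨ u = v ∨ u ∈ ({si, so, sa} : Set V) ∨
      (9 ≤ L₁ u ∧ L₁ u ≤ 12)} with hQ
  obtain ⟨via, vio, vib, vao, vab, vob⟩ := h.cyc.vals
  have := i.2; have := a.2; have := o.2; have := b.2
  have hn := h.nums
  have li := h.li; have lo := h.lo; have la := h.la
  have hlow : ∀ u, L₁ u < 4 → u ∈ Q := fun u hu => Or.inl hu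
  have hvQ : v ∈ Q := Or.inr (Or.inl rfl)
  have hsi : si ∈ Q := Or.inr (Or.inr (Or.inl (by simp)))
  have hso : so ∈ Q := Or.inr (Or.inr (Or.inl (by simp)))
  have hsa : sa ∈ Q := Or.inr (Or.inr (Or.inl (by simp)))
  have hbig : ∀ u, 9 ≤ L₁ u → L₁ u ≤ 12 → u ∈ Q := fun u h1 h2 => Or.inr (Or.inr (Or.inr ⟨h1, h2⟩))
  have hpD : ∀ u ∈ D, u ∈ Q := fun u hu => by
    have := (h.mid.p_iff u).mpr hu
    exact hbig u (by omega) (by omega)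
  have hpD' : ∀ u ∈ D', u ∈ Q := fun u hu => by
    have := (h.mid.p_iff' u).mpr hu
    exact hbig u (by omega) (by omega)
  have hcQ : c ∈ Q := by
    have := (h.mid.q_iff c).mpr rfl
    exact hbig c (by omega) (by omega)
  have hc' : c' ∈ Q := by
    have := (h.mid.q_iff' c').mpr rfl
    exact hbig c' (by omega) (by omega)
  obtain ⟨ti, ta, t_o, tb⟩ := h.term_lab
  have key : ∀ u ∈ Q, u ≠ v → u ≠ si →
      (L₁ u = i.val ∧ L u = i.val) ∨ (L₁ u = o.val ∧ L u = o.val) ∨ (u = sa ∧ L₁ u = 4 + a.val ∧ L u = 4 + a.val) ∨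
      (u = so ∧ L₁ u = 4 + o.val ∧ L u = 4 + o.val) ∨ ((u ∈ D ∨ u = c) ∧ 9 ≤ L₁ u ∧ L u = a.val) ∨
      (9 ≤ L₁ u ∧ L u = b.val) := by
    rintro u (hu | hu | hu | hu) huv hui
    · have := h.mem_cases hu
      omega
    · exact absurd hu huv
    · rcases hu with rfl | rfl | rfl
      · exact absurd rfl hui
      · have := h.mid_S (u := u) (by omega)
        exact Or.inr (Or.inr (Or.inr (Or.inl ⟨rfl, by omega, by omega⟩)))
      · have := h.mid_S (u := u) (by omega)
        exact Or.inr (Or.inr (Or.inl ⟨rfl, by omega, by omega⟩))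
    · have h4 : L₁ u = p ∨ L₁ u = p + 1 ∨ L₁ u = p' ∨ L₁ u = p' + 1 := by omega
      rcases h4 with h4 | h4 | h4 | h4
      · have hD := (h.mid.p_iff u).mp h4
        exact Or.inr (Or.inr (Or.inr (Or.inr (Or.inl ⟨Or.inl hD, hu.1, (h.side.of_mem hD).1⟩))))
      · have hD := (h.mid.q_iff u).mp h4
        exact Or.inr (Or.inr (Or.inr (Or.inr (Or.inl ⟨Or.inr hD, hu.1, hD ▸ h.side.lab⟩))))
      · have hD := (h.mid.p_iff' u).mp h4
        exact Or.inr (Or.inr (Or.inr (Or.inr (Or.inr ⟨hu.1, (h.side'.of_mem hD).1⟩))))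
      · have hD := (h.mid.q_iff' u).mp h4
        exact Or.inr (Or.inr (Or.inr (Or.inr (Or.inr ⟨hu.1, hD ▸ h.side'.lab⟩))))
  have key' : ∀ u ∈ Q, u ≠ v → u ≠ si → L u < 8 ∧ L u ≠ 4 + i.val ∧ L u ≠ 4 + b.val ∧
      (L u = 4 + a.val → u = sa) ∧ (L u = a.val → u ∈ D ∨ u = c) ∧
      (L₁ u = i.val ↔ L u = i.val) ∧ (9 ≤ L₁ u ↔ (L u = a.val ∨ L u = b.val)) := by
    intro u hu huv hui
    rcases key u hu huv hui with ku | ku | ⟨ku', ku⟩ | ⟨-, ku⟩ | ⟨ku', ku⟩ | ku <;> clear key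
    · rw [ku.1, ku.2]; omega
    · rw [ku.1, ku.2]; omega
    · refine ⟨by omega, by omega, by omega, fun _ => ku', fun _ => by omega, by omega, by omega⟩
    · rw [ku.1, ku.2]; omega
    · refine ⟨by omega, by omega, by omega, fun _ => by omega, fun _ => ku', by omega, by omega⟩
    · rw [ku.2]; omega
  set κ : ℕ → ℕ := fun l => if l = i.val then 2 else if 9 ≤ l then 1 else 0 with hκ
  have ci : κ (L₁ (y i)) = 2 := by rw [hκ, ti]; simp only; rw [if_pos trivial]
  have ca : κ (L₁ (y a)) = 1 := by rw [hκ, ta]; simp only; rw [if_neg (by omega), if_pos (by omega)]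
  have co : κ (L₁ (y o)) = 0 := by rw [hκ, t_o]; simp only; rw [if_neg (by omega), if_neg (by omega)]
  have cb : κ (L₁ (y b)) = 1 := by rw [hκ, tb]; simp only; rw [if_neg (by omega), if_pos (by omega)]
  refine goodMask_of_labels (L := L₁) h.term_ne si κ 1 i o
    (fun he => vio (congrArg _ he)) ?_ ?_ ?_ ?_ ?_
  · have half : ∀ u ∈ Q, ∀ w ∈ Q, u ≠ si → w ≠ si → u ≠ v → w ≠ v → G.Adj u w → L u < 4 →
        (L₁ u = i.val ↔ L₁ w = i.val) ∧ (9 ≤ L₁ u ↔ 9 ≤ L₁ w) := by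
      intro u hu w hw hui hwi huv hwv huw hu4
      obtain ⟨-, -, -, -, ku0, ku1, ku2⟩ := key' u hu huv hui
      obtain ⟨kw1, kw2, kw3, kw0, -, kw4, kw5⟩ := key' w hw hwv hwi
      refine half_iff i.2 a.2 b.2 hu4 (h.inv.nb_low hu4 huw) kw1 kw2 kw3 (fun hua hwa => ?_)
        ku1 kw4 ku2 kw5
      obtain rfl := kw0 hwa
      rcases ku0 hua with hu' | rfl
      · exact hD u hu' huw
      · exact hc huw
    intro u hu w hw hui hwi huv hwv huw
    by_cases hu4 : L u < 4
    · obtain ⟨h1, h2⟩ := half u hu w hw hui hwi huv hwv huw hu4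
      simp only [hκ, h1, h2]
    · by_cases hw4 : L w < 4
      · obtain ⟨h1, h2⟩ := half w hw u hu hwi hui hwv huv huw.symm hw4
        simp only [hκ, h1, h2]
      · obtain ⟨-, -, -, -, -, ku1, ku2⟩ := key' u hu huv hui
        obtain ⟨-, -, -, -, -, kw1, kw2⟩ := key' w hw hwv hwi
        have n1 : ¬ (L₁ u = i.val) := fun he => hu4 ((ku1.mp he) ▸ i.2)
        have n2 : ¬ (L₁ w = i.val) := fun he => hw4 ((kw1.mp he) ▸ i.2)
        have n3 := mt ku2.mp (by omega)
        have n4 := mt kw2.mp (by omega)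
        simp only [hκ, n1, n2, n3, n4]
  · rintro - u hu hui huv hvu
    have h1 := h.no u hvu
    rcases key u hu huv hui with hk | hk | ⟨-, hk⟩ | ⟨-, hk⟩ | ⟨hk, hk'⟩ | ⟨hk, hk'⟩
    · omega
    · omega
    · exact absurd hvu (h.not_adj_a ht hk.2)
    · omega
    · have n1 : ¬ (L₁ u = i.val) := by omega
      simp only [hκ, n1, hk'.1, if_true, if_false]
    · have n1 : ¬ (L₁ u = i.val) := by omega
      simp only [hκ, n1, hk, if_true, if_false]
  · intro e he
    rcases h.cyc.cases e with rfl | rfl | rfl | rfl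
    · rfl
    · rw [ca, ci] at he; omega
    · rw [co, ci] at he; omega
    · rw [cb, ci] at he; omega
  · intro e he
    rcases h.cyc.cases e with rfl | rfl | rfl | rfl
    · rw [ci, co] at he; omega
    · rw [ca, co] at he; omega
    · rfl
    · rw [cb, co] at he; omega
  · intro e
    by_cases hea : e = a
    · subst hea
      obtain ⟨z, hz, hzc⟩ := h.side.adj
      exact ((((h.side.conn hz).mono hpD).step hzc hcQ).step h.side.adj_v.symm hvQ).step h.vi hsi
    · exact h.reach hlow hvQ hsi hso hsa hpD' hc' e hea

end TurnCtx

end Turning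

/-! ### The cubic structure that arises at a turn -/

section Cube

variable {V : Type u} {G : SimpleGraph V} {y : Fin 4 → V} {L L₁ L₂ : V → ℕ} {v : V}

/-- The labels of the cubic structure that a square structure turns into. -/
structure CubeLab (L L₂ : V → ℕ) (v : V) (i a o b : Fin 4) (D : Set V) (c : V) (D' : Set V) (c' : V)
    (si sa sb : V) : Prop where
  A_a : ∀ u, L₂ u = a.val ↔ u ∈ D
  S_a : ∀ u, L₂ u = 8 + a.val ↔ u = c
  A_b : ∀ u, L₂ u = b.val ↔ u ∈ D'
  S_b : ∀ u, L₂ u = 8 + b.val ↔ u = c'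
  A_i : ∀ u, L₂ u = i.val ↔ L u = i.val
  A_o : ∀ u, L₂ u = o.val ↔ L u = o.val
  S_i : ∀ u, L₂ u = 8 + i.val ↔ u = si
  S_o : ∀ u, L₂ u = 8 + o.val ↔ L u = 4 + o.val
  H_a : ∀ u, L₂ u = 12 + a.val ↔ u = sb
  H_b : ∀ u, L₂ u = 12 + b.val ↔ u = sa
  H_o : ∀ u, L₂ u = 12 + o.val ↔ u = v
  only : ∀ u, L₂ u = 16 ∨ ∃ j : Fin 4, L₂ u = j.val ∨ L₂ u = 8 + j.val ∨ (j ≠ i ∧ L₂ u = 12 + j.val)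

namespace TurnCtx

variable {i a o b : Fin 4} {D D' : Set V} {c c' : V} {p p' : ℕ} {si so sa sb : V}

theorem cube_corner (h : TurnCtx G y L L₁ v i a o b D c D' c' p p' si so sa sb)
    (hL : CubeLab L L₂ v i a o b D c D' c' si sa sb) {u : V} (hu : L₂ u < 12) :
    (∃ j : Fin 4, L u = j.val ∧ L₂ u % 4 = j.val ∧ (L₂ u < 4 ∨ 8 ≤ L₂ u)) ∨
      (L u = 4 + i.val ∧ L₂ u = 8 + i.val) ∨ (L u = 4 + o.val ∧ L₂ u = 8 + o.val) := by
  rcases hL.only u with h1 | ⟨j, h1⟩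
  · omega
  have hj := j.2
  rcases h1 with h1 | h1 | ⟨-, h1⟩
  · refine Or.inl ⟨j, ?_, by omega, by omega⟩
    rcases h.cyc.cases j with rfl | rfl | rfl | rfl
    · exact (hL.A_i u).mp h1
    · exact (h.side.of_mem ((hL.A_a u).mp h1)).1
    · exact (hL.A_o u).mp h1
    · exact (h.side'.of_mem ((hL.A_b u).mp h1)).1
  · rcases h.cyc.cases j with rfl | rfl | rfl | rfl
    · exact Or.inr (Or.inl ⟨(hL.S_i u).mp h1 ▸ h.li, h1⟩)
    · exact Or.inl ⟨j, (hL.S_a u).mp h1 ▸ h.side.lab, by omega, by omega⟩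
    · exact Or.inr (Or.inr ⟨(hL.S_o u).mp h1, h1⟩)
    · exact Or.inl ⟨j, (hL.S_b u).mp h1 ▸ h.side'.lab, by omega, by omega⟩
  · omega

/-- Vertices that stay in a corner keep their index. So conditions on edges inside corners are
inherited from the square structure. -/
theorem cube_mod (h : TurnCtx G y L L₁ v i a o b D c D' c' p p' si so sa sb)
    (hL : CubeLab L L₂ v i a o b D c D' c' si sa sb) {u : V} (hu : L₂ u < 12) :
    L u < 8 ∧ L u % 4 = L₂ u % 4 := by
  have := i.2; have := o.2
  rcases h.cube_corner hL hu with ⟨j, h1, h2, -⟩ | ⟨h1, h2⟩ | ⟨h1, h2⟩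
  · have := j.2
    omega
  · omega
  · omega

theorem cube_side (h : TurnCtx G y L L₁ v i a o b D c D' c' p p' si so sa sb)
    (hL : CubeLab L L₂ v i a o b D c D' c' si sa sb) {u : V} (hu : L₂ u < 12)
    (ha : L₂ u % 4 = a.val ∨ L₂ u % 4 = b.val) : L u < 4 := by
  obtain ⟨v1, v2, v3, v4, v5, v6⟩ := h.cyc.vals
  have := i.2; have := o.2
  rcases h.cube_corner hL hu with ⟨j, h1, h2, -⟩ | ⟨h1, h2⟩ | ⟨h1, h2⟩
  · have := j.2
    omega
  · rcases ha with ha | ha <;> omega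
  · rcases ha with ha | ha <;> omega

/-- An edge at an old `A_j` keeps the index. The only other corner vertices come from the old `S_i`
and `S_o`, which are opposite and hence anticomplete. -/
theorem cube_low (ht : TriFree G) (h : TurnCtx G y L L₁ v i a o b D c D' c' p p' si so sa sb)
    (hL : CubeLab L L₂ v i a o b D c D' c' si sa sb) {u w : V} (hu : L₂ u < 12) (hw : L₂ w < 12)
    (huw : G.Adj u w) : L₂ u % 4 = L₂ w % 4 := by
  obtain ⟨hu8, hum⟩ := h.cube_mod hL hu
  obtain ⟨hw8, hwm⟩ := h.cube_mod hL hw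
  by_cases hu4 : L u < 4
  · have := h.inv.nb_low hu4 huw
    omega
  by_cases hw4 : L w < 4
  · have := h.inv.nb_low hw4 huw.symm
    omega
  rcases h.cube_corner hL hu with ⟨j, h1, -, -⟩ | ⟨h1, h2⟩ | ⟨h1, h2⟩
  · have := j.2
    omega
  · rcases h.cube_corner hL hw with ⟨j, h3, -, -⟩ | ⟨h3, h4⟩ | ⟨h3, h4⟩
    · have := j.2
      omega
    · omega
    · exact absurd huw (h.inv.not_adj_opp ht h.cyc h1 h3)
  · rcases h.cube_corner hL hw with ⟨j, h3, -, -⟩ | ⟨h3, h4⟩ | ⟨h3, h4⟩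
    · have := j.2
      omega
    · exact absurd huw.symm (h.inv.not_adj_opp ht h.cyc h3 h1)
    · omega

/-- The vertices in the sets `S₅, …, S₈` of the new cubic structure. -/
theorem cube_high (h : TurnCtx G y L L₁ v i a o b D c D' c' p p' si so sa sb)
    (hL : CubeLab L L₂ v i a o b D c D' c' si sa sb) {w : V} (hw : 12 ≤ L₂ w) (hw' : L₂ w < 16) :
    (w = sb ∧ L₂ w = 12 + a.val) ∨ (w = sa ∧ L₂ w = 12 + b.val) ∨ (w = v ∧ L₂ w = 12 + o.val) := by
  rcases hL.only w with h1 | ⟨j, h1⟩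
  · omega
  have hj := j.2
  rcases h1 with h1 | h1 | ⟨hji, h1⟩
  · omega
  · omega
  rcases h.cyc.cases j with rfl | rfl | rfl | rfl
  · exact absurd rfl hji
  · exact Or.inl ⟨(hL.H_a w).mp h1, h1⟩
  · exact Or.inr (Or.inr ⟨(hL.H_o w).mp h1, h1⟩)
  · exact Or.inr (Or.inl ⟨(hL.H_b w).mp h1, h1⟩)

theorem cube_opp (h : TurnCtx G y L L₁ v i a o b D c D' c' p p' si so sa sb)
    (hL : CubeLab L L₂ v i a o b D c D' c' si sa sb) {u w : V} (hu : L₂ u < 12) (hw : 12 ≤ L₂ w)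
    (hw' : L₂ w < 16) (huw : G.Adj u w) : L₂ w % 4 ≠ L₂ u % 4 := by
  intro he
  obtain ⟨v1, v2, v3, v4, v5, v6⟩ := h.cyc.vals
  obtain ⟨hu8, hum⟩ := h.cube_mod hL hu
  have := a.2; have := b.2; have := o.2
  rcases h.cube_high hL hw hw' with ⟨rfl, h1⟩ | ⟨rfl, h1⟩ | ⟨rfl, h1⟩
  · have h2 := h.inv.nb_low (h.cube_side hL hu (by omega)) huw
    have := h.lb
    omega
  · have h2 := h.inv.nb_low (h.cube_side hL hu (by omega)) huw
    have := h.la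
    omega
  · have := h.no u huw.symm
    omega

/-- The new vertices outside the corners are `sb`, `sa` and `v`. The first two could only see the
new `A_b` and `A_a`, which the hypotheses exclude. The sides `D` and `D'` were chosen to avoid `v`.
-/
theorem cube_nbA (h : TurnCtx G y L L₁ v i a o b D c D' c' p p' si so sa sb)
    (hL : CubeLab L L₂ v i a o b D c D' c' si sa sb) (hD : ∀ z ∈ D, ¬ G.Adj z sa)
    (hD' : ∀ z ∈ D', ¬ G.Adj z sb) {u w : V} (hu : L₂ u < 4) (huw : G.Adj u w) :
    L₂ w < 12 ∨ L₂ w = 16 := by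
  by_contra! hno
  have hle : L₂ w ≤ 16 := by
    rcases hL.only w with h1 | ⟨j, h1⟩
    · omega
    · have := j.2
      omega
  obtain ⟨v1, v2, v3, v4, v5, v6⟩ := h.cyc.vals
  have := i.2; have := a.2; have := b.2; have := o.2
  obtain ⟨hu8, hum⟩ := h.cube_mod hL (show L₂ u < 12 by omega)
  rcases h.cube_high hL hno.1 (by omega) with ⟨rfl, h1⟩ | ⟨rfl, h1⟩ | ⟨rfl, h1⟩
  · have hlb := h.lb
    have hu4 : L u < 4 := by
      rcases h.cube_corner hL (show L₂ u < 12 by omega) with ⟨j, h3, -, -⟩ | ⟨h3, h4⟩ | ⟨h3, h4⟩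
      · have := j.2
        omega
      · omega
      · omega
    have := h.inv.nb_low hu4 huw
    exact hD' u ((hL.A_b u).mp (by omega)) huw
  · have hla := h.la
    have hu4 : L u < 4 := by
      rcases h.cube_corner hL (show L₂ u < 12 by omega) with ⟨j, h3, -, -⟩ | ⟨h3, h4⟩ | ⟨h3, h4⟩
      · have := j.2
        omega
      · omega
      · omega
    have := h.inv.nb_low hu4 huw
    exact hD u ((hL.A_a u).mp (by omega)) huw
  · have h2 := h.no u huw.symm
    rcases h.cyc.cases ⟨L₂ u, hu⟩ with h3 | h3 | h3 | h3 <;> have h3 := congrArg Fin.val h3 <;>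
      simp only at h3
    · exact h2.1 ((hL.A_i u).mp h3)
    · exact (h.side.of_mem ((hL.A_a u).mp h3)).2 huw.symm
    · exact h2.2.1 ((hL.A_o u).mp h3)
    · exact (h.side'.of_mem ((hL.A_b u).mp h3)).2 huw.symm

/-- The edges come from three sources: completeness of consecutive sets in the old square, the two
hypotheses on `c` and `c'`, and the neighbours `si`, `c`, `c'` of `v`. -/
theorem cube_comp (h : TurnCtx G y L L₁ v i a o b D c D' c' p p' si so sa sb)
    (hL : CubeLab L L₂ v i a o b D c D' c' si sa sb) (hc : G.Adj c sa) (hc' : G.Adj c' sb)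
    {j k : Fin 4} {u w : V} (hjk : j ≠ k) (hu : L₂ u = 8 + j.val) (hw : L₂ w = 12 + k.val) :
    G.Adj u w := by
  have := k.2; have := a.2; have := b.2; have := o.2
  rcases h.cube_high hL (w := w) (by omega) (by omega) with ⟨rfl, h1⟩ | ⟨rfl, h1⟩ | ⟨rfl, h1⟩
  · obtain rfl : k = a := Fin.ext (by omega)
    rcases h.cyc.cases j with rfl | rfl | rfl | rfl
    · rw [(hL.S_i u).mp hu]
      exact (h.inv.adj h.cyc.rot.rot.rot h.lb h.li).symm
    · exact absurd rfl hjk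
    · exact h.inv.adj h.cyc.rot.rot ((hL.S_o u).mp hu) h.lb
    · rw [(hL.S_b u).mp hu]
      exact hc'
  · obtain rfl : k = b := Fin.ext (by omega)
    rcases h.cyc.cases j with rfl | rfl | rfl | rfl
    · rw [(hL.S_i u).mp hu]
      exact h.inv.adj h.cyc h.li h.la
    · rw [(hL.S_a u).mp hu]
      exact hc
    · exact (h.inv.adj h.cyc.rot h.la ((hL.S_o u).mp hu)).symm
    · exact absurd rfl hjk
  · obtain rfl : k = o := Fin.ext (by omega)
    rcases h.cyc.cases j with rfl | rfl | rfl | rfl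
    · rw [(hL.S_i u).mp hu]
      exact h.vi.symm
    · rw [(hL.S_a u).mp hu]
      exact h.side.adj_v.symm
    · exact absurd rfl hjk
    · rw [(hL.S_b u).mp hu]
      exact h.side'.adj_v.symm

theorem cube_att (h : TurnCtx G y L L₁ v i a o b D c D' c' p p' si so sa sb)
    (hL : CubeLab L L₂ v i a o b D c D' c' si sa sb) {j : Fin 4} {u : V} (hu : L₂ u = 8 + j.val) :
    ∃ w, G.Adj u w ∧ L₂ w = j.val := by
  rcases h.cyc.cases j with rfl | rfl | rfl | rfl
  · obtain ⟨w, hw, hwl⟩ := h.inv.att _ u ((hL.S_i u).mp hu ▸ h.li)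
    exact ⟨w, hw, (hL.A_i w).mpr hwl⟩
  · obtain ⟨z, hz, hzc⟩ := h.side.adj
    exact ⟨z, (hL.S_a u).mp hu ▸ hzc.symm, (hL.A_a z).mpr hz⟩
  · obtain ⟨w, hw, hwl⟩ := h.inv.att _ u ((hL.S_o u).mp hu)
    exact ⟨w, hw, (hL.A_o w).mpr hwl⟩
  · obtain ⟨z, hz, hzc⟩ := h.side'.adj
    exact ⟨z, (hL.S_b u).mp hu ▸ hzc.symm, (hL.A_b z).mpr hz⟩

theorem cube_conn (h : TurnCtx G y L L₁ v i a o b D c D' c' p p' si so sa sb)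
    (hL : CubeLab L L₂ v i a o b D c D' c' si sa sb) {j : Fin 4} {u : V} (hu : L₂ u = j.val) :
    RIn G {w | L₂ w = j.val} (y j) u := by
  rcases h.cyc.cases j with rfl | rfl | rfl | rfl
  · exact (h.inv.conn _ u ((hL.A_i u).mp hu)).mono fun w hw => (hL.A_i w).mpr hw
  · exact (h.side.conn ((hL.A_a u).mp hu)).mono fun w hw => (hL.A_a w).mpr hw
  · exact (h.inv.conn _ u ((hL.A_o u).mp hu)).mono fun w hw => (hL.A_o w).mpr hw
  · exact (h.side'.conn ((hL.A_b u).mp hu)).mono fun w hw => (hL.A_b w).mpr hw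

/-- The cube has `D` and `D'` in place of `A_a` and `A_b`, with `c` and `c'` as their neighbours.
The sets `S' a`, `S' b`, `S' o` are the single vertices `sb`, `sa`, `v`, and `S' i` is the one set
that is allowed to be empty. No vertex is in a `B_j` yet. -/
theorem cubInv (ht : TriFree G) (h : TurnCtx G y L L₁ v i a o b D c D' c' p p' si so sa sb)
    (hL : CubeLab L L₂ v i a o b D c D' c' si sa sb)
    (hD : ∀ z ∈ D, ¬ G.Adj z sa) (hc : G.Adj c sa) (hD' : ∀ z ∈ D', ¬ G.Adj z sb)
    (hc' : G.Adj c' sb) : CubInv G y L₂ where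
  term j := by
    have := h.inv.term j
    rcases h.cyc.cases j with rfl | rfl | rfl | rfl
    · exact (hL.A_i _).mpr this
    · exact (hL.A_a _).mpr h.side.term
    · exact (hL.A_o _).mpr this
    · exact (hL.A_b _).mpr h.side'.term
  ne j := by
    rcases h.cyc.cases j with rfl | rfl | rfl | rfl
    · exact ⟨si, (hL.S_i _).mpr rfl⟩
    · exact ⟨c, (hL.S_a _).mpr rfl⟩
    · exact ⟨so, (hL.S_o _).mpr h.lo⟩
    · exact ⟨c', (hL.S_b _).mpr rfl⟩
  ne' := by
    have key : ∀ j : Fin 4, (∀ u, L₂ u ≠ 12 + j.val) → j = i := by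
      intro j hj
      rcases h.cyc.cases j with rfl | rfl | rfl | rfl
      · rfl
      · exact absurd ((hL.H_a _).mpr rfl) (hj sb)
      · exact absurd ((hL.H_o _).mpr rfl) (hj v)
      · exact absurd ((hL.H_b _).mpr rfl) (hj sa)
    exact fun j k hj hk => (key j hj).trans (key k hk).symm
  comp j k u w := h.cube_comp hL hc hc'
  att j u := h.cube_att hL
  low u w := h.cube_low ht hL
  opp u w := h.cube_opp hL
  nbA u w := h.cube_nbA hL hD hD'
  conn j u := h.cube_conn hL
  connC j u hu huj := by
    have hj := j.2
    have hsub : {w | L₂ w = j.val} ⊆ {w | L₂ w < 12 ∧ L₂ w % 4 = j.val} := by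
      intro w hw
      have hw' : L₂ w = j.val := hw
      exact ⟨by omega, by omega⟩
    rcases hL.only u with h1 | ⟨k, h1⟩
    · omega
    · have hk := k.2
      by_cases hlow : L₂ u = j.val
      · exact (h.cube_conn hL hlow).mono hsub
      · have h8 : L₂ u = 8 + j.val := by omega
        obtain ⟨w, hw, hwl⟩ := h.cube_att hL h8
        exact ((h.cube_conn hL hwl).mono hsub).step hw.symm ⟨hu, huj⟩
  le u := by
    rcases hL.only u with h1 | ⟨k, h1⟩
    · omega
    · have := k.2
      omega

/-- The parts `D`, `c`, `D'`, `c'` enter the good sets as whole classes, and for this they receive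
labels of their own. The vertices `si`, `so`, `sa` enter as tabulated representatives. -/
theorem exists_good (ht : TriFree G) (h : TurnCtx G y L L₁ v i a o b D c D' c' p p' si so sa sb)
    {P M : ℕ → Set V} (hsi : P (L₁ si) = {si} ∨ M (L₁ si) = {si})
    (hso : P (L₁ so) = {so} ∨ M (L₁ so) = {so}) (hsa : P (L₁ sa) = {sa} ∨ M (L₁ sa) = {sa})
    (hbad : ¬ ((∀ z ∈ D, ¬ G.Adj z sa) ∧ G.Adj c sa)) :
    ∃ Q, InFam L₁ v y P M [4, 5, 6, 7, 8, 9, 10, 11, 12] Q ∧ GoodMask G y Q := by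
  obtain ⟨v1, v2, v3, v4, v5, v6⟩ := h.cyc.vals
  have := i.2; have := a.2; have := b.2; have := o.2
  have hn := h.nums
  have e1 := h.li; have e2 := h.la; have e3 := h.lo
  have f1 : L₁ si = 4 + i.val := (h.mid_S (by omega)).trans e1
  have f2 : L₁ sa = 4 + a.val := (h.mid_S (by omega)).trans e2
  have f3 : L₁ so = 4 + o.val := (h.mid_S (by omega)).trans e3
  obtain ⟨ti, ta, t_o, tb⟩ := h.term_lab
  have hls : ∀ l ∈ [4, 5, 6, 7, 8, 9, 10, 11, 12], 4 ≤ l := by decide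
  have hmem : ∀ l, 4 ≤ l → l ≤ 12 → l ∈ [4, 5, 6, 7, 8, 9, 10, 11, 12] := by
    intro l h4 h12
    simp only [List.mem_cons, List.not_mem_nil, or_false]
    omega
  have hinj : ∀ s ∈ ({si, so, sa} : Set V), ∀ s' ∈ ({si, so, sa} : Set V), L₁ s = L₁ s' → s = s' := by
    rintro s (rfl | rfl | rfl) s' (rfl | rfl | rfl) he <;> first | rfl | omega
  have hT : ∀ F : ℕ → Prop, (∀ l, l < 8 → ¬ F l) → ∀ s ∈ ({si, so, sa} : Set V),
      L₁ s ∈ [4, 5, 6, 7, 8, 9, 10, 11, 12] ∧ ¬ F (L₁ s) ∧ (P (L₁ s) = {s} ∨ M (L₁ s) = {s}) := by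
    rintro F hF s (rfl | rfl | rfl)
    · exact ⟨hmem _ (by omega) (by omega), hF _ (by omega), hsi⟩
    · exact ⟨hmem _ (by omega) (by omega), hF _ (by omega), hso⟩
    · exact ⟨hmem _ (by omega) (by omega), hF _ (by omega), hsa⟩
  have hy : ∀ F : ℕ → Prop, F p → F p' → ∀ j, L₁ (y j) < 4 ∨ F (L₁ (y j)) := by
    intro F h1 h2 j
    rcases h.cyc.cases j with rfl | rfl | rfl | rfl
    · exact Or.inl (by omega)
    · exact Or.inr (ta ▸ h1)
    · exact Or.inl (by omega)
    · exact Or.inr (tb ▸ h2)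
  by_cases hD : ∃ z ∈ D, G.Adj z sa
  · refine ⟨_, ?_, h.good_hit ht hD⟩
    refine inFam_of_labels hls _ (fun l => l = p ∨ l = p' ∨ l = p' + 1) ?_
      (hy (fun l => l = p ∨ l = p' ∨ l = p' + 1) (Or.inl rfl) (Or.inr (Or.inl rfl)))
      (hT (fun l => l = p ∨ l = p' ∨ l = p' + 1) ?_) hinj
    · intro l hl
      exact hmem l (by omega) (by omega)
    · intro l hl
      omega
  · push Not at hD
    refine ⟨_, ?_, h.good_miss ht hD fun hc => hbad ⟨hD, hc⟩⟩
    refine inFam_of_labels hls _ (fun l => 9 ≤ l ∧ l ≤ 12) ?_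
      (hy (fun l => 9 ≤ l ∧ l ≤ 12) (by omega) (by omega))
      (hT (fun l => 9 ≤ l ∧ l ≤ 12) ?_) hinj
    · intro l hl
      exact hmem l (by omega) (by omega)
    · intro l hl
      omega

end TurnCtx

/-- A square structure that cannot grow at `v` yields a good set, or it turns into a cubic
structure. -/
theorem SqInv.turn (ht : TriFree G) (h : SqInv G y L) (hv : L v = 8) {i a o b : Fin 4}
    (hcyc : Cyc i a o b) (hT : Turn G L v i) {D D' : Set V} {c c' : V}
    (hside : Side G y L v a D c) (hside' : Side G y L v b D' c')
    (hmid : MidLab L L₁ a b D c D' c' 9 11) {P M : ℕ → Set V} (T : Tab G L₁ v P M) :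
    (∃ Q, InFam L₁ v y P M [4, 5, 6, 7, 8, 9, 10, 11, 12] Q ∧ GoodMask G y Q) ∨
    ∃ si sa sb, P (4 + i.val) = {si} ∧ M (4 + a.val) = {sa} ∧ M (4 + b.val) = {sb} ∧
      ∀ L₂, CubeLab L L₂ v i a o b D c D' c' si sa sb → CubInv G y L₂ := by
  have ho := hcyc.opp
  have hS : ∀ u, 4 ≤ L u → L₁ u = L u := by
    intro u hu
    have := a.2; have := b.2
    exact hmid.other u (by omega) (by omega)
  obtain ⟨z, hvz, hz⟩ : ∃ z, G.Adj v z ∧ L z = 4 + i.val := by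
    have := hT.some (4 + i.val) (by simp)
    simpa only [and_comm] using this
  have hno : ∀ u, G.Adj v u → L u ≠ i.val ∧ L u ≠ o.val ∧ L u ≠ 4 + o.val := by
    intro u hvu
    rw [ho]
    exact ⟨fun he => hT.none _ (by simp) u hvu he, fun he => hT.none _ (by simp) u hvu he,
      fun he => hT.none _ (by simp) u hvu he⟩
  obtain ⟨si, hsi, hsi', hsi''⟩ := T.pos hvz ((hS z (by omega)).trans hz)
  have hback : ∀ u (k : Fin 4), L₁ u = 4 + k.val → L u = 4 + k.val := by
    intro u k hu
    by_cases h4 : L u = a.val ∨ L u = b.val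
    · have := hmid.rest u h4
      have := k.2
      omega
    · push Not at h4
      rw [← hmid.other u h4.1 h4.2, hu]
  have hli := hback _ _ hsi''
  -- The vertex `v` sees `si`, which is complete to `S_a` and `S_b`. So `sa` and `sb` are found in
  -- the table of non-neighbours.
  have hanti : ∀ k : Fin 4, (k = a ∨ k = b) → ∀ u, L u = 4 + k.val → ¬ G.Adj v u := by
    rintro k (rfl | rfl) u hu hvu
    · exact ht _ _ _ hsi' (h.adj hcyc hli hu) hvu
    · exact ht _ _ _ hsi' (h.adj hcyc.rot.rot.rot hu hli).symm hvu
  obtain ⟨za, hza⟩ := h.ne a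
  obtain ⟨zb, hzb⟩ := h.ne b
  obtain ⟨zo, hzo⟩ := h.ne o
  obtain ⟨sa, hsa, -, hsa''⟩ := T.neg (hanti a (Or.inl rfl) za hza) ((hS za (by omega)).trans hza)
  obtain ⟨sb, hsb, -, hsb''⟩ := T.neg (hanti b (Or.inr rfl) zb hzb) ((hS zb (by omega)).trans hzb)
  obtain ⟨so, hso, hso'⟩ := T.pick zo
  have hso'' : L₁ so = 4 + o.val := hso.trans ((hS zo (by omega)).trans hzo)
  have ctx : TurnCtx G y L L₁ v i a o b D c D' c' 9 11 si so sa sb :=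
    ⟨h, hv, hcyc, hside, hside', hmid, Or.inl ⟨rfl, rfl⟩, hli, hback _ _ hso'', hback _ _ hsa'',
      hback _ _ hsb'', hsi', hno⟩
  -- The cube needs that `D` avoids `sa` and `c` sees it, and likewise on the other side. Each
  -- failure produces a good set, on the second side by reflection.
  by_cases h1 : (∀ z ∈ D, ¬ G.Adj z sa) ∧ G.Adj c sa
  · by_cases h2 : (∀ z ∈ D', ¬ G.Adj z sb) ∧ G.Adj c' sb
    · exact Or.inr ⟨si, sa, sb, hsi, hsa, hsb, fun L₂ hL => ctx.cubInv ht hL h1.1 h1.2 h2.1 h2.2⟩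
    · exact Or.inl (ctx.symm.exists_good ht (Or.inl (hsi''.symm ▸ hsi)) hso'
        (Or.inr (hsb''.symm ▸ hsb)) h2)
  · exact Or.inl (ctx.exists_good ht (Or.inl (hsi''.symm ▸ hsi)) hso'
      (Or.inr (hsa''.symm ▸ hsa)) h1)

/-- The square structure around a cycle of length four. -/
theorem sqInv_of_square {x : Fin 4 → V} {H : Set V} {c : ℕ → V} (hc : CycIn G H 4 c)
    {π : Equiv.Perm (Fin 4)}
    (hπ : ∀ k : Fin 4, (∃ z, RIn G (H \ Set.range c) (x (π k)) z ∧ G.Adj z (c k)) ∧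
      ∀ z k', RIn G (H \ Set.range c) (x (π k)) z → G.Adj z (c k') → c k' = c k)
    (hA : ∀ (k : Fin 4) u, L u = k.val ↔ RIn G (H \ Set.range c) (x (π k)) u)
    (hS : ∀ (k : Fin 4) u, L u = 4 + k.val ↔ u = c k)
    (hle : ∀ u, L u ≤ 8) :
    SqInv G (x ∘ π) L where
  term k := by
    obtain ⟨z, hz, -⟩ := (hπ k).1
    exact (hA k _).mpr (RIn.refl hz.left)
  ne k := ⟨c k, (hS k _).mpr rfl⟩
  comp k u w hu hw := by
    rw [(hS k u).mp hu, (hS _ w).mp hw]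
    have := hc.adj k
    -- At `k = 3` the index wraps around in `Fin 4` but not in `ℕ`, and periodicity makes up for it.
    have hp : c (k + 1 : Fin 4) = c (k.val + 1) := by
      have h4 := hc.per
      fin_cases k
      · rfl
      · rfl
      · rfl
      · exact (h4 0).symm
    rw [hp]
    exact this
  att k u hu := by
    obtain ⟨z, hz, hzc⟩ := (hπ k).1
    exact ⟨z, (hS k u).mp hu ▸ hzc.symm, (hA k z).mpr hz⟩
  nbA k u w hu huw := by
    have hu' := (hA k u).mp hu
    by_cases hr : w ∈ Set.range c
    · obtain ⟨m, rfl⟩ := hr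
      exact Or.inr (Or.inl ((hS k _).mpr ((hπ k).2 u m hu' huw)))
    · by_cases hH : w ∈ H
      · exact Or.inl ((hA k w).mpr (hu'.step huw ⟨hH, hr⟩))
      · refine Or.inr (Or.inr ?_)
        have h8 := hle w
        by_contra hne
        by_cases h4 : L w < 4
        · exact hH ((hA ⟨L w, h4⟩ w).mp rfl).right.1
        · refine hr ⟨L w - 4, ?_⟩
          exact ((hS ⟨L w - 4, by omega⟩ w).mp (by simp only; omega)).symm
  conn k u hu := by
    have hu' := (hA k u).mp hu
    refine RIn.of_forall hu' fun z hz => (hA k z).mpr hz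
  le := hle

end Cube

/-! ## Reasoning about random access machine programs -/

namespace RAM

/-- Executions without a bound on the values. -/
inductive Run : Prog → State → ℕ → State → Prop where
  | skip (σ : State) : Run .skip σ 1 σ
  | assign (σ : State) (r : ℕ) (e : Expr) : Run (.assign r e) σ (e.cost + 1) (σ.setReg r (e.eval σ))
  | store (σ : State) (a : ℕ) (i e : Expr) :
      Run (.store a i e) σ (i.cost + e.cost + 1) (σ.setArr a (i.eval σ) (e.eval σ))
  | seq {σ τ υ : State} {p q : Prog} {s t : ℕ} (hp : Run p σ s τ) (hq : Run q τ t υ) :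
      Run (.seq p q) σ (s + t) υ
  | ite_true {σ τ : State} {e : Expr} {p q : Prog} {t : ℕ} (h : e.eval σ ≠ 0) (hp : Run p σ t τ) :
      Run (.ite e p q) σ (e.cost + 1 + t) τ
  | ite_false {σ τ : State} {e : Expr} {p q : Prog} {t : ℕ} (h : e.eval σ = 0) (hq : Run q σ t τ) :
      Run (.ite e p q) σ (e.cost + 1 + t) τ
  | loop_true {σ τ υ : State} {e : Expr} {p : Prog} {s t : ℕ} (h : e.eval σ ≠ 0)
      (hp : Run p σ s τ) (hl : Run (.loop e p) τ t υ) :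
      Run (.loop e p) σ (e.cost + 1 + s + t) υ
  | loop_false {σ : State} {e : Expr} {p : Prog} (h : e.eval σ = 0) :
      Run (.loop e p) σ (e.cost + 1) σ

/-! ### Tame programs handle small values only -/

/-- All constants are at most `20`, and only constants are added. -/
def Expr.tame : Expr → Bool
  | .const c => c ≤ 20
  | .reg _ => true
  | .get _ i => i.tame
  | .add e (.const c) => e.tame && c ≤ 20
  | .add _ _ => false
  | .sub e f => e.tame && f.tame
  | .lt e f => e.tame && f.tame
  | .eq e f => e.tame && f.tame

def Prog.tame : Prog → Bool
  | .skip => true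
  | .assign _ e => e.tame
  | .store _ i e => i.tame && e.tame
  | .seq p q => p.tame && q.tame
  | .ite e p q => e.tame && p.tame && q.tame
  | .loop e p => e.tame && p.tame

/-- All values in the memory are at most `B`. -/
structure State.Le (σ : State) (B : ℕ) : Prop where
  reg : ∀ r, σ.reg r ≤ B
  arr : ∀ a i, σ.arr a i ≤ B

theorem State.Le.mono {σ : State} {B B' : ℕ} (h : σ.Le B) (hB : B ≤ B') : σ.Le B' :=
  ⟨fun r => (h.reg r).trans hB, fun a i => (h.arr a i).trans hB⟩

theorem State.Le.setReg {σ : State} {B r v : ℕ} (h : σ.Le B) (hv : v ≤ B) : (σ.setReg r v).Le B where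
  reg r' := by
    by_cases hr : r' = r
    · subst hr; simpa [State.setReg] using hv
    · simpa [State.setReg, Function.update_of_ne hr] using h.reg r'
  arr := h.arr

theorem State.Le.setArr {σ : State} {B a i v : ℕ} (h : σ.Le B) (hv : v ≤ B) :
    (σ.setArr a i v).Le B where
  reg := h.reg
  arr a' i' := by
    by_cases ha : a' = a
    · subst ha
      by_cases hi : i' = i
      · subst hi; simpa [State.setArr] using hv
      · simpa [State.setArr, Function.update_of_ne hi] using h.arr a' i'
    · simpa [State.setArr, Function.update_of_ne ha] using h.arr a' i'

/-- Only adding a constant can exceed the values at hand, and it does so by at most `20`, for an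
operation that costs at least one step. -/
theorem Expr.fits {σ : State} {B W : ℕ} (hσ : σ.Le B) (hB : 20 ≤ B) : ∀ (e : Expr), e.tame →
    B + 20 * e.cost ≤ W → e.Fits W σ ∧ e.eval σ ≤ B + 20 * e.cost
  | .const c, h, hW => by
      simp only [Expr.tame, decide_eq_true_eq] at h
      simp only [Expr.Fits, Expr.eval, Expr.cost] at hW ⊢
      omega
  | .reg r, _, hW => by
      have := hσ.reg r
      simp only [Expr.Fits, Expr.eval, Expr.cost] at hW ⊢
      omega
  | .get a i, h, hW => by
      simp only [Expr.cost] at hW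
      have := Expr.fits (W := W) hσ hB i h (by omega)
      have h2 := hσ.arr a (i.eval σ)
      simp only [Expr.Fits, Expr.eval, Expr.cost]
      exact ⟨⟨this.1, by omega⟩, by omega⟩
  | .add e (.const c), h, hW => by
      simp only [Expr.tame, Bool.and_eq_true, decide_eq_true_eq] at h
      simp only [Expr.cost] at hW
      have := Expr.fits (W := W) hσ hB e h.1 (by omega)
      simp only [Expr.Fits, Expr.eval, Expr.cost]
      exact ⟨⟨this.1, by omega, by omega⟩, by omega⟩
  | .sub e f, h, hW => by
      simp only [Expr.tame, Bool.and_eq_true] at h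
      simp only [Expr.cost] at hW
      have h1 := Expr.fits (W := W) hσ hB e h.1 (by omega)
      have h2 := Expr.fits (W := W) hσ hB f h.2 (by omega)
      simp only [Expr.Fits, Expr.eval, Expr.cost]
      exact ⟨⟨h1.1, h2.1⟩, by omega⟩
  | .lt e f, h, hW => by
      simp only [Expr.tame, Bool.and_eq_true] at h
      simp only [Expr.cost] at hW
      have h1 := Expr.fits (W := W) hσ hB e h.1 (by omega)
      have h2 := Expr.fits (W := W) hσ hB f h.2 (by omega)
      simp only [Expr.Fits, Expr.eval, Expr.cost]
      exact ⟨⟨h1.1, h2.1, by omega⟩, by split_ifs <;> omega⟩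
  | .eq e f, h, hW => by
      simp only [Expr.tame, Bool.and_eq_true] at h
      simp only [Expr.cost] at hW
      have h1 := Expr.fits (W := W) hσ hB e h.1 (by omega)
      have h2 := Expr.fits (W := W) hσ hB f h.2 (by omega)
      simp only [Expr.Fits, Expr.eval, Expr.cost]
      exact ⟨⟨h1.1, h2.1, by omega⟩, by split_ifs <;> omega⟩
  | .add _ (.reg _), h, _ => by simp [Expr.tame] at h
  | .add _ (.get _ _), h, _ => by simp [Expr.tame] at h
  | .add _ (.add _ _), h, _ => by simp [Expr.tame] at h
  | .add _ (.sub _ _), h, _ => by simp [Expr.tame] at h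
  | .add _ (.lt _ _), h, _ => by simp [Expr.tame] at h
  | .add _ (.eq _ _), h, _ => by simp [Expr.tame] at h

/-- In `t` steps a tame program lifts the largest value from `B` to at most `B + 20 * t`. So running
times can be analysed without a word bound, and the bound on the values follows from the bound on
the time. -/
theorem Run.exec {p : Prog} {σ τ : State} {t : ℕ} (h : Run p σ t τ) : ∀ {B W : ℕ}, p.tame → 20 ≤ B →
    σ.Le B → B + 20 * t ≤ W → Exec W p σ t τ ∧ τ.Le (B + 20 * t) := by
  induction h with
  | skip σ => exact fun _ _ hσ _ => ⟨.skip σ, hσ.mono (by omega)⟩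
  | assign σ r e =>
    intro B W hp hB hσ hW
    have h1 := Expr.fits (W := W) hσ hB e hp (by omega)
    exact ⟨.assign σ r e h1.1, (hσ.mono (by omega)).setReg (by omega)⟩
  | store σ a i e =>
    intro B W hp hB hσ hW
    simp only [Prog.tame, Bool.and_eq_true] at hp
    have h1 := Expr.fits (W := W) hσ hB i hp.1 (by omega)
    have h2 := Expr.fits (W := W) hσ hB e hp.2 (by omega)
    exact ⟨.store σ a i e h1.1 h2.1, (hσ.mono (by omega)).setArr (by omega)⟩
  | seq hp hq ihp ihq =>
    intro B W hp hB hσ hW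
    simp only [Prog.tame, Bool.and_eq_true] at hp
    have h1 := ihp (W := W) hp.1 hB hσ (by omega)
    have h2 := ihq (W := W) hp.2 (by omega) h1.2 (by omega)
    exact ⟨.seq _ _ _ _ _ _ _ h1.1 h2.1, h2.2.mono (by omega)⟩
  | @ite_true σ τ e p q t h hr ih =>
    intro B W hp hB hσ hW
    simp only [Prog.tame, Bool.and_eq_true] at hp
    have h1 := Expr.fits (W := W) hσ hB e hp.1.1 (by omega)
    have h2 := ih (W := W) hp.1.2 hB hσ (by omega)
    exact ⟨.ite_true _ _ _ _ _ _ h1.1 h h2.1, h2.2.mono (by omega)⟩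
  | @ite_false σ τ e p q t h hr ih =>
    intro B W hp hB hσ hW
    simp only [Prog.tame, Bool.and_eq_true] at hp
    have h1 := Expr.fits (W := W) hσ hB e hp.1.1 (by omega)
    have h2 := ih (W := W) hp.2 hB hσ (by omega)
    exact ⟨.ite_false _ _ _ _ _ _ h1.1 h h2.1, h2.2.mono (by omega)⟩
  | @loop_true σ τ υ e p s t h hr hl ihp ihl =>
    intro B W hp hB hσ hW
    have hp' := hp
    simp only [Prog.tame, Bool.and_eq_true] at hp
    have h1 := Expr.fits (W := W) hσ hB e hp.1 (by omega)
    have h2 := ihp (W := W) hp.2 hB hσ (by omega)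
    have h3 := ihl (W := W) hp' (by omega) h2.2 (by omega)
    exact ⟨.loop_true _ _ _ _ _ _ _ h1.1 h h2.1 h3.1, h3.2.mono (by omega)⟩
  | @loop_false σ e p h =>
    intro B W hp hB hσ hW
    simp only [Prog.tame, Bool.and_eq_true] at hp
    have h1 := Expr.fits (W := W) hσ hB e hp.1 (by omega)
    exact ⟨.loop_false _ _ _ h1.1 h, hσ.mono (by omega)⟩

/-! ### What programs write and expressions read -/

/-- `p` writes the register `r`. -/
def Prog.wr (r : ℕ) : Prog → Bool
  | .skip => false
  | .assign r' _ => r' == r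
  | .store _ _ _ => false
  | .seq p q => p.wr r || q.wr r
  | .ite _ p q => p.wr r || q.wr r
  | .loop _ p => p.wr r

/-- `p` writes the array `a`. -/
def Prog.wa (a : ℕ) : Prog → Bool
  | .skip => false
  | .assign _ _ => false
  | .store a' _ _ => a' == a
  | .seq p q => p.wa a || q.wa a
  | .ite _ p q => p.wa a || q.wa a
  | .loop _ p => p.wa a

/-- `e` reads the register `r`. -/
def Expr.rr (r : ℕ) : Expr → Bool
  | .const _ => false
  | .reg r' => r' == r
  | .get _ i => i.rr r
  | .add e f => e.rr r || f.rr r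
  | .sub e f => e.rr r || f.rr r
  | .lt e f => e.rr r || f.rr r
  | .eq e f => e.rr r || f.rr r

/-- `e` reads the array `a`. -/
def Expr.ra (a : ℕ) : Expr → Bool
  | .const _ => false
  | .reg _ => false
  | .get a' i => a' == a || i.ra a
  | .add e f => e.ra a || f.ra a
  | .sub e f => e.ra a || f.ra a
  | .lt e f => e.ra a || f.ra a
  | .eq e f => e.ra a || f.ra a

theorem Expr.eval_congr {σ τ : State} : ∀ (e : Expr), (∀ r, e.rr r → σ.reg r = τ.reg r) →
    (∀ a, e.ra a → σ.arr a = τ.arr a) → e.eval σ = e.eval τ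
  | .const _, _, _ => rfl
  | .reg r, hr, _ => hr r (by simp [Expr.rr])
  | .get a i, hr, ha => by
      simp only [Expr.eval]
      rw [Expr.eval_congr i hr fun b hb => ha b (by simp [Expr.ra, hb]), ha a (by simp [Expr.ra])]
  | .add e f, hr, ha => by
      simp only [Expr.eval]
      rw [Expr.eval_congr e (fun r h => hr r (by simp [Expr.rr, h]))
        (fun r h => ha r (by simp [Expr.ra, h])), Expr.eval_congr f
        (fun r h => hr r (by simp [Expr.rr, h])) (fun r h => ha r (by simp [Expr.ra, h]))]
  | .sub e f, hr, ha => by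
      simp only [Expr.eval]
      rw [Expr.eval_congr e (fun r h => hr r (by simp [Expr.rr, h]))
        (fun r h => ha r (by simp [Expr.ra, h])), Expr.eval_congr f
        (fun r h => hr r (by simp [Expr.rr, h])) (fun r h => ha r (by simp [Expr.ra, h]))]
  | .lt e f, hr, ha => by
      simp only [Expr.eval]
      rw [Expr.eval_congr e (fun r h => hr r (by simp [Expr.rr, h]))
        (fun r h => ha r (by simp [Expr.ra, h])), Expr.eval_congr f
        (fun r h => hr r (by simp [Expr.rr, h])) (fun r h => ha r (by simp [Expr.ra, h]))]
  | .eq e f, hr, ha => by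
      simp only [Expr.eval]
      rw [Expr.eval_congr e (fun r h => hr r (by simp [Expr.rr, h]))
        (fun r h => ha r (by simp [Expr.ra, h])), Expr.eval_congr f
        (fun r h => hr r (by simp [Expr.rr, h])) (fun r h => ha r (by simp [Expr.ra, h]))]

/-- The states agree on everything that `p` does not write. -/
structure Fr (p : Prog) (σ τ : State) : Prop where
  reg : ∀ r, p.wr r = false → τ.reg r = σ.reg r
  arr : ∀ a, p.wa a = false → τ.arr a = σ.arr a

theorem Fr.refl (p : Prog) (σ : State) : Fr p σ σ := ⟨fun _ _ => rfl, fun _ _ => rfl⟩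

theorem Fr.trans {p : Prog} {σ τ υ : State} (h : Fr p σ τ) (h' : Fr p τ υ) : Fr p σ υ :=
  ⟨fun r hr => (h'.reg r hr).trans (h.reg r hr), fun a ha => (h'.arr a ha).trans (h.arr a ha)⟩

theorem Fr.mono {p q : Prog} {σ τ : State} (h : Fr p σ τ) (hr : ∀ r, q.wr r = false → p.wr r = false)
    (ha : ∀ a, q.wa a = false → p.wa a = false) : Fr q σ τ :=
  ⟨fun r h' => h.reg r (hr r h'), fun a h' => h.arr a (ha a h')⟩

theorem Fr.seq_left {p q : Prog} {σ τ : State} (h : Fr p σ τ) : Fr (.seq p q) σ τ :=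
  h.mono (fun r hr => by simp only [Prog.wr, Bool.or_eq_false_iff] at hr; exact hr.1)
    (fun r hr => by simp only [Prog.wa, Bool.or_eq_false_iff] at hr; exact hr.1)

theorem Fr.seq_right {p q : Prog} {σ τ : State} (h : Fr q σ τ) : Fr (.seq p q) σ τ :=
  h.mono (fun r hr => by simp only [Prog.wr, Bool.or_eq_false_iff] at hr; exact hr.2)
    (fun r hr => by simp only [Prog.wa, Bool.or_eq_false_iff] at hr; exact hr.2)

/-- Whether a program writes a register or an array is a computable property of its text. Facts
about the rest of the memory thus pass through a program by `rfl` or `decide`. -/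
theorem Run.frame {p : Prog} {σ τ : State} {t : ℕ} (h : Run p σ t τ) : Fr p σ τ := by
  induction h with
  | skip σ => exact Fr.refl _ _
  | assign σ r e =>
    refine ⟨fun r' hr => ?_, fun _ _ => rfl⟩
    simp only [Prog.wr, beq_eq_false_iff_ne] at hr
    exact Function.update_of_ne hr.symm _ _
  | store σ a i e =>
    refine ⟨fun _ _ => rfl, fun a' ha => ?_⟩
    simp only [Prog.wa, beq_eq_false_iff_ne] at ha
    exact Function.update_of_ne ha.symm _ _
  | seq hp hq ihp ihq => exact ihp.seq_left.trans ihq.seq_right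
  | ite_true h hp ih =>
    exact ih.mono (fun r hr => by simp only [Prog.wr, Bool.or_eq_false_iff] at hr; exact hr.1)
      (fun r hr => by simp only [Prog.wa, Bool.or_eq_false_iff] at hr; exact hr.1)
  | ite_false h hp ih =>
    exact ih.mono (fun r hr => by simp only [Prog.wr, Bool.or_eq_false_iff] at hr; exact hr.2)
      (fun r hr => by simp only [Prog.wa, Bool.or_eq_false_iff] at hr; exact hr.2)
  | loop_true h hp hl ihp ihl => exact Fr.trans ⟨ihp.reg, ihp.arr⟩ ihl
  | loop_false h => exact Fr.refl _ _

/-! ### Total correctness with a time bound -/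

/-- Started in `σ`, the program halts after at most `T` steps in a state with `Q`. -/
def Tri (p : Prog) (σ : State) (T : ℕ) (Q : State → Prop) : Prop :=
  ∃ t τ, Run p σ t τ ∧ t ≤ T ∧ Q τ

theorem Tri.mono {p : Prog} {σ : State} {T T' : ℕ} {Q Q' : State → Prop} (h : Tri p σ T Q)
    (hT : T ≤ T') (hQ : ∀ τ, Fr p σ τ → Q τ → Q' τ) : Tri p σ T' Q' := by
  obtain ⟨t, τ, hr, ht, hq⟩ := h
  exact ⟨t, τ, hr, ht.trans hT, hQ τ hr.frame hq⟩

theorem Tri.skip {σ : State} {Q : State → Prop} (h : Q σ) : Tri .skip σ 1 Q :=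
  ⟨1, σ, .skip σ, le_rfl, h⟩

theorem Tri.assign {σ : State} {r : ℕ} {e : Expr} {Q : State → Prop} (h : Q (σ.setReg r (e.eval σ))) :
    Tri (.assign r e) σ (e.cost + 1) Q :=
  ⟨_, _, .assign σ r e, le_rfl, h⟩

theorem Tri.seq {p q : Prog} {σ : State} {S T U : ℕ} {R Q : State → Prop} (hp : Tri p σ S R)
    (hq : ∀ τ, Fr p σ τ → R τ → Tri q τ T Q) (hU : S + T ≤ U) : Tri (.seq p q) σ U Q := by
  obtain ⟨s, τ, hr, hs, hR⟩ := hp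
  obtain ⟨t, υ, hr', ht, hQ⟩ := hq τ hr.frame hR
  exact ⟨s + t, υ, .seq hr hr', by omega, hQ⟩

theorem Tri.ite {e : Expr} {p q : Prog} {σ : State} {T U : ℕ} {Q : State → Prop}
    (hp : e.eval σ ≠ 0 → Tri p σ T Q) (hq : e.eval σ = 0 → Tri q σ T Q) (hU : e.cost + 1 + T ≤ U) :
    Tri (.ite e p q) σ U Q := by
  by_cases h : e.eval σ = 0
  · obtain ⟨t, τ, hr, ht, hQ⟩ := hq h
    exact ⟨_, τ, .ite_false h hr, by omega, hQ⟩
  · obtain ⟨t, τ, hr, ht, hQ⟩ := hp h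
    exact ⟨_, τ, .ite_true h hr, by omega, hQ⟩

/-- Loops with a measure that decreases. -/
theorem Tri.loop {e : Expr} {p : Prog} {σ : State} {T : ℕ} (I : State → Prop) (μ : State → ℕ)
    (hI : I σ) (hstep : ∀ ρ, Fr (.loop e p) σ ρ → I ρ → e.eval ρ ≠ 0 →
      Tri p ρ T fun τ => I τ ∧ μ τ < μ ρ) :
    Tri (.loop e p) σ ((e.cost + 1 + T) * (μ σ + 1)) fun τ => I τ ∧ e.eval τ = 0 := by
  -- Induction on an upper bound `m` of the measure. The time bound is monotone in `m`, so the
  -- measure need not drop by exactly one.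
  suffices H : ∀ m ρ, Fr (.loop e p) σ ρ → I ρ → μ ρ ≤ m →
      Tri (.loop e p) ρ ((e.cost + 1 + T) * (m + 1)) fun τ => I τ ∧ e.eval τ = 0 from
    H _ σ (Fr.refl _ _) hI le_rfl
  intro m
  induction m with
  | zero =>
    intro ρ hf hρ hm
    by_cases h : e.eval ρ = 0
    · exact ⟨_, ρ, .loop_false h, by omega, hρ, h⟩
    · obtain ⟨t, τ, -, -, -, hlt⟩ := hstep ρ hf hρ h
      omega
  | succ m ih =>
    intro ρ hf hρ hm
    by_cases h : e.eval ρ = 0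
    · exact ⟨_, ρ, .loop_false h, by nlinarith, hρ, h⟩
    · obtain ⟨t, τ, hr, ht, hI', hlt⟩ := hstep ρ hf hρ h
      have hf' : Fr (.loop e p) ρ τ := hr.frame.mono (fun _ h => h) (fun _ h => h)
      obtain ⟨t', υ, hr', ht', hQ⟩ := ih τ (hf.trans hf') hI' (by omega)
      refine ⟨_, υ, .loop_true h hr hr', ?_, hQ⟩
      have : (e.cost + 1 + T) * (m + 1 + 1) = (e.cost + 1 + T) * (m + 1) + (e.cost + 1 + T) := by ring
      omega

@[simp] theorem setReg_reg (σ : State) (r v r' : ℕ) :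
    (σ.setReg r v).reg r' = if r' = r then v else σ.reg r' := by
  simp [State.setReg, Function.update_apply]

@[simp] theorem setReg_arr (σ : State) (r v : ℕ) : (σ.setReg r v).arr = σ.arr := rfl

@[simp] theorem setArr_reg (σ : State) (a i v : ℕ) : (σ.setArr a i v).reg = σ.reg := rfl

theorem setArr_arr (σ : State) (a i v a' : ℕ) :
    (σ.setArr a i v).arr a' = if a' = a then Function.update (σ.arr a) i v else σ.arr a' := by
  by_cases h : a' = a
  · subst h; simp [State.setArr]
  · simp [State.setArr, h]

@[simp] theorem setArr_get (σ : State) (a i v a' j : ℕ) :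
    (σ.setArr a i v).arr a' j = if a' = a ∧ j = i then v else σ.arr a' j := by
  rw [setArr_arr]
  by_cases h : a' = a
  · subst h; simp [Function.update_apply]
  · simp [h]

/-- Straight-line programs: the result. -/
def Prog.den : Prog → State → State
  | .skip, σ => σ
  | .assign r e, σ => σ.setReg r (e.eval σ)
  | .store a i e, σ => σ.setArr a (i.eval σ) (e.eval σ)
  | .seq p q, σ => q.den (p.den σ)
  | .ite e p q, σ => if e.eval σ = 0 then q.den σ else p.den σ
  | .loop _ _, σ => σ

def Prog.flat : Prog → Bool
  | .seq p q => p.flat && q.flat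
  | .ite _ p q => p.flat && q.flat
  | .loop _ _ => false
  | _ => true

/-- Straight-line programs: a bound for the time. -/
def Prog.mx : Prog → ℕ
  | .skip => 1
  | .assign _ e => e.cost + 1
  | .store _ i e => i.cost + e.cost + 1
  | .seq p q => p.mx + q.mx
  | .ite e p q => e.cost + 1 + (p.mx + q.mx)
  | .loop _ _ => 0

/-- Loop-free programs are verified by computing their result with `den`. The bound `mx` adds up
both branches of a test, which is crude but sufficient. -/
theorem Tri.flat : ∀ (p : Prog) {σ : State} {T : ℕ} {Q : State → Prop}, p.flat → p.mx ≤ T →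
    Q (p.den σ) → Tri p σ T Q
  | .skip, σ, T, Q, _, hT, h => ⟨_, _, .skip σ, hT, h⟩
  | .assign r e, σ, T, Q, _, hT, h => ⟨_, _, .assign σ r e, hT, h⟩
  | .store a i e, σ, T, Q, _, hT, h => ⟨_, _, .store σ a i e, hT, h⟩
  | .seq p q, σ, T, Q, hf, hT, h => by
      simp only [Prog.flat, Bool.and_eq_true] at hf
      exact Tri.seq (Tri.flat p (Q := fun τ => τ = p.den σ) hf.1 le_rfl rfl)
        (fun τ _ hτ => Tri.flat q hf.2 le_rfl (by rw [hτ]; exact h)) hT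
  | .ite e p q, σ, T, Q, hf, hT, h => by
      simp only [Prog.flat, Bool.and_eq_true] at hf
      simp only [Prog.mx] at hT
      simp only [Prog.den] at h
      refine Tri.ite (T := p.mx + q.mx) (fun he => Tri.flat p hf.1 (by omega) ?_)
        (fun he => Tri.flat q hf.2 (by omega) ?_) hT
      · rwa [if_neg he] at h
      · rwa [if_pos he] at h
  | .loop _ _, σ, T, Q, hf, _, _ => by simp [Prog.flat] at hf

/-! ### Counting loops -/

/-- Run `p` with register `r` counting up to the value of register `rb`. -/
def forR (r rb : ℕ) (p : Prog) : Prog :=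
  .seq (.assign r (.const 0)) (.loop (.lt (.reg r) (.reg rb))
    (.seq p (.assign r (.add (.reg r) (.const 1)))))

theorem forR_wr (r rb : ℕ) (p : Prog) (s : ℕ) :
    (forR r rb p).wr s = (r == s || (p.wr s || r == s)) := rfl

theorem forR_wa (r rb : ℕ) (p : Prog) (a : ℕ) : (forR r rb p).wa a = p.wa a := by
  simp [forR, Prog.wa]

/-- The invariant `I i` refers to the state in which the counter already holds `i`. For this reason
the step has to establish it after the counter has been set to `i + 1`. -/
theorem Tri.forR {r rb : ℕ} {p : Prog} {σ : State} {T N : ℕ} (I : ℕ → State → Prop)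
    (hN : σ.reg rb = N) (hrb : r ≠ rb) (hr : p.wr r = false) (hrb' : p.wr rb = false)
    (h0 : I 0 (σ.setReg r 0))
    (hstep : ∀ i < N, ∀ ρ, Fr (forR r rb p) σ ρ → ρ.reg r = i → I i ρ →
      Tri p ρ T fun τ => I (i + 1) (τ.setReg r (i + 1))) :
    Tri (forR r rb p) σ ((T + 8) * (N + 1) + 2) fun τ => I N τ ∧ τ.reg r = N := by
  have hkeep : (RAM.forR r rb p).wr rb = false := by
    rw [forR_wr, hrb']; simpa using hrb
  have hN0 : ∀ ρ, Fr (RAM.forR r rb p) σ ρ → ρ.reg rb = N := fun ρ h => (h.reg rb hkeep).trans hN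
  have hf0 : Fr (RAM.forR r rb p) σ (σ.setReg r 0) :=
    (Run.assign σ r (.const 0)).frame.seq_left
  refine Tri.seq (R := fun τ => τ = σ.setReg r 0) (Tri.assign rfl) ?_ (S := 2)
    (T := (T + 8) * (N + 1)) (by omega)
  rintro τ - rfl
  -- A round costs `T` for the body, `4` for the increment and `4` for the test. The final `+ 2`
  -- pays for setting the counter to zero.
  have hmain := Tri.loop (e := .lt (.reg r) (.reg rb))
    (p := .seq p (.assign r (.add (.reg r) (.const 1)))) (σ := σ.setReg r 0) (T := T + 4)
    (fun ρ => I (ρ.reg r) ρ ∧ ρ.reg r ≤ N) (fun ρ => N - ρ.reg r) (by simpa using h0) ?_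
  · refine hmain.mono ?_ ?_
    · have : (σ.setReg r 0).reg r = 0 := by simp
      simp only [Expr.cost, this, Nat.sub_zero]
      exact Nat.mul_le_mul_right _ (by omega)
    · rintro τ hf ⟨⟨h1, h2⟩, h3⟩
      have hn := hN0 τ (hf0.trans hf.seq_right)
      simp only [Expr.eval, hn, ite_eq_right_iff, one_ne_zero, imp_false] at h3
      have : τ.reg r = N := by omega
      rw [this] at h1
      exact ⟨h1, this⟩
  · rintro ρ hf ⟨h1, h2⟩ h3
    have hf' : Fr (RAM.forR r rb p) σ ρ := hf0.trans hf.seq_right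
    have hn := hN0 ρ hf'
    simp only [Expr.eval, hn, ne_eq, ite_eq_right_iff, one_ne_zero, imp_false, not_not] at h3
    refine Tri.seq (hstep (ρ.reg r) h3 ρ hf' rfl h1) (fun τ hτ hI => Tri.assign ?_) (by simp [Expr.cost])
    have := hτ.reg r hr
    simp only [Expr.eval, setReg_reg, if_true, this]
    exact ⟨⟨hI, by omega⟩, by omega⟩

/-! ### Truth values -/

/-- The value of the test `e` is true. -/
def Expr.Holds (e : Expr) (σ : State) : Prop := e.eval σ ≠ 0

def Expr.and (e f : Expr) : Expr := .lt (.eq e (.const 0)) (.lt (.const 0) f)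

def Expr.not (e : Expr) : Expr := .eq e (.const 0)

def Expr.or (e f : Expr) : Expr := (e.not.and f.not).not

@[simp] theorem Expr.holds_lt {e f : Expr} {σ : State} : (Expr.lt e f).Holds σ ↔ e.eval σ < f.eval σ := by
  simp [Expr.Holds, Expr.eval]

@[simp] theorem Expr.holds_eq {e f : Expr} {σ : State} : (Expr.eq e f).Holds σ ↔ e.eval σ = f.eval σ := by
  simp [Expr.Holds, Expr.eval]

@[simp] theorem Expr.holds_get {a : ℕ} {i : Expr} {σ : State} :
    (Expr.get a i).Holds σ ↔ σ.arr a (i.eval σ) ≠ 0 := Iff.rfl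

@[simp] theorem Expr.holds_reg {r : ℕ} {σ : State} : (Expr.reg r).Holds σ ↔ σ.reg r ≠ 0 := Iff.rfl

@[simp] theorem Expr.holds_not {e : Expr} {σ : State} : e.not.Holds σ ↔ ¬ e.Holds σ := by
  by_cases h : e.eval σ = 0 <;> simp [Expr.Holds, Expr.not, Expr.eval, h]

@[simp] theorem Expr.holds_and {e f : Expr} {σ : State} : (e.and f).Holds σ ↔ e.Holds σ ∧ f.Holds σ := by
  simp only [Expr.Holds, Expr.and, Expr.eval]
  by_cases h1 : e.eval σ = 0 <;> by_cases h2 : f.eval σ = 0 <;>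
    simp [h1, h2, Nat.pos_iff_ne_zero]

@[simp] theorem Expr.holds_or {e f : Expr} {σ : State} : (e.or f).Holds σ ↔ e.Holds σ ∨ f.Holds σ := by
  simp only [Expr.or, Expr.holds_not, Expr.holds_and]
  tauto

theorem Tri.cond {e : Expr} {p q : Prog} {σ : State} {T U : ℕ} {Q : State → Prop}
    (hp : e.Holds σ → Tri p σ T Q) (hq : ¬ e.Holds σ → Tri q σ T Q) (hU : e.cost + 1 + T ≤ U) :
    Tri (.ite e p q) σ U Q :=
  Tri.ite hp (fun h => hq fun h' => h' h) hU

theorem Expr.holds_congr {σ τ : State} (e : Expr) (hr : ∀ r, e.rr r → σ.reg r = τ.reg r)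
    (ha : ∀ a, e.ra a → σ.arr a = τ.arr a) : e.Holds σ ↔ e.Holds τ := by
  rw [Expr.Holds, Expr.Holds, Expr.eval_congr e hr ha]

/-! ### Filling arrays and searching -/

/-- For all values of register `r` below that of `rb`: if `c` holds, store `e` at `i` in `a`. -/
def scatter (r rb a : ℕ) (c i e : Expr) : Prog := forR r rb (.ite c (.store a i e) .skip)

/-- Several values of the counter may write to the same cell. It is enough to know that the content
comes from one of them, or that the cell is untouched because none of them writes there. As `c`, `i`
and `e` do not read `a`, they can be evaluated in the initial state. -/
theorem Tri.scatter {r rb a : ℕ} {c i e : Expr} {σ : State} {N T : ℕ} (hN : σ.reg rb = N)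
    (hrb : r ≠ rb) (hc : c.ra a = false) (hi : i.ra a = false) (he : e.ra a = false)
    (hT : (c.cost + i.cost + e.cost + 11) * (N + 1) + 2 ≤ T) :
    Tri (scatter r rb a c i e) σ T fun τ => ∀ k,
      (∃ j < N, c.Holds (σ.setReg r j) ∧ i.eval (σ.setReg r j) = k ∧
        τ.arr a k = e.eval (σ.setReg r j)) ∨
      ((∀ j < N, c.Holds (σ.setReg r j) → i.eval (σ.setReg r j) ≠ k) ∧ τ.arr a k = σ.arr a k) := by
  have hmain := Tri.forR (r := r) (rb := rb) (p := .ite c (.store a i e) .skip) (σ := σ)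
    (T := c.cost + i.cost + e.cost + 3) (N := N)
    (fun m τ => ∀ k, (∃ j < m, c.Holds (σ.setReg r j) ∧ i.eval (σ.setReg r j) = k ∧
        τ.arr a k = e.eval (σ.setReg r j)) ∨
      ((∀ j < m, c.Holds (σ.setReg r j) → i.eval (σ.setReg r j) ≠ k) ∧ τ.arr a k = σ.arr a k))
    hN hrb rfl rfl (fun k => Or.inr ⟨by simp, rfl⟩) ?_
  · exact hmain.mono (by nlinarith) fun τ _ h => h.1
  · intro m hm ρ hf hr hI
    have key : ∀ f : Expr, f.ra a = false → f.eval ρ = f.eval (σ.setReg r m) := by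
      intro f hfa
      refine Expr.eval_congr f (fun s _ => ?_) (fun b hb => ?_)
      · by_cases hs : s = r
        · subst hs; simp [hr]
        · rw [hf.reg s (by simp [forR_wr, Prog.wr, Ne.symm hs])]; simp [hs]
      · have : a ≠ b := by rintro rfl; simp [hfa] at hb
        rw [hf.arr b (by simp [forR_wa, Prog.wa, this])]; rfl
    refine Tri.cond (T := i.cost + e.cost + 1 + 1) (fun h => Tri.flat _ rfl (by simp [Prog.mx]) ?_)
      (fun h => Tri.flat _ rfl (by simp [Prog.mx]) ?_) (by omega)
    · intro k
      simp only [Prog.den, setReg_arr, setArr_get, true_and, key i hi, key e he]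
      rw [Expr.Holds, key c hc] at h
      by_cases hk : k = i.eval (σ.setReg r m)
      · exact Or.inl ⟨m, by omega, h, hk.symm, by rw [if_pos hk]⟩
      · rw [if_neg hk]
        rcases hI k with ⟨j, hj, h1⟩ | ⟨h1, h2⟩
        · exact Or.inl ⟨j, by omega, h1⟩
        · refine Or.inr ⟨fun j hj hcj => ?_, h2⟩
          rcases Nat.lt_succ_iff_lt_or_eq.mp hj with hj | rfl
          · exact h1 j hj hcj
          · exact Ne.symm hk
    · intro k
      simp only [Prog.den, setReg_arr]
      rw [Expr.Holds, key c hc] at h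
      rcases hI k with ⟨j, hj, h1⟩ | ⟨h1, h2⟩
      · exact Or.inl ⟨j, by omega, h1⟩
      · refine Or.inr ⟨fun j hj hcj => ?_, h2⟩
        rcases Nat.lt_succ_iff_lt_or_eq.mp hj with hj | rfl
        · exact h1 j hj hcj
        · exact absurd hcj h

/-- For all values of register `r` below that of `rb`, store `e` at this place in `a`. -/
def fill (r rb a : ℕ) (e : Expr) : Prog := scatter r rb a (.const 1) (.reg r) e

theorem Tri.fill {r rb a : ℕ} {e : Expr} {σ : State} {N T : ℕ} (hN : σ.reg rb = N)
    (hrb : r ≠ rb) (he : e.ra a = false) (hT : (e.cost + 13) * (N + 1) + 2 ≤ T) :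
    Tri (fill r rb a e) σ T fun τ => ∀ k < N, τ.arr a k = e.eval (σ.setReg r k) := by
  refine (Tri.scatter hN hrb rfl rfl he le_rfl).mono (by simp only [Expr.cost]; linarith) ?_
  intro τ _ h k hk
  rcases h k with ⟨j, _, _, h1, h2⟩ | ⟨h1, -⟩
  · simp only [Expr.eval, setReg_reg, if_true] at h1
    rw [h2, h1]
  · exact absurd (by simp [Expr.eval]) (h1 k hk (by simp [Expr.Holds, Expr.eval]))

/-- Put a value of register `r` below that of `rb` for which `c` holds into `ro`, or the value of
`rb`, if there is none. -/
def find (r rb ro : ℕ) (c : Expr) : Prog :=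
  .seq (.assign ro (.reg rb)) (forR r rb (.ite c (.assign ro (.reg r)) .skip))

theorem Tri.find {r rb ro : ℕ} {c : Expr} {σ : State} {N T : ℕ} (hN : σ.reg rb = N)
    (hrb : r ≠ rb) (hro : ro ≠ r) (hro' : ro ≠ rb) (hc : c.rr ro = false)
    (hT : (c.cost + 11) * (N + 1) + 4 ≤ T) :
    Tri (find r rb ro c) σ T fun τ =>
      (τ.reg ro = N ∧ ∀ j < N, ¬ c.Holds (σ.setReg r j)) ∨
      (τ.reg ro < N ∧ c.Holds (σ.setReg r (τ.reg ro))) := by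
  refine Tri.seq (R := fun τ => τ = σ.setReg ro N) (Tri.assign (by simp [Expr.eval, hN])) ?_
    (S := 2) (T := (c.cost + 11) * (N + 1) + 2) (by omega)
  rintro σ' - rfl
  have hmain := Tri.forR (r := r) (rb := rb) (p := .ite c (.assign ro (.reg r)) .skip)
    (σ := σ.setReg ro N) (T := c.cost + 3) (N := N)
    (fun m τ => (τ.reg ro = N ∧ ∀ j < m, ¬ c.Holds (σ.setReg r j)) ∨
      (τ.reg ro < m ∧ c.Holds (σ.setReg r (τ.reg ro))))
    (by simp [hro'.symm, hN]) hrb (by simp [Prog.wr, hro]) (by simp [Prog.wr, hro'])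
    (Or.inl ⟨by simp [hro], by simp⟩) ?_
  · exact hmain.mono le_rfl fun τ _ h => h.1
  · intro m hm ρ hf hr hI
    have key : c.Holds ρ ↔ c.Holds (σ.setReg r m) := by
      refine Expr.holds_congr c (fun s hs => ?_) (fun b hb => ?_)
      · have hso : s ≠ ro := by rintro rfl; simp [hc] at hs
        by_cases hs : s = r
        · subst hs; simp [hr]
        · rw [hf.reg s (by simp [forR_wr, Prog.wr, Ne.symm hs, Ne.symm hso])]; simp [hs, hso]
      · rw [hf.arr b (by simp [forR_wa, Prog.wa])]; rfl
    refine Tri.cond (T := 2) (fun h => Tri.flat _ rfl (by simp [Prog.mx, Expr.cost]) ?_)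
      (fun h => Tri.flat _ rfl (by simp [Prog.mx]) ?_) (by omega)
    · simp only [Prog.den, setReg_reg, hro, if_false, if_true, Expr.eval, hr]
      exact Or.inr ⟨by omega, key.mp h⟩
    · simp only [Prog.den, setReg_reg, hro, if_false]
      rcases hI with ⟨h1, h2⟩ | ⟨h1, h2⟩
      · refine Or.inl ⟨h1, fun j hj => ?_⟩
        rcases Nat.lt_succ_iff_lt_or_eq.mp hj with hj | rfl
        · exact h2 j hj
        · exact mt key.mpr h
      · exact Or.inr ⟨by omega, h2⟩

/-- Programs one after the other. -/
def seqAll : List Prog → Prog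
  | [] => .skip
  | p :: ps => .seq p (seqAll ps)

end RAM

/-! ## Flooding -/

namespace RAM

variable {n : ℕ} {G : SimpleGraph (Fin n)} {x : Fin 4 → Fin n} {M : ℕ}

/-- The memory holds the graph and the terminals: registers `1-4` the terminals, register `5` the
number of vertices, register `6` the number of arcs, array `1` the heads and array `3` the tails of
the arcs, and array `0` the positions of the first arcs of the vertices. -/
structure Ctx (G : SimpleGraph (Fin n)) (x : Fin 4 → Fin n) (M : ℕ) (σ : State) : Prop where
  rn : σ.reg 5 = n
  rM : σ.reg 6 = M
  rx : ∀ i : Fin 4, σ.reg (i.val + 1) = x i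
  off_zero : σ.arr 0 0 = 0
  off_mono : ∀ v < n, σ.arr 0 v ≤ σ.arr 0 (v + 1)
  off_n : σ.arr 0 n = M
  src_iff : ∀ e < M, ∀ v < n, σ.arr 3 e = v ↔ σ.arr 0 v ≤ e ∧ e < σ.arr 0 (v + 1)
  arc : ∀ e < M, ∃ u v : Fin n, σ.arr 3 e = u ∧ σ.arr 1 e = v ∧ G.Adj u v
  exists_arc : ∀ u v, G.Adj u v → ∃ e < M, σ.arr 3 e = u ∧ σ.arr 1 e = v

/-- The program does not touch the graph and the terminals. -/
def Prog.safe (p : Prog) : Bool :=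
  (!p.wr 1 && !p.wr 2 && !p.wr 3 && !p.wr 4 && !p.wr 5 && !p.wr 6) && (!p.wa 0 && !p.wa 1 && !p.wa 3)

theorem Ctx.frame {p : Prog} {σ τ : State} (h : Ctx G x M σ) (hf : Fr p σ τ) (hp : p.safe = true) :
    Ctx G x M τ := by
  simp only [Prog.safe, Bool.and_eq_true, Bool.not_eq_true'] at hp
  obtain ⟨⟨⟨⟨⟨⟨h1, h2⟩, h3⟩, h4⟩, h5⟩, h6⟩, ⟨h7, h8⟩, h9⟩ := hp
  have e1 := hf.reg 1 h1
  have e2 := hf.reg 2 h2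
  have e3 := hf.reg 3 h3
  have e4 := hf.reg 4 h4
  have a0 := hf.arr 0 h7
  have a1 := hf.arr 1 h8
  have a3 := hf.arr 3 h9
  refine ⟨(hf.reg 5 h5).trans h.rn, (hf.reg 6 h6).trans h.rM, fun i => ?_, ?_, ?_, ?_, ?_, ?_, ?_⟩
  · rw [← h.rx i]
    fin_cases i
    · exact e1
    · exact e2
    · exact e3
    · exact e4
  · rw [a0]; exact h.off_zero
  · rw [a0]; exact h.off_mono
  · rw [a0]; exact h.off_n
  · rw [a0, a3]; exact h.src_iff
  · rw [a1, a3]; exact h.arc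
  · rw [a1, a3]; exact h.exists_arc

theorem Ctx.off_le {σ : State} (h : Ctx G x M σ) {v w : ℕ} (hvw : v ≤ w) (hw : w ≤ n) :
    σ.arr 0 v ≤ σ.arr 0 w := by
  induction hvw with
  | refl => exact le_rfl
  | step hvw ih => exact (ih (by omega)).trans (h.off_mono _ (by omega))

theorem Ctx.off_le_M {σ : State} (h : Ctx G x M σ) (v : Fin n) : σ.arr 0 (v + 1) ≤ M :=
  h.off_n ▸ h.off_le v.2 le_rfl

theorem Ctx.arc_at {σ : State} (h : Ctx G x M σ) (v : Fin n) {e : ℕ} (h1 : σ.arr 0 v ≤ e)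
    (h2 : e < σ.arr 0 (v + 1)) : ∃ w : Fin n, σ.arr 1 e = w ∧ G.Adj v w := by
  have he := h2.trans_le (h.off_le_M v)
  obtain ⟨u, w, hu, hw, huw⟩ := h.arc e he
  have := (h.src_iff e he v v.2).mpr ⟨h1, h2⟩
  obtain rfl : u = v := Fin.ext (hu.symm.trans this)
  exact ⟨w, hw, huw⟩

theorem Ctx.arc_pos {σ : State} (h : Ctx G x M σ) {v w : Fin n} (hvw : G.Adj v w) :
    ∃ e, σ.arr 0 v ≤ e ∧ e < σ.arr 0 (v + 1) ∧ σ.arr 1 e = w := by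
  obtain ⟨e, he, h1, h2⟩ := h.exists_arc v w hvw
  have := (h.src_iff e he v v.2).mp h1
  exact ⟨e, this.1, this.2, h2⟩

/-- The lists of all vertices together make up all arcs. This is the initial number of unscanned
arcs in the search. -/
theorem Ctx.sum_deg {σ : State} (h : Ctx G x M σ) :
    ∑ v ∈ Finset.range n, (σ.arr 0 (v + 1) - σ.arr 0 v) = M := by
  have : ∀ k ≤ n, ∑ v ∈ Finset.range k, (σ.arr 0 (v + 1) - σ.arr 0 v) = σ.arr 0 k := by
    intro k
    induction k with
    | zero => intro _; simp [h.off_zero]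
    | succ k ih =>
      intro hk
      rw [Finset.sum_range_succ, ih (by omega)]
      have := h.off_mono k (by omega)
      omega
  rw [this n le_rfl, h.off_n]

/-- The vertices at which the array `a` is not zero. -/
def supp (n : ℕ) (a : ℕ → ℕ) : Set (Fin n) := {u | a u ≠ 0}

@[simp] theorem mem_supp {a : ℕ → ℕ} {u : Fin n} : u ∈ supp n a ↔ a u ≠ 0 := Iff.rfl

/-- One step of the search: look at the next arc of the first vertex of the queue, or remove it. -/
def floodStep : Prog :=
  .seq (.assign 11 (.get 6 (.reg 9)))
  (.ite (.lt (.get 7 (.reg 11)) (.get 0 (.add (.reg 11) (.const 1))))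
    (.seq (.assign 12 (.get 1 (.get 7 (.reg 11))))
    (.seq (.store 7 (.reg 11) (.add (.get 7 (.reg 11)) (.const 1)))
    (.ite ((Expr.get 4 (.reg 12)).and (Expr.get 5 (.reg 12)).not)
      (.seq (.store 5 (.reg 12) (.const 1))
      (.seq (.store 6 (.reg 10) (.reg 12)) (.assign 10 (.add (.reg 10) (.const 1)))))
      .skip)))
    (.assign 9 (.add (.reg 9) (.const 1))))

/-- Breadth first search from register `7` in the support of array `4`. The result is the
support of array `5`. -/
def flood : Prog :=
  .seq (fill 8 5 5 (.const 0))
  (.seq (fill 8 5 7 (.get 0 (.reg 8)))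
  (.seq (.seq (.assign 9 (.const 0)) (.seq (.assign 10 (.const 0))
    (.ite (.get 4 (.reg 7))
      (.seq (.store 5 (.reg 7) (.const 1)) (.seq (.store 6 (.const 0) (.reg 7))
        (.assign 10 (.const 1)))) .skip)))
  (.loop (.lt (.reg 9) (.reg 10)) floodStep)))

/-- The invariant of the search. -/
structure FloodInv (G : SimpleGraph (Fin n)) (s : Fin n) (ρ : State) : Prop where
  le : ρ.reg 9 ≤ ρ.reg 10
  queue : ∀ i < ρ.reg 10, ∃ u : Fin n, ρ.arr 6 i = u ∧ ρ.arr 5 u ≠ 0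
  sound : ∀ u : Fin n, ρ.arr 5 u ≠ 0 → RIn G (supp n (ρ.arr 4)) s u
  mem : ∀ u : Fin n, ρ.arr 5 u ≠ 0 → ∃ i < ρ.reg 10, ρ.arr 6 i = u
  ptr : ∀ v : Fin n, ρ.arr 0 v ≤ ρ.arr 7 v ∧ ρ.arr 7 v ≤ ρ.arr 0 (v + 1)
  seen : ∀ (v w : Fin n) e, ρ.arr 0 v ≤ e → e < ρ.arr 7 v → ρ.arr 1 e = w → ρ.arr 4 w ≠ 0 →
    ρ.arr 5 w ≠ 0
  done : ∀ i < ρ.reg 9, ∀ u : Fin n, ρ.arr 6 i = u → ρ.arr 7 u = ρ.arr 0 (u + 1)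
  start : ρ.arr 4 s ≠ 0 → ρ.arr 5 s ≠ 0

/-- Unscanned arcs plus unreached vertices plus the length of the queue. Scanning an arc lowers the
first term, and a vertex that enters the queue leaves the second. Removing the head lowers the
third. -/
def floodMeasure (n : ℕ) (ρ : State) : ℕ :=
  ∑ v ∈ Finset.range n, (ρ.arr 0 (v + 1) - ρ.arr 7 v) +
    ∑ v ∈ Finset.range n, (1 - ρ.arr 5 v) + (ρ.reg 10 - ρ.reg 9)

/-- There are three kinds of steps: the arc leads to a new vertex of the mask, the arc leads
elsewhere, or the head of the queue has no arc left and is removed. -/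
theorem floodStep_spec {s : Fin n} {ρ : State} (hc : Ctx G x M ρ) (h : FloodInv G s ρ)
    (hlt : ρ.reg 9 < ρ.reg 10) :
    FloodInv G s (floodStep.den ρ) ∧ floodMeasure n (floodStep.den ρ) < floodMeasure n ρ := by
  obtain ⟨v, hv, hvis⟩ := h.queue _ hlt
  by_cases h1 : ρ.arr 7 v < ρ.arr 0 (v + 1)
  · obtain ⟨w, hw, hvw⟩ := hc.arc_at v (h.ptr v).1 h1
    have hP : ∑ u ∈ Finset.range n, (ρ.arr 0 (u + 1) - if u = v then ρ.arr 7 v + 1 else ρ.arr 7 u) <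
        ∑ u ∈ Finset.range n, (ρ.arr 0 (u + 1) - ρ.arr 7 u) := by
      refine Finset.sum_lt_sum (fun u _ => ?_) ⟨v, Finset.mem_range.mpr v.2, ?_⟩
      · split_ifs with hu
        · subst hu; omega
        · exact le_rfl
      · rw [if_pos rfl]; omega
    have hseen : ∀ (u z : Fin n) e, ρ.arr 0 u ≤ e →
        e < (if u.val = v then ρ.arr 7 v + 1 else ρ.arr 7 u) → ρ.arr 1 e = z → ρ.arr 4 z ≠ 0 →
        z ≠ w → ρ.arr 5 z ≠ 0 := by
      intro u z e h3 h4 h5 h6 h7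
      by_cases hu : u.val = v
      · rw [if_pos hu] at h4
        obtain rfl := Fin.ext hu
        rcases Nat.lt_succ_iff_lt_or_eq.mp h4 with h4 | rfl
        · exact h.seen u z e h3 h4 h5 h6
        · exact absurd (Fin.ext (h5.symm.trans hw)) h7
      · rw [if_neg hu] at h4
        exact h.seen u z e h3 h4 h5 h6
    have hptr : ∀ u : Fin n, ρ.arr 0 u ≤ (if u.val = v then ρ.arr 7 v + 1 else ρ.arr 7 u) ∧
        (if u.val = v then ρ.arr 7 v + 1 else ρ.arr 7 u) ≤ ρ.arr 0 (u + 1) := by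
      intro u
      have := h.ptr u
      split_ifs with hu
      · obtain rfl := Fin.ext hu
        omega
      · exact this
    have hdone : ∀ i < ρ.reg 9, ∀ u : Fin n, ρ.arr 6 i = u →
        (if u.val = v then ρ.arr 7 v + 1 else ρ.arr 7 u) = ρ.arr 0 (u + 1) := by
      intro i hi u hu
      have := h.done i hi u hu
      split_ifs with huv
      · obtain rfl := Fin.ext huv
        omega
      · exact this
    by_cases h2 : ρ.arr 4 w ≠ 0 ∧ ρ.arr 5 w = 0
    · have hden : floodStep.den ρ = (((((ρ.setReg 11 v).setReg 12 w).setArr 7 v (ρ.arr 7 v + 1)).setArr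
          5 w 1).setArr 6 (ρ.reg 10) w).setReg 10 (ρ.reg 10 + 1) := by
        simp [floodStep, Prog.den, Expr.eval, hv, h1, hw, Expr.and, Expr.not, h2.1, h2.2]
      have h4 : (floodStep.den ρ).arr 4 = ρ.arr 4 := by rw [hden]; simp [setArr_arr]
      rw [hden] at h4 ⊢
      refine ⟨⟨?_, ?_, ?_, ?_, ?_, ?_, ?_, ?_⟩, ?_⟩
      · simp only [setReg_reg, setArr_reg]
        norm_num
        omega
      · simp only [setReg_reg, setArr_reg, setReg_arr, setArr_get]
        norm_num
        intro i hi
        rcases hi.lt_or_eq with hi' | rfl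
        · obtain ⟨u, hu, hu'⟩ := h.queue i hi'
          exact ⟨u, by rw [if_neg hi'.ne]; exact hu, by split_ifs <;> simp [hu']⟩
        · exact ⟨w, by simp, by simp⟩
      · intro u hu
        rw [h4]
        by_cases huw : u = w
        · subst huw
          exact (h.sound v hvis).step hvw h2.1
        · refine h.sound u ?_
          simpa [Fin.val_inj, huw] using hu
      · intro u hu
        simp only [setReg_reg, setArr_reg, setReg_arr, setArr_get]
        norm_num
        by_cases huw : u = w
        · subst huw
          exact ⟨ρ.reg 10, by omega, by simp⟩
        · obtain ⟨i, hi, hi'⟩ := h.mem u (by simpa [Fin.val_inj, huw] using hu)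
          exact ⟨i, by omega, by rw [if_neg hi.ne]; exact hi'⟩
      · simpa using hptr
      · intro u z e h3 h4 h5 h6
        by_cases hzw : z = w
        · simp [hzw]
        · have := hseen u z e (by simpa using h3) (by simpa using h4) (by simpa using h5)
            (by simpa using h6) hzw
          simpa [Fin.val_inj, hzw] using this
      · intro i hi u hu
        simp only [setReg_reg, setArr_reg, setReg_arr, setArr_get] at hi hu ⊢
        norm_num at hi hu ⊢
        rw [if_neg (by omega)] at hu
        exact hdone i hi u hu
      · intro hs
        have := h.start (by simpa using hs)
        by_cases hsw : s = w
        · simp [hsw]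
        · simpa [Fin.val_inj, hsw] using this
      · have hU : ∑ u ∈ Finset.range n, (1 - if u = w then 1 else ρ.arr 5 u) <
            ∑ u ∈ Finset.range n, (1 - ρ.arr 5 u) := by
          refine Finset.sum_lt_sum (fun u _ => ?_) ⟨w, Finset.mem_range.mpr w.2, ?_⟩
          · by_cases huw : u = w <;> simp [huw]
          · simp [h2.2]
        simp only [floodMeasure, setReg_reg, setArr_reg, setReg_arr, setArr_get]
        norm_num at hU ⊢
        omega
    · have hden : floodStep.den ρ = ((ρ.setReg 11 v).setReg 12 w).setArr 7 v (ρ.arr 7 v + 1) := by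
        have h2' : ρ.arr 4 w ≠ 0 → ρ.arr 5 w ≠ 0 := by tauto
        by_cases h3 : ρ.arr 4 w = 0
        · by_cases h5 : ρ.arr 5 w = 0 <;>
            simp [floodStep, Prog.den, Expr.eval, hv, h1, hw, Expr.and, Expr.not, h3, h5]
        · simp [floodStep, Prog.den, Expr.eval, hv, h1, hw, Expr.and, Expr.not, h3, h2' h3]
      have h4 : (floodStep.den ρ).arr 4 = ρ.arr 4 := by rw [hden]; simp [setArr_arr]
      rw [hden] at h4 ⊢
      refine ⟨⟨?_, ?_, ?_, ?_, ?_, ?_, ?_, ?_⟩, ?_⟩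
      · simpa using h.le
      · simpa using h.queue
      · intro u hu
        rw [h4]
        exact h.sound u (by simpa using hu)
      · simpa using h.mem
      · simpa using hptr
      · intro u z e h3 h4 h5 h6
        by_cases hzw : z = w
        · subst hzw
          have h6' : ρ.arr 4 z ≠ 0 := by simpa using h6
          simp only [setArr_get, setReg_arr]
          norm_num
          tauto
        · have := hseen u z e (by simpa using h3) (by simpa using h4) (by simpa using h5)
            (by simpa using h6) hzw
          simpa using this
      · intro i hi u hu
        simp only [setReg_reg, setArr_reg, setReg_arr, setArr_get] at hi hu ⊢
        norm_num at hi hu ⊢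
        exact hdone i hi u hu
      · simpa using h.start
      · simp only [floodMeasure, setReg_reg, setArr_reg, setReg_arr, setArr_get]
        norm_num
        omega
  · have hden : floodStep.den ρ = (ρ.setReg 11 v).setReg 9 (ρ.reg 9 + 1) := by
      simp [floodStep, Prog.den, Expr.eval, hv, h1]
    rw [hden]
    refine ⟨⟨?_, ?_, ?_, ?_, ?_, ?_, ?_, ?_⟩, ?_⟩
    · simpa using hlt
    · simpa using h.queue
    · exact h.sound
    · simpa using h.mem
    · exact h.ptr
    · exact h.seen
    · intro i hi u hu
      simp only [setReg_reg, if_true, setReg_arr] at hi hu ⊢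
      rcases Nat.lt_succ_iff_lt_or_eq.mp hi with hi | rfl
      · exact h.done i hi u hu
      · obtain rfl : u = v := Fin.ext (hu.symm.trans hv)
        have := h.ptr u
        omega
    · exact h.start
    · simp only [floodMeasure, setReg_reg, setReg_arr]
      norm_num
      omega

theorem flood_spec {s : Fin n} {σ : State} (hc : Ctx G x M σ) (hs : σ.reg 7 = s) :
    Tri flood σ (210 * (n + M + 1)) fun τ => supp n (τ.arr 5) = {u | RIn G (supp n (σ.arr 4)) s u} := by
  refine Tri.seq (Tri.fill hc.rn (by decide) rfl le_rfl) (fun σ₁ f1 h1 => ?_)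
    (S := 14 * (n + 1) + 2) (T := 190 * (n + M + 1)) (by omega)
  have c1 := hc.frame f1 (by decide)
  refine Tri.seq (Tri.fill c1.rn (by decide) rfl le_rfl) (fun σ₂ f2 h2 => ?_)
    (S := 15 * (n + 1) + 2) (T := 170 * (n + M + 1)) (by omega)
  have c2 := c1.frame f2 (by decide)
  have h1' : ∀ k < n, σ₂.arr 5 k = 0 := by
    intro k hk
    rw [f2.arr 5 (by decide), h1 k hk]; rfl
  have h2' : ∀ k < n, σ₂.arr 7 k = σ₂.arr 0 k := by
    intro k hk
    rw [h2 k hk, f2.arr 0 (by decide)]; simp [Expr.eval]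
  have e4 : σ₂.arr 4 = σ.arr 4 := by rw [f2.arr 4 (by decide), f1.arr 4 (by decide)]
  have e7 : σ₂.reg 7 = s := by rw [f2.reg 7 (by decide), f1.reg 7 (by decide), hs]
  -- Initially all `M` arcs are unscanned, at most `n` vertices are unreached, and the queue holds
  -- at most the start vertex.
  refine Tri.seq (R := fun τ => FloodInv G s τ ∧ floodMeasure n τ ≤ n + M + 1)
    (S := 30) (T := 140 * (n + M + 1)) (Tri.flat _ rfl (by decide) ?_) (fun σ₃ f3 h3 => ?_) (by omega)
  · have hle : ∑ v ∈ Finset.range n, (σ₂.arr 0 (v + 1) - σ₂.arr 7 v) = M := by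
      rw [← c2.sum_deg]
      exact Finset.sum_congr rfl fun v hv => by rw [h2' v (Finset.mem_range.mp hv)]
    by_cases hm : σ₂.arr 4 s = 0
    · simp only [Prog.den, Expr.eval, setReg_reg, setReg_arr]
      norm_num [e7, hm]
      refine ⟨⟨by simp, by simp, ?_, ?_, ?_, ?_, by simp, ?_⟩, ?_⟩
      · intro u hu
        exact absurd (h1' u u.2) hu
      · intro u hu
        exact absurd (h1' u u.2) hu
      · intro v
        have := c2.off_mono v v.2
        simp only [setReg_arr, h2' v v.2]
        omega
      · intro v w e h3 h4
        simp only [setReg_arr, h2' v v.2] at h3 h4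
        omega
      · exact fun hs => absurd hm hs
      · simp only [floodMeasure, setReg_arr, setReg_reg, hle]
        have : ∑ v ∈ Finset.range n, (1 - σ₂.arr 5 v) ≤ n := by
          refine (Finset.sum_le_sum (g := fun _ => 1) fun v _ => Nat.sub_le _ _).trans ?_
          simp
        norm_num
        omega
    · simp only [Prog.den, Expr.eval, setReg_reg, setReg_arr]
      norm_num [e7, hm]
      refine ⟨⟨by simp, ?_, ?_, ?_, ?_, ?_, by simp, ?_⟩, ?_⟩
      · simp only [setReg_reg, setArr_reg, setReg_arr, setArr_get]
        norm_num
        exact ⟨s, rfl, by simp⟩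
      · intro u hu
        obtain rfl : u = s := by
          by_contra hus
          simp [Fin.val_inj, hus, h1'] at hu
        have hm' : u ∈ supp n (σ₂.arr 4) := hm
        refine (RIn.refl hm').mono fun z hz => ?_
        simpa using hz
      · intro u hu
        obtain rfl : u = s := by
          by_contra hus
          simp [Fin.val_inj, hus, h1'] at hu
        exact ⟨0, by simp, by simp⟩
      · intro v
        have := c2.off_mono v v.2
        simp [h2' v v.2, this]
      · intro v w e h3 h4
        simp only [setReg_arr, setArr_get] at h3 h4
        norm_num [h2' v v.2] at h3 h4
        omega
      · intro _
        simp
      · have : ∑ v ∈ Finset.range n, (1 - if v = s.val then 1 else σ₂.arr 5 v) ≤ n := by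
          refine (Finset.sum_le_sum (g := fun _ => 1) fun v _ => Nat.sub_le _ _).trans ?_
          simp
        simp only [floodMeasure, setReg_arr, setReg_reg, setArr_reg, setArr_get]
        norm_num at this ⊢
        omega
  · have c3 := c2.frame f3 (by decide)
    have hmain := Tri.loop (e := .lt (.reg 9) (.reg 10)) (p := floodStep) (σ := σ₃) (T := floodStep.mx)
      (fun ρ => FloodInv G s ρ) (floodMeasure n) h3.1 ?_
    · have hx : (Expr.lt (.reg 9) (.reg 10)).cost + 1 + floodStep.mx ≤ 70 := by decide
      refine hmain.mono ?_ ?_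
      · calc _ ≤ 70 * (floodMeasure n σ₃ + 1) := Nat.mul_le_mul_right _ hx
          _ ≤ _ := by have := h3.2; omega
      · rintro τ f4 ⟨hI, he⟩
        have c4 := c3.frame f4 (by decide)
        have hle : τ.reg 10 ≤ τ.reg 9 := by
          by_contra hlt
          push Not at hlt
          simp [Expr.eval, hlt] at he
        have e4' : τ.arr 4 = σ.arr 4 := by rw [f4.arr 4 (by decide), f3.arr 4 (by decide), e4]
        have hI4 := hI.sound
        rw [e4'] at hI4
        ext u
        refine ⟨fun hu => hI4 u hu, fun hu => ?_⟩
        have hu' : RIn G (supp n (σ.arr 4)) s u := hu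
        -- When the queue is exhausted, all arcs of all reached vertices have been scanned. So the
        -- reached set is closed under adjacency inside the mask.
        refine hu'.mem_of_closed ?_ ?_
        · refine hI.start ?_
          rw [e4']
          exact hu'.left
        · intro v hv w hw hvw
          obtain ⟨i, hi, hi'⟩ := hI.mem v hv
          obtain ⟨e, h5, h6, h7⟩ := c4.arc_pos hvw
          have hd := hI.done i (by omega) v hi'
          exact hI.seen v w e h5 (by omega) h7 (by rw [e4']; exact hw)
    · intro ρ f4 hρ hlt
      refine Tri.flat _ rfl le_rfl ?_
      refine floodStep_spec (c3.frame f4 (by decide)) hρ ?_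
      by_contra hno
      simp [Expr.eval, hno] at hlt

end RAM

/-! ## Minimal connections and cycles of length four -/

namespace RAM

variable {n : ℕ} {G : SimpleGraph (Fin n)} {x : Fin 4 → Fin n} {M : ℕ}

/-- Converts the cost of a loop over `n` vertices with a body of cost `a * N` into the form `b * (n
* N)`, using `n + 1 ≤ 2 * n`. -/
theorem mul_bound {a b n N : ℕ} (hn : 1 ≤ n) (hN : 1 ≤ N) (hb : 2 * a + 18 ≤ b) :
    (a * N + 8) * (n + 1) + 2 ≤ b * (n * N) :=
  calc (a * N + 8) * (n + 1) + 2 ≤ ((a + 8) * N) * (2 * n) + 2 * (n * N) := by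
        have h1 : 1 * 1 ≤ n * N := Nat.mul_le_mul hn hN
        have h2 : (a * N + 8) * (n + 1) ≤ ((a + 8) * N) * (2 * n) :=
          Nat.mul_le_mul (by rw [Nat.add_mul]; omega) (by omega)
        omega
    _ = (2 * a + 18) * (n * N) := by ring
    _ ≤ b * (n * N) := Nat.mul_le_mul_right _ hb

theorem Ctx.regs {σ : State} (h : Ctx G x M σ) :
    σ.reg 1 = x 0 ∧ σ.reg 2 = x 1 ∧ σ.reg 3 = x 2 ∧ σ.reg 4 = x 3 :=
  ⟨h.rx 0, h.rx 1, h.rx 2, h.rx 3⟩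

theorem Ctx.pos {σ : State} (_ : Ctx G x M σ) : 1 ≤ n := (x 0).pos

theorem forall_fin_four {P : Fin 4 → Prop} : (∀ j, P j) ↔ P 0 ∧ P 1 ∧ P 2 ∧ P 3 := by
  simp [Fin.forall_fin_succ]

/-- The terminals have all been reached from the first one. -/
def linked : Expr := (Expr.get 5 (.reg 2)).and ((Expr.get 5 (.reg 3)).and (Expr.get 5 (.reg 4)))

theorem linked_iff {σ : State} {H : Set (Fin n)} (hc : Ctx G x M σ)
    (h : supp n (σ.arr 5) = {u | RIn G H (x 0) u}) :
    linked.Holds σ ↔ ∀ j, RIn G H (x 0) (x j) := by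
  have key : ∀ u : Fin n, σ.arr 5 u ≠ 0 ↔ RIn G H (x 0) u := fun u => Set.ext_iff.mp h u
  obtain ⟨h1, h2, h3, h4⟩ := hc.regs
  simp only [linked, Expr.holds_and, Expr.holds_get, Expr.eval, h2, h3, h4, key, forall_fin_four]
  exact ⟨fun ⟨a, b, c⟩ => ⟨RIn.refl a.left, a, b, c⟩, fun h => h.2⟩

/-- The register `r` holds no terminal. -/
def nonterminal (r : ℕ) : Expr :=
  ((Expr.eq (.reg r) (.reg 1)).not.and (Expr.eq (.reg r) (.reg 2)).not).and
    ((Expr.eq (.reg r) (.reg 3)).not.and (Expr.eq (.reg r) (.reg 4)).not)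

theorem nonterminal_iff {σ : State} {r : ℕ} {u : Fin n} (hc : Ctx G x M σ) (hu : σ.reg r = u) :
    (nonterminal r).Holds σ ↔ ∀ j, u ≠ x j := by
  obtain ⟨h1, h2, h3, h4⟩ := hc.regs
  simp only [nonterminal, Expr.holds_and, Expr.holds_not, Expr.holds_eq, Expr.eval, hu, h1, h2, h3,
    h4, Fin.val_inj, forall_fin_four]
  tauto

/-- Try to remove the vertex in register `14` from the support of array `4`. -/
def dropStep : Prog :=
  .ite ((Expr.get 4 (.reg 14)).and (nonterminal 14))
    (.seq (.seq (.store 4 (.reg 14) (.const 0)) (.assign 7 (.reg 1)))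
      (.seq flood (.ite linked .skip (.store 4 (.reg 14) (.const 1)))))
    .skip

/-- Make the support of array `4` minimal such that it connects the terminals. -/
def minimize : Prog := forR 14 5 dropStep

/-- One pass is enough. The set only shrinks, so a vertex that could not be dropped when its turn
came cannot be dropped later. Each attempt costs one search. -/
theorem minimize_spec {σ : State} (hc : Ctx G x M σ)
    (hl : ∀ j, RIn G (supp n (σ.arr 4)) (x 0) (x j)) :
    Tri minimize σ (1000 * (n * (n + M + 1))) fun τ =>
      MinLink G x (supp n (τ.arr 4)) ∧ supp n (τ.arr 4) ⊆ supp n (σ.arr 4) := by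
  have hmain := Tri.forR (r := 14) (rb := 5) (p := dropStep) (σ := σ) (T := 400 * (n + M + 1)) (N := n)
    (fun i ρ => (∀ j, RIn G (supp n (ρ.arr 4)) (x 0) (x j)) ∧ supp n (ρ.arr 4) ⊆ supp n (σ.arr 4) ∧
      ∀ u ∈ supp n (ρ.arr 4), u.val < i → (∀ j, u ≠ x j) →
        ¬ ∀ j, RIn G (supp n (ρ.arr 4) \ {u}) (x 0) (x j))
    hc.rn (by decide) (by decide) (by decide) ⟨hl, subset_rfl, by simp⟩ ?_
  · refine hmain.mono ?_ fun τ _ h => ⟨⟨h.1.1, fun u hu => h.1.2.2 u hu u.2⟩, h.1.2.1⟩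
    exact mul_bound hc.pos (by omega) (by norm_num)
  · rintro i hi ρ hf hr ⟨h1, h2, h3⟩
    have cρ := hc.frame hf (by decide)
    have hu : ρ.reg 14 = (⟨i, hi⟩ : Fin n) := hr
    refine Tri.cond (T := 280 * (n + M + 1)) (fun hcond => ?_) (fun hcond => ?_) ?_
    · rw [Expr.holds_and, nonterminal_iff cρ hu] at hcond
      refine Tri.seq (R := fun τ => τ = (ρ.setArr 4 i 0).setReg 7 (x 0)) (S := 5)
        (T := 270 * (n + M + 1)) (Tri.flat _ rfl (by decide) ?_) ?_ (by omega)
      · simp [Prog.den, Expr.eval, hr, cρ.regs.1]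
      rintro ρ₁ f1 rfl
      have c1 := cρ.frame f1 (by decide)
      have hs : supp n (((ρ.setArr 4 i 0).setReg 7 (x 0)).arr 4) = supp n (ρ.arr 4) \ {⟨i, hi⟩} := by
        ext u
        by_cases hui : u.val = i
        · simp [hui, Fin.ext_iff]
        · simp [hui, Fin.ext_iff]
      refine Tri.seq (flood_spec c1 (s := x 0) (by simp)) (fun ρ₂ f2 hv => ?_)
        (T := 60 * (n + M + 1)) (by omega)
      have c2 := c1.frame f2 (by decide)
      rw [hs] at hv
      have hs2 : supp n (ρ₂.arr 4) = supp n (ρ.arr 4) \ {⟨i, hi⟩} := by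
        rw [f2.arr 4 (by decide), hs]
      have hr2 : ρ₂.reg 14 = i := by
        rw [f2.reg 14 (by decide)]
        simpa using hr
      refine Tri.cond (T := 10) (fun hk => Tri.flat _ rfl (by decide) ?_)
        (fun hk => Tri.flat _ rfl (by decide) ?_) ?_
      · rw [linked_iff c2 hv] at hk
        simp only [Prog.den, setReg_arr, hs2]
        refine ⟨hk, Set.sdiff_subset.trans h2, fun u hu hui hx hl' => ?_⟩
        have : u.val ≠ i := fun he => hu.2 (Fin.ext he)
        -- If `u` could be left out of the smaller set, it could have been left out of the larger
        -- one.
        refine h3 u hu.1 (by omega) hx fun j => (hl' j).mono ?_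
        exact Set.sdiff_subset_sdiff_left Set.sdiff_subset
      · rw [linked_iff c2 hv] at hk
        have hs3 : supp n ((ρ₂.setArr 4 i 1).arr 4) = supp n (ρ.arr 4) := by
          ext u
          have : u ∈ supp n (ρ₂.arr 4) ↔ u ∈ supp n (ρ.arr 4) \ {⟨i, hi⟩} := by rw [hs2]
          by_cases hui : u.val = i
          · have hu' : u = ⟨i, hi⟩ := Fin.ext hui
            have h4 : ρ.arr 4 (ρ.reg 14) ≠ 0 := hcond.1
            rw [hr] at h4
            simp [hu', h4]
          · simpa [hui, Fin.ext_iff] using this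
        simp only [Prog.den, setReg_arr, Expr.eval, hr2, hs3]
        refine ⟨h1, h2, fun u hu hui hx hl' => ?_⟩
        by_cases hui' : u.val = i
        · have hu' : u = ⟨i, hi⟩ := Fin.ext hui'
          rw [hu'] at hl'
          exact hk hl'
        · exact h3 u hu (by omega) hx hl'
      · have : linked.cost + 1 + 10 ≤ 60 := by decide
        omega
    · rw [Expr.holds_and, nonterminal_iff cρ hu] at hcond
      refine Tri.flat _ rfl (by simp only [Prog.mx]; omega) ?_
      simp only [Prog.den, setReg_arr]
      refine ⟨h1, h2, fun u hu hui hx => ?_⟩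
      by_cases hui' : u.val = i
      · have hu' : u = ⟨i, hi⟩ := Fin.ext hui'
        refine absurd ⟨?_, hu' ▸ hx⟩ hcond
        have : ρ.arr 4 u ≠ 0 := hu
        rw [hui', ← hr] at this
        exact this
      · exact h3 u hu (by omega) hx
    · have : ((Expr.get 4 (.reg 14)).and (nonterminal 14)).cost + 1 ≤ 70 := by decide
      omega

/-! ### Cycles of length four -/

/-- The arc in register `8` goes from a neighbour of the vertex in register `14` to another vertex,
inside the support of array `4`. -/
def awayArc : Expr :=
  ((Expr.get 8 (.get 3 (.reg 8))).and (Expr.get 4 (.get 3 (.reg 8)))).and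
    ((Expr.get 4 (.get 1 (.reg 8))).and (Expr.eq (.get 1 (.reg 8)) (.reg 14)).not)

/-- Look for a cycle of length four through the vertex in register `14`. -/
def squareStep : Prog :=
  .seq (fill 8 5 8 (.const 0))
  (.seq (scatter 8 6 8 (.eq (.get 3 (.reg 8)) (.reg 14)) (.get 1 (.reg 8)) (.const 1))
  (.seq (scatter 8 6 12 awayArc (.get 1 (.reg 8)) (.get 3 (.reg 8)))
  (.seq (find 8 6 13 (awayArc.and (Expr.eq (.get 12 (.get 1 (.reg 8))) (.get 3 (.reg 8))).not))
  (.ite (.lt (.reg 13) (.reg 6))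
    (.seq (.assign 15 (.const 1)) (.seq (.assign 16 (.reg 14)) (.seq (.assign 17 (.get 3 (.reg 13)))
      (.seq (.assign 18 (.get 1 (.reg 13))) (.assign 19 (.get 12 (.get 1 (.reg 13))))))))
    .skip))))

/-- Look for a cycle of length four in the support of array `4`. -/
def findSquare : Prog :=
  .seq (.assign 15 (.const 0))
    (forR 14 5 (.ite ((Expr.get 4 (.reg 14)).and (Expr.eq (.reg 15) (.const 0))) squareStep .skip))

/-- The registers `16-19` hold a cycle of length four in `H`. -/
def SquareFound (G : SimpleGraph (Fin n)) (H : Set (Fin n)) (τ : State) : Prop :=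
  ∃ a b c d : Fin n, (a ∈ H ∧ b ∈ H ∧ c ∈ H ∧ d ∈ H) ∧
    (G.Adj a b ∧ G.Adj b c ∧ G.Adj c d ∧ G.Adj d a) ∧ (a ≠ c ∧ b ≠ d) ∧
    τ.reg 16 = a ∧ τ.reg 17 = b ∧ τ.reg 18 = c ∧ τ.reg 19 = d

/-- For the fixed vertex `a`, array `8` marks its neighbours, and array `12` remembers for each
vertex `c ≠ a` one marked neighbour of `c`. An arc to `c` from a different marked vertex completes a
square, so two passes over the arcs suffice. -/
theorem squareStep_spec {ρ : State} {a : Fin n} (hc : Ctx G x M ρ) (ha : ρ.reg 14 = a)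
    (h15 : ρ.reg 15 = 0) (haH : a ∈ supp n (ρ.arr 4)) :
    Tri squareStep ρ (500 * (n + M + 1)) fun τ =>
      (τ.reg 15 = 0 ∧ ∀ b ∈ supp n (ρ.arr 4), ∀ d ∈ supp n (ρ.arr 4), ∀ c ∈ supp n (ρ.arr 4),
        G.Adj a b → G.Adj a d → G.Adj b c → G.Adj d c → c ≠ a → b = d) ∨
      (τ.reg 15 = 1 ∧ SquareFound G (supp n (ρ.arr 4)) τ) := by
  refine Tri.seq (Tri.fill hc.rn (by decide) rfl le_rfl) (fun ρ₁ f1 h1 => ?_)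
    (S := 14 * (n + 1) + 2) (T := 480 * (n + M + 1)) (by omega)
  have c1 := hc.frame f1 (by decide)
  refine Tri.seq (Tri.scatter c1.rM (by decide) rfl rfl rfl le_rfl) (fun ρ₂ f2 h2 => ?_)
    (S := 18 * (M + 1) + 2) (T := 460 * (n + M + 1)) (by omega)
  have c2 := c1.frame f2 (by decide)
  -- the neighbours of `a`
  have hmk : ∀ u : Fin n, ρ₂.arr 8 u ≠ 0 ↔ G.Adj a u := by
    intro u
    have e14 : ρ₁.reg 14 = a := (f1.reg 14 (by decide)).trans ha
    rcases h2 u with ⟨e, he, h3, h4, h5⟩ | ⟨h3, h4⟩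
    · rw [h5]
      simp only [Expr.holds_eq, Expr.eval, setReg_reg, setReg_arr] at h3 h4
      norm_num [e14] at h3
      norm_num at h4
      obtain ⟨s, t, hs, ht, hst⟩ := c1.arc e he
      obtain rfl : s = a := Fin.ext (hs.symm.trans h3)
      obtain rfl : t = u := Fin.ext (ht.symm.trans h4)
      simpa [Expr.eval] using hst
    · rw [h4, h1 u u.2]
      simp only [Expr.eval, ne_eq, not_true_eq_false, false_iff]
      intro hau
      obtain ⟨e, he, hs, ht⟩ := c1.exists_arc a u hau
      exact h3 e he (by simp [Expr.eval, hs, e14]) (by simp [Expr.eval, ht])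
  have e4 : ρ₂.arr 4 = ρ.arr 4 := (f2.arr 4 (by decide)).trans (f1.arr 4 (by decide))
  have e14 : ρ₂.reg 14 = a := ((f2.reg 14 (by decide)).trans (f1.reg 14 (by decide))).trans ha
  have haway : ∀ ρ' : State, ρ'.reg 14 = ρ₂.reg 14 → ρ'.arr 8 = ρ₂.arr 8 → ρ'.arr 4 = ρ₂.arr 4 →
      ρ'.arr 3 = ρ₂.arr 3 → ρ'.arr 1 = ρ₂.arr 1 → ∀ e (s t : Fin n), ρ₂.arr 3 e = s → ρ₂.arr 1 e = t →
      (awayArc.Holds (ρ'.setReg 8 e) ↔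
        G.Adj a s ∧ s ∈ supp n (ρ.arr 4) ∧ t ∈ supp n (ρ.arr 4) ∧ t ≠ a) := by
    intro ρ' g1 g2 g3 g4 g5 e s t hs ht
    have := hmk s
    simp only [awayArc, Expr.holds_and, Expr.holds_not, Expr.holds_eq, Expr.holds_get, Expr.eval,
      setReg_reg, setReg_arr, if_true, g1, g2, g3, g4, g5, hs, ht, this, e4, mem_supp]
    norm_num [g1, e14, Fin.val_inj]
    tauto
  refine Tri.seq (Tri.scatter c2.rM (by decide) rfl rfl rfl
    (Nat.add_le_add_right (Nat.mul_le_mul_right _ (by decide)) 2)) (fun ρ₃ f3 h3 => ?_)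
    (S := 100 * (M + 1) + 2) (T := 350 * (n + M + 1)) ?_
  · have c3 := c2.frame f3 (by decide)
    have haway3 := haway ρ₃ (f3.reg 14 (by decide)) (f3.arr 8 (by decide)) (f3.arr 4 (by decide))
      (f3.arr 3 (by decide)) (f3.arr 1 (by decide))
    have g1 : ρ₃.arr 1 = ρ₂.arr 1 := f3.arr 1 (by decide)
    have g3 : ρ₃.arr 3 = ρ₂.arr 3 := f3.arr 3 (by decide)
    -- the last neighbour of `a` that sees `c`
    have hseen : ∀ e < M, ∀ s t : Fin n, ρ₂.arr 3 e = s → ρ₂.arr 1 e = t →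
        awayArc.Holds (ρ₂.setReg 8 e) → ∃ d : Fin n, ρ₃.arr 12 t = d ∧ d ∈ supp n (ρ.arr 4) ∧
          G.Adj a d ∧ G.Adj d t := by
      intro e he s t hs ht hcond
      rcases h3 t with ⟨e', he', h4, h5, h6⟩ | ⟨h4, -⟩
      · obtain ⟨s', t', hs', ht', hst'⟩ := c2.arc e' he'
        rw [haway ρ₂ rfl rfl rfl rfl rfl e' s' t' hs' ht'] at h4
        simp only [Expr.eval, setReg_reg, setReg_arr, if_true] at h5 h6
        obtain rfl : t' = t := Fin.ext (ht'.symm.trans h5)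
        exact ⟨s', h6.trans hs', h4.2.1, h4.1, hst'⟩
      · exact absurd (by simpa [Expr.eval] using ht) (h4 e he hcond)
    refine Tri.seq (Tri.find c3.rM (by decide) (by decide) (by decide) (by decide)
      (Nat.add_le_add_right (Nat.mul_le_mul_right _ (by decide)) 4))
      (fun ρ₄ f4 h4 => ?_) (S := 120 * (M + 1) + 4) (T := 25) ?_
    · have c4 := c3.frame f4 (by decide)
      have k1 : ρ₄.arr 1 = ρ₂.arr 1 := (f4.arr 1 (by decide)).trans g1
      have k3 : ρ₄.arr 3 = ρ₂.arr 3 := (f4.arr 3 (by decide)).trans g3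
      have k12 : ρ₄.arr 12 = ρ₃.arr 12 := f4.arr 12 (by decide)
      have k14 : ρ₄.reg 14 = a := (f4.reg 14 (by decide)).trans ((f3.reg 14 (by decide)).trans e14)
      have k15 : ρ₄.reg 15 = 0 := by
        rw [f4.reg 15 (by decide), f3.reg 15 (by decide), f2.reg 15 (by decide),
          f1.reg 15 (by decide), h15]
      refine Tri.flat _ rfl (by decide) ?_
      rcases h4 with ⟨h5, h6⟩ | ⟨h5, h6⟩
      · refine Or.inl ?_
        have hden : ¬ ρ₄.reg 13 < ρ₄.reg 6 := by rw [h5, c4.rM]; omega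
        simp only [Prog.den, Expr.eval, hden, if_true, if_false, k15, true_and]
        -- If the search comes up empty, every path `a, b, c` has the remembered vertex of `c` in
        -- the middle, so two such paths to the same `c` share their middle.
        have huniq : ∀ b ∈ supp n (ρ.arr 4), ∀ c ∈ supp n (ρ.arr 4), G.Adj a b → G.Adj b c → c ≠ a →
            ρ₃.arr 12 c = b := by
          intro b hb c hcH hab hbc hca
          obtain ⟨e, he, hs, ht⟩ := c2.exists_arc b c hbc
          have := h6 e he
          rw [Expr.holds_and, haway3 e b c hs ht] at this
          by_contra hne
          refine this ⟨⟨hab, hb, hcH, hca⟩, ?_⟩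
          simpa [Expr.eval, g1, g3, hs, ht] using hne
        intro b hb d hd c hcH hab had hbc hdc hca
        exact Fin.ext ((huniq b hb c hcH hab hbc hca).symm.trans (huniq d hd c hcH had hdc hca))
      · refine Or.inr ?_
        have hden : ρ₄.reg 13 < ρ₄.reg 6 := by rw [c4.rM]; exact h5
        simp only [Prog.den, Expr.eval, hden, if_true, one_ne_zero, if_false]
        obtain ⟨b, c, hs, ht, hbc⟩ := c2.arc _ h5
        rw [Expr.holds_and, haway3 _ b c hs ht] at h6
        obtain ⟨⟨hab, hb, hcH, hca⟩, h7⟩ := h6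
        obtain ⟨d, hd, hdH, had, hdc⟩ := hseen _ h5 b c hs ht
          ((haway ρ₂ rfl rfl rfl rfl rfl _ b c hs ht).mpr ⟨hab, hb, hcH, hca⟩)
        refine ⟨by simp, a, b, c, d, ⟨haH, hb, hcH, hdH⟩, ⟨hab, hbc, hdc.symm, had.symm⟩,
          ⟨hca.symm, ?_⟩, ?_⟩
        · rintro rfl
          simp [Expr.eval, g1, g3, hs, ht, hd] at h7
        · simp [k1, k3, k12, k14, hs, ht, hd]
    · omega
  · omega

theorem findSquare_spec {σ : State} (hc : Ctx G x M σ) :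
    Tri findSquare σ (1500 * (n * (n + M + 1))) fun τ =>
      (τ.reg 15 = 0 ∧ ¬ HasSquare G (supp n (σ.arr 4))) ∨
      (τ.reg 15 = 1 ∧ SquareFound G (supp n (σ.arr 4)) τ) := by
  refine Tri.seq (R := fun τ => τ = σ.setReg 15 0) (Tri.assign rfl) ?_ (S := 2)
    (T := 1300 * (n * (n + M + 1))) ?_
  · rintro σ' f0 rfl
    have c0 := hc.frame f0 (by decide)
    set H := supp n (σ.arr 4) with hH
    have hmain := Tri.forR (r := 14) (rb := 5)
      (p := .ite ((Expr.get 4 (.reg 14)).and (Expr.eq (.reg 15) (.const 0))) squareStep .skip)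
      (σ := σ.setReg 15 0) (T := 540 * (n + M + 1)) (N := n)
      (fun i ρ => (ρ.reg 15 = 0 ∧ ∀ a ∈ H, a.val < i → ∀ b ∈ H, ∀ d ∈ H, ∀ c ∈ H,
          G.Adj a b → G.Adj a d → G.Adj b c → G.Adj d c → c ≠ a → b = d) ∨
        (ρ.reg 15 = 1 ∧ SquareFound G H ρ))
      c0.rn (by decide) (by decide) (by decide) (Or.inl ⟨by simp, by simp⟩) ?_
    · refine hmain.mono ?_ ?_
      · exact mul_bound hc.pos (by omega) (by norm_num)
      · rintro τ _ ⟨⟨h1, h2⟩ | h, -⟩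
        · refine Or.inl ⟨h1, ?_⟩
          rintro ⟨a, ha, b, hb, c, hc', d, hd, hac, hbd, hab, hbc, hcd, hda⟩
          exact hbd (h2 a ha a.2 b hb d hd c hc' hab hda.symm hbc hcd.symm hac.symm)
        · exact Or.inr h
    · rintro i hi ρ hf hr hI
      have cρ := c0.frame hf (by decide)
      have e4 : ρ.arr 4 = σ.arr 4 := hf.arr 4 (by decide)
      have hcost : ((Expr.get 4 (.reg 14)).and (Expr.eq (.reg 15) (.const 0))).cost + 1 ≤ 30 := by
        decide
      refine Tri.cond (T := 500 * (n + M + 1)) (fun hcond => ?_)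
        (fun hcond => Tri.flat _ rfl (by simp only [Prog.mx]; omega) ?_) (by omega)
      · simp only [Expr.holds_and, Expr.holds_eq, Expr.eval, Expr.holds_get, hr] at hcond
        have haH : (⟨i, hi⟩ : Fin n) ∈ supp n (ρ.arr 4) := hcond.1
        refine (squareStep_spec cρ (a := ⟨i, hi⟩) hr hcond.2 haH).mono le_rfl fun τ _ h => ?_
        rw [e4, ← hH] at h
        rcases h with ⟨h1, h2⟩ | ⟨h1, h2⟩
        · refine Or.inl ⟨by simpa using h1, fun a ha hai => ?_⟩
          rcases Nat.lt_succ_iff_lt_or_eq.mp hai with h3 | h3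
          · rcases hI with ⟨-, h4⟩ | ⟨h4, -⟩
            · exact h4 a ha h3
            · omega
          · obtain rfl : a = ⟨i, hi⟩ := Fin.ext h3
            exact h2
        · refine Or.inr ⟨by simpa using h1, ?_⟩
          simpa [SquareFound] using h2
      · simp only [Expr.holds_and, Expr.holds_eq, Expr.eval, Expr.holds_get, hr] at hcond
        simp only [Prog.den]
        rcases hI with ⟨h1, h2⟩ | ⟨h1, h2⟩
        · refine Or.inl ⟨by simpa using h1, fun a ha hai => ?_⟩
          rcases Nat.lt_succ_iff_lt_or_eq.mp hai with h3 | h3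
          · exact h2 a ha h3
          · refine absurd ⟨?_, h1⟩ hcond
            have : σ.arr 4 a ≠ 0 := ha
            rw [e4, ← h3]
            exact this
        · refine Or.inr ⟨by simpa using h1, ?_⟩
          simpa [SquareFound] using h2
  · have h1 : 1 * 1 ≤ n * (n + M + 1) := Nat.mul_le_mul hc.pos (by omega)
    omega

end RAM

/-! ## Trying all sets of a family -/

namespace RAM

variable {n : ℕ} {G : SimpleGraph (Fin n)} {x : Fin 4 → Fin n} {M : ℕ}

/-- The vertex in register `8` belongs to the part that option `k` selects from the label `l`. -/
def optExpr (l : ℕ) : ℕ → Expr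
  | 0 => .const 0
  | 1 => (Expr.eq (.get 2 (.reg 8)) (.const l)).and (Expr.eq (.get 9 (.const l)) (.reg 8))
  | 2 => (Expr.eq (.get 2 (.reg 8)) (.const l)).and (Expr.eq (.get 10 (.const l)) (.reg 8))
  | _ => .eq (.get 2 (.reg 8)) (.const l)

def maskExpr : List (ℕ × ℕ) → Expr
  | [] => (Expr.lt (.get 2 (.reg 8)) (.const 4)).or
      ((Expr.eq (.reg 8) (.reg 23)).or (nonterminal 8).not)
  | p :: c => (optExpr p.1 p.2).or (maskExpr c)

/-- All ways to choose an option for every label. -/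
def choices : List ℕ → List (List (ℕ × ℕ))
  | [] => [[]]
  | l :: ls => (choices ls).flatMap fun c => [(l, 0) :: c, (l, 1) :: c, (l, 2) :: c, (l, 3) :: c]

theorem map_mem_choices (k : ℕ → ℕ) (hk : ∀ l, k l < 4) (ls : List ℕ) :
    ls.map (fun l => (l, k l)) ∈ choices ls := by
  induction ls with
  | nil => simp [choices]
  | cons l ls ih =>
    refine List.mem_flatMap.mpr ⟨_, ih, ?_⟩
    have := hk l
    obtain h | h | h | h : k l = 0 ∨ k l = 1 ∨ k l = 2 ∨ k l = 3 := by omega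
    all_goals simp [h]

/-- The labels of the vertices. -/
def labels (n : ℕ) (σ : State) (u : Fin n) : ℕ := σ.arr 2 u

/-- The entries of a table of vertices, indexed by labels. -/
def entry (n : ℕ) (a : ℕ → ℕ) (l : ℕ) : Set (Fin n) := {u | l ≤ 16 ∧ a l = u}

/-- The set that a choice describes. -/
def maskSet (n : ℕ) (σ : State) (c : List (ℕ × ℕ)) : Set (Fin n) :=
  {u | (maskExpr c).Holds (σ.setReg 8 u)}

theorem holds_maskExpr_map {σ : State} (k : ℕ → ℕ) (ls : List ℕ) :
    (maskExpr (ls.map fun l => (l, k l))).Holds σ ↔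
      (maskExpr []).Holds σ ∨ ∃ l ∈ ls, (optExpr l (k l)).Holds σ := by
  induction ls with
  | nil => simp
  | cons l ls ih =>
    have h : (maskExpr ((l :: ls).map fun l => (l, k l))).Holds σ ↔
        (optExpr l (k l)).Holds σ ∨ (maskExpr (ls.map fun l => (l, k l))).Holds σ :=
      Expr.holds_or
    rw [h, ih, List.exists_mem_cons_iff]
    exact or_left_comm

/-- The four options of `optExpr` are the four possibilities that `InFam` offers for each label. The
vertex `v` and the terminals are covered by the basic mask, whatever their labels are. -/
theorem exists_choice {σ : State} {v : Fin n} (hc : Ctx G x M σ) (hv : σ.reg 23 = v) {ls : List ℕ}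
    (hls : ∀ l ∈ ls, l ≤ 16) {Q : Set (Fin n)}
    (hQ : InFam (labels n σ) v x (entry n (σ.arr 9)) (entry n (σ.arr 10)) ls Q) :
    ∃ c ∈ choices ls, maskSet n σ c = Q := by
  have hopt : ∀ l, ∃ k < 4, l ∈ ls → ∀ u : Fin n, u ≠ v → labels n σ u = l →
      (u ∈ Q ↔ (optExpr l k).Holds (σ.setReg 8 u)) := by
    intro l
    by_cases hl : l ∈ ls
    · obtain ⟨E, hE, h⟩ := hQ.rep l hl
      have hl16 := hls l hl
      have key : ∀ k, (∀ u : Fin n, σ.arr 2 u = l → (u ∈ E ↔ (optExpr l k).Holds (σ.setReg 8 u))) →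
          l ∈ ls → ∀ u : Fin n, u ≠ v → labels n σ u = l →
          (u ∈ Q ↔ (optExpr l k).Holds (σ.setReg 8 u)) :=
        fun k hk _ u huv hul => (h u huv hul).trans (hk u hul)
      rcases hE with hE | hE | hE | hE
      · refine ⟨0, by norm_num, key 0 fun u hul => ?_⟩
        simp [optExpr, Expr.Holds, Expr.eval, hE]
      · refine ⟨1, by norm_num, key 1 fun u hul => ?_⟩
        simp [optExpr, Expr.eval, entry, hul, hE, hl16]
      · refine ⟨2, by norm_num, key 2 fun u hul => ?_⟩
        simp [optExpr, Expr.eval, entry, hul, hE, hl16]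
      · refine ⟨3, by norm_num, key 3 fun u hul => ?_⟩
        simp [optExpr, Expr.eval, labels, hul, hE]
    · exact ⟨0, by omega, fun h => absurd h hl⟩
  choose k hk4 hk using hopt
  have hlab : ∀ l m (u : Fin n), (optExpr l m).Holds (σ.setReg 8 u) → labels n σ u = l := by
    intro l m u h
    match m with
    | 0 => simp [optExpr, Expr.Holds, Expr.eval] at h
    | 1 => simp [optExpr, Expr.eval] at h; exact h.1
    | 2 => simp [optExpr, Expr.eval] at h; exact h.1
    | m + 3 => simpa [optExpr, Expr.eval, labels] using h
  refine ⟨_, map_mem_choices k hk4 ls, ?_⟩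
  have hnt : ∀ u : Fin n, (nonterminal 8).Holds (σ.setReg 8 u) ↔ ∀ j, u ≠ x j := by
    intro u
    have hc' : Ctx G x M (σ.setReg 8 u) :=
      hc.frame (p := .assign 8 (.const 0)) ⟨fun r hr => by
        simp only [Prog.wr, beq_eq_false_iff_ne] at hr
        simp [Ne.symm hr], fun _ _ => rfl⟩ (by decide)
    exact nonterminal_iff hc' (by simp)
  ext u
  have hbase : (maskExpr []).Holds (σ.setReg 8 u) ↔
      labels n σ u < 4 ∨ u = v ∨ ∃ j, u = x j := by
    simp only [maskExpr, Expr.holds_or, Expr.holds_not, Expr.holds_lt, Expr.holds_eq, Expr.eval, hnt u]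
    norm_num [labels, hv, Fin.val_inj]
  simp only [maskSet, Set.mem_ofPred_eq, holds_maskExpr_map, hbase]
  constructor
  · rintro ((h | rfl | ⟨j, rfl⟩) | ⟨l, hl, h⟩)
    · exact hQ.low u h
    · exact hQ.self
    · exact hQ.term j
    · by_cases huv : u = v
      · exact huv ▸ hQ.self
      · exact (hk l hl u huv (hlab _ _ _ h)).mpr h
  · intro hu
    by_cases huv : u = v
    · exact Or.inl (Or.inr (Or.inl huv))
    · rcases hQ.sub u hu with h | h | h | h
      · exact absurd h huv
      · exact Or.inl (Or.inl h)
      · exact Or.inl (Or.inr (Or.inr h))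
      · exact Or.inr ⟨_, h, (hk _ h u huv rfl).mp hu⟩

/-- Unless a tree has been found already, look for one in the set that `c` describes. -/
def leaf (c : List (ℕ × ℕ)) : Prog :=
  .ite (.eq (.reg 20) (.const 0))
    (.seq (fill 8 5 4 (maskExpr c))
    (.seq (.assign 7 (.reg 1))
    (.seq flood
    (.ite linked
      (.seq minimize (.seq findSquare (.ite (.eq (.reg 15) (.const 0)) (.assign 20 (.const 1)) .skip)))
      .skip))))
    .skip

theorem ra_maskExpr (c : List (ℕ × ℕ)) : (maskExpr c).ra 4 = false := by
  induction c with
  | nil => rfl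
  | cons p c ih =>
    obtain ⟨l, k⟩ := p
    have : (optExpr l k).ra 4 = false := by
      match k with
      | 0 => rfl
      | 1 => rfl
      | 2 => rfl
      | k + 3 => rfl
    simp only [maskExpr, Expr.or, Expr.not, Expr.and, Expr.ra, this, ih, Bool.or_self]

theorem area_bounds {n N : ℕ} (hn : 1 ≤ n) (hN : 1 ≤ N) : 1 ≤ n * N ∧ N ≤ n * N ∧ n ≤ n * N :=
  ⟨Nat.mul_le_mul hn hN, Nat.le_mul_of_pos_left _ hn, Nat.le_mul_of_pos_right _ hN⟩

/-- A tree has been found. -/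
def TreeFound (G : SimpleGraph (Fin n)) (x : Fin 4 → Fin n) (τ : State) : Prop :=
  τ.reg 20 = 1 ∧ IsInducedTreeCovering G x (supp n (τ.arr 4))

/-- A good set links the terminals, and no minimal linking set inside it has a square. So if
minimizing is impossible or leaves a square, the set was not good. -/
theorem leaf_spec (ht : TriFree G) (hp : Pendant G x) {σ : State} (hc : Ctx G x M σ)
    (h20 : σ.reg 20 = 0) (c : List (ℕ × ℕ)) :
    Tri (leaf c) σ ((2 * (maskExpr c).cost + 5000) * (n * (n + M + 1))) fun τ =>
      TreeFound G x τ ∨ (τ.reg 20 = 0 ∧ ¬ GoodMask G x (maskSet n σ c)) := by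
  obtain ⟨b1, b2, b3⟩ := area_bounds hc.pos (show 1 ≤ n + M + 1 by omega)
  set W := n * (n + M + 1) with hW
  have hcW : (maskExpr c).cost ≤ (maskExpr c).cost * W := Nat.le_mul_of_pos_right _ b1
  have hcn : (maskExpr c).cost * n ≤ (maskExpr c).cost * W := Nat.mul_le_mul_left _ b3
  refine Tri.cond (T := 2 * ((maskExpr c).cost * W) + 4990 * W) (fun _ => ?_)
    (fun h => absurd (by simpa [Expr.eval] using h20) h)
    (by rw [Nat.add_mul, Nat.mul_assoc]; simp only [Expr.cost]; omega)
  refine Tri.seq (Tri.fill hc.rn (by decide) (ra_maskExpr c) le_rfl) (fun σ₁ f1 h1 => ?_)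
    (S := ((maskExpr c).cost + 13) * (n + 1) + 2) (T := 4000 * W) ?_
  swap
  · have : ((maskExpr c).cost + 13) * (n + 1) =
      (maskExpr c).cost * n + (maskExpr c).cost + 13 * n + 13 := by ring
    omega
  have c1 := hc.frame f1 rfl
  have hs1 : supp n (σ₁.arr 4) = maskSet n σ c := by
    ext u
    rw [mem_supp, h1 u u.2]
    rfl
  refine Tri.seq (R := fun τ => τ = σ₁.setReg 7 (x 0)) (Tri.assign (by simp [Expr.eval, c1.regs.1]))
    (fun σ₂ f2 h2 => ?_) (S := 2) (T := 3900 * W) (by omega)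
  subst h2
  have c2 := c1.frame f2 (by decide)
  refine Tri.seq (flood_spec c2 (s := x 0) (by simp)) (fun σ₃ f3 h3 => ?_)
    (T := 3600 * W) (by omega)
  have c3 := c2.frame f3 (by decide)
  have e20 : σ₃.reg 20 = 0 := by
    rw [f3.reg 20 (by decide), f2.reg 20 (by decide), f1.reg 20 (by rfl), h20]
  rw [setReg_arr, hs1] at h3
  have hs3 : supp n (σ₃.arr 4) = maskSet n σ c := by
    rw [f3.arr 4 (by decide), setReg_arr, hs1]
  have hlc : linked.cost + 1 ≤ 50 := by decide
  refine Tri.cond (T := 3500 * W) (fun hl => ?_) (fun hl => Tri.flat _ rfl (by simp only [Prog.mx]; omega) ?_)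
    (by omega)
  · rw [linked_iff c3 h3, ← hs3] at hl
    refine Tri.seq (minimize_spec c3 hl) (fun σ₄ f4 h4 => ?_) (T := 2500 * W) (by omega)
    have c4 := c3.frame f4 (by decide)
    refine Tri.seq (findSquare_spec c4) (fun σ₅ f5 h5 => ?_) (T := 10) (by omega)
    have e4 : σ₅.arr 4 = σ₄.arr 4 := f5.arr 4 (by decide)
    refine Tri.flat _ rfl (by decide) ?_
    rcases h5 with ⟨h6, h7⟩ | ⟨h6, h7⟩
    · refine Or.inl ⟨by simp [Prog.den, Expr.eval, h6], ?_⟩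
      simp only [Prog.den, Expr.eval, h6, if_true, one_ne_zero, if_false, setReg_arr, e4]
      exact h4.1.isInducedTreeCovering ht hp h7
    · refine Or.inr ⟨?_, fun hg => ?_⟩
      · have e20' : σ₅.reg 20 = 0 := by rw [f5.reg 20 (by decide), f4.reg 20 (by decide), e20]
        simp [Prog.den, Expr.eval, h6, e20']
      -- The minimized set lies inside the mask, so a square in it contradicts goodness.
      · obtain ⟨a, b, c', d, ⟨ha, hb, hc', hd⟩, ⟨k1, k2, k3, k4⟩, ⟨k5, k6⟩, -⟩ := h7
        exact hg.not_hasSquare hp h4.1 (h4.2.trans hs3.subset)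
          ⟨a, ha, b, hb, c', hc', d, hd, k5, k6, k1, k2, k3, k4⟩
  · rw [linked_iff c3 h3] at hl
    exact Or.inr ⟨e20, fun hg => hl hg.link⟩

/-- Look for a tree in all sets of a family. -/
def trial (ls : List ℕ) : Prog := seqAll ((choices ls).map leaf)

/-- Which registers a member of the sequence writes does not depend on its choice. One small
instance, `leaf []`, therefore decides the question for the whole family. -/
theorem seqAll_leaf_wr (r : ℕ) (h : (leaf []).wr r = false) (cs : List (List (ℕ × ℕ))) :
    (seqAll (cs.map leaf)).wr r = false := by
  induction cs with
  | nil => rfl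
  | cons c cs ih =>
    simp only [List.map_cons, seqAll, Prog.wr, ih, Bool.or_false]
    exact h

theorem seqAll_leaf_wa (r : ℕ) (h : (leaf []).wa r = false) (cs : List (List (ℕ × ℕ))) :
    (seqAll (cs.map leaf)).wa r = false := by
  induction cs with
  | nil => rfl
  | cons c cs ih =>
    simp only [List.map_cons, seqAll, Prog.wa, ih, Bool.or_false]
    exact h

theorem trial_wr (ls : List ℕ) (r : ℕ) (h : (leaf []).wr r = false) : (trial ls).wr r = false :=
  seqAll_leaf_wr r h _

theorem trial_wa (ls : List ℕ) (a : ℕ) (h : (leaf []).wa a = false) : (trial ls).wa a = false :=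
  seqAll_leaf_wa a h _

/-- Once a tree has been found, the remaining members of the family only perform their test, and the
tree in array `4` is preserved. -/
theorem seqAll_leaf_skip {cs : List (List (ℕ × ℕ))} {σ : State} (h : σ.reg 20 = 1) :
    Tri (seqAll (cs.map leaf)) σ (10 * cs.length + 1) fun τ => τ = σ := by
  induction cs with
  | nil => exact Tri.flat _ rfl (by simp [seqAll, Prog.mx]) rfl
  | cons c cs ih =>
    refine Tri.seq (S := 10) (T := 10 * cs.length + 1) (R := fun τ => τ = σ)
      (Tri.cond (T := 1) (fun he => ?_) (fun _ => Tri.skip rfl) (by simp [Expr.cost]))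
      (fun τ _ hτ => hτ ▸ ih) (by simp; omega)
    simp [Expr.eval, h] at he

/-- The factor in the time bound for `trial`. -/
def trialCost (cs : List (List (ℕ × ℕ))) : ℕ :=
  (cs.map fun c => 2 * (maskExpr c).cost + 5010).sum + 1

/-- Earlier attempts overwrite the mask but not the labels, the tables or the vertex in register
`23`. All masks can thus be described in terms of the state before the first attempt. -/
theorem maskSet_congr {σ τ : State} (h2 : τ.arr 2 = σ.arr 2) (h9 : τ.arr 9 = σ.arr 9)
    (h10 : τ.arr 10 = σ.arr 10) (h23 : τ.reg 23 = σ.reg 23) (hσ : Ctx G x M σ) (hτ : Ctx G x M τ)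
    (c : List (ℕ × ℕ)) : maskSet n τ c = maskSet n σ c := by
  ext u
  have e1 := hσ.regs
  have e2 := hτ.regs
  show (maskExpr c).Holds _ ↔ (maskExpr c).Holds _
  induction c with
  | nil =>
    simp only [maskExpr, nonterminal, Expr.holds_or, Expr.holds_not, Expr.holds_and, Expr.holds_lt,
      Expr.holds_eq, Expr.eval]
    norm_num [h2, h23, e1, e2]
  | cons p c ih =>
    obtain ⟨l, k⟩ := p
    simp only [maskExpr, Expr.holds_or, ih]
    refine or_congr_left ?_
    match k with
    | 0 => rfl
    | 1 => simp [optExpr, Expr.eval, h2, h9]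
    | 2 => simp [optExpr, Expr.eval, h2, h10]
    | k + 3 => simp [optExpr, Expr.eval, h2]

theorem seqAll_leaf_spec (ht : TriFree G) (hp : Pendant G x) (cs : List (List (ℕ × ℕ))) {σ : State}
    (hc : Ctx G x M σ) (h20 : σ.reg 20 = 0) :
    Tri (seqAll (cs.map leaf)) σ (trialCost cs * (n * (n + M + 1))) fun τ =>
      TreeFound G x τ ∨ (τ.reg 20 = 0 ∧ ∀ c ∈ cs, ¬ GoodMask G x (maskSet n σ c)) := by
  obtain ⟨b1, -, -⟩ := area_bounds hc.pos (show 1 ≤ n + M + 1 by omega)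
  induction cs generalizing σ with
  | nil => exact Tri.flat _ rfl (by simpa [seqAll, Prog.mx, trialCost] using b1) (Or.inr ⟨h20, by simp⟩)
  | cons c cs ih =>
    have hsum : trialCost (c :: cs) = 2 * (maskExpr c).cost + 5010 + trialCost cs := by
      simp [trialCost]; omega
    have hlen : 10 * cs.length + 1 ≤ trialCost cs := by
      simp only [trialCost]
      have : (cs.map fun _ => 10).sum ≤ (cs.map fun c => 2 * (maskExpr c).cost + 5010).sum :=
        List.sum_le_sum fun c _ => by omega
      rw [List.map_const', List.sum_replicate, smul_eq_mul] at this
      omega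
    refine Tri.seq (leaf_spec ht hp hc h20 c) (fun σ₁ f1 h1 => ?_)
      (T := trialCost cs * (n * (n + M + 1))) ?_
    · have c1 := hc.frame f1 rfl
      rcases h1 with h1 | ⟨h1, h2⟩
      · refine (seqAll_leaf_skip h1.1).mono ?_ fun τ _ hτ => Or.inl (hτ ▸ h1)
        exact hlen.trans (Nat.le_mul_of_pos_right _ b1)
      · refine (ih c1 h1).mono le_rfl fun τ _ hτ => ?_
        refine hτ.imp_right fun h3 => ⟨h3.1, ?_⟩
        intro c' hc'
        rcases List.mem_cons.mp hc' with rfl | hc'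
        · exact h2
        · rw [← maskSet_congr (f1.arr 2 rfl) (f1.arr 9 rfl) (f1.arr 10 rfl) (f1.reg 23 rfl) hc c1 c']
          exact h3.2 c' hc'
    · rw [hsum, Nat.add_mul (2 * (maskExpr c).cost + 5010)]
      have : (2 * (maskExpr c).cost + 5000) * (n * (n + M + 1)) ≤
        (2 * (maskExpr c).cost + 5010) * (n * (n + M + 1)) := Nat.mul_le_mul_right _ (by omega)
      omega

/-- This turns a failed search into the absence of good sets in the family. Together with a lemma
that predicts a good set, it forces the desired alternative. -/
theorem trial_spec (ht : TriFree G) (hp : Pendant G x) {ls : List ℕ} (hls : ∀ l ∈ ls, l ≤ 16) {σ : State} {v : Fin n}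
    (hc : Ctx G x M σ) (h20 : σ.reg 20 = 0) (hv : σ.reg 23 = v) :
    Tri (trial ls) σ (trialCost (choices ls) * (n * (n + M + 1))) fun τ =>
      TreeFound G x τ ∨ (τ.reg 20 = 0 ∧ ∀ Q,
        InFam (labels n σ) v x (entry n (σ.arr 9)) (entry n (σ.arr 10)) ls Q → ¬ GoodMask G x Q) := by
  refine (seqAll_leaf_spec ht hp (choices ls) hc h20).mono le_rfl fun τ _ h => ?_
  refine h.imp_right fun h1 => ⟨h1.1, fun Q hQ => ?_⟩
  obtain ⟨c, hc', rfl⟩ := exists_choice hc hv hls hQ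
  exact h1.2 c hc'

theorem tame_leaf {c : List (ℕ × ℕ)} (hc : ∀ p ∈ c, p.1 ≤ 20) : (leaf c).tame := by
  have : (maskExpr c).tame := by
    induction c with
    | nil => rfl
    | cons p c ih =>
      obtain ⟨l, k⟩ := p
      have hl := hc _ List.mem_cons_self
      have h1 := ih fun q hq => hc q (List.mem_cons_of_mem _ hq)
      have h2 : (optExpr l k).tame := by
        match k with
        | 0 => rfl
        | 1 => simpa [optExpr, Expr.and, Expr.tame] using hl
        | 2 => simpa [optExpr, Expr.and, Expr.tame] using hl
        | k + 3 => simpa [optExpr, Expr.tame] using hl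
      simp [maskExpr, Expr.or, Expr.not, Expr.and, Expr.tame, h1, h2]
  have h2 : (leaf c).tame = (maskExpr c).tame := by
    have : flood.tame ∧ minimize.tame ∧ findSquare.tame ∧ linked.tame := by decide
    simp [leaf, Prog.tame, Expr.tame, this, fill, scatter, forR]
  rw [h2, this]

theorem choices_labels {ls : List ℕ} : ∀ c ∈ choices ls, ∀ p ∈ c, p.1 ∈ ls := by
  induction ls with
  | nil => simp [choices]
  | cons l ls ih =>
    intro c hc p hp
    obtain ⟨c', hc', h⟩ := List.mem_flatMap.mp hc
    simp only [List.mem_cons, List.not_mem_nil, or_false] at h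
    rcases h with rfl | rfl | rfl | rfl <;> rcases List.mem_cons.mp hp with rfl | hp <;>
      first | exact List.mem_cons_self | exact List.mem_cons_of_mem _ (ih c' hc' p hp)

theorem tame_trial {ls : List ℕ} (h : ∀ l ∈ ls, l ≤ 20) : (trial ls).tame := by
  have key : ∀ cs : List (List (ℕ × ℕ)), (∀ c ∈ cs, ∀ p ∈ c, p.1 ≤ 20) →
      (seqAll (cs.map leaf)).tame := by
    intro cs
    induction cs with
    | nil => intro _; rfl
    | cons c cs ih =>
      intro hcs
      simp [seqAll, Prog.tame, tame_leaf (hcs c List.mem_cons_self),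
        ih fun c' hc' => hcs c' (List.mem_cons_of_mem _ hc')]
  exact key _ fun c hc p hp => h _ (choices_labels c hc p hp)

end RAM

/-! ## Growing a structure -/

namespace RAM

variable {n : ℕ} {G : SimpleGraph (Fin n)} {x : Fin 4 → Fin n} {M : ℕ}

theorem labels_setArr (σ : State) (v : Fin n) (k : ℕ) :
    labels n (σ.setArr 2 v k) = Function.update (labels n σ) v k := by
  ext u
  by_cases h : u = v
  · subst h; simp [labels]
  · simp [labels, h, Fin.val_inj]

/-- Arrays `9` and `10` hold, for every label, a neighbour and a non-neighbour of `v` with this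
label, or `n`, if there is none. The support of array `14` is the neighbourhood of `v`. -/
structure HasTab (G : SimpleGraph (Fin n)) (v : Fin n) (σ : State) : Prop where
  tab : Tab G (labels n σ) v (entry n (σ.arr 9)) (entry n (σ.arr 10))
  cell_nbr : ∀ l ≤ 16, σ.arr 9 l = n ∨ ∃ u : Fin n, σ.arr 9 l = u
  cell_non : ∀ l ≤ 16, σ.arr 10 l = n ∨ ∃ u : Fin n, σ.arr 10 l = u
  mark : ∀ u : Fin n, σ.arr 14 u ≠ 0 ↔ G.Adj v u

theorem HasTab.congr {v : Fin n} {σ τ : State} (h : HasTab G v σ) (h2 : τ.arr 2 = σ.arr 2)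
    (h9 : τ.arr 9 = σ.arr 9) (h10 : τ.arr 10 = σ.arr 10)
    (h14 : τ.arr 14 = σ.arr 14) : HasTab G v τ := by
  have hl : labels n τ = labels n σ := by ext u; simp [labels, h2]
  obtain ⟨a, b, c, d⟩ := h
  rw [← hl, ← h9, ← h10] at a
  exact ⟨a, by rwa [h9], by rwa [h10], by rwa [h14]⟩

/-- The value `n` is not a vertex and stands for an empty entry, so the conditions of growth rules
become comparisons of table cells with `n`. -/
theorem HasTab.nbr_iff {v : Fin n} {σ : State} (h : HasTab G v σ) {l : ℕ} (hl : l ≤ 16) :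
    σ.arr 9 l = n ↔ ∀ w, G.Adj v w → labels n σ w ≠ l := by
  constructor
  · rintro hn w hw rfl
    obtain ⟨u, -, hu⟩ := h.tab.P_ex w hw
    have := u.2
    omega
  · intro hw
    refine (h.cell_nbr l hl).resolve_right ?_
    rintro ⟨u, hu⟩
    have := h.tab.P_sub l u ⟨hl, hu⟩
    exact hw u this.1 this.2

theorem HasTab.non_iff {v : Fin n} {σ : State} (h : HasTab G v σ) {l : ℕ} (hl : l ≤ 16) :
    σ.arr 10 l = n ↔ ∀ w, labels n σ w = l → G.Adj v w := by
  constructor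
  · rintro hn w rfl
    by_contra hw
    obtain ⟨u, -, hu⟩ := h.tab.M_ex w hw
    have := u.2
    omega
  · intro hw
    refine (h.cell_non l hl).resolve_right ?_
    rintro ⟨u, hu⟩
    have := h.tab.M_sub l u ⟨hl, hu⟩
    exact this.1 (hw u this.2)

/-- Compute the tables of neighbours and non-neighbours of the vertex in register `23`. -/
def mkTab : Prog :=
  .seq (.assign 26 (.const 17))
  (.seq (fill 8 26 9 (.reg 5))
  (.seq (fill 8 26 10 (.reg 5))
  (.seq (fill 8 5 14 (.const 0))
  (.seq (scatter 8 6 14 (.eq (.get 3 (.reg 8)) (.reg 23)) (.get 1 (.reg 8)) (.const 1))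
  (.seq (scatter 8 5 9 (.get 14 (.reg 8)) (.get 2 (.reg 8)) (.reg 8))
    (scatter 8 5 10 (.eq (.get 14 (.reg 8)) (.const 0)) (.get 2 (.reg 8)) (.reg 8)))))))

/-- Writing all neighbours of `v` into the cells of their labels leaves some neighbour in each cell
that is hit, and the same holds for the non-neighbours. `v` counts as a non-neighbour of itself. -/
theorem mkTab_spec {σ : State} (hc : Ctx G x M σ) {v : Fin n} (hv : σ.reg 23 = v)
    (hL : ∀ u, labels n σ u ≤ 16) :
    Tri mkTab σ (800 * (n + M + 1)) fun τ => HasTab G v τ := by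
  -- The labels run from `0` to `16`, so the tables have `17` cells.
  refine Tri.seq (R := fun τ => τ = σ.setReg 26 17) (Tri.assign rfl) ?_ (S := 2)
    (T := 790 * (n + M + 1)) (by omega)
  rintro σ₁ f1 rfl
  have c1 := hc.frame f1 (by decide)
  refine Tri.seq (Tri.fill (N := 17) (by simp) (by decide) rfl le_rfl) (fun σ₂ f2 h2 => ?_)
    (S := 14 * 18 + 2) (T := 530 * (n + M + 1)) (by omega)
  have c2 := c1.frame f2 (by decide)
  refine Tri.seq (Tri.fill (N := 17) (by rw [f2.reg 26 (by decide)]; simp) (by decide) rfl le_rfl)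
    (fun σ₃ f3 h3 => ?_) (S := 14 * 18 + 2) (T := 270 * (n + M + 1)) (by omega)
  have c3 := c2.frame f3 (by decide)
  refine Tri.seq (Tri.fill c3.rn (by decide) rfl le_rfl) (fun σ₄ f4 h4 => ?_)
    (S := 14 * (n + 1) + 2) (T := 240 * (n + M + 1)) (by omega)
  have c4 := c3.frame f4 (by decide)
  refine Tri.seq (Tri.scatter c4.rM (by decide) rfl rfl rfl le_rfl) (fun σ₅ f5 h5 => ?_)
    (S := 18 * (M + 1) + 2) (T := 200 * (n + M + 1)) (by omega)
  have c5 := c4.frame f5 (by decide)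
  have e23 : σ₄.reg 23 = v := by
    rw [f4.reg 23 (by decide), f3.reg 23 (by decide), f2.reg 23 (by decide), f1.reg 23 (by decide), hv]
  have hmk : ∀ u : Fin n, σ₅.arr 14 u ≠ 0 ↔ G.Adj v u := by
    intro u
    rcases h5 u with ⟨e, he, k3, k4, k5⟩ | ⟨k3, k4⟩
    · rw [k5]
      simp only [Expr.holds_eq, Expr.eval, setReg_reg, setReg_arr] at k3 k4
      norm_num [e23] at k3
      norm_num at k4
      obtain ⟨s, t, hs, ht, hst⟩ := c4.arc e he
      obtain rfl : s = v := Fin.ext (hs.symm.trans k3)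
      obtain rfl : t = u := Fin.ext (ht.symm.trans k4)
      simpa [Expr.eval] using hst
    · rw [k4, h4 u u.2]
      simp only [Expr.eval, ne_eq, not_true_eq_false, false_iff]
      intro hvu
      obtain ⟨e, he, hs, ht⟩ := c4.exists_arc v u hvu
      exact k3 e he (by simp [Expr.eval, hs, e23]) (by simp [Expr.eval, ht])
  refine Tri.seq (Tri.scatter c5.rn (by decide) rfl rfl rfl le_rfl) (fun σ₆ f6 h6 => ?_)
    (S := 16 * (n + 1) + 2) (T := 30 * (n + 1) + 2) (by omega)
  have c6 := c5.frame f6 (by decide)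
  refine (Tri.scatter c6.rn (by decide) rfl rfl rfl le_rfl).mono
    (by simp only [Expr.cost]; omega) fun τ f7 h7 => ?_
  have e2 : ∀ u : Fin n, σ₅.arr 2 u = labels n σ u := fun u => by
    rw [f5.arr 2 (by decide), f4.arr 2 (by decide), f3.arr 2 (by decide), f2.arr 2 (by decide)]
    rfl
  have e2' : ∀ u : Fin n, σ₆.arr 2 u = labels n σ u := fun u => by
    rw [f6.arr 2 (by decide), e2]
  have hlab : labels n τ = labels n σ := by
    ext u
    rw [labels, f7.arr 2 (by decide), e2']
  have b9 : ∀ l ≤ 16, σ₅.arr 9 l = n := fun l hl => by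
    rw [f5.arr 9 (by decide), f4.arr 9 (by decide), f3.arr 9 (by decide), h2 l (by omega)]
    simpa [Expr.eval] using c1.rn
  have b10 : ∀ l ≤ 16, σ₆.arr 10 l = n := fun l hl => by
    rw [f6.arr 10 (by decide), f5.arr 10 (by decide), f4.arr 10 (by decide), h3 l (by omega)]
    simpa [Expr.eval] using c2.rn
  have a14 : σ₆.arr 14 = σ₅.arr 14 := f6.arr 14 (by decide)
  have hP : ∀ l ≤ 16, (∃ u : Fin n, G.Adj v u ∧ labels n σ u = l ∧ τ.arr 9 l = u) ∨
      ((∀ u : Fin n, G.Adj v u → labels n σ u ≠ l) ∧ τ.arr 9 l = n) := by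
    intro l hl
    rw [f7.arr 9 (by decide)]
    rcases h6 l with ⟨j, hj, k1, k2, k3⟩ | ⟨k1, k2⟩
    · refine Or.inl ⟨⟨j, hj⟩, (hmk ⟨j, hj⟩).mp (by simpa [Expr.eval] using k1), ?_, ?_⟩
      · rw [← e2]; simpa [Expr.eval] using k2
      · simpa [Expr.eval] using k3
    · refine Or.inr ⟨fun u hu hul => k1 u u.2 ?_ ?_, k2.trans (b9 l hl)⟩
      · simpa [Expr.eval] using (hmk u).mpr hu
      · rw [← hul, ← e2]; simp [Expr.eval]
  have hM : ∀ l ≤ 16, (∃ u : Fin n, ¬ G.Adj v u ∧ labels n σ u = l ∧ τ.arr 10 l = u) ∨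
      ((∀ u : Fin n, ¬ G.Adj v u → labels n σ u ≠ l) ∧ τ.arr 10 l = n) := by
    intro l hl
    rcases h7 l with ⟨j, hj, k1, k2, k3⟩ | ⟨k1, k2⟩
    · refine Or.inl ⟨⟨j, hj⟩, fun h => (hmk ⟨j, hj⟩).mpr h (by simpa [Expr.eval, a14] using k1), ?_, ?_⟩
      · rw [← e2']; simpa [Expr.eval] using k2
      · simpa [Expr.eval] using k3
    · refine Or.inr ⟨fun u hu hul => k1 u u.2 ?_ ?_, k2.trans (b10 l hl)⟩
      · simpa [Expr.eval, a14] using mt (hmk u).mp hu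
      · rw [← hul, ← e2']; simp [Expr.eval]
  refine ⟨?_, fun l hl => (hP l hl).elim (fun ⟨u, h⟩ => Or.inr ⟨u, h.2.2⟩) fun h => Or.inl h.2,
    fun l hl => (hM l hl).elim (fun ⟨u, h⟩ => Or.inr ⟨u, h.2.2⟩) fun h => Or.inl h.2,
    fun u => by rw [f7.arr 14 (by decide), a14, hmk]⟩
  rw [hlab]
  refine ⟨?_, ?_, ?_, ?_, ?_, ?_⟩
  · rintro l u ⟨hl, hu⟩
    rcases hP l hl with ⟨w, h1, h2, h3⟩ | ⟨-, h2⟩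
    · obtain rfl : u = w := Fin.ext (hu.symm.trans h3)
      exact ⟨h1, h2⟩
    · have := u.2
      omega
  · rintro l u ⟨hl, hu⟩
    rcases hM l hl with ⟨w, h1, h2, h3⟩ | ⟨-, h2⟩
    · obtain rfl : u = w := Fin.ext (hu.symm.trans h3)
      exact ⟨h1, h2⟩
    · have := u.2
      omega
  · intro u hu
    rcases hP _ (hL u) with ⟨w, -, -, h3⟩ | ⟨h1, -⟩
    · exact ⟨w, hL u, h3⟩
    · exact absurd rfl (h1 u hu)
  · intro u hu
    rcases hM _ (hL u) with ⟨w, -, -, h3⟩ | ⟨h1, -⟩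
    · exact ⟨w, hL u, h3⟩
    · exact absurd rfl (h1 u hu)
  · exact fun l u hu w hw => Fin.ext (hu.2.symm.trans hw.2)
  · exact fun l u hu w hw => Fin.ext (hu.2.symm.trans hw.2)

/-- The rule applies to the vertex in register `23`. -/
def ruleTest (r : Rule) : Expr :=
  r.none.foldr (fun l e => (Expr.eq (.get 9 (.const l)) (.reg 5)).and e)
    (r.all.foldr (fun l e => (Expr.eq (.get 10 (.const l)) (.reg 5)).and e)
      (.eq (.get 2 (.reg 23)) (.const r.old)))

theorem holds_foldr_and (σ : State) (f : ℕ → Expr) (e : Expr) (ls : List ℕ) :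
    (ls.foldr (fun l e => (f l).and e) e).Holds σ ↔ (∀ l ∈ ls, (f l).Holds σ) ∧ e.Holds σ := by
  induction ls with
  | nil => simp
  | cons l ls ih => simp [ih, and_assoc]

theorem ruleTest_iff {σ : State} (hc : Ctx G x M σ) {v : Fin n} (hv : σ.reg 23 = v)
    (h : HasTab G v σ) {r : Rule} (hr : ∀ l ∈ r.none ++ r.all, l ≤ 16) :
    (ruleTest r).Holds σ ↔ r.Applies G (labels n σ) v := by
  rw [ruleTest, holds_foldr_and, holds_foldr_and]
  simp only [Expr.holds_eq, Expr.eval, hc.rn, hv]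
  have h1 : ∀ l ≤ 16, σ.arr 9 l = n ↔ _ := fun _ => h.nbr_iff
  have h2 : ∀ l ≤ 16, σ.arr 10 l = n ↔ _ := fun _ => h.non_iff
  simp only [List.mem_append] at hr
  constructor
  · rintro ⟨k1, k2, k3⟩
    exact ⟨k3, fun l hl => (h1 l (hr l (Or.inl hl))).mp (k1 l hl),
      fun l hl => (h2 l (hr l (Or.inr hl))).mp (k2 l hl)⟩
  · rintro ⟨k1, k2, k3⟩
    exact ⟨fun l hl => (h1 l (hr l (Or.inl hl))).mpr (k2 l hl),
      fun l hl => (h2 l (hr l (Or.inr hl))).mpr (k3 l hl), k1⟩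

/-- Apply the first rule that applies to the vertex in register `23`, or stop with failure. -/
def applyRules : List Rule → Prog
  | [] => .seq (.assign 22 (.const 1)) (.assign 21 (.const 0))
  | r :: rs => .ite (ruleTest r) (.store 2 (.reg 23) (.const r.new)) (applyRules rs)

theorem applyRules_flat : ∀ rs : List Rule, (applyRules rs).flat
  | [] => rfl
  | r :: rs => by simp [applyRules, Prog.flat, applyRules_flat rs]

theorem applyRules_den {σ : State} (hc : Ctx G x M σ) {v : Fin n} (hv : σ.reg 23 = v)
    (h : HasTab G v σ) : ∀ {rs : List Rule}, (∀ r ∈ rs, ∀ l ∈ r.none ++ r.all, l ≤ 16) →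
    (∃ r ∈ rs, r.Applies G (labels n σ) v ∧ (applyRules rs).den σ = σ.setArr 2 v r.new) ∨
    ((∀ r ∈ rs, ¬ r.Applies G (labels n σ) v) ∧
      (applyRules rs).den σ = (σ.setReg 22 1).setReg 21 0)
  | [], _ => Or.inr ⟨by simp, rfl⟩
  | r :: rs, hrs => by
      have hiff := ruleTest_iff hc hv h (hrs r List.mem_cons_self)
      by_cases hr : r.Applies G (labels n σ) v
      · refine Or.inl ⟨r, List.mem_cons_self, hr, ?_⟩
        have : (ruleTest r).eval σ ≠ 0 := hiff.mpr hr
        simp only [applyRules, Prog.den, this, if_false, Expr.eval, hv]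
      · have h0 : (ruleTest r).eval σ = 0 := by
          by_contra h'
          exact hr (hiff.mp h')
        have hd : (applyRules (r :: rs)).den σ = (applyRules rs).den σ := by
          simp only [applyRules, Prog.den, h0, if_true]
        rw [hd]
        rcases applyRules_den hc hv h fun r' hr' => hrs r' (List.mem_cons_of_mem _ hr') with
          ⟨r', hr', h1⟩ | ⟨h1, h2⟩
        · exact Or.inl ⟨r', List.mem_cons_of_mem _ hr', h1⟩
        · exact Or.inr ⟨fun r' hr' => (List.mem_cons.mp hr').elim (fun h => h ▸ hr) (h1 r'), h2⟩

/-- Register `21` says whether the phase goes on. It is cleared when no candidate arc is left, and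
also by `applyRules` when no rule fits, in which case register `22` is set. -/
def phaseStep (cand : Expr) (rs : List Rule) : Prog :=
  .seq (find 8 6 24 cand)
    (.ite (.lt (.reg 24) (.reg 6))
      (.seq (.assign 23 (.get 3 (.reg 24))) (.seq mkTab (applyRules rs)))
      (.assign 21 (.const 0)))

/-- Apply the rules to tails of arcs with `cand` until there is none, or no rule applies. In the
latter case register `22` is `1` and register `23` holds the vertex. -/
def phase (cand : Expr) (rs : List Rule) : Prog :=
  .seq (.seq (.assign 21 (.const 1)) (.assign 22 (.const 0))) (.loop (.reg 21) (phaseStep cand rs))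

theorem applyRules_wr (s : ℕ) (h1 : s ≠ 21) (h2 : s ≠ 22) : ∀ rs : List Rule, (applyRules rs).wr s = false
  | [] => by simp [applyRules, Prog.wr, Ne.symm h1, Ne.symm h2]
  | r :: rs => by simp [applyRules, Prog.wr, applyRules_wr s h1 h2 rs]

theorem applyRules_wa (a : ℕ) (h : a ≠ 2) : ∀ rs : List Rule, (applyRules rs).wa a = false
  | [] => by simp [applyRules, Prog.wa]
  | r :: rs => by simp [applyRules, Prog.wa, applyRules_wa a h rs, Ne.symm h]

theorem phase_wr (s : ℕ) (h1 : s ≠ 21) (h2 : s ≠ 22) (h3 : (phase (.const 0) []).wr s = false)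
    (cand : Expr) (rs : List Rule) : (phase cand rs).wr s = false := by
  have h4 := applyRules_wr s h1 h2 rs
  simp only [phase, phaseStep, find, forR, Prog.wr, Bool.or_eq_false_iff, h4, and_true] at h3 ⊢
  tauto

theorem phase_wa (a : ℕ) (h : a ≠ 2) (h3 : mkTab.wa a = false)
    (cand : Expr) (rs : List Rule) : (phase cand rs).wa a = false := by
  have h4 := applyRules_wa a h rs
  simp [phase, phaseStep, find, forR, Prog.wa, h4, h3]

theorem phase_safe (cand : Expr) (rs : List Rule) : (phase cand rs).safe = true := by
  simp [Prog.safe, phase_wr, phase_wa, show (phase (.const 0) []).wr 1 = false from rfl,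
    show (phase (.const 0) []).wr 2 = false from rfl, show (phase (.const 0) []).wr 3 = false from rfl,
    show (phase (.const 0) []).wr 4 = false from rfl, show (phase (.const 0) []).wr 5 = false from rfl,
    show (phase (.const 0) []).wr 6 = false from rfl, show mkTab.wa 0 = false from rfl,
    show mkTab.wa 1 = false from rfl, show mkTab.wa 3 = false from rfl]

/-- This serves both kinds of structure. A round takes linear time, and a successful one lowers the
weight `w` of the label of some vertex. Weights are at most `2`, so there are `O(n)` rounds. Here
`C` is the condition on the labels of tail and head that makes the tail a candidate. -/
theorem phase_spec {cand : Expr} {rs : List Rule} (C : ℕ → ℕ → Prop) (Inv : (Fin n → ℕ) → Prop)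
    (w : ℕ → ℕ) (hrs : ∀ r ∈ rs, ∀ l ∈ r.none ++ r.all, l ≤ 16)
    (hw : ∀ r ∈ rs, w r.new < w r.old) (hw2 : ∀ l, w l ≤ 2) (hle : ∀ L, Inv L → ∀ u, L u ≤ 16)
    (hgrow : ∀ L v, Inv L → (∃ u, G.Adj v u ∧ C (L v) (L u)) → ∀ r ∈ rs, r.Applies G L v →
      Inv (Function.update L v r.new))
    (hrr : cand.rr 24 = false)
    (hcand : ∀ (ρ : State) e, Ctx G x M ρ →
      (cand.Holds (ρ.setReg 8 e) ↔ C (ρ.arr 2 (ρ.arr 3 e)) (ρ.arr 2 (ρ.arr 1 e))))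
    (hcost : cand.cost ≤ 89) (hmx : (applyRules rs).mx ≤ 3000)
    {σ : State} (hc : Ctx G x M σ) (hI : Inv (labels n σ)) :
    Tri (phase cand rs) σ (20000 * (n * (n + M + 1))) fun τ => Inv (labels n τ) ∧
      ((τ.reg 22 = 0 ∧ ∀ v u, G.Adj v u → ¬ C (labels n τ v) (labels n τ u)) ∨
       (τ.reg 22 = 1 ∧ ∃ v : Fin n, τ.reg 23 = v ∧ (∃ u, G.Adj v u ∧ C (labels n τ v) (labels n τ u)) ∧
        HasTab G v τ ∧ ∀ r ∈ rs, ¬ r.Applies G (labels n τ) v)) := by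
  set Post : State → Prop := fun τ =>
    (τ.reg 22 = 0 ∧ ∀ v u, G.Adj v u → ¬ C (labels n τ v) (labels n τ u)) ∨
    (τ.reg 22 = 1 ∧ ∃ v : Fin n, τ.reg 23 = v ∧ (∃ u, G.Adj v u ∧ C (labels n τ v) (labels n τ u)) ∧
      HasTab G v τ ∧ ∀ r ∈ rs, ¬ r.Applies G (labels n τ) v) with hPost
  obtain ⟨b1, b2, b3⟩ := area_bounds hc.pos (show 1 ≤ n + M + 1 by omega)
  refine Tri.seq (R := fun τ => τ = (σ.setReg 21 1).setReg 22 0) (Tri.flat _ rfl (by decide) rfl) ?_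
    (S := 4) (T := 19000 * (n * (n + M + 1))) (by omega)
  rintro σ₁ f1 rfl
  have c1 := hc.frame f1 (by decide)
  -- The measure is the total weight plus register `21`. The register accounts for the last round,
  -- which changes no label.
  have hmain := Tri.loop (e := .reg 21) (p := phaseStep cand rs)
    (σ := (σ.setReg 21 1).setReg 22 0) (T := 4000 * (n + M + 1))
    (fun ρ => Inv (labels n ρ) ∧ ((ρ.reg 21 = 1 ∧ ρ.reg 22 = 0) ∨ (ρ.reg 21 = 0 ∧ Post ρ)))
    (fun ρ => ∑ u : Fin n, w (labels n ρ u) + ρ.reg 21) ⟨hI, Or.inl (by simp)⟩ ?_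
  · refine hmain.mono ?_ ?_
    · have hsum : ∑ u : Fin n, w (labels n ((σ.setReg 21 1).setReg 22 0) u) ≤ 2 * n := by
        refine (Finset.sum_le_sum (g := fun _ => 2) fun u _ => hw2 _).trans ?_
        simp [Nat.mul_comm]
      have hr : ((σ.setReg 21 1).setReg 22 0).reg 21 = 1 := by simp
      have hpos := hc.pos
      calc _ ≤ (4002 * (n + M + 1)) * (4 * n) := by
            refine Nat.mul_le_mul ?_ ?_
            · simp only [Expr.cost]; omega
            · rw [hr]; omega
        _ = 16008 * (n * (n + M + 1)) := by ring
        _ ≤ _ := Nat.mul_le_mul_right _ (by norm_num)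
    · rintro τ - ⟨⟨h1, h2⟩, h3⟩
      simp only [Expr.eval] at h3
      rcases h2 with h2 | h2
      · omega
      · exact ⟨h1, h2.2⟩
  · rintro ρ hf ⟨hIρ, hρ⟩ h21
    simp only [Expr.eval] at h21
    obtain ⟨e21, e22⟩ : ρ.reg 21 = 1 ∧ ρ.reg 22 = 0 := hρ.resolve_right fun h => h21 h.1
    have cρ : Ctx G x M ρ := c1.frame hf.seq_right (p := phase cand rs) (phase_safe cand rs)
    refine Tri.seq (Tri.find cρ.rM (by decide) (by decide) (by decide) hrr
      (Nat.add_le_add_right (Nat.mul_le_mul_right _ (Nat.add_le_add_right hcost 11)) 4))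
      (fun ρ₁ f2 h2 => ?_) (S := 100 * (M + 1) + 4) (T := 3850 * (n + M + 1)) (by omega)
    have c2 := cρ.frame f2 rfl
    have e2 : ρ₁.arr 2 = ρ.arr 2 := f2.arr 2 rfl
    have hl1 : labels n ρ₁ = labels n ρ := by ext u; simp [labels, e2]
    have e22' : ρ₁.reg 22 = 0 := (f2.reg 22 rfl).trans e22
    have e21' : ρ₁.reg 21 = 1 := (f2.reg 21 rfl).trans e21
    refine Tri.cond (T := 3840 * (n + M + 1)) (fun hcond => ?_) (fun hcond => ?_)
      (by simp only [Expr.cost]; omega)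
    · simp only [Expr.holds_lt, Expr.eval, c2.rM] at hcond
      obtain ⟨h3, h4⟩ : ρ₁.reg 24 < M ∧ cand.Holds (ρ.setReg 8 (ρ₁.reg 24)) :=
        h2.resolve_left fun h => by omega
      rw [hcand ρ _ cρ] at h4
      obtain ⟨v, u, hv, hu, hvu⟩ := cρ.arc _ h3
      rw [hv, hu] at h4
      have hC : ∃ u, G.Adj v u ∧ C (labels n ρ v) (labels n ρ u) := ⟨u, hvu, h4⟩
      refine Tri.seq (R := fun τ => τ = ρ₁.setReg 23 v) (S := 3) (T := 3830 * (n + M + 1))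
        (Tri.assign ?_) ?_ (by omega)
      · simp only [Expr.eval]
        rw [f2.arr 3 rfl, hv]
      rintro ρ₂ f3 rfl
      have c3 := c2.frame f3 (by decide)
      refine Tri.seq (mkTab_spec c3 (v := v) (by simp) ?_) (fun ρ₃ f4 h5 => ?_)
        (T := 3000 * (n + M + 1)) (by omega)
      · intro z
        exact hle _ (hl1 ▸ hIρ) z
      have c4 := c3.frame f4 (by decide)
      have hl3 : labels n ρ₃ = labels n ρ := by
        ext z; simp [labels, f4.arr 2 (by decide), e2]
      have e23 : ρ₃.reg 23 = v := by rw [f4.reg 23 (by decide)]; simp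
      have e21'' : ρ₃.reg 21 = 1 := by rw [f4.reg 21 (by decide)]; simpa using e21'
      have e22'' : ρ₃.reg 22 = 0 := by rw [f4.reg 22 (by decide)]; simpa using e22'
      refine Tri.flat _ (applyRules_flat rs) (by omega) ?_
      rcases applyRules_den c4 e23 h5 hrs with ⟨r, hr, ha, hd⟩ | ⟨hno, hd⟩
      · rw [hd, labels_setArr]
        rw [hl3] at ha ⊢
        refine ⟨⟨hgrow _ v hIρ hC r hr ha, Or.inl ⟨by simpa using e21'', by simpa using e22''⟩⟩, ?_⟩
        rw [setArr_reg, e21'', e21]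
        refine Nat.add_lt_add_right (Finset.sum_lt_sum (fun z _ => ?_) ⟨v, Finset.mem_univ v, ?_⟩) 1
        · by_cases hz : z = v
          · subst hz
            simpa [ha.1] using (hw r hr).le
          · simp [hz]
        · simpa [ha.1] using hw r hr
      · rw [hd]
        have hl4 : labels n ((ρ₃.setReg 22 1).setReg 21 0) = labels n ρ := hl3
        refine ⟨⟨hl4 ▸ hIρ, Or.inr ⟨by simp, Or.inr ⟨by simp, v, by simpa using e23, ?_, ?_, ?_⟩⟩⟩, ?_⟩
        · rw [hl4]; exact hC
        · exact h5.congr rfl rfl rfl rfl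
        · exact hno
        · rw [hl4]; simp [e21]
    · simp only [Expr.holds_lt, Expr.eval, c2.rM] at hcond
      have h3 := (h2.resolve_right fun h => hcond h.1).2
      refine Tri.flat _ rfl (by simp only [Prog.mx, Expr.cost]; omega) ?_
      have hl4 : labels n (ρ₁.setReg 21 0) = labels n ρ := hl1
      simp only [Prog.den, Expr.eval]
      refine ⟨⟨hl4 ▸ hIρ, Or.inr ⟨by simp, Or.inl ⟨by simpa using e22', fun v u hvu => ?_⟩⟩⟩, ?_⟩
      · obtain ⟨e, he, hv, hu⟩ := cρ.exists_arc v u hvu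
        have := h3 e he
        rw [hcand ρ _ cρ, hv, hu] at this
        rw [hl4]
        exact this
      · rw [hl4]; simp [e21]

end RAM

/-! ## The square structure around a cycle of length four -/

namespace RAM

variable {n : ℕ} {G : SimpleGraph (Fin n)} {x : Fin 4 → Fin n} {M : ℕ}

/-- The arc in register `8` goes from a vertex that has been reached to the cycle. -/
def toCycle : Expr :=
  (Expr.get 5 (.get 3 (.reg 8))).and
    ((Expr.lt (.const 3) (.get 2 (.get 1 (.reg 8)))).and (Expr.lt (.get 2 (.get 1 (.reg 8))) (.const 8)))

/-- Label the vertices that the terminal in register `j + 1` reaches. -/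
def place (j : ℕ) : Prog :=
  .seq (.assign 7 (.reg (j + 1)))
  (.seq flood
  (.seq (find 8 6 25 toCycle)
  (.seq (.assign 25 (.sub (.get 2 (.get 1 (.reg 25))) (.const 4)))
  (.seq (scatter 8 5 2 (.get 5 (.reg 8)) (.reg 8) (.reg 25))
    (.seq (.store 16 (.reg 25) (.reg (j + 1))) (.store 17 (.reg 25) (.const j)))))))

/-- The terminals up to `j` have been treated, and lie in the order `π` around the cycle `c`. -/
structure PlaceInv (G : SimpleGraph (Fin n)) (x : Fin 4 → Fin n) (H : Set (Fin n)) (c : ℕ → Fin n)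
    (π : Equiv.Perm (Fin 4)) (j : ℕ) (ρ : State) : Prop where
  low : ∀ (k : Fin 4) u, labels n ρ u = k ↔ (π k).val < j ∧ RIn G H (x (π k)) u
  cyc : ∀ (k : Fin 4) u, labels n ρ u = 4 + k ↔ u = c k
  le : ∀ u, labels n ρ u ≤ 8
  mask : supp n (ρ.arr 4) = H
  perm : ∀ k : Fin 4, (π k).val < j → ρ.arr 16 k = x (π k) ∧ ρ.arr 17 k = π k

/-- The search stays off the cycle and finds the component of the terminal. Any arc from it to the
cycle reveals, by the label of its head, the position of the terminal in the cyclic order. -/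
theorem place_spec {H : Set (Fin n)} {c : ℕ → Fin n} {π : Equiv.Perm (Fin 4)}
    (hinj : ∀ k k' : Fin 4, c k = c k' → k = k') (hcH : ∀ k, c k ∉ H)
    (hπ : ∀ k : Fin 4, (∃ z, RIn G H (x (π k)) z ∧ G.Adj z (c k)) ∧
      ∀ z k', RIn G H (x (π k)) z → G.Adj z (c k') → c k' = c k)
    {σ : State} (hc : Ctx G x M σ) (j : Fin 4) (hI : PlaceInv G x H c π j σ) :
    Tri (place j) σ (500 * (n + M + 1)) fun τ => PlaceInv G x H c π (j + 1) τ := by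
  obtain ⟨k₀, rfl⟩ : ∃ k₀, π k₀ = j := ⟨π.symm j, by simp⟩
  refine Tri.seq (R := fun τ => τ = σ.setReg 7 (x (π k₀))) (S := 2) (T := 490 * (n + M + 1))
    (Tri.assign (by simp [Expr.eval, hc.rx])) ?_ (by omega)
  rintro σ₁ f1 rfl
  have c1 := hc.frame f1 rfl
  refine Tri.seq (flood_spec c1 (s := x (π k₀)) (by simp)) (fun σ₂ f2 h2 => ?_)
    (T := 270 * (n + M + 1)) (by omega)
  have c2 := c1.frame f2 (by decide)
  rw [setReg_arr, hI.mask] at h2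
  have hvis : ∀ u : Fin n, σ₂.arr 5 u ≠ 0 ↔ RIn G H (x (π k₀)) u := fun u => Set.ext_iff.mp h2 u
  have e2 : ∀ u : Fin n, σ₂.arr 2 u = labels n σ u := fun u => by rw [f2.arr 2 (by decide)]; rfl
  refine Tri.seq (Tri.find c2.rM (by decide) (by decide) (by decide) (by decide)
    (Nat.add_le_add_right (Nat.mul_le_mul_right _ (by decide)) 4)) (fun σ₃ f3 h3 => ?_)
    (S := 100 * (M + 1) + 4) (T := 150 * (n + M + 1)) (by omega)
  have c3 := c2.frame f3 (by decide)
  have hcond : ∀ e < M, ∀ s t : Fin n, σ₂.arr 3 e = s → σ₂.arr 1 e = t →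
      (toCycle.Holds (σ₂.setReg 8 e) ↔
        RIn G H (x (π k₀)) s ∧ 4 ≤ labels n σ t ∧ labels n σ t < 8) := by
    intro e he s t hs ht
    simp only [toCycle, Expr.holds_and, Expr.holds_get, Expr.holds_lt, Expr.eval, setReg_reg,
      setReg_arr, if_true, hs, ht, hvis, e2]
    exact Iff.rfl
  obtain ⟨hlt, hh⟩ : σ₃.reg 25 < M ∧ toCycle.Holds (σ₂.setReg 8 (σ₃.reg 25)) := by
    refine h3.resolve_left fun h => ?_
    obtain ⟨z, hz, hzc⟩ := (hπ k₀).1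
    obtain ⟨e, he, hs, ht⟩ := c2.exists_arc z (c k₀) hzc
    have h4 := (hI.cyc k₀ _).mpr rfl
    refine h.2 e he ((hcond e he z _ hs ht).mpr ⟨hz, ?_, ?_⟩) <;> omega
  obtain ⟨s, t, hs, ht, hst⟩ := c2.arc _ hlt
  rw [hcond _ hlt s t hs ht] at hh
  -- The component of a terminal touches one cycle vertex only, so it does not matter which arc the
  -- search returned.
  have hlt' : labels n σ t = 4 + k₀ := by
    have h4 := (hI.cyc ⟨labels n σ t - 4, by omega⟩ t).mp (by simp only; omega)
    have h5 := (hπ k₀).2 s _ hh.1 (h4 ▸ hst)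
    rw [h4, h5]
    exact (hI.cyc k₀ _).mpr rfl
  refine Tri.seq (R := fun τ => τ = σ₃.setReg 25 k₀) (S := 6) (T := 140 * (n + M + 1))
    (Tri.assign ?_) ?_ (by omega)
  · simp only [Expr.eval, f3.arr 1 (by decide), f3.arr 2 (by decide), ht, e2, hlt']
    rw [Nat.add_sub_cancel_left]
  rintro σ₄ f4 rfl
  have c4 := c3.frame f4 (by decide)
  refine Tri.seq (Tri.scatter c4.rn (by decide) rfl rfl rfl le_rfl) (fun σ₅ f5 h5 => ?_)
    (S := 15 * (n + 1) + 2) (T := 20) (by omega)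
  have c5 := c4.frame f5 (by decide)
  have e25 : σ₅.reg 25 = k₀ := by rw [f5.reg 25 (by decide)]; simp
  refine Tri.flat _ rfl (by simp only [Prog.mx, Expr.cost]; omega) ?_
  have hden : Prog.den (.seq (.store 16 (.reg 25) (.reg ((π k₀).val + 1)))
      (.store 17 (.reg 25) (.const (π k₀).val))) σ₅ =
      (σ₅.setArr 16 k₀ (x (π k₀))).setArr 17 k₀ (π k₀) := by
    simp [Prog.den, Expr.eval, e25, c5.rx]
  rw [hden]
  have a5 : ∀ u : Fin n, (σ₃.setReg 25 k₀).arr 5 u ≠ 0 ↔ RIn G H (x (π k₀)) u := by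
    intro u
    rw [setReg_arr, f3.arr 5 (by decide), hvis]
  have hlab : ∀ u : Fin n, (RIn G H (x (π k₀)) u ∧
      labels n ((σ₅.setArr 16 k₀ (x (π k₀))).setArr 17 k₀ (π k₀)) u = k₀) ∨
      (¬ RIn G H (x (π k₀)) u ∧
      labels n ((σ₅.setArr 16 k₀ (x (π k₀))).setArr 17 k₀ (π k₀)) u = labels n σ u) := by
    intro u
    have hl : labels n ((σ₅.setArr 16 k₀ (x (π k₀))).setArr 17 k₀ (π k₀)) u = σ₅.arr 2 u := by
      simp [labels]
    rw [hl]
    rcases h5 u with ⟨m, hm, k1, k2, k3⟩ | ⟨k1, k2⟩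
    · have hmu : m = u := by simpa [Expr.eval] using k2
      subst hmu
      refine Or.inl ⟨(a5 u).mp ?_, ?_⟩
      · simpa [Expr.eval] using k1
      · rw [k3]; simp [Expr.eval]
    · refine Or.inr ⟨fun hu => k1 u u.2 ?_ ?_, ?_⟩
      · simpa [Expr.eval] using (a5 u).mpr hu
      · simp [Expr.eval]
      · rw [k2, setReg_arr, f3.arr 2 (by decide), e2]
  -- Components of different terminals are disjoint because they are attached to different cycle
  -- vertices.
  have hdis : ∀ k u, RIn G H (x (π k)) u → RIn G H (x (π k₀)) u → k = k₀ := by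
    intro k u hu hu'
    obtain ⟨z, hz, hzc⟩ := (hπ k₀).1
    exact (hinj _ _ ((hπ k).2 z k₀ (hu.trans (hu'.symm.trans hz)) hzc)).symm
  have hout : ∀ k u, RIn G H (x (π k₀)) u → u ≠ c k := by
    rintro k u hu rfl
    exact hcH k hu.right
  refine ⟨?_, ?_, ?_, ?_, ?_⟩
  · intro k u
    have hk₀ : (π k).val < (π k₀).val + 1 ↔ (π k).val < (π k₀).val ∨ k = k₀ := by
      rw [Nat.lt_succ_iff_lt_or_eq, Fin.val_inj, π.injective.eq_iff]
    rw [hk₀]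
    rcases hlab u with ⟨h6, h7⟩ | ⟨h6, h7⟩
    · rw [h7, Fin.val_inj]
      constructor
      · rintro rfl
        exact ⟨Or.inr rfl, h6⟩
      · rintro ⟨-, h8⟩
        exact (hdis k u h8 h6).symm
    · rw [h7, hI.low]
      constructor
      · rintro ⟨h8, h9⟩
        exact ⟨Or.inl h8, h9⟩
      · rintro ⟨h8 | rfl, h9⟩
        · exact ⟨h8, h9⟩
        · exact absurd h9 h6
  · intro k u
    rcases hlab u with ⟨h6, h7⟩ | ⟨h6, h7⟩
    · rw [h7]
      have := k₀.2
      exact ⟨fun h => by omega, fun h => absurd h (hout k u h6)⟩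
    · rw [h7, hI.cyc]
  · intro u
    rcases hlab u with ⟨h6, h7⟩ | ⟨h6, h7⟩
    · have := k₀.2
      omega
    · rw [h7]; exact hI.le u
  · rw [← hI.mask]
    ext u
    simp [f5.arr 4 (by decide), f3.arr 4 (by decide), f2.arr 4 (by decide)]
  · intro k hk
    have h16 : σ₅.arr 16 = σ.arr 16 := by
      rw [f5.arr 16 (by decide), setReg_arr, f3.arr 16 (by decide), f2.arr 16 (by decide), setReg_arr]
    have h17 : σ₅.arr 17 = σ.arr 17 := by
      rw [f5.arr 17 (by decide), setReg_arr, f3.arr 17 (by decide), f2.arr 17 (by decide), setReg_arr]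
    by_cases hkk : k = k₀
    · subst hkk; simp
    · have hne : (π k).val ≠ (π k₀).val := fun h => hkk (π.injective (Fin.ext h))
      have hne' : k.val ≠ k₀.val := fun h => hkk (Fin.ext h)
      have := hI.perm k (by omega)
      simpa [hne', h16, h17] using this

/-- Arrays `16` and `17` hold the terminals and their indices in the order `π`. -/
def HasPerm (x : Fin 4 → Fin n) (π : Equiv.Perm (Fin 4)) (σ : State) : Prop :=
  ∀ k : Fin 4, σ.arr 16 k = x (π k) ∧ σ.arr 17 k = π k

/-- Label the vertices according to the cycle in registers `16-19`, in the support of array `4`. -/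
def labelSquare : Prog :=
  .seq (fill 8 5 2 (.const 8))
  (.seq (.seq (.store 4 (.reg 16) (.const 0)) (.seq (.store 4 (.reg 17) (.const 0))
    (.seq (.store 4 (.reg 18) (.const 0)) (.seq (.store 4 (.reg 19) (.const 0))
    (.seq (.store 2 (.reg 16) (.const 4)) (.seq (.store 2 (.reg 17) (.const 5))
    (.seq (.store 2 (.reg 18) (.const 6)) (.store 2 (.reg 19) (.const 7)))))))))
  (.seq (place 0) (.seq (place 1) (.seq (place 2) (place 3)))))

/-- The cycle vertices get the labels `4` to `7` and leave the mask, so that the four searches run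
in `H` without the cycle. The order `π` is known only from `MinLink.square`; the program discovers
it terminal by terminal. -/
theorem labelSquare_spec (hp : Pendant G x) {σ : State} (hc : Ctx G x M σ)
    (hm : MinLink G x (supp n (σ.arr 4))) (hs : SquareFound G (supp n (σ.arr 4)) σ) :
    Tri labelSquare σ (3000 * (n + M + 1)) fun τ =>
      ∃ π : Equiv.Perm (Fin 4), SqInv G (x ∘ π) (labels n τ) ∧ HasPerm x π τ := by
  obtain ⟨a, b, c, d, ⟨ha, hb, hc', hd⟩, ⟨h1, h2, h3, h4⟩, ⟨h5, h6⟩, e16, e17, e18, e19⟩ := hs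
  have hcyc := cycIn_of_square ha hb hc' hd h5 h6 h1 h2 h3 h4
  set f : ℕ → Fin n := fun k => if k % 4 = 0 then a else if k % 4 = 1 then b else
    if k % 4 = 2 then c else d with hf
  obtain ⟨π, hπ⟩ := hm.square hp hcyc
  set H := supp n (σ.arr 4) with hH
  have hinj : ∀ k k' : Fin 4, f k = f k' → k = k' := fun k k' h =>
    Fin.ext (hcyc.inj _ k.2 _ k'.2 h)
  have hrange : Set.range f = {a, b, c, d} := by
    ext u
    constructor
    · rintro ⟨k, rfl⟩
      simp only [hf]
      split_ifs <;> simp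
    · rintro (rfl | rfl | rfl | rfl)
      · exact ⟨0, rfl⟩
      · exact ⟨1, rfl⟩
      · exact ⟨2, rfl⟩
      · exact ⟨3, rfl⟩
  have hab : a ≠ b := h1.ne
  have hbc : b ≠ c := h2.ne
  have hcd : c ≠ d := h3.ne
  have hda : d ≠ a := h4.ne
  refine Tri.seq (Tri.fill hc.rn (by decide) rfl le_rfl) (fun σ₁ f1 g1 => ?_)
    (S := 14 * (n + 1) + 2) (T := 2900 * (n + M + 1)) (by omega)
  have c1 := hc.frame f1 (by decide)
  refine Tri.seq (S := 30) (T := 2800 * (n + M + 1))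
    (R := fun τ => PlaceInv G x (H \ Set.range f) f π (0 : Fin 4) τ)
    (Tri.flat _ rfl (by decide) ?_) (fun σ₂ f2 g2 => ?_) (by omega)
  · simp only [Prog.den, Expr.eval, setArr_reg, f1.reg 16 (by decide), f1.reg 17 (by decide),
      f1.reg 18 (by decide), f1.reg 19 (by decide), e16, e17, e18, e19]
    have hl : ∀ u : Fin n, labels n ((((((((σ₁.setArr 4 a 0).setArr 4 b 0).setArr 4 c 0).setArr 4
        d 0).setArr 2 a 4).setArr 2 b 5).setArr 2 c 6).setArr 2 d 7) u =
        if u = d then 7 else if u = c then 6 else if u = b then 5 else if u = a then 4 else 8 := by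
      intro u
      have := g1 u u.2
      simp [labels, Fin.val_inj, this, Expr.eval]
    refine ⟨fun k u => ?_, fun k u => ?_, fun u => ?_, ?_, fun k hk => by simp at hk⟩
    · rw [hl]
      have := k.2
      refine ⟨fun h => ?_, fun h => by simp at h⟩
      split_ifs at h <;> omega
    · rw [hl]
      have hfa : f 0 = a := rfl
      have hfb : f 1 = b := rfl
      have hfc : f 2 = c := rfl
      have hfd : f 3 = d := rfl
      have : f k = if k = 0 then a else if k = 1 then b else if k = 2 then c else d := by
        fin_cases k <;> rfl
      rw [this]
      by_cases u1 : u = d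
      · subst u1
        fin_cases k <;> simp [hcd.symm, h6.symm, hda]
      · by_cases u2 : u = c
        · subst u2
          fin_cases k <;> simp [u1, hbc.symm, h5.symm]
        · by_cases u3 : u = b
          · subst u3
            fin_cases k <;> simp [u1, u2, hab.symm]
          · by_cases u4 : u = a
            · subst u4
              fin_cases k <;> simp [u1, u2, u3]
            · fin_cases k <;> simp [u1, u2, u3, u4]
    · rw [hl]
      split_ifs <;> omega
    · ext u
      have e4 : σ₁.arr 4 = σ.arr 4 := f1.arr 4 (by decide)
      simp only [mem_supp, setArr_get, Set.mem_sdiff, hrange, hH, e4, Fin.val_inj,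
        Set.mem_insert_iff, Set.mem_singleton_iff]
      norm_num
      tauto
  · have c2 := c1.frame f2 (by decide)
    have hplace : ∀ {ρ : State}, Ctx G x M ρ → ∀ j : Fin 4,
        PlaceInv G x (H \ Set.range f) f π j ρ → Tri (place j) ρ (500 * (n + M + 1))
          fun τ => PlaceInv G x (H \ Set.range f) f π (j + 1) τ := fun hρ j =>
      place_spec hinj (fun k h => h.2 ⟨k, rfl⟩) hπ hρ j
    refine Tri.seq (hplace c2 0 g2) (fun σ₃ f3 g3 => ?_) (T := 2000 * (n + M + 1)) (by omega)
    have c3 := c2.frame f3 (by decide)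
    refine Tri.seq (hplace c3 1 g3) (fun σ₄ f4 g4 => ?_) (T := 1000 * (n + M + 1)) (by omega)
    have c4 := c3.frame f4 (by decide)
    refine Tri.seq (hplace c4 2 g4) (fun σ₅ f5 g5 => ?_) (T := 500 * (n + M + 1)) (by omega)
    have c5 := c4.frame f5 (by decide)
    refine (hplace c5 3 g5).mono le_rfl fun τ _ g6 => ⟨π, ?_, fun k => g6.perm k (π k).2⟩
    refine sqInv_of_square hcyc hπ (fun k u => ?_) g6.cyc g6.le
    rw [g6.low]
    exact and_iff_right (π k).2

end RAM

/-! ## Turning a square structure into a cubic structure -/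

section Relabelling

variable {V : Type u} {G : SimpleGraph V} {L L₁ : V → ℕ} {v : V}

/-- The table that translates the intermediate labels. -/
structure RelTable (T : ℕ → ℕ) (f : Fin 4 → ℕ) (i a o b : Fin 4) : Prop where
  p : T 9 = f a
  q : T 10 = 8 + f a
  p' : T 11 = f b
  q' : T 12 = 8 + f b
  A_i : T i = f i
  A_o : T o = f o
  S_o : T (4 + o) = 8 + f o
  rest : ∀ l ≤ 8, l ≠ i.val → l ≠ o.val → l ≠ 4 + o.val → T l = 16

/-- The labels that the table and four exceptions prescribe. -/
structure RelLab (L₁ L₂ : V → ℕ) (T : ℕ → ℕ) (f : Fin 4 → ℕ) (v : V) (i a o b : Fin 4)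
    (si sa sb : V) : Prop where
  at_v : L₂ v = 12 + f o
  at_sb : L₂ sb = 12 + f a
  at_sa : L₂ sa = 12 + f b
  at_si : L₂ si = 8 + f i
  rest : ∀ u, u ≠ v → u ≠ sb → u ≠ sa → u ≠ si → L₂ u = T (L₁ u)

theorem exists_relTable (f : Fin 4 → ℕ) {i a o b : Fin 4} (hcyc : Cyc i a o b) :
    ∃ T, RelTable T f i a o b := by
  obtain ⟨d1, d2, d3, d4, d5, d6⟩ := hcyc.vals
  have hi := i.2
  have ho := o.2
  refine ⟨fun l => if l = 9 then f a else if l = 10 then 8 + f a else if l = 11 then f b else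
    if l = 12 then 8 + f b else if l = i then f i else if l = o then f o else
    if l = 4 + o then 8 + f o else 16, ⟨rfl, rfl, rfl, rfl, ?_, ?_, ?_, fun l h1 h2 h3 h4 => ?_⟩⟩
  · split_ifs <;> first | rfl | omega
  · split_ifs <;> first | rfl | omega
  · split_ifs <;> first | rfl | omega
  · split_ifs <;> first | rfl | omega

theorem exists_relLab (T : ℕ → ℕ) (f : Fin 4 → ℕ) (i a o b : Fin 4) {si sa sb : V}
    (h1 : sb ≠ v) (h2 : sa ≠ v) (h3 : si ≠ v) (h4 : sa ≠ sb) (h5 : si ≠ sb) (h6 : si ≠ sa) :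
    ∃ L₂, RelLab L₁ L₂ T f v i a o b si sa sb := by
  classical
  refine ⟨fun u => if u = v then 12 + f o else if u = sb then 12 + f a else
    if u = sa then 12 + f b else if u = si then 8 + f i else T (L₁ u), ⟨if_pos rfl, ?_, ?_, ?_, ?_⟩⟩
  · rw [if_neg h1, if_pos rfl]
  · rw [if_neg h2, if_neg h4, if_pos rfl]
  · rw [if_neg h3, if_neg h5, if_neg h6, if_pos rfl]
  · intro u k1 k2 k3 k4
    rw [if_neg k1, if_neg k2, if_neg k3, if_neg k4]

/-- The hypothesis `key` lists every combination of old, intermediate and new label that can occur.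
Each field follows by inspection of the list. -/
theorem cubeLab_of_values {L₂ : V → ℕ} {i a o b : Fin 4} {D D' : Set V} {c c' si sa sb : V}
    (hcyc : Cyc i a o b) (hmid : MidLab L L₁ a b D c D' c' 9 11) (at_v : L₂ v = 12 + o)
    (at_sb : L₂ sb = 12 + a) (at_sa : L₂ sa = 12 + b) (at_si : L₂ si = 8 + i)
    (key : ∀ u, (u = v ∧ L u = 8 ∧ L₁ u = 8 ∧ L₂ u = 12 + o) ∨
        (u = sb ∧ L u = 4 + b ∧ L₁ u = 4 + b ∧ L₂ u = 12 + a) ∨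
        (u = sa ∧ L u = 4 + a ∧ L₁ u = 4 + a ∧ L₂ u = 12 + b) ∨
        (u = si ∧ L u = 4 + i ∧ L₁ u = 4 + i ∧ L₂ u = 8 + i) ∨
        ((L u = a ∨ L u = b) ∧ (L₁ u = 9 ∧ L₂ u = a ∨ L₁ u = 10 ∧ L₂ u = 8 + a ∨
          L₁ u = 11 ∧ L₂ u = b ∨ L₁ u = 12 ∧ L₂ u = 8 + b)) ∨
        (L₁ u = L u ∧ (L u = i ∧ L₂ u = i ∨ L u = o ∧ L₂ u = o ∨ L u = 4 + o ∧ L₂ u = 8 + o)) ∨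
        ((L u ≠ i ∧ L u ≠ o ∧ L u ≠ 4 + o) ∧ L₁ u ≤ 8 ∧ L₂ u = 16)) :
    CubeLab L L₂ v i a o b D c D' c' si sa sb := by
  obtain ⟨d1, d2, d3, d4, d5, d6⟩ := hcyc.vals
  have hi := i.2
  have ha := a.2
  have ho := o.2
  have hb := b.2
  have hio : o ≠ i := fun h => d2 (by rw [h])
  have hia : a ≠ i := fun h => d1 (by rw [h])
  have hib : b ≠ i := fun h => d3 (by rw [h])
  refine ⟨fun u => ?_, fun u => ?_, fun u => ?_, fun u => ?_, fun u => ?_, fun u => ?_, fun u => ?_,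
    fun u => ?_, fun u => ?_, fun u => ?_, fun u => ?_, fun u => ?_⟩
  · rw [← hmid.p_iff]
    rcases key u with h | h | h | h | h | h | h <;> omega
  · rw [← hmid.q_iff]
    rcases key u with h | h | h | h | h | h | h <;> omega
  · rw [← hmid.p_iff']
    rcases key u with h | h | h | h | h | h | h <;> omega
  · rw [← hmid.q_iff']
    rcases key u with h | h | h | h | h | h | h <;> omega
  · rcases key u with h | h | h | h | h | h | h <;> omega
  · rcases key u with h | h | h | h | h | h | h <;> omega
  · refine ⟨fun h' => ?_, fun h => h ▸ at_si⟩
    rcases key u with h | h | h | h | h | h | h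
    iterate 3 omega
    · exact h.1
    iterate 3 omega
  · rcases key u with h | h | h | h | h | h | h <;> omega
  · refine ⟨fun h' => ?_, fun h => h ▸ at_sb⟩
    rcases key u with h | h | h | h | h | h | h
    · omega
    · exact h.1
    iterate 5 omega
  · refine ⟨fun h' => ?_, fun h => h ▸ at_sa⟩
    rcases key u with h | h | h | h | h | h | h
    iterate 2 omega
    · exact h.1
    iterate 4 omega
  · refine ⟨fun h' => ?_, fun h => h ▸ at_v⟩
    rcases key u with h | h | h | h | h | h | h
    · exact h.1
    iterate 6 omega
  · rcases key u with h | h | h | h | ⟨-, h | h | h | h⟩ | ⟨-, h | h | h⟩ | h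
    · exact Or.inr ⟨o, Or.inr (Or.inr ⟨hio, h.2.2.2⟩)⟩
    · exact Or.inr ⟨a, Or.inr (Or.inr ⟨hia, h.2.2.2⟩)⟩
    · exact Or.inr ⟨b, Or.inr (Or.inr ⟨hib, h.2.2.2⟩)⟩
    · exact Or.inr ⟨i, Or.inr (Or.inl h.2.2.2)⟩
    · exact Or.inr ⟨a, Or.inl h.2⟩
    · exact Or.inr ⟨a, Or.inr (Or.inl h.2)⟩
    · exact Or.inr ⟨b, Or.inl h.2⟩
    · exact Or.inr ⟨b, Or.inr (Or.inl h.2)⟩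
    · exact Or.inr ⟨i, Or.inl h.2⟩
    · exact Or.inr ⟨o, Or.inl h.2⟩
    · exact Or.inr ⟨o, Or.inr (Or.inl h.2)⟩
    · exact Or.inl h.2.2

theorem RelTable.values {T : ℕ → ℕ} {f : Fin 4 → ℕ} {i a o b : Fin 4} (hT : RelTable T f i a o b)
    (hcyc : Cyc i a o b) {l l₁ : ℕ} (h : l₁ = l ∧ l ≤ 8 ∧ l ≠ a ∧ l ≠ b ∨
      (l = a ∨ l = b) ∧ (l₁ = 9 ∨ l₁ = 10 ∨ l₁ = 11 ∨ l₁ = 12 ∨ l₁ = 8)) :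
    ((l = a ∨ l = b) ∧ (l₁ = 9 ∧ T l₁ = f a ∨ l₁ = 10 ∧ T l₁ = 8 + f a ∨
      l₁ = 11 ∧ T l₁ = f b ∨ l₁ = 12 ∧ T l₁ = 8 + f b)) ∨
    (l₁ = l ∧ (l = i ∧ T l₁ = f i ∨ l = o ∧ T l₁ = f o ∨ l = 4 + o ∧ T l₁ = 8 + f o)) ∨
    ((l ≠ i ∧ l ≠ o ∧ l ≠ 4 + o) ∧ l₁ ≤ 8 ∧ T l₁ = 16) := by
  obtain ⟨d1, d2, d3, d4, d5, d6⟩ := hcyc.vals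
  have hi := i.2
  have ho := o.2
  rcases h with ⟨rfl, h1, h2, h3⟩ | ⟨h1, h2⟩
  · refine Or.inr ?_
    by_cases k1 : l₁ = i
    · exact Or.inl ⟨rfl, Or.inl ⟨k1, k1 ▸ hT.A_i⟩⟩
    by_cases k2 : l₁ = o
    · exact Or.inl ⟨rfl, Or.inr (Or.inl ⟨k2, k2 ▸ hT.A_o⟩)⟩
    by_cases k3 : l₁ = 4 + o
    · exact Or.inl ⟨rfl, Or.inr (Or.inr ⟨k3, k3 ▸ hT.S_o⟩)⟩
    exact Or.inr ⟨⟨k1, k2, k3⟩, h1, hT.rest _ h1 k1 k2 k3⟩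
  · rcases h2 with k | k | k | k | k
    · exact Or.inl ⟨h1, Or.inl ⟨k, k ▸ hT.p⟩⟩
    · exact Or.inl ⟨h1, Or.inr (Or.inl ⟨k, k ▸ hT.q⟩)⟩
    · exact Or.inl ⟨h1, Or.inr (Or.inr (Or.inl ⟨k, k ▸ hT.p'⟩))⟩
    · exact Or.inl ⟨h1, Or.inr (Or.inr (Or.inr ⟨k, k ▸ hT.q'⟩))⟩
    · refine Or.inr (Or.inr ⟨?_, k.le, k ▸ hT.rest 8 le_rfl ?_ ?_ ?_⟩)
      · have ha := a.2
        have hb := b.2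
        rcases h1 with rfl | rfl
        · exact ⟨d1.symm, d4, by omega⟩
        · exact ⟨d3.symm, d6.symm, by omega⟩
      all_goals omega

/-- The program writes labels with the original indices `π k`, while `SqInv.turn` speaks about the
cyclic order. The auxiliary labelling `L₂` follows the same recipe with the identity in place of
`π`. It is a cubic structure for `x ∘ π`, and `CubInv.of_comp` transfers this to `L'`. -/
theorem cubInv_of_relLab {x : Fin 4 → V} {π : Equiv.Perm (Fin 4)} {L' : V → ℕ} {T : ℕ → ℕ}
    {i a o b : Fin 4} {D D' : Set V} {c c' si sa sb : V} (hcyc : Cyc i a o b)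
    (hle : ∀ u, L u ≤ 8) (hv : L v = 8)
    (hmid : MidLab L L₁ a b D c D' c' 9 11)
    (hsi : L si = 4 + i.val) (hsa : L sa = 4 + a.val) (hsb : L sb = 4 + b.val)
    (hT : RelTable T (fun k => (π k).val) i a o b)
    (hL : RelLab L₁ L' T (fun k => (π k).val) v i a o b si sa sb)
    (hcub : ∀ L₂, CubeLab L L₂ v i a o b D c D' c' si sa sb → CubInv G (x ∘ π) L₂) :
    CubInv G x L' := by
  obtain ⟨d1, d2, d3, d4, d5, d6⟩ := hcyc.vals
  have hi := i.2
  have ha := a.2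
  have ho := o.2
  have hb := b.2
  have hS : ∀ u, 4 ≤ L u → L₁ u = L u := fun u hu => hmid.other u (by omega) (by omega)
  have kv := hS v (by omega)
  have ki := hS si (by omega)
  have ka := hS sa (by omega)
  have kb := hS sb (by omega)
  obtain ⟨T₂, hT₂⟩ := exists_relTable (fun k => k.val) hcyc
  have hne : ∀ {u w : V}, L u ≠ L w → u ≠ w := fun h h' => h (h' ▸ rfl)
  obtain ⟨L₂, hL₂⟩ := exists_relLab (L₁ := L₁) T₂ (fun k => k.val) i a o b (si := si) (sa := sa)
    (sb := sb) (v := v) (hne (by omega)) (hne (by omega)) (hne (by omega)) (hne (by omega))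
    (hne (by omega)) (hne (by omega))
  -- the possible labels
  have hcases : ∀ u, L₁ u = L u ∧ L u ≤ 8 ∧ L u ≠ a ∧ L u ≠ b ∨
      (L u = a ∨ L u = b) ∧ (L₁ u = 9 ∨ L₁ u = 10 ∨ L₁ u = 11 ∨ L₁ u = 12 ∨ L₁ u = 8) := by
    intro u
    by_cases h : L u = a.val ∨ L u = b.val
    · exact Or.inr ⟨h, hmid.rest u h⟩
    · push Not at h
      exact Or.inl ⟨hmid.other u h.1 h.2, hle u, h⟩
  have hex : ∀ u, (u = v ∧ L₂ u = 12 + o) ∨ (u = sb ∧ L₂ u = 12 + a) ∨ (u = sa ∧ L₂ u = 12 + b) ∨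
      (u = si ∧ L₂ u = 8 + i) ∨ ((u ≠ v ∧ u ≠ sb ∧ u ≠ sa ∧ u ≠ si) ∧ L₂ u = T₂ (L₁ u)) := by
    intro u
    by_cases h1 : u = v
    · exact Or.inl ⟨h1, h1 ▸ hL₂.at_v⟩
    · by_cases h2 : u = sb
      · exact Or.inr (Or.inl ⟨h2, h2 ▸ hL₂.at_sb⟩)
      · by_cases h3 : u = sa
        · exact Or.inr (Or.inr (Or.inl ⟨h3, h3 ▸ hL₂.at_sa⟩))
        · by_cases h4 : u = si
          · exact Or.inr (Or.inr (Or.inr (Or.inl ⟨h4, h4 ▸ hL₂.at_si⟩)))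
          · exact Or.inr (Or.inr (Or.inr (Or.inr ⟨⟨h1, h2, h3, h4⟩, hL₂.rest u h1 h2 h3 h4⟩)))
  have hL₁ : ∀ u, L₁ u = 9 ∨ L₁ u = 10 ∨ L₁ u = 11 ∨ L₁ u = 12 ∨ L₁ u = i ∨ L₁ u = o ∨ L₁ u = 4 + o ∨
      (L₁ u ≤ 8 ∧ L₁ u ≠ i ∧ L₁ u ≠ o ∧ L₁ u ≠ 4 + o) := by
    intro u
    rcases hcases u with h | h <;> omega
  have hval : ∀ u, (∃ m < 4, ∃ j : Fin 4, L₂ u = 4 * m + j ∧ L' u = 4 * m + π j) ∨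
      (L₂ u = 16 ∧ L' u = 16) := by
    intro u
    rcases hex u with ⟨rfl, h⟩ | ⟨rfl, h⟩ | ⟨rfl, h⟩ | ⟨rfl, h⟩ | ⟨⟨h1, h2, h3, h4⟩, h⟩
    · exact Or.inl ⟨3, by omega, o, h, hL.at_v⟩
    · exact Or.inl ⟨3, by omega, a, h, hL.at_sb⟩
    · exact Or.inl ⟨3, by omega, b, h, hL.at_sa⟩
    · exact Or.inl ⟨2, by omega, i, h, hL.at_si⟩
    · have h' := hL.rest u h1 h2 h3 h4
      rw [h, h']
      rcases hL₁ u with k | k | k | k | k | k | k | k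
      · exact Or.inl ⟨0, by omega, a, by rw [k, hT₂.p]; omega, by rw [k, hT.p]; omega⟩
      · exact Or.inl ⟨2, by omega, a, by rw [k, hT₂.q], by rw [k, hT.q]⟩
      · exact Or.inl ⟨0, by omega, b, by rw [k, hT₂.p']; omega, by rw [k, hT.p']; omega⟩
      · exact Or.inl ⟨2, by omega, b, by rw [k, hT₂.q'], by rw [k, hT.q']⟩
      · exact Or.inl ⟨0, by omega, i, by rw [k, hT₂.A_i]; omega, by rw [k, hT.A_i]; omega⟩
      · exact Or.inl ⟨0, by omega, o, by rw [k, hT₂.A_o]; omega, by rw [k, hT.A_o]; omega⟩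
      · exact Or.inl ⟨2, by omega, o, by rw [k, hT₂.S_o], by rw [k, hT.S_o]⟩
      · exact Or.inr ⟨hT₂.rest _ k.1 k.2.1 k.2.2.1 k.2.2.2, hT.rest _ k.1 k.2.1 k.2.2.1 k.2.2.2⟩
  have hcube : CubeLab L L₂ v i a o b D c D' c' si sa sb := by
    have key : ∀ u, (u = v ∧ L u = 8 ∧ L₁ u = 8 ∧ L₂ u = 12 + o) ∨
        (u = sb ∧ L u = 4 + b ∧ L₁ u = 4 + b ∧ L₂ u = 12 + a) ∨
        (u = sa ∧ L u = 4 + a ∧ L₁ u = 4 + a ∧ L₂ u = 12 + b) ∨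
        (u = si ∧ L u = 4 + i ∧ L₁ u = 4 + i ∧ L₂ u = 8 + i) ∨
        ((L u = a ∨ L u = b) ∧ (L₁ u = 9 ∧ L₂ u = a ∨ L₁ u = 10 ∧ L₂ u = 8 + a ∨
          L₁ u = 11 ∧ L₂ u = b ∨ L₁ u = 12 ∧ L₂ u = 8 + b)) ∨
        (L₁ u = L u ∧ (L u = i ∧ L₂ u = i ∨ L u = o ∧ L₂ u = o ∨ L u = 4 + o ∧ L₂ u = 8 + o)) ∨
        ((L u ≠ i ∧ L u ≠ o ∧ L u ≠ 4 + o) ∧ L₁ u ≤ 8 ∧ L₂ u = 16) := by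
      intro u
      rcases hex u with ⟨rfl, h⟩ | ⟨rfl, h⟩ | ⟨rfl, h⟩ | ⟨rfl, h⟩ | ⟨-, h⟩
      · exact Or.inl ⟨rfl, hv, kv.trans hv, h⟩
      · exact Or.inr (Or.inl ⟨rfl, hsb, kb.trans hsb, h⟩)
      · exact Or.inr (Or.inr (Or.inl ⟨rfl, hsa, ka.trans hsa, h⟩))
      · exact Or.inr (Or.inr (Or.inr (Or.inl ⟨rfl, hsi, ki.trans hsi, h⟩)))
      · refine Or.inr (Or.inr (Or.inr (Or.inr ?_)))
        rw [h]
        exact hT₂.values hcyc (hcases u)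
    exact cubeLab_of_values hcyc hmid hL₂.at_v hL₂.at_sb hL₂.at_sa hL₂.at_si key
  refine (hcub L₂ hcube).of_comp π (fun u => ?_) (fun u m hm j hj => ?_)
  · rcases hval u with ⟨m, hm, j, h1, h2⟩ | ⟨h1, h2⟩
    · have := j.2; have := (π j).2
      omega
    · simp [h1, h2]
  · have := j.2
    rcases hval u with ⟨m', hm', j', h1, h2⟩ | ⟨h1, h2⟩
    · have := j'.2
      have hj' : j' = j := Fin.ext (by omega)
      subst hj'
      omega
    · omega

end Relabelling

/-! ## The program that turns a square structure into a cubic structure -/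

namespace RAM

variable {n : ℕ} {G : SimpleGraph (Fin n)} {x : Fin 4 → Fin n} {M : ℕ}

/-- The arc in register `8` leaves the set of vertices that have been reached, but not the label. -/
def exitArc (a : ℕ) : Expr :=
  (Expr.get 5 (.get 3 (.reg 8))).and
    ((Expr.eq (.get 2 (.get 1 (.reg 8))) (.const a)).and (Expr.eq (.get 5 (.get 1 (.reg 8))) (.const 0)))

/-- Give the label `p` to the side at `a` and `p + 1` to a vertex next to it, in array `13`. -/
def markSide (a p : ℕ) : Prog :=
  .seq (fill 8 5 4 ((Expr.eq (.get 2 (.reg 8)) (.const a)).and (Expr.eq (.get 14 (.reg 8)) (.const 0))))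
  (.seq (.assign 7 (.get 16 (.const a)))
  (.seq flood
  (.seq (find 8 6 24 (exitArc a))
  (.seq (.assign 25 (.get 1 (.reg 24)))
  (.seq (scatter 8 5 13 (.get 5 (.reg 8)) (.reg 8) (.const p))
    (.store 13 (.reg 25) (.const (p + 1))))))))

/-- The search in the class of `a` without the neighbours of `v` yields `D`. An arc that leaves `D`
inside the class exists by `SqInv.exists_side`, and its head serves as `c`. -/
theorem markSide_spec {y : Fin 4 → Fin n} (hp : Pendant G y) {σ : State} (hc : Ctx G x M σ) {v : Fin n}
    (hI : SqInv G y (labels n σ)) (hv : labels n σ v = 8) (a : Fin 4) (p : ℕ)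
    (hmark : ∀ u : Fin n, σ.arr 14 u ≠ 0 ↔ G.Adj v u) (hy : σ.arr 16 a = y a)
    (hva : ∃ u, G.Adj v u ∧ labels n σ u = a) :
    Tri (markSide a p) σ (600 * (n + M + 1)) fun τ => ∃ D c, Side G y (labels n σ) v a D c ∧
      ∀ u : Fin n, (u = c ∧ τ.arr 13 u = p + 1) ∨ (u ≠ c ∧ u ∈ D ∧ τ.arr 13 u = p) ∨
        (u ≠ c ∧ u ∉ D ∧ τ.arr 13 u = σ.arr 13 u) := by
  refine Tri.seq (Tri.fill hc.rn (by decide) rfl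
    (Nat.add_le_add_right (Nat.mul_le_mul_right _ (show _ ≤ 30 from Nat.le_of_ble_eq_true rfl)) 2))
    (fun σ₁ f1 h1 => ?_) (S := 30 * (n + 1) + 2) (T := 560 * (n + M + 1)) (by omega)
  have c1 := hc.frame f1 rfl
  refine Tri.seq (R := fun τ => τ = σ₁.setReg 7 (y a)) (S := 3) (T := 550 * (n + M + 1))
    (Tri.assign (by simp only [Expr.eval, f1.arr 16 rfl, hy])) ?_ (by omega)
  rintro σ₂ f2 rfl
  have c2 := c1.frame f2 rfl
  have hmask : supp n (σ₁.arr 4) = {w | labels n σ w = a ∧ ¬ G.Adj v w} := by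
    ext u
    rw [mem_supp, h1 u u.2]
    show Expr.Holds _ _ ↔ _
    rw [Expr.holds_and]
    have := hmark u
    simp only [Expr.holds_eq, Expr.eval, setReg_reg, setReg_arr, if_true, labels, Set.mem_ofPred_eq,
      ← this, not_not]
  refine Tri.seq (flood_spec c2 (s := y a) (by simp)) (fun σ₃ f3 h3 => ?_)
    (T := 330 * (n + M + 1)) (by omega)
  have c3 := c2.frame f3 (by decide)
  rw [setReg_arr, hmask] at h3
  have hvis : ∀ u : Fin n, σ₃.arr 5 u ≠ 0 ↔ RIn G {w | labels n σ w = a ∧ ¬ G.Adj v w} (y a) u :=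
    fun u => Set.ext_iff.mp h3 u
  have e2 : ∀ u : Fin n, σ₃.arr 2 u = labels n σ u := fun u => by
    rw [f3.arr 2 (by decide), setReg_arr, f1.arr 2 rfl]; rfl
  refine Tri.seq (Tri.find c3.rM (by decide) (by decide) (by decide) rfl
    (Nat.add_le_add_right (Nat.mul_le_mul_right _ (show (exitArc a).cost + 11 ≤ 100 from
      Nat.le_of_ble_eq_true rfl)) 4)) (fun σ₄ f4 h4 => ?_)
    (S := 100 * (M + 1) + 4) (T := 150 * (n + M + 1)) (by omega)
  have c4 := c3.frame f4 rfl
  have hcond : ∀ e < M, ∀ s t : Fin n, σ₃.arr 3 e = s → σ₃.arr 1 e = t →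
      ((exitArc a).Holds (σ₃.setReg 8 e) ↔ RIn G {w | labels n σ w = a ∧ ¬ G.Adj v w} (y a) s ∧
        labels n σ t = a ∧ ¬ RIn G {w | labels n σ w = a ∧ ¬ G.Adj v w} (y a) t) := by
    intro e he s t hs ht
    simp only [exitArc, Expr.holds_and, Expr.holds_get, Expr.holds_eq, Expr.eval, setReg_reg,
      setReg_arr, if_true, hs, ht, ← hvis, e2, not_not]
  obtain ⟨hlt, hh⟩ : σ₄.reg 24 < M ∧ (exitArc a).Holds (σ₃.setReg 8 (σ₄.reg 24)) := by
    refine h4.resolve_left fun h => ?_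
    obtain ⟨z, c, hz, hzc, hcl, hcn⟩ := hI.exists_side hp hv a hva
    obtain ⟨e, he, hs, ht⟩ := c3.exists_arc z c hzc
    exact h.2 e he ((hcond e he z c hs ht).mpr ⟨hz, hcl, hcn⟩)
  obtain ⟨z, c, hs, ht, hzc⟩ := c3.arc _ hlt
  rw [hcond _ hlt z c hs ht] at hh
  refine Tri.seq (R := fun τ => τ = σ₄.setReg 25 c) (S := 3) (T := 140 * (n + M + 1))
    (Tri.assign ?_) ?_ (by omega)
  · simp only [Expr.eval, f4.arr 1 rfl, ht]
  rintro σ₅ f5 rfl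
  have c5 := c4.frame f5 (by decide)
  refine Tri.seq (Tri.scatter c5.rn (by decide) rfl rfl rfl le_rfl) (fun σ₆ f6 h6 => ?_)
    (S := 15 * (n + 1) + 2) (T := 20) (by omega)
  refine Tri.flat _ rfl (by simp only [Prog.mx, Expr.cost]; omega) ?_
  have e25 : σ₆.reg 25 = c := by rw [f6.reg 25 rfl]; simp
  simp only [Prog.den, Expr.eval, e25]
  refine ⟨{u | RIn G {w | labels n σ w = a ∧ ¬ G.Adj v w} (y a) u}, c,
    ⟨rfl, hI.term_mem_side hp hv a, hh.2.1, hh.2.2, z, hh.1, hzc⟩, fun u => ?_⟩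
  have a5 : (σ₄.setReg 25 c).arr 5 u ≠ 0 ↔ RIn G {w | labels n σ w = a ∧ ¬ G.Adj v w} (y a) u := by
    rw [setReg_arr, f4.arr 5 rfl, hvis]
  have e13 : σ₄.arr 13 = σ.arr 13 := by
    rw [f4.arr 13 rfl, f3.arr 13 (by decide), setReg_arr, f1.arr 13 rfl]
  by_cases huc : u = c
  · subst huc
    exact Or.inl ⟨rfl, by simp⟩
  · refine Or.inr ?_
    have hk : (σ₆.setArr 13 c (p + 1)).arr 13 u = σ₆.arr 13 u := by simp [Fin.val_inj, huc]
    rw [hk]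
    rcases h6 u with ⟨m, hm, k1, k2, k3⟩ | ⟨k1, k2⟩
    · have hmu : m = u := by simpa [Expr.eval] using k2
      subst hmu
      refine Or.inl ⟨huc, a5.mp ?_, ?_⟩
      · simpa [Expr.eval] using k1
      · rw [k3]; simp [Expr.eval]
    · refine Or.inr ⟨huc, fun hu => k1 u u.2 ?_ ?_, ?_⟩
      · simpa [Expr.eval] using a5.mpr hu
      · simp [Expr.eval]
      · rw [k2, setReg_arr, e13]

/-- Compute the intermediate labels in array `13`. -/
def markSides (a b : ℕ) : Prog :=
  .seq (fill 8 5 13 (.get 2 (.reg 8)))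
  (.seq (scatter 8 5 13 ((Expr.eq (.get 2 (.reg 8)) (.const a)).or (Expr.eq (.get 2 (.reg 8)) (.const b)))
    (.reg 8) (.const 8))
  (.seq (markSide a 9) (markSide b 11)))

theorem markSides_spec {y : Fin 4 → Fin n} (hp : Pendant G y) {σ : State} (hc : Ctx G x M σ) {v : Fin n}
    (hI : SqInv G y (labels n σ)) (hv : labels n σ v = 8) {a b : Fin 4} (hab : a ≠ b)
    (hmark : ∀ u : Fin n, σ.arr 14 u ≠ 0 ↔ G.Adj v u) (hy : ∀ k : Fin 4, σ.arr 16 k = y k)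
    (hva : ∃ u, G.Adj v u ∧ labels n σ u = a) (hvb : ∃ u, G.Adj v u ∧ labels n σ u = b) :
    Tri (markSides a b) σ (1500 * (n + M + 1)) fun τ => ∃ D c D' c',
      Side G y (labels n σ) v a D c ∧ Side G y (labels n σ) v b D' c' ∧
      MidLab (labels n σ) (fun u => τ.arr 13 u) a b D c D' c' 9 11 := by
  refine Tri.seq (Tri.fill hc.rn (by decide) rfl le_rfl) (fun σ₁ f1 h1 => ?_)
    (S := 15 * (n + 1) + 2) (T := 1400 * (n + M + 1)) (by omega)
  have c1 := hc.frame f1 rfl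
  refine Tri.seq (Tri.scatter c1.rn (by decide) rfl rfl rfl
    (Nat.add_le_add_right (Nat.mul_le_mul_right _ (show _ ≤ 50 from Nat.le_of_ble_eq_true rfl)) 2))
    (fun σ₂ f2 h2 => ?_) (S := 50 * (n + 1) + 2) (T := 1300 * (n + M + 1)) (by omega)
  have c2 := c1.frame f2 rfl
  have l2 : labels n σ₂ = labels n σ := by
    ext u; rw [labels, f2.arr 2 rfl, f1.arr 2 rfl]; rfl
  have b2 : ∀ u : Fin n, ((labels n σ u = a ∨ labels n σ u = b) ∧ σ₂.arr 13 u = 8) ∨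
      (¬ (labels n σ u = a ∨ labels n σ u = b) ∧ σ₂.arr 13 u = labels n σ u) := by
    intro u
    have e2 : σ₁.arr 2 u = labels n σ u := by rw [f1.arr 2 rfl]; rfl
    rcases h2 u with ⟨m, hm, k1, k2, k3⟩ | ⟨k1, k2⟩
    · have hmu : m = u := by simpa [Expr.eval] using k2
      subst hmu
      refine Or.inl ⟨?_, by rw [k3]; rfl⟩
      simpa [Expr.eval, e2] using k1
    · refine Or.inr ⟨fun hu => k1 u u.2 ?_ ?_, ?_⟩
      · simpa [Expr.eval, e2] using hu
      · simp [Expr.eval]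
      · rw [k2, h1 u u.2]; simp [Expr.eval, labels]
  refine Tri.seq (markSide_spec hp c2 (v := v) (by rwa [l2]) (by rwa [l2]) a 9 ?_ ?_ (by rwa [l2]))
    (fun σ₃ f3 h3 => ?_) (T := 600 * (n + M + 1)) (by omega)
  · rwa [f2.arr 14 rfl, f1.arr 14 rfl]
  · rw [f2.arr 16 rfl, f1.arr 16 rfl, hy]
  have c3 := c2.frame f3 rfl
  have l3 : labels n σ₃ = labels n σ := by
    ext u; rw [labels, f3.arr 2 rfl, ← l2]; rfl
  refine (markSide_spec hp c3 (v := v) (by rwa [l3]) (by rwa [l3]) b 11 ?_ ?_ (by rwa [l3])).mono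
    le_rfl fun τ f4 h4 => ?_
  · rwa [f3.arr 14 rfl, f2.arr 14 rfl, f1.arr 14 rfl]
  · rw [f3.arr 16 rfl, f2.arr 16 rfl, f1.arr 16 rfl, hy]
  obtain ⟨D, c, hD, g3⟩ := h3
  obtain ⟨D', c', hD', g4⟩ := h4
  rw [l2] at hD
  rw [l3] at hD'
  have hab' : a.val ≠ b.val := fun h => hab (Fin.ext h)
  have ha := a.2
  have hb := b.2
  have hle := hI.le
  have key : ∀ u : Fin n,
      (u = c ∧ u ∉ D ∧ u ≠ c' ∧ u ∉ D' ∧ labels n σ u = a ∧ τ.arr 13 u = 10) ∨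
      (u ≠ c ∧ u ∈ D ∧ u ≠ c' ∧ u ∉ D' ∧ labels n σ u = a ∧ τ.arr 13 u = 9) ∨
      (u ≠ c ∧ u ∉ D ∧ u = c' ∧ u ∉ D' ∧ labels n σ u = b ∧ τ.arr 13 u = 12) ∨
      (u ≠ c ∧ u ∉ D ∧ u ≠ c' ∧ u ∈ D' ∧ labels n σ u = b ∧ τ.arr 13 u = 11) ∨
      (u ≠ c ∧ u ∉ D ∧ u ≠ c' ∧ u ∉ D' ∧ (labels n σ u = a ∨ labels n σ u = b) ∧ τ.arr 13 u = 8) ∨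
      (u ≠ c ∧ u ∉ D ∧ u ≠ c' ∧ u ∉ D' ∧ ¬ (labels n σ u = a ∨ labels n σ u = b) ∧
        τ.arr 13 u = labels n σ u ∧ labels n σ u ≤ 8) := by
    intro u
    have hDl : u ∈ D → labels n σ u = a := fun h => (hD.of_mem h).1
    have hDl' : u ∈ D' → labels n σ u = b := fun h => (hD'.of_mem h).1
    have hcl : u = c → labels n σ u = a ∧ u ∉ D := fun h => h ▸ ⟨hD.lab, hD.notMem⟩
    have hcl' : u = c' → labels n σ u = b ∧ u ∉ D' := fun h => h ▸ ⟨hD'.lab, hD'.notMem⟩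
    have hbA : labels n σ u = a → u ≠ c' ∧ u ∉ D' := fun h =>
      ⟨fun h' => hab' (h.symm.trans (hcl' h').1), fun h' => hab' (h.symm.trans (hDl' h'))⟩
    have hbB : labels n σ u = b → u ≠ c ∧ u ∉ D := fun h =>
      ⟨fun h' => hab' ((hcl h').1.symm.trans h), fun h' => hab' ((hDl h').symm.trans h)⟩
    rcases g4 u with ⟨k1, k2⟩ | ⟨k1, k2, k3⟩ | ⟨k1, k2, k3⟩
    · have h5 := hcl' k1
      have h6 := hbB h5.1
      exact Or.inr (Or.inr (Or.inl ⟨h6.1, h6.2, k1, h5.2, h5.1, k2⟩))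
    · have h5 := hDl' k2
      have h6 := hbB h5
      exact Or.inr (Or.inr (Or.inr (Or.inl ⟨h6.1, h6.2, k1, k2, h5, k3⟩)))
    · rw [k3]
      rcases g3 u with ⟨m1, m2⟩ | ⟨m1, m2, m3⟩ | ⟨m1, m2, m3⟩
      · exact Or.inl ⟨m1, (hcl m1).2, k1, k2, (hcl m1).1, m2⟩
      · exact Or.inr (Or.inl ⟨m1, m2, k1, k2, hDl m2, m3⟩)
      · rw [m3]
        rcases b2 u with h | h
        · exact Or.inr (Or.inr (Or.inr (Or.inr (Or.inl ⟨m1, m2, k1, k2, h⟩))))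
        · exact Or.inr (Or.inr (Or.inr (Or.inr (Or.inr ⟨m1, m2, k1, k2, h.1, h.2, hle u⟩))))
  refine ⟨D, c, D', c', hD, hD', ⟨fun u => ?_, fun u => ?_, fun u => ?_, fun u => ?_, fun u h1 h2 => ?_,
    fun u h => ?_⟩⟩
  all_goals
    have hk := key u
  · rcases hk with h | h | h | h | h | h
    · exact ⟨fun h' => by omega, fun h' => absurd h' h.2.1⟩
    · exact ⟨fun _ => h.2.1, fun _ => h.2.2.2.2.2⟩
    all_goals exact ⟨fun h' => by omega, fun h' => absurd h' h.2.1⟩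
  · rcases hk with h | h | h | h | h | h
    · exact ⟨fun _ => h.1, fun _ => h.2.2.2.2.2⟩
    all_goals exact ⟨fun h' => by omega, fun h' => absurd h' h.1⟩
  · rcases hk with h | h | h | h | h | h
    iterate 3 exact ⟨fun h' => by omega, fun h' => absurd h' h.2.2.2.1⟩
    · exact ⟨fun _ => h.2.2.2.1, fun _ => h.2.2.2.2.2⟩
    all_goals exact ⟨fun h' => by omega, fun h' => absurd h' h.2.2.2.1⟩
  · rcases hk with h | h | h | h | h | h
    iterate 2 exact ⟨fun h' => by omega, fun h' => absurd h' h.2.2.1⟩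
    · exact ⟨fun _ => h.2.2.1, fun _ => h.2.2.2.2.2⟩
    all_goals exact ⟨fun h' => by omega, fun h' => absurd h' h.2.2.1⟩
  · rcases hk with h | h | h | h | h | h <;> omega
  · rcases hk with h | h | h | h | h | h <;> omega

end RAM

namespace RAM

variable {n : ℕ} {G : SimpleGraph (Fin n)} {x : Fin 4 → Fin n} {M : ℕ}

theorem trial_safe (ls : List ℕ) : (trial ls).safe = true := by
  simp [Prog.safe, trial_wr ls 1 rfl, trial_wr ls 2 rfl, trial_wr ls 3 rfl, trial_wr ls 4 rfl,
    trial_wr ls 5 rfl, trial_wr ls 6 rfl, trial_wa ls 0 rfl, trial_wa ls 1 rfl, trial_wa ls 3 rfl]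

/-- The table that translates the intermediate labels, in array `15`. -/
def mkRelTable (i a o b : ℕ) : Prog :=
  .seq (.assign 26 (.const 17))
  (.seq (fill 8 26 15 (.const 16))
  (.seq (.store 15 (.const 9) (.get 17 (.const a)))
  (.seq (.store 15 (.const 10) (.add (.get 17 (.const a)) (.const 8)))
  (.seq (.store 15 (.const 11) (.get 17 (.const b)))
  (.seq (.store 15 (.const 12) (.add (.get 17 (.const b)) (.const 8)))
  (.seq (.store 15 (.const i) (.get 17 (.const i)))
  (.seq (.store 15 (.const o) (.get 17 (.const o)))
    (.store 15 (.const (4 + o)) (.add (.get 17 (.const o)) (.const 8))))))))))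

theorem mkRelTable_spec {π : Equiv.Perm (Fin 4)} {σ : State} (hper : HasPerm x π σ) {i a o b : Fin 4}
    (hcyc : Cyc i a o b) :
    Tri (mkRelTable i a o b) σ 400 fun τ => RelTable (τ.arr 15) (fun k => (π k).val) i a o b := by
  obtain ⟨d1, d2, d3, d4, d5, d6⟩ := hcyc.vals
  have hi := i.2
  have ho := o.2
  refine Tri.seq (R := fun τ => τ = σ.setReg 26 17) (S := 2) (T := 390) (Tri.assign rfl) ?_ (by omega)
  rintro σ₁ f1 rfl
  refine Tri.seq (Tri.fill (N := 17) (by simp) (by decide) rfl le_rfl) (fun σ₂ f2 h2 => ?_)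
    (S := 14 * 18 + 2) (T := 60) (by omega)
  refine Tri.flat _ rfl (by simp only [Prog.mx, Expr.cost]; omega) ?_
  have h17 : σ₂.arr 17 = σ.arr 17 := f2.arr 17 rfl
  have e := fun k => (hper k).2
  simp only [Prog.den, Expr.eval, setArr_get, h17]
  norm_num [e]
  have n1 : i.val ≠ 4 + o.val := by omega
  have n2 : ∀ k : Fin 4, 9 ≠ k.val ∧ 10 ≠ k.val ∧ 11 ≠ k.val ∧ 12 ≠ k.val ∧ 9 ≠ 4 + k.val ∧
    10 ≠ 4 + k.val ∧ 11 ≠ 4 + k.val ∧ 12 ≠ 4 + k.val ∧ k.val ≠ 6 ∧ k.val ≠ 8 := fun k => by have := k.2; omega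
  refine ⟨?_, ?_, ?_, ?_, ?_, ?_, ?_, fun l h1 h3 h4 h5 => ?_⟩
  · simp [n2]
  · simp [n2, Nat.add_comm]
  · simp [n2]
  · simp [n2, Nat.add_comm]
  · simp [n1, d2]
  · simp
  · simp [Nat.add_comm]
  · rw [setArr_get, setArr_get, setArr_get, setArr_get, setArr_get, setArr_get, setArr_get]
    simp only [true_and, h3, h4, h5, if_false]
    rw [if_neg (by omega), if_neg (by omega), if_neg (by omega), if_neg (by omega),
      h2 l (by omega)]
    rfl

/-- Turn the intermediate labels into labels of a cubic structure. -/
def relabel (i a o b : ℕ) : Prog :=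
  .seq (mkRelTable i a o b)
  (.seq (fill 8 5 2 (.get 15 (.get 13 (.reg 8))))
  (.seq (.store 2 (.get 9 (.const (4 + i))) (.add (.get 17 (.const i)) (.const 8)))
  (.seq (.store 2 (.get 10 (.const (4 + a))) (.add (.get 17 (.const b)) (.const 12)))
  (.seq (.store 2 (.get 10 (.const (4 + b))) (.add (.get 17 (.const a)) (.const 12)))
    (.store 2 (.reg 23) (.add (.get 17 (.const o)) (.const 12)))))))

/-- The table handles whole classes, and four stores treat the exceptional vertices. Since these are
distinct, no store overwrites another. -/
theorem relabel_spec {π : Equiv.Perm (Fin 4)} {σ : State} (hc : Ctx G x M σ) (hper : HasPerm x π σ)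
    {i a o b : Fin 4} (hcyc : Cyc i a o b) {v si sa sb : Fin n} (hv : σ.reg 23 = v)
    (hsi : σ.arr 9 (4 + i) = si) (hsa : σ.arr 10 (4 + a) = sa) (hsb : σ.arr 10 (4 + b) = sb)
    (h1 : sb ≠ v) (h2 : sa ≠ v) (h3 : si ≠ v) (h4 : sa ≠ sb) (h5 : si ≠ sb) (h6 : si ≠ sa) :
    Tri (relabel i a o b) σ (600 * (n + M + 1)) fun τ => ∃ T,
      RelTable T (fun k => (π k).val) i a o b ∧
      RelLab (fun u : Fin n => σ.arr 13 u) (labels n τ) T (fun k => (π k).val) v i a o b si sa sb := by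
  refine Tri.seq (mkRelTable_spec hper hcyc) (fun σ₁ f1 g1 => ?_) (T := 100 * (n + M + 1)) (by omega)
  have c1 := hc.frame f1 rfl
  refine Tri.seq (Tri.fill c1.rn (by decide) rfl le_rfl) (fun σ₂ f2 g2 => ?_)
    (S := 16 * (n + 1) + 2) (T := 50 * (n + M + 1)) (by omega)
  have c2 := c1.frame f2 rfl
  refine Tri.flat _ rfl (by simp only [Prog.mx, Expr.cost]; omega) ?_
  refine ⟨σ₁.arr 15, g1, ?_⟩
  have e := fun k => (hper k).2
  have a17 : σ₂.arr 17 = σ.arr 17 := by rw [f2.arr 17 rfl, f1.arr 17 rfl]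
  have a9 : σ₂.arr 9 = σ.arr 9 := by rw [f2.arr 9 rfl, f1.arr 9 rfl]
  have a10 : σ₂.arr 10 = σ.arr 10 := by rw [f2.arr 10 rfl, f1.arr 10 rfl]
  have a23 : σ₂.reg 23 = v := by rw [f2.reg 23 rfl, f1.reg 23 rfl, hv]
  have b2 : ∀ u : Fin n, labels n σ₂ u = σ₁.arr 15 (σ.arr 13 u) := fun u => by
    rw [labels, g2 u u.2]
    simp [Expr.eval, f1.arr 13 rfl]
  have hden : (Prog.seq (.store 2 (.get 9 (.const (4 + i))) (.add (.get 17 (.const i)) (.const 8)))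
      (.seq (.store 2 (.get 10 (.const (4 + a))) (.add (.get 17 (.const b)) (.const 12)))
      (.seq (.store 2 (.get 10 (.const (4 + b))) (.add (.get 17 (.const a)) (.const 12)))
      (.store 2 (.reg 23) (.add (.get 17 (.const o)) (.const 12)))))).den σ₂ =
      (((σ₂.setArr 2 si (π i + 8)).setArr 2 sa (π b + 12)).setArr 2 sb (π a + 12)).setArr 2 v
        (π o + 12) := by
    simp only [Prog.den, Expr.eval, setArr_get, setArr_reg, a9, a10, a17, a23, hsi, hsa, hsb, e]
    norm_num [a17, a9, a10, hsa, hsb, e]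
  rw [hden, labels_setArr, labels_setArr, labels_setArr, labels_setArr]
  refine ⟨?_, ?_, ?_, ?_, fun u k1 k2 k3 k4 => ?_⟩
  · simp [Nat.add_comm]
  · simp [h1, Nat.add_comm]
  · simp [h2, h4, Nat.add_comm]
  · simp [h3, h5, h6, Nat.add_comm]
  · simp [k1, k2, k3, k4, b2]

/-- Turn a square structure into a cubic structure at the vertex in register `23`, or find a tree. -/
def convert (ls : List ℕ) (i : Fin 4) : Prog :=
  .seq (markSides (i + 1).val (i + 3).val)
  (.seq (fill 8 5 2 (.get 13 (.reg 8)))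
  (.seq mkTab
  (.seq (trial ls)
    (.ite (.eq (.reg 20) (.const 0)) (relabel i.val (i + 1).val (i + 2).val (i + 3).val) .skip))))

/-- The intermediate labels replace the square labels before the tables are recomputed, so that the
family of masks can select `D`, `c`, `D'` and `c'`. If the search finds no tree, the alternative in
`SqInv.turn` must hold, and the tables still contain the vertices `si`, `sa`, `sb` for which it
holds. -/
theorem convert_spec (ht : TriFree G) (hp : Pendant G x) {ls : List ℕ}
    (hl : [4, 5, 6, 7, 8, 9, 10, 11, 12] = ls) {π : Equiv.Perm (Fin 4)} {σ : State}
    (hc : Ctx G x M σ) (hper : HasPerm x π σ) (h20 : σ.reg 20 = 0) {v : Fin n} (h23 : σ.reg 23 = v)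
    (hI : SqInv G (x ∘ π) (labels n σ)) (hv : labels n σ v = 8)
    (hmark : ∀ u : Fin n, σ.arr 14 u ≠ 0 ↔ G.Adj v u) {i : Fin 4} (hT : Turn G (labels n σ) v i) :
    Tri (convert ls i) σ ((trialCost (choices ls) + 4000) * (n * (n + M + 1)))
      fun τ => TreeFound G x τ ∨ (τ.reg 20 = 0 ∧ CubInv G x (labels n τ)) := by
  obtain ⟨b1, b2, b3⟩ := area_bounds hc.pos (show 1 ≤ n + M + 1 by omega)
  have hcyc : Cyc i (i + 1) (i + 2) (i + 3) := Or.inl ⟨rfl, rfl, rfl⟩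
  have hls : ∀ l ∈ ls, l ≤ 16 := hl ▸ by decide
  generalize hK : trialCost (choices ls) = K
  have hpy : Pendant G (x ∘ π) := fun j u w => hp (π j) u w
  have hva : ∃ u, G.Adj v u ∧ labels n σ u = (i + 1 : Fin 4) := hT.some _ (by simp)
  have hvb : ∃ u, G.Adj v u ∧ labels n σ u = (i + 3 : Fin 4) := hT.some _ (by simp)
  have hne : (i + 1 : Fin 4) ≠ i + 3 := fun h => hcyc.vals.2.2.2.2.1 (by rw [h])
  rw [Nat.add_mul]
  refine Tri.seq (markSides_spec hpy hc hI hv hne hmark (fun k => (hper k).1) hva hvb)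
    (fun σ₁ f1 h1 => ?_) (T := K * (n * (n + M + 1)) + 2500 * (n * (n + M + 1))) (by omega)
  have c1 := hc.frame f1 rfl
  obtain ⟨D, c, D', c', hD, hD', hmid⟩ := h1
  refine Tri.seq (Tri.fill c1.rn (by decide) rfl le_rfl) (fun σ₂ f2 h2 => ?_)
    (S := 15 * (n + 1) + 2) (T := K * (n * (n + M + 1)) + 2400 * (n * (n + M + 1))) (by omega)
  have c2 := c1.frame f2 rfl
  have l2 : labels n σ₂ = fun u : Fin n => σ₁.arr 13 u := by
    ext u
    rw [labels, h2 u u.2]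
    simp [Expr.eval]
  have e23 : σ₂.reg 23 = v := by rw [f2.reg 23 rfl, f1.reg 23 rfl, h23]
  refine Tri.seq (mkTab_spec c2 e23 fun u => ?_) (fun σ₃ f3 h3 => ?_)
    (T := K * (n * (n + M + 1)) + 1500 * (n * (n + M + 1))) (by omega)
  · rw [l2]
    have h8 := hI.le u
    have h7 := hmid.rest u
    have h9 := hmid.other u
    simp only at h7 h9 ⊢
    omega
  have c3 := c2.frame f3 (by decide)
  have l3 : labels n σ₃ = fun u : Fin n => σ₁.arr 13 u := by
    rw [← l2]; ext u; simp [labels, f3.arr 2 (by decide)]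
  have e23' : σ₃.reg 23 = v := (f3.reg 23 (by decide)).trans e23
  have e20 : σ₃.reg 20 = 0 := by rw [f3.reg 20 (by decide), f2.reg 20 rfl, f1.reg 20 rfl, h20]
  have htab := h3.tab
  rw [l3] at htab
  have hturn := hI.turn ht hv hcyc hT hD hD' hmid htab
  rw [hl] at hturn
  refine Tri.seq (trial_spec ht hp hls c3 e20 e23') (fun σ₄ f4 h4 => ?_)
    (T := 1400 * (n * (n + M + 1))) (by rw [hK]; omega)
  have c4 := c3.frame f4 (trial_safe ls)
  rcases h4 with h4 | ⟨h4, h5⟩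
  · refine Tri.cond (T := 1) (fun h => ?_) (fun _ => Tri.skip (Or.inl h4)) (by simp only [Expr.cost]; omega)
    have := h4.1
    simp only [Expr.holds_eq, Expr.eval] at h
    omega
  · rcases hturn with ⟨Q, hQ, hg⟩ | ⟨si, sa, sb, hsi, hsa, hsb, hcub⟩
    · rw [l3] at h5
      exact absurd (hg.of_comp π) (h5 Q (hQ.of_comp π))
    · have m1 : si ∈ entry n (σ₃.arr 9) (4 + i) := by rw [hsi]; rfl
      have m2 : sa ∈ entry n (σ₃.arr 10) (4 + (i + 1 : Fin 4)) := by rw [hsa]; rfl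
      have m3 : sb ∈ entry n (σ₃.arr 10) (4 + (i + 3 : Fin 4)) := by rw [hsb]; rfl
      have k1 := (h3.tab.P_sub _ _ m1).2
      have k2 := (h3.tab.M_sub _ _ m2).2
      have k3 := (h3.tab.M_sub _ _ m3).2
      rw [l3] at k1 k2 k3
      -- The intermediate labelling touches the sets `A_a` and `A_b` only and gives them labels from
      -- `8` on. So the labels `4` to `7` still mean the same.
      have hback : ∀ (u : Fin n) (k : Fin 4), σ₁.arr 13 u = 4 + k → labels n σ u = 4 + k := by
        intro u k hu
        have h7 := hmid.rest u
        have h9 := hmid.other u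
        have := k.2
        by_cases hh : labels n σ u = (i + 1 : Fin 4) ∨ labels n σ u = (i + 3 : Fin 4)
        · have := h7 hh
          omega
        · push Not at hh
          rw [← h9 hh.1 hh.2, hu]
      have k1' := hback si _ k1
      have k2' := hback sa _ k2
      have k3' := hback sb _ k3
      have a13 : σ₄.arr 13 = σ₁.arr 13 := by
        rw [f4.arr 13 (trial_wa ls 13 rfl), f3.arr 13 (by decide), f2.arr 13 rfl]
      have hper4 : HasPerm x π σ₄ := by
        intro k
        rw [f4.arr 16 (trial_wa ls 16 rfl), f4.arr 17 (trial_wa ls 17 rfl), f3.arr 16 (by decide),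
          f3.arr 17 (by decide), f2.arr 16 rfl, f2.arr 17 rfl, f1.arr 16 rfl, f1.arr 17 rfl]
        exact hper k
      obtain ⟨d1, d2, d3, d4, d5, d6⟩ := hcyc.vals
      have hi := i.2
      have ha := (i + 1).2
      have hb := (i + 3).2
      have hnv : ∀ {u w : Fin n}, labels n σ u ≠ labels n σ w → u ≠ w := fun h h' => h (h' ▸ rfl)
      refine Tri.cond (T := 600 * (n + M + 1)) (fun _ => ?_)
        (fun h => absurd (by simpa [Expr.eval] using h4) h) (by simp only [Expr.cost]; omega)
      refine (relabel_spec (v := v) (si := si) (sa := sa) (sb := sb) c4 hper4 hcyc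
        ((f4.reg 23 (trial_wr ls 23 rfl)).trans e23') ?_ ?_ ?_ (hnv (by omega)) (hnv (by omega))
        (hnv (by omega)) (hnv (by omega)) (hnv (by omega)) (hnv (by omega))).mono le_rfl
        fun τ f5 h6 => ?_
      · rw [f4.arr 9 (trial_wa ls 9 rfl)]; exact m1.2
      · rw [f4.arr 10 (trial_wa ls 10 rfl)]; exact m2.2
      · rw [f4.arr 10 (trial_wa ls 10 rfl)]; exact m3.2
      · obtain ⟨T, hT1, hT2⟩ := h6
        rw [a13] at hT2
        refine Or.inr ⟨(f5.reg 20 rfl).trans h4, ?_⟩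
        exact cubInv_of_relLab hcyc hI.le hv hmid k1' k2' k3' hT1 hT2 hcub

end RAM

/-! ## Reading the input -/

namespace RAM

variable {n : ℕ} {G : SimpleGraph (Fin n)} {x : Fin 4 → Fin n} {adj : Fin n → List (Fin n)}

/-- The position of the adjacency list of `v`. -/
def pos (adj : Fin n → List (Fin n)) (k : ℕ) : ℕ := ((List.ofFn adj).take k).flatten.length

theorem pos_zero : pos adj 0 = 0 := by simp [pos]

theorem pos_succ (v : Fin n) : pos adj (v + 1) = pos adj v + (adj v).length := by
  have h : v.val < (List.ofFn adj).length := by simp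
  rw [pos, List.take_succ_eq_append_getElem h]
  simp [pos]

theorem pos_mono {a b : ℕ} (hab : a ≤ b) (hb : b ≤ n) : pos adj a ≤ pos adj b := by
  induction hab with
  | refl => exact le_rfl
  | @step k _ ih =>
    have h : pos adj (k + 1) = pos adj k + _ := pos_succ ⟨k, hb⟩
    exact (ih (Nat.le_of_succ_le hb)).trans (h ▸ Nat.le_add_right _ _)

theorem pos_eq_sum (k : ℕ) (hk : k ≤ n) :
    pos adj k = ∑ v : Fin k, (adj ⟨v, by omega⟩).length := by
  induction k with
  | zero => simp [pos]
  | succ k ih =>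
    have h : pos adj (k + 1) = pos adj k + _ := pos_succ ⟨k, hk⟩
    rw [Fin.sum_univ_castSucc, h, ih (by omega)]
    rfl

theorem exists_pos {e : ℕ} (he : e < pos adj n) : ∃ v : Fin n, pos adj v ≤ e ∧ e < pos adj (v + 1) := by
  have : ∀ k ≤ n, e < pos adj k → ∃ v : Fin n, pos adj v ≤ e ∧ e < pos adj (v + 1) := by
    intro k
    induction k with
    | zero => intro _ h; rw [pos_zero] at h; omega
    | succ k ih =>
      intro hk h
      by_cases h' : e < pos adj k
      · exact ih (by omega) h'
      · exact ⟨⟨k, hk⟩, by simpa using h', h⟩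
  exact this n le_rfl he

theorem getElem_flatten (v : Fin n) {i : ℕ} (hi : i < (adj v).length) :
    ((List.ofFn adj).flatten.map Fin.val).getD (pos adj v + i) 0 = (adj v)[i] := by
  have h : v.val < (List.ofFn adj).length := by simp
  have hsplit : (List.ofFn adj).flatten =
      ((List.ofFn adj).take v).flatten ++ (adj v ++ ((List.ofFn adj).drop (v + 1)).flatten) := by
    conv_lhs => rw [← List.take_append_drop v.val (List.ofFn adj), List.drop_eq_getElem_cons h]
    simp
  rw [hsplit, List.getD_eq_getElem?_getD, List.getElem?_map, pos,
    List.getElem?_append_right (by omega), Nat.add_sub_cancel_left, List.getElem?_append_left hi,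
    List.getElem?_eq_getElem hi]
  rfl

/-- Compute the number of arcs and their tails. -/
def init : Prog :=
  .seq (.assign 5 (.reg 0))
  (.seq (.assign 6 (.get 0 (.reg 5)))
    (forR 14 5 (scatter 8 6 3 ((Expr.lt (.reg 8) (.get 0 (.reg 14))).not.and
      (Expr.lt (.reg 8) (.get 0 (.add (.reg 14) (.const 1))))) (.reg 8) (.reg 14))))

/-- The tails of the arcs are found by scanning all arcs once for every vertex. This takes time `O(n
(n + m))`, which the overall bound permits. -/
theorem init_spec (hadj : IsAdjLists G adj) :
    Tri init (inputState adj x) (100 * (n * (n + pos adj n + 1))) fun τ => Ctx G x (pos adj n) τ := by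
  have hn : 1 ≤ n := (x 0).pos
  obtain ⟨b1, b2, b3⟩ := area_bounds hn (show 1 ≤ n + pos adj n + 1 by omega)
  have h0 : ∀ k ≤ n, (inputState adj x).arr 0 k = pos adj k := fun k hk => by
    simp [inputState, hk, pos]
  have h1 : (inputState adj x).arr 1 = fun k => ((List.ofFn adj).flatten.map Fin.val).getD k 0 := rfl
  generalize hσ : inputState adj x = σ at h0 h1
  have hr0 : σ.reg 0 = n := by rw [← hσ]; rfl
  have hrx : ∀ i : Fin 4, σ.reg (i + 1) = x i := fun i => by
    rw [← hσ]; simp [inputState]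
  refine Tri.seq (R := fun τ => τ = σ.setReg 5 n) (S := 2)
    (T := 98 * (n * (n + pos adj n + 1))) (Tri.assign (by simp [Expr.eval, hr0])) ?_ (by omega)
  rintro σ₁ f1 rfl
  refine Tri.seq (R := fun τ => τ = (σ.setReg 5 n).setReg 6 (pos adj n)) (S := 3)
    (T := 95 * (n * (n + pos adj n + 1))) (Tri.assign (by simp [Expr.eval, h0])) ?_ (by omega)
  rintro σ₂ f2 rfl
  have hmain := Tri.forR (r := 14) (rb := 5) (p := scatter 8 6 3
      ((Expr.lt (.reg 8) (.get 0 (.reg 14))).not.and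
        (Expr.lt (.reg 8) (.get 0 (.add (.reg 14) (.const 1))))) (.reg 8) (.reg 14))
    (σ := (σ.setReg 5 n).setReg 6 (pos adj n)) (T := 35 * (n + pos adj n + 1)) (N := n)
    (fun i ρ => ∀ e < pos adj n, ∀ w < i, pos adj w ≤ e → e < pos adj (w + 1) → ρ.arr 3 e = w)
    (by simp) (by decide) rfl rfl (by simp) ?_
  · refine hmain.mono (mul_bound hn (by omega) (by norm_num)) fun τ hf h => ?_
    have a0 : ∀ k ≤ n, τ.arr 0 k = pos adj k := fun k hk => by rw [hf.arr 0 rfl]; exact h0 k hk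
    have a1 : τ.arr 1 = _ := (hf.arr 1 rfl).trans h1
    have hsrc : ∀ e < pos adj n, ∀ v < n, τ.arr 3 e = v ↔ τ.arr 0 v ≤ e ∧ e < τ.arr 0 (v + 1) := by
      intro e he v hv
      rw [a0 v hv.le, a0 (v + 1) hv]
      refine ⟨?_, fun hh => h.1 e he v hv hh.1 hh.2⟩
      rintro rfl
      obtain ⟨w, hw1, hw2⟩ := exists_pos he
      rw [h.1 e he w w.2 hw1 hw2]
      exact ⟨hw1, hw2⟩
    have harc : ∀ (v : Fin n) i (hi : i < (adj v).length), τ.arr 1 (pos adj v + i) = (adj v)[i] := by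
      intro v i hi
      rw [a1]
      exact getElem_flatten v hi
    refine ⟨?_, ?_, fun i => ?_, ?_, fun v hv => ?_, a0 n le_rfl, hsrc, fun e he => ?_, fun u v huv => ?_⟩
    · rw [hf.reg 5 rfl]; simp
    · rw [hf.reg 6 rfl]; simp
    · rw [← hrx i]
      fin_cases i
      · exact hf.reg 1 rfl
      · exact hf.reg 2 rfl
      · exact hf.reg 3 rfl
      · exact hf.reg 4 rfl
    · rw [a0 0 (by omega), pos_zero]
    · rw [a0 v hv.le, a0 (v + 1) hv]
      exact pos_mono (by omega) hv
    · obtain ⟨v, hv1, hv2⟩ := exists_pos he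
      rw [pos_succ] at hv2
      have hi : e - pos adj v < (adj v).length := by omega
      have := harc v _ hi
      rw [Nat.add_sub_cancel' hv1] at this
      refine ⟨v, _, (hsrc e he v v.2).mpr ?_, this, ((hadj v).2 _).mp (List.getElem_mem hi)⟩
      rw [a0 v v.2.le, a0 (v + 1) v.2, pos_succ]
      exact ⟨hv1, hv2⟩
    · obtain ⟨i, hi, hiv⟩ := List.getElem_of_mem (((hadj u).2 v).mpr huv)
      have hlt : pos adj u + i < pos adj (u + 1) := by rw [pos_succ]; omega
      have hlt' : pos adj u + i < pos adj n := hlt.trans_le (pos_mono u.2 le_rfl)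
      refine ⟨_, hlt', (hsrc _ hlt' u u.2).mpr ?_, by rw [harc u i hi, hiv]⟩
      rw [a0 u u.2.le, a0 (u + 1) u.2]
      exact ⟨by omega, hlt⟩
  · intro i hi ρ hf hr hρ
    have e6 : ρ.reg 6 = pos adj n := by rw [hf.reg 6 rfl]; simp
    have a0 : ∀ k ≤ n, ρ.arr 0 k = pos adj k := fun k hk => by rw [hf.arr 0 rfl]; exact h0 k hk
    refine (Tri.scatter e6 (by decide) rfl rfl rfl le_rfl).mono ?_ fun τ _ h e he w hw k1 k2 => ?_
    · simp only [Expr.cost, Expr.and, Expr.not]; omega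
    rw [setReg_arr]
    have hcond : ∀ e, (Expr.and (Expr.lt (.reg 8) (.get 0 (.reg 14))).not
        (Expr.lt (.reg 8) (.get 0 (.add (.reg 14) (.const 1))))).Holds (ρ.setReg 8 e) ↔
        pos adj i ≤ e ∧ e < pos adj (i + 1) := by
      intro e
      simp only [Expr.holds_and, Expr.holds_not, Expr.holds_lt, Expr.eval, setReg_reg, setReg_arr]
      norm_num [hr, a0 i hi.le, a0 (i + 1) hi]
    rcases h e with ⟨j, hj, g1, g2, g3⟩ | ⟨g1, g2⟩
    · obtain rfl : j = e := by simpa [Expr.eval] using g2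
      rw [hcond] at g1
      have : w = i := by
        by_contra hne
        have := pos_mono (adj := adj) (show w + 1 ≤ i by omega) hi.le
        omega
      rw [g3, this]
      simp [Expr.eval, hr]
    · rw [g2]
      have hwi : w ≠ i := by
        rintro rfl
        exact g1 e he ((hcond e).mpr ⟨k1, k2⟩) (by simp [Expr.eval])
      exact hρ e he w (by omega) k1 k2

/-- The number of arcs is twice the number of edges. -/
theorem pos_eq_two_mul (hadj : IsAdjLists G adj) : pos adj n = 2 * G.edgeSet.ncard := by
  classical
  rw [pos_eq_sum n le_rfl]
  have hdeg : ∀ v : Fin n, (adj v).length = G.degree v := by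
    intro v
    rw [← List.toFinset_card_of_nodup (hadj v).1, ← G.card_neighborFinset_eq_degree]
    congr 1
    ext w
    simp [(hadj v).2 w]
  calc ∑ v : Fin n, (adj ⟨v, v.2⟩).length = ∑ v : Fin n, G.degree v :=
        Finset.sum_congr rfl fun v _ => hdeg v
    _ = 2 * G.edgeSet.ncard := by
        rw [G.sum_degrees_eq_twice_card_edges, ← G.coe_edgeFinset, Set.ncard_coe_finset]

theorem pos_le_sq (hadj : IsAdjLists G adj) : pos adj n ≤ n * n := by
  rw [pos_eq_sum n le_rfl]
  refine (Finset.sum_le_sum (g := fun _ => n) fun v _ => ?_).trans (by simp)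
  simpa using (hadj v).1.length_le_card

theorem inputState_le (hadj : IsAdjLists G adj) (hn : 1 ≤ n) : (inputState adj x).Le (n * n) := by
  have hnn : n ≤ n * n := Nat.le_mul_of_pos_left _ hn
  refine ⟨fun r => ?_, fun a i => ?_⟩
  · simp only [inputState]
    split_ifs with h1 h2
    · exact hnn
    · exact (x _).2.le.trans hnn
    · omega
  · simp only [inputState]
    split_ifs with h1 h2 h3
    · exact (pos_mono h2 le_rfl).trans (pos_le_sq hadj)
    · omega
    · rw [List.getD_eq_getElem?_getD, List.getElem?_map]
      cases h : (List.ofFn adj).flatten[i]? with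
      | none => simp
      | some v => simpa using v.2.le.trans hnn
    · omega

end RAM

/-! ## The algorithm -/

namespace RAM

variable {n : ℕ} {G : SimpleGraph (Fin n)} {x : Fin 4 → Fin n} {M : ℕ}

/-- The output for a tree on the support of array `4`. -/
def outTree : Prog := .seq (fill 8 5 2 (.lt (.const 0) (.get 4 (.reg 8)))) (.assign 0 (.const 0))

theorem outTree_spec {σ : State} (hc : Ctx G x M σ)
    (h : IsInducedTreeCovering G x (supp n (σ.arr 4))) :
    Tri outTree σ (40 * (n * (n + M + 1))) (IsCorrectOutput G x) := by
  obtain ⟨b1, b2, b3⟩ := area_bounds hc.pos (show 1 ≤ n + M + 1 by omega)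
  refine Tri.seq (Tri.fill hc.rn (by decide) rfl le_rfl) (fun σ₁ f1 h1 => Tri.assign ?_)
    (S := 17 * (n + 1) + 2) (by simp only [Expr.cost]; omega)
  refine Or.inl ⟨by simp [Expr.eval], ?_⟩
  convert h using 1
  ext u
  simp [labelled, h1 u u.2, Expr.eval, Nat.pos_iff_ne_zero]

/-- An arc from an untreated vertex into some `A_i`: a violation of `N(A_i) = S_i`. -/
def sqCand : Expr :=
  (Expr.eq (.get 2 (.get 3 (.reg 8))) (.const 8)).and (Expr.lt (.get 2 (.get 1 (.reg 8))) (.const 4))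

/-- `CubCand` for the arc in register `8`: an untreated vertex that sees a corner, or a vertex of
`B_i` that sees some `A_j`. -/
def cubCand : Expr :=
  ((Expr.eq (.get 2 (.get 3 (.reg 8))) (.const 16)).and
    (Expr.lt (.get 2 (.get 1 (.reg 8))) (.const 12))).or
  ((Expr.lt (.const 3) (.get 2 (.get 3 (.reg 8)))).and
    ((Expr.lt (.get 2 (.get 3 (.reg 8))) (.const 8)).and
      (Expr.lt (.get 2 (.get 1 (.reg 8))) (.const 4))))

/-- Let a cubic structure grow. -/
def growCubic (ls : List ℕ) : Prog :=
  .seq (phase cubCand cubRules)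
    (.ite (.eq (.reg 22) (.const 0)) (.assign 0 (.const 2)) (.seq (trial ls) outTree))

/-- If the phase ends without candidates, the labels are a split. If it gets stuck, `CubInv.fail`
promises a good set in the family, so the search for a tree cannot fail. -/
theorem growCubic_spec (ht : TriFree G) (hp : Pendant G x) {ls : List ℕ}
    (hl : [4, 5, 6, 7, 8, 9, 10, 11, 12, 13, 14, 15] = ls) {σ : State} (hc : Ctx G x M σ)
    (h20 : σ.reg 20 = 0) (hI : CubInv G x (labels n σ)) :
    Tri (growCubic ls) σ ((trialCost (choices ls) + 21000) * (n * (n + M + 1)))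
      (IsCorrectOutput G x) := by
  obtain ⟨b1, b2, b3⟩ := area_bounds hc.pos (show 1 ≤ n + M + 1 by omega)
  have hls : ∀ l ∈ ls, l ≤ 16 := hl ▸ by decide
  generalize hK : trialCost (choices ls) = K
  rw [Nat.add_mul]
  -- Untreated vertices have weight `2` and vertices of the sets `B_i` weight `1`, because they may
  -- move once more. All other labels are final.
  refine Tri.seq (phase_spec (fun l m => (l = 16 ∧ m < 12) ∨ (4 ≤ l ∧ l < 8 ∧ m < 4)) (CubInv G x)
    (fun l => if l = 16 then 2 else if 4 ≤ l ∧ l < 8 then 1 else 0) (by decide) (by decide)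
    (fun l => by split_ifs <;> omega) (fun L h => h.le) ?_ (by decide) ?_ (by decide) (by decide) hc hI)
    (fun σ₁ f1 h1 => ?_) (T := K * (n * (n + M + 1)) + 100 * (n * (n + M + 1))) (by omega)
  · intro L v hL hC r hr ha
    obtain ⟨u, hu, hC⟩ := hC
    exact hL.grow hr ha ⟨u, hu, hC⟩
  · intro ρ e _
    simp only [cubCand, Expr.holds_or, Expr.holds_and, Expr.holds_eq, Expr.holds_lt, Expr.eval,
      setReg_reg, setReg_arr, if_true]
    exact Iff.rfl
  have c1 := hc.frame f1 (phase_safe _ _)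
  obtain ⟨hI1, h2⟩ := h1
  rcases h2 with ⟨h22, hno⟩ | ⟨h22, v, hv, ⟨u, hu, hC⟩, htab, hno⟩
  · refine Tri.cond (T := 2) (fun _ => Tri.assign (Or.inr (Or.inr ⟨by simp [Expr.eval], ?_⟩)))
      (fun h => absurd (by simpa [Expr.eval] using h22) h) (by simp only [Expr.cost]; omega)
    exact hI1.isCubicSplit ht (fun u w hu hw huw => hno w u huw.symm (Or.inl ⟨hw, hu⟩))
      (fun u w hu h4 h8 huw => hno w u huw.symm (Or.inr ⟨h4, h8, hu⟩))
  · refine Tri.cond (T := K * (n * (n + M + 1)) + 50 * (n * (n + M + 1))) (fun h => ?_) (fun _ => ?_)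
      (by simp only [Expr.cost]; omega)
    · simp only [Expr.holds_eq, Expr.eval] at h
      omega
    · have e20 : σ₁.reg 20 = 0 := by
        rw [f1.reg 20 (phase_wr 20 (by decide) (by decide) rfl _ _), h20]
      refine Tri.seq (trial_spec ht hp hls c1 e20 hv) (fun σ₂ f2 h2 => ?_)
        (T := 40 * (n * (n + M + 1))) (by rw [hK]; omega)
      have c2 := c1.frame f2 (trial_safe ls)
      rcases h2 with h2 | ⟨-, h2⟩
      · exact outTree_spec c2 h2.2
      · obtain ⟨Q, hQ, hg⟩ := hI1.fail ⟨u, hu, hC⟩ hno htab.tab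
        rw [hl] at hQ
        exact absurd hg (h2 Q hQ)

/-- The structure turns at the vertex in register `23`, with `i` as in `Turn`. -/
def turnTest (i : Fin 4) : Expr :=
  [4 + i.val, (i + 1).val, (i + 3).val].foldr (fun l e => (Expr.eq (.get 9 (.const l)) (.reg 5)).not.and e)
    ([i.val, (i + 2).val, 4 + (i + 2).val].foldr (fun l e => (Expr.eq (.get 9 (.const l)) (.reg 5)).and e)
      (.const 1))

theorem turnTest_iff {σ : State} (hc : Ctx G x M σ) {v : Fin n} (h : HasTab G v σ) (i : Fin 4) :
    (turnTest i).Holds σ ↔ Turn G (labels n σ) v i := by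
  rw [turnTest, holds_foldr_and σ (fun l => (Expr.eq (.get 9 (.const l)) (.reg 5)).not),
    holds_foldr_and σ (fun l => (Expr.eq (.get 9 (.const l)) (.reg 5)))]
  have hle : ∀ k : Fin 4, k.val ≤ 16 ∧ 4 + k.val ≤ 16 := fun k => by have := k.2; omega
  have h1 : ∀ l ∈ [4 + i.val, (i + 1).val, (i + 3).val], l ≤ 16 := by simp [hle]
  have h2 : ∀ l ∈ [i.val, (i + 2).val, 4 + (i + 2).val], l ≤ 16 := by simp [hle]
  have h3 : (Expr.const 1).Holds σ := one_ne_zero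
  simp only [Expr.holds_eq, Expr.holds_not, Expr.eval, hc.rn, h3, and_true]
  have k1 : ∀ l ∈ [4 + i.val, (i + 1).val, (i + 3).val],
      ¬ σ.arr 9 l = n ↔ ∃ u, G.Adj v u ∧ labels n σ u = l := fun l hl => by
    rw [h.nbr_iff (h1 l hl)]; push Not; rfl
  constructor
  · rintro ⟨g1, g2⟩
    exact ⟨fun l hl => (k1 l hl).mp (g1 l hl), fun l hl => (h.nbr_iff (h2 l hl)).mp (g2 l hl)⟩
  · rintro ⟨g1, g2⟩
    exact ⟨fun l hl => (k1 l hl).mpr (g1 l hl), fun l hl => (h.nbr_iff (h2 l hl)).mpr (g2 l hl)⟩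

def convertAny (ls : List ℕ) : Prog :=
  .ite (turnTest 0) (convert ls 0) (.ite (turnTest 1) (convert ls 1)
    (.ite (turnTest 2) (convert ls 2) (convert ls 3)))

theorem convertAny_spec (ht : TriFree G) (hp : Pendant G x) {ls : List ℕ}
    (hl : [4, 5, 6, 7, 8, 9, 10, 11, 12] = ls) {π : Equiv.Perm (Fin 4)} {σ : State}
    (hc : Ctx G x M σ) (hper : HasPerm x π σ) (h20 : σ.reg 20 = 0) {v : Fin n} (h23 : σ.reg 23 = v)
    (hI : SqInv G (x ∘ π) (labels n σ)) (hv : labels n σ v = 8) (htab : HasTab G v σ)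
    (hT : ∃ i, Turn G (labels n σ) v i) :
    Tri (convertAny ls) σ ((trialCost (choices ls) + 5000) * (n * (n + M + 1)))
      fun τ => Ctx G x M τ ∧ (TreeFound G x τ ∨ (τ.reg 20 = 0 ∧ CubInv G x (labels n τ))) := by
  obtain ⟨b1, b2, b3⟩ := area_bounds hc.pos (show 1 ≤ n + M + 1 by omega)
  have hconv : ∀ i, Turn G (labels n σ) v i →
      Tri (convert ls i) σ (trialCost (choices ls) * (n * (n + M + 1)) + 4000 * (n * (n + M + 1)))
        fun τ => Ctx G x M τ ∧ (TreeFound G x τ ∨ (τ.reg 20 = 0 ∧ CubInv G x (labels n τ))) := by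
    intro i hi
    refine (convert_spec ht hp hl hc hper h20 h23 hI hv htab.mark hi).mono
      (Nat.add_mul _ _ _).le fun τ hf h => ⟨?_, h⟩
    have hsafe : (convert ls i).safe = true := by
      have := trial_safe ls
      simp only [Prog.safe, Bool.and_eq_true, Bool.not_eq_true'] at this
      obtain ⟨⟨⟨⟨⟨⟨h1, h2⟩, h3⟩, h4⟩, h5⟩, h6⟩, ⟨h7, h8⟩, h9⟩ := this
      simp only [Prog.safe, convert, Prog.wr, Prog.wa, h1, h2, h3, h4, h5, h6, h7, h8, h9]
      rfl
    exact hc.frame hf hsafe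
  have hcost : ∀ i, (turnTest i).cost ≤ 100 := by decide
  have hc0 := hcost 0
  have hc1 := hcost 1
  have hc2 := hcost 2
  rw [Nat.add_mul]
  generalize trialCost (choices ls) * (n * (n + M + 1)) = K at *
  have hiff := turnTest_iff hc htab
  refine Tri.cond (T := K + 4700 * (n * (n + M + 1)))
    (fun h => (hconv 0 ((hiff 0).mp h)).mono (by omega) fun _ _ h => h) (fun h0 => ?_) (by omega)
  refine Tri.cond (T := K + 4400 * (n * (n + M + 1)))
    (fun h => (hconv 1 ((hiff 1).mp h)).mono (by omega) fun _ _ h => h) (fun h1 => ?_) (by omega)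
  refine Tri.cond (T := K + 4100 * (n * (n + M + 1)))
    (fun h => (hconv 2 ((hiff 2).mp h)).mono (by omega) fun _ _ h => h) (fun h2 => ?_) (by omega)
  -- The last branch needs no test: some turn exists, and the first three have been ruled out.
  refine (hconv 3 ?_).mono (by omega) fun _ _ h => h
  obtain ⟨i, hi⟩ := hT
  rw [hiff] at h0 h1 h2
  fin_cases i
  · exact absurd hi h0
  · exact absurd hi h1
  · exact absurd hi h2
  · exact hi

/-- Let a square structure grow. -/
def growSquare (ls₁ ls₂ ls₃ : List ℕ) : Prog :=
  .seq (phase sqCand sqRules)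
    (.ite (.eq (.reg 22) (.const 0)) (.assign 0 (.const 1))
      (.seq (trial ls₁) (.ite (.reg 20) outTree
        (.seq (convertAny ls₂) (.ite (.reg 20) outTree (growCubic ls₃))))))

/-- A stuck phase leads to a search for a tree. If this fails, `SqInv.fail` leaves only a turn, and
the conversion finds a tree or hands a cubic structure over to `growCubic`. -/
theorem growSquare_spec (ht : TriFree G) (hp : Pendant G x) {ls₁ ls₂ ls₃ : List ℕ}
    (hl₁ : [4, 5, 6, 7] = ls₁) (hl₂ : [4, 5, 6, 7, 8, 9, 10, 11, 12] = ls₂)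
    (hl₃ : [4, 5, 6, 7, 8, 9, 10, 11, 12, 13, 14, 15] = ls₃) {π : Equiv.Perm (Fin 4)} {σ : State}
    (hc : Ctx G x M σ) (hper : HasPerm x π σ) (h20 : σ.reg 20 = 0)
    (hI : SqInv G (x ∘ π) (labels n σ)) :
    Tri (growSquare ls₁ ls₂ ls₃) σ ((trialCost (choices ls₁) + trialCost (choices ls₂) +
      trialCost (choices ls₃) + 47000) * (n * (n + M + 1))) (IsCorrectOutput G x) := by
  obtain ⟨b1, b2, b3⟩ := area_bounds hc.pos (show 1 ≤ n + M + 1 by omega)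
  have hls : ∀ l ∈ ls₁, l ≤ 16 := hl₁ ▸ by decide
  generalize hK₁ : trialCost (choices ls₁) = K₁
  generalize hK₂ : trialCost (choices ls₂) = K₂
  generalize hK₃ : trialCost (choices ls₃) = K₃
  simp only [Nat.add_mul]
  refine Tri.seq (phase_spec (fun l m => l = 8 ∧ m < 4) (SqInv G (x ∘ π))
    (fun l => if l = 8 then 1 else 0) (by decide) (by decide)
    (fun l => by split_ifs <;> omega) (fun L h u => (h.le u).trans (by norm_num)) ?_ (by decide) ?_
    (by decide) (by decide) hc hI)
    (fun σ₁ f1 h1 => ?_) (T := K₁ * (n * (n + M + 1)) + K₂ * (n * (n + M + 1)) +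
      K₃ * (n * (n + M + 1)) + 27000 * (n * (n + M + 1))) (by omega)
  · rintro L v hL ⟨u, hu, -, hC⟩ r hr ha
    exact hL.grow hr ha ⟨u, hC, hu⟩
  · intro ρ e _
    simp only [sqCand, Expr.holds_and, Expr.holds_eq, Expr.holds_lt, Expr.eval,
      setReg_reg, setReg_arr, if_true]
  have c1 := hc.frame f1 (phase_safe _ _)
  obtain ⟨hI1, h2⟩ := h1
  rcases h2 with ⟨h22, hno⟩ | ⟨h22, v, hv, ⟨u, hu, hv8, hu4⟩, htab, hno⟩
  · refine Tri.cond (T := 2) (fun _ => Tri.assign (Or.inr (Or.inl ⟨by simp [Expr.eval], π, ?_⟩)))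
      (fun h => absurd (by simpa [Expr.eval] using h22) h) (by simp only [Expr.cost]; omega)
    exact hI1.isSquareSplit ht fun u w hu hw huw => hno w u huw.symm ⟨hw, hu⟩
  · refine Tri.cond (T := K₁ * (n * (n + M + 1)) + K₂ * (n * (n + M + 1)) +
      K₃ * (n * (n + M + 1)) + 26900 * (n * (n + M + 1))) (fun h => ?_) (fun _ => ?_)
      (by simp only [Expr.cost]; omega)
    · simp only [Expr.holds_eq, Expr.eval] at h
      omega
    have e20 : σ₁.reg 20 = 0 := by
      rw [f1.reg 20 (phase_wr 20 (by decide) (by decide) rfl _ _), h20]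
    refine Tri.seq (trial_spec ht hp hls c1 e20 hv) (fun σ₂ f2 h2 => ?_)
      (T := K₂ * (n * (n + M + 1)) + K₃ * (n * (n + M + 1)) + 26900 * (n * (n + M + 1)))
      (by rw [hK₁]; omega)
    have c2 := c1.frame f2 (trial_safe ls₁)
    rcases h2 with h2 | ⟨k20, h2⟩
    · refine Tri.cond (T := 40 * (n * (n + M + 1))) (fun _ => outTree_spec c2 h2.2) (fun h => ?_)
        (by simp only [Expr.cost]; omega)
      rw [Expr.holds_reg, h2.1] at h
      exact absurd one_ne_zero h
    refine Tri.cond (T := K₂ * (n * (n + M + 1)) + K₃ * (n * (n + M + 1)) + 26800 * (n * (n + M + 1)))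
      (fun h => absurd k20 h) (fun _ => ?_) (by simp only [Expr.cost]; omega)
    have hT : ∃ i, Turn G (labels n σ₁) v i := by
      refine (hI1.fail ht hv8 ⟨u, hu4, hu⟩ hno htab.tab).resolve_left ?_
      rintro ⟨Q, hQ, hg⟩
      rw [hl₁] at hQ
      exact h2 Q (hQ.of_comp π) (hg.of_comp π)
    have l2 : labels n σ₂ = labels n σ₁ := by
      ext z; rw [labels, f2.arr 2 (trial_wa ls₁ 2 rfl)]; rfl
    have hper2 : HasPerm x π σ₂ := by
      intro k
      rw [f2.arr 16 (trial_wa ls₁ 16 rfl), f2.arr 17 (trial_wa ls₁ 17 rfl),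
        f1.arr 16 (phase_wa 16 (by decide) rfl _ _), f1.arr 17 (phase_wa 17 (by decide) rfl _ _)]
      exact hper k
    have htab2 : HasTab G v σ₂ := htab.congr (f2.arr 2 (trial_wa ls₁ 2 rfl))
      (f2.arr 9 (trial_wa ls₁ 9 rfl)) (f2.arr 10 (trial_wa ls₁ 10 rfl)) (f2.arr 14 (trial_wa ls₁ 14 rfl))
    refine Tri.seq (convertAny_spec ht hp hl₂ c2 hper2 k20 ((f2.reg 23 (trial_wr ls₁ 23 rfl)).trans hv)
      (by rwa [l2]) (by rwa [l2]) htab2 (by rwa [l2])) (fun σ₃ f3 h3 => ?_)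
      (T := K₃ * (n * (n + M + 1)) + 21500 * (n * (n + M + 1))) (by rw [hK₂, Nat.add_mul]; omega)
    obtain ⟨c3, h3 | ⟨k20', h3⟩⟩ := h3
    · refine Tri.cond (T := 40 * (n * (n + M + 1))) (fun _ => outTree_spec c3 h3.2) (fun h => ?_)
        (by simp only [Expr.cost]; omega)
      rw [Expr.holds_reg, h3.1] at h
      exact absurd one_ne_zero h
    · refine Tri.cond (T := K₃ * (n * (n + M + 1)) + 21000 * (n * (n + M + 1)))
        (fun h => absurd k20' h) (fun _ => ?_) (by simp only [Expr.cost]; omega)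
      exact (growCubic_spec ht hp hl₃ c3 k20' h3).mono (by rw [hK₃, Nat.add_mul]) fun _ _ h => h

/-- The algorithm. -/
def main (ls₁ ls₂ ls₃ : List ℕ) : Prog :=
  .seq init
  (.seq (fill 8 5 4 (.const 1))
  (.seq minimize
  (.seq findSquare
    (.ite (.eq (.reg 15) (.const 0)) outTree (.seq labelSquare (growSquare ls₁ ls₂ ls₃))))))

theorem _root_.SimpleGraph.Connected.rIn_univ {V : Type u} {G : SimpleGraph V} (hG : G.Connected)
    (a b : V) : RIn G Set.univ a b := by
  obtain ⟨p⟩ := hG.preconnected a b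
  induction p with
  | nil => exact RIn.refl (Set.mem_univ _)
  | cons h _ ih => exact (RIn.of_adj (Set.mem_univ _) h (Set.mem_univ _)).trans ih

/-- The set of all vertices links the terminals, so minimization starts from it. A result without
squares is a tree already, and a square starts the growth of a square structure. -/
theorem main_spec (ht : TriFree G) (hp : Pendant G x) (hG : G.Connected) {ls₁ ls₂ ls₃ : List ℕ}
    (hl₁ : [4, 5, 6, 7] = ls₁) (hl₂ : [4, 5, 6, 7, 8, 9, 10, 11, 12] = ls₂)
    (hl₃ : [4, 5, 6, 7, 8, 9, 10, 11, 12, 13, 14, 15] = ls₃) {adj : Fin n → List (Fin n)}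
    (hadj : IsAdjLists G adj) :
    Tri (main ls₁ ls₂ ls₃) (inputState adj x) ((trialCost (choices ls₁) + trialCost (choices ls₂) +
      trialCost (choices ls₃) + 47000 + 13000) *
      (n * (n + pos adj n + 1))) (IsCorrectOutput G x) := by
  obtain ⟨b1, b2, b3⟩ := area_bounds (n := n) (x 0).pos (show 1 ≤ n + pos adj n + 1 by omega)
  rw [Nat.add_mul]
  have hsq := fun (π : Equiv.Perm (Fin 4)) σ (hc : Ctx G x (pos adj n) σ) =>
    growSquare_spec (π := π) (σ := σ) ht hp hl₁ hl₂ hl₃ hc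
  generalize (trialCost (choices ls₁) + trialCost (choices ls₂) + trialCost (choices ls₃) + 47000) *
    (n * (n + pos adj n + 1)) = K at hsq ⊢
  have z20 : (inputState adj x).reg 20 = 0 := rfl
  refine Tri.seq (init_spec hadj) (fun σ₁ f1 c1 => ?_)
    (T := K + 12900 * (n * (n + pos adj n + 1))) (by omega)
  refine Tri.seq (Tri.fill c1.rn (by decide) rfl le_rfl) (fun σ₂ f2 h2 => ?_)
    (S := 14 * (n + 1) + 2) (T := K + 12800 * (n * (n + pos adj n + 1))) (by omega)
  have c2 := c1.frame f2 rfl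
  have hs2 : supp n (σ₂.arr 4) = Set.univ := by
    ext u; simp [h2 u u.2, Expr.eval]
  refine Tri.seq (minimize_spec c2 fun j => ?_) (fun σ₃ f3 h3 => ?_)
    (T := K + 11800 * (n * (n + pos adj n + 1))) (by omega)
  · rw [hs2]
    exact hG.rIn_univ _ _
  have c3 := c2.frame f3 (by decide)
  refine Tri.seq (findSquare_spec c3) (fun σ₄ f4 h4 => ?_)
    (T := K + 10300 * (n * (n + pos adj n + 1))) (by omega)
  have c4 := c3.frame f4 (by decide)
  have e4 : σ₄.arr 4 = σ₃.arr 4 := f4.arr 4 (by decide)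
  rw [← e4] at h3 h4
  rcases h4 with ⟨k15, h4⟩ | ⟨k15, h4⟩
  · refine Tri.cond (T := 40 * (n * (n + pos adj n + 1)))
      (fun _ => outTree_spec c4 (h3.1.isInducedTreeCovering ht hp h4))
      (fun h => absurd (by simpa [Expr.eval] using k15) h) (by simp only [Expr.cost]; omega)
  · refine Tri.cond (T := K + 10000 * (n * (n + pos adj n + 1))) (fun h => ?_) (fun _ => ?_)
      (by simp only [Expr.cost]; omega)
    · simp only [Expr.holds_eq, Expr.eval] at h
      omega
    refine Tri.seq (labelSquare_spec hp c4 h3.1 h4) (fun σ₅ f5 h5 => ?_) (T := K) (by omega)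
    have c5 := c4.frame f5 (by decide)
    obtain ⟨π, hI, hper⟩ := h5
    refine hsq π σ₅ c5 hper ?_ hI
    rw [f5.reg 20 (by decide), f4.reg 20 (by decide), f3.reg 20 (by decide), f2.reg 20 rfl,
      f1.reg 20 (by decide), z20]

end RAM

theorem pendant_of_isTerminal {V : Type u} {G : SimpleGraph V} {x : Fin 4 → V}
    (h : ∀ i, IsTerminal G (x i)) : Pendant G x := by
  intro j u w hu hw
  obtain ⟨a, ha⟩ := Set.ncard_eq_one.mp (h j)
  have h1 : ∀ z, G.Adj (x j) z → z = a := fun z hz => by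
    have : z ∈ G.neighborSet (x j) := hz
    rwa [ha] at this
  rw [h1 u hu, h1 w hw]

/-! ### Running time and word size of the whole program -/

namespace RAM

theorem tame_convert {ls : List ℕ} (h : (trial ls).tame) : ∀ i, (convert ls i).tame := by
  have h1 : ∀ i : Fin 4, (markSides (i + 1).val (i + 3).val).tame ∧
      (fill 8 5 2 (.get 13 (.reg 8))).tame ∧ mkTab.tame ∧
      (relabel i.val (i + 1).val (i + 2).val (i + 3).val).tame := by decide
  intro i
  obtain ⟨h1, h2, h3, h4⟩ := h1 i
  simp [convert, Prog.tame, Expr.tame, h, h1, h2, h3, h4]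

theorem tame_main {ls₁ ls₂ ls₃ : List ℕ} (h₁ : (trial ls₁).tame) (h₂ : (trial ls₂).tame)
    (h₃ : (trial ls₃).tame) : (main ls₁ ls₂ ls₃).tame := by
  have h4 : init.tame ∧ (fill 8 5 4 (.const 1)).tame ∧ minimize.tame ∧ findSquare.tame ∧
      outTree.tame ∧ labelSquare.tame := by decide
  obtain ⟨k1, k2, k3, k4, k5, k6⟩ := h4
  have h5 : (phase sqCand sqRules).tame := by decide
  have h6 : (phase cubCand cubRules).tame := by decide
  have h7 : ∀ i, (turnTest i).tame := by decide
  simp [main, growSquare, growCubic, convertAny, Prog.tame, Expr.tame, tame_convert h₂, *]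

/-- Connectivity gives `n ≤ m + 1`, which turns `O(n (n + m))` into `O(nm)`. The lists are variables
tied by equations throughout, so that the families of up to `4 ^ 12` masks are never evaluated. -/
theorem solvesInTimeNM_main {ls₁ ls₂ ls₃ : List ℕ} (hl₁ : [4, 5, 6, 7] = ls₁)
    (hl₂ : [4, 5, 6, 7, 8, 9, 10, 11, 12] = ls₂)
    (hl₃ : [4, 5, 6, 7, 8, 9, 10, 11, 12, 13, 14, 15] = ls₃) :
    SolvesInTimeNM (main ls₁ ls₂ ls₃) := by
  have htame : (main ls₁ ls₂ ls₃).tame :=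
    tame_main (tame_trial (hl₁ ▸ by decide)) (tame_trial (hl₂ ▸ by decide))
      (tame_trial (hl₃ ▸ by decide))
  obtain ⟨K, hK⟩ : ∃ K, K = trialCost (choices ls₁) + trialCost (choices ls₂) +
    trialCost (choices ls₃) + 47000 + 13000 := ⟨_, rfl⟩
  -- The factor `5` comes from `n + 2 * m + 1 ≤ 5 * m`. In the exponent, `3` pays for the cubic time
  -- bound, and `21 + 40 * K` for the constant factor, which is absorbed by a power of `n` since `n
  -- ≥ 2`.
  refine ⟨5 * K, 24 + 40 * K, fun n G x adj hG hcf hx hterm hadj => ?_⟩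
  obtain ⟨t, τ, hrun, ht, hout⟩ :=
    main_spec (triFree_of_cliqueFree hcf) (pendant_of_isTerminal hterm) hG hl₁ hl₂ hl₃ hadj
  rw [← hK] at ht
  have hn : 4 ≤ n := by simpa using Fintype.card_le_of_injective x hx
  have hm : n ≤ G.edgeSet.ncard + 1 := by simpa using hG.card_vert_le_card_edgeSet_add_one
  have hpos := pos_eq_two_mul hadj
  have hsq := pos_le_sq hadj
  have hpow : n * n + 20 + 20 * t ≤ n ^ (24 + 40 * K) := by
    have h1 : n * (n + pos adj n + 1) ≤ 2 * n ^ 3 := by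
      calc n * (n + pos adj n + 1) ≤ n * (2 * (n * n)) := Nat.mul_le_mul_left _ (by nlinarith)
        _ = 2 * n ^ 3 := by ring
    have h2 : t ≤ 2 * K * n ^ 3 := (ht.trans (Nat.mul_le_mul_left K h1)).trans_eq (by ring)
    have h3 : 21 + 40 * K ≤ n ^ (21 + 40 * K) :=
      Nat.lt_two_pow_self.le.trans (Nat.pow_le_pow_left (by omega) _)
    have h4 : n * n ≤ n ^ 3 := by nlinarith [Nat.zero_le (n * n)]
    have h5 : 1 ≤ n ^ 3 := Nat.one_le_pow _ _ (by omega)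
    calc n * n + 20 + 20 * t ≤ (21 + 40 * K) * n ^ 3 := by nlinarith
      _ ≤ n ^ (21 + 40 * K) * n ^ 3 := Nat.mul_le_mul_right _ h3
      _ = n ^ (24 + 40 * K) := by rw [← pow_add]; congr 1; omega
  refine ⟨t, τ, (hrun.exec htame (Nat.le_add_left 20 (n * n)) ((inputState_le hadj (by omega)).mono
    (Nat.le_add_right _ _)) hpow).1, ?_, hout⟩
  calc t ≤ K * (n * (n + pos adj n + 1)) := ht
    _ ≤ K * (n * (5 * G.edgeSet.ncard)) :=
      Nat.mul_le_mul_left _ (Nat.mul_le_mul_left _ (by omega))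
    _ = 5 * K * (n * G.edgeSet.ncard) := by ring

end RAM

theorem exists_isAdjLists {n : ℕ} (G : SimpleGraph (Fin n)) : ∃ adj, IsAdjLists G adj := by
  classical
  exact ⟨fun v => (G.neighborFinset v).toList, fun v => ⟨Finset.nodup_toList _, fun w => by simp⟩⟩

/-! ### Transfer of structures along graph isomorphisms -/

section Transport

variable {V W : Type*} {G : SimpleGraph V} {H : SimpleGraph W}

/-- An isomorphism restricts to the subgraphs induced on a set and on its preimage. -/
def SimpleGraph.Iso.inducePreimage (φ : G ≃g H) (T : Set W) : G.induce (φ ⁻¹' T) ≃g H.induce T where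
  toEquiv := φ.toEquiv.subtypeEquiv fun _ => Iff.rfl
  map_rel_iff' := φ.map_adj_iff

theorem nbhd_preimage (φ : G ≃g H) (A : Set W) : nbhd G (φ ⁻¹' A) = φ ⁻¹' nbhd H A := by
  ext v
  refine and_congr Iff.rfl ⟨fun ⟨a, ha, h⟩ => ⟨φ a, ha, φ.map_adj_iff.mpr h⟩, fun ⟨b, hb, h⟩ => ?_⟩
  refine ⟨φ.symm b, by simpa using hb, φ.map_adj_iff.mp ?_⟩
  simpa using h

variable {x : Fin 4 → V}

theorem IsSquareSplit.preimage (φ : G ≃g H) {A S : Fin 4 → Set W} {R : Set W}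
    (h : IsSquareSplit H (φ ∘ x) A S R) :
    IsSquareSplit G x (fun i => φ ⁻¹' A i) (fun i => φ ⁻¹' S i) (φ ⁻¹' R) where
  cover := by simp only [← Set.preimage_iUnion, ← Set.preimage_union, h.cover, Set.preimage_univ]
  disjoint a b hab := by
    have := (h.disjoint hab).preimage φ
    rcases a with i | i | i <;> rcases b with j | j | j <;> exact this
  terminal_mem := h.terminal_mem
  stable i a ha b hb hab := fun hadj =>
    h.stable i ha hb (φ.injective.ne hab) (φ.map_adj_iff.mpr hadj)
  nonempty i := (h.nonempty i).preimage φ.surjective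
  complete i a ha b hb := φ.map_adj_iff.mp (h.complete i _ ha _ hb)
  anticomplete i a ha b hb := fun hadj => h.anticomplete i _ ha _ hb (φ.map_adj_iff.mpr hadj)
  nbhd_A i := by rw [nbhd_preimage, h.nbhd_A]
  nbhd_R := by
    rw [nbhd_preimage, ← Set.preimage_iUnion]
    exact Set.preimage_mono h.nbhd_R
  connected_A i := (φ.inducePreimage _).connected_iff.mpr (h.connected_A i)

theorem IsCubicSplit.preimage (φ : G ≃g H) {A B S S' : Fin 4 → Set W} {R : Set W}
    (h : IsCubicSplit H (φ ∘ x) A B S S' R) :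
    IsCubicSplit G x (fun i => φ ⁻¹' A i) (fun i => φ ⁻¹' B i) (fun i => φ ⁻¹' S i)
      (fun i => φ ⁻¹' S' i) (φ ⁻¹' R) where
  cover := by simp only [← Set.preimage_iUnion, ← Set.preimage_union, h.cover, Set.preimage_univ]
  disjoint a b hab := by
    have := (h.disjoint hab).preimage φ
    rcases a with i | i | i | i | i <;> rcases b with j | j | j | j | j <;> exact this
  terminal_mem := h.terminal_mem
  stable i a ha b hb hab := fun hadj =>
    h.stable i ha hb (φ.injective.ne hab) (φ.map_adj_iff.mpr hadj)
  stable' i a ha b hb hab := fun hadj =>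
    h.stable' i ha hb (φ.injective.ne hab) (φ.map_adj_iff.mpr hadj)
  nonempty i := (h.nonempty i).preimage φ.surjective
  nonempty' i j hi hj := h.nonempty' i j
    (φ.surjective.preimage_injective (hi.trans Set.preimage_empty.symm))
    (φ.surjective.preimage_injective (hj.trans Set.preimage_empty.symm))
  complete i j hij a ha b hb := φ.map_adj_iff.mp (h.complete i j hij _ ha _ hb)
  anticomplete_opp i a ha b hb := fun hadj =>
    h.anticomplete_opp i _ ha _ hb (φ.map_adj_iff.mpr hadj)
  anticomplete i j hij a ha b hb := fun hadj =>
    h.anticomplete i j hij _ ha _ hb (φ.map_adj_iff.mpr hadj)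
  anticomplete' i j hij a ha b hb := fun hadj =>
    h.anticomplete' i j hij _ ha _ hb (φ.map_adj_iff.mpr hadj)
  nbhd_A i := by rw [nbhd_preimage, h.nbhd_A]
  nbhd_B i := by
    simp only [nbhd_preimage, ← Set.preimage_iUnion, ← Set.preimage_union, ← Set.preimage_inter]
    exact Set.preimage_mono (h.nbhd_B i)
  nbhd_R := by
    rw [nbhd_preimage, ← Set.preimage_iUnion]
    exact Set.preimage_mono h.nbhd_R
  connected_A i := (φ.inducePreimage _).connected_iff.mpr (h.connected_A i)

end Transport

/-- The program is run on an isomorphic copy of the graph with vertices `0, ..., n - 1` and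
arbitrary adjacency lists. Its correct output, pulled back along the isomorphism, is the split or
the tree. The running time plays no role here. -/
theorem structure_or_tree {V : Type u} [Finite V] {G : SimpleGraph V} {x : Fin 4 → V}
    (hG : G.Connected) (hcf : G.CliqueFree 3) (hterm : ∀ i, IsTerminal G (x i)) :
    (IsCubicStructure G x ∨ ∃ π : Equiv.Perm (Fin 4), IsSquareStructure G (x ∘ π)) ∨
      ∃ T : Set V, IsInducedTreeCovering G x T := by
  obtain ⟨n, ⟨e⟩⟩ := Finite.exists_equiv_fin V
  let φ : G ≃g G.map e.toEmbedding := SimpleGraph.Iso.map e G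
  obtain ⟨adj, hadj⟩ := exists_isAdjLists (G.map e.toEmbedding)
  have hp : Pendant (G.map e.toEmbedding) (φ ∘ x) := fun j u w hu hw => by
    apply φ.symm.injective
    apply pendant_of_isTerminal hterm j
    · exact φ.map_adj_iff.mp (by simpa using hu)
    · exact φ.map_adj_iff.mp (by simpa using hw)
  have ht : TriFree (G.map e.toEmbedding) := fun a b c h1 h2 h3 =>
    triFree_of_cliqueFree hcf (φ.symm a) (φ.symm b) (φ.symm c) (φ.symm.map_adj_iff.mpr h1)
      (φ.symm.map_adj_iff.mpr h2) (φ.symm.map_adj_iff.mpr h3)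
  -- The lists are hidden behind variables, since the program enumerates `4 ^ 4`, `4 ^ 9` and `4 ^
  -- 12` masks for them.
  obtain ⟨ls₁, h₁⟩ : ∃ ls, [4, 5, 6, 7] = ls := ⟨_, rfl⟩
  obtain ⟨ls₂, h₂⟩ : ∃ ls, [4, 5, 6, 7, 8, 9, 10, 11, 12] = ls := ⟨_, rfl⟩
  obtain ⟨ls₃, h₃⟩ : ∃ ls, [4, 5, 6, 7, 8, 9, 10, 11, 12, 13, 14, 15] = ls := ⟨_, rfl⟩
  obtain ⟨t, τ, -, -, h⟩ := RAM.main_spec ht hp (φ.connected_iff.mp hG) h₁ h₂ h₃ hadj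
  rcases h with ⟨-, h1, h2⟩ | ⟨-, π, h⟩ | ⟨-, h⟩
  · exact Or.inr ⟨φ ⁻¹' labelled n τ 1, h1, (φ.inducePreimage _).isTree_iff.mpr h2⟩
  · exact Or.inl (Or.inr ⟨π, _, _, _, IsSquareSplit.preimage (x := x ∘ π) φ h⟩)
  · exact Or.inl (Or.inl ⟨_, _, _, _, _, IsCubicSplit.preimage φ h⟩)

theorem mainTheorem1 :
    (∀ (V : Type u) [Finite V] (G : SimpleGraph V) (x : Fin 4 → V),
      G.Connected → G.CliqueFree 3 → Function.Injective x → (∀ i, IsTerminal G (x i)) →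
      Xor (IsCubicStructure G x ∨ ∃ π : Equiv.Perm (Fin 4), IsSquareStructure G (x ∘ π))
        (∃ T : Set V, IsInducedTreeCovering G x T)) ∧
    (∃ p : RAM.Prog, SolvesInTimeNM p) := by
  refine ⟨fun V _ G x hG hcf hx hterm => ?_, ?_⟩
  · rw [xor_iff_or_and_not_and]
    refine ⟨structure_or_tree hG hcf hterm, ?_⟩
    rintro ⟨⟨A, B, S, S', R, h⟩ | ⟨π, A, S, R, h⟩, T, hT, hTree⟩
    · exact no_tree_of_cubic h hT hTree
    · exact no_tree_of_square h (fun i => hT (π i)) hTree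
  · obtain ⟨ls₁, h₁⟩ : ∃ ls, [4, 5, 6, 7] = ls := ⟨_, rfl⟩
    obtain ⟨ls₂, h₂⟩ : ∃ ls, [4, 5, 6, 7, 8, 9, 10, 11, 12] = ls := ⟨_, rfl⟩
    obtain ⟨ls₃, h₃⟩ : ∃ ls, [4, 5, 6, 7, 8, 9, 10, 11, 12, 13, 14, 15] = ls := ⟨_, rfl⟩
    exact ⟨_, RAM.solvesInTimeNM_main h₁ h₂ h₃⟩
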